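/- Work at the prime $3$ and let $k=\mathbb F_3$. Let $P=k[\xi_1,\xi_2,\dots]$ be the Hopf algebra with $\Delta\xi_n=\sum_{i+j=n}\xi_i\otimes\xi_j^{3^i}$ ($\xi_0=1$), graded by $|\xi_n|=2(3^n-1)$, let $D=k[\xi_1]/(\xi_1^3)$ be its quotient by $\xi_1^3,\xi_2,\xi_3,\dots$, and let $B=P\square_D k=k[\xi_1^3,\xi_2,\xi_3,\dots]$, a left $P$-comodule algebra. For a comodule algebra $N$ over $H=P$ or $H=D$ let $\operatorname{Ext}_H(k,N)$ be the cohomology ring of the cobar complex, with classes $h_{10}=[\xi_1]$ and $b_{10}=[\xi_1|\xi_1^2]+[\xi_1^2|\xi_1]$. Put $K(\xi_1)=b_{10}^{-1}B$ and $\pi_{**}(K(\xi_1)^{\otimes n})=b_{10}^{-1}\operatorname{Ext}_P(k,B^{\otimes n})$, with the diagonal coaction on $B^{\otimes n}$; write $K(\xi_1)_{**}$ and $\Gamma=K(\xi_1)_{**}K(\xi_1)$ for the cases $n=1$ and $n=2$. Let $\eta_L,\eta_R:K(\xi_1)_{**}\to\Gamma$, $\varepsilon:\Gamma\to K(\xi_1)_{**}$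 and $c:\Gamma\to\Gamma$ be induced by $b\mapsto b\otimes 1$, $b\mapsto 1\otimes b$, the multiplication $B\otimes B\to B$, and the interchange of the factors of $B\otimes B$. Let $\alpha:\Gamma\to b_{10}^{-1}\operatorname{Ext}_P(k,B^{\otimes3})$ be induced by $a\otimes b\mapsto a\otimes1\otimes b$, and let $\beta:\Gamma\otimes_{K(\xi_1)_{**}}\Gamma\to b_{10}^{-1}\operatorname{Ext}_P(k,B^{\otimes3})$ send $x\otimes y$ to the product of the images of $x$ and $y$ under the maps induced by $a\otimes b\mapsto a\otimes b\otimes 1$ and $a\otimes b\mapsto 1\otimes a\otimes b$. Then the following hold. 1. There is a ring isomorphism $R:=E[h_{10}]\otimes k[b_{10}^{\pm1}]\cong K(\xi_1)_{**}$ that sends $h_{10}$ and $b_{10}$ to the classes of the same name, and the change-of-rings map $\Gamma\to b_{10}^{-1}\operatorname{Ext}_D(k,B)$ (restriction to $D$, followed by $\varepsilon_P\otimes\mathrm{id}:B\otimes B\to B$ with $\varepsilon_P$ the restriction to $B$ of the counit of $P$) is an isomorphism of rings. 2. $\eta_L=\eta_R$, and $\Gamma$ is flat, indeed free, as an $R$-module.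 3. $\beta$ is bijective, so that $\Delta=\beta^{-1}\alpha$ is defined. For $n\ge2$ let $e_n\in\Gamma$ be the element that corresponds to $[\xi_1]\xi_n-[\xi_1^2]\xi_{n-1}^3\in b_{10}^{-1}\operatorname{Ext}^1_D(k,B)$. Then $e_n$ is homogeneous of homological degree $1$ and internal degree $2(3^n+1)$, and it is primitive: $\Delta e_n=e_n\otimes1+1\otimes e_n$. 4. With $\eta_L=\eta_R$ as unit, $\Delta$ as comultiplication, $\varepsilon$ as counit and $c$ as antipode, $\Gamma$ is isomorphic, as a Hopf algebra over $R$, to the exterior Hopf algebra $R\otimes E[e_2,e_3,\dots]$ on the primitive odd generators $e_n$ (graded tensor product, $h_{10}$ odd), by an isomorphism that is the unit on $R$ and sends each generator to the element $e_n$ of $\Gamma$. In particular $\varepsilon(e_n)=0$ and $c(e_n)=-e_n$. 5. Let $E_2$ be the $E_2$ page of the $K(\xi_1)$-based Margolis–Palmieri Adams spectral sequence for $b_{10}^{-1}\operatorname{Ext}_P(k,k)$, that is, the cohomology ring of $E_1^s=\pi_{**}(K(\xi_1)^{\otimes(s+1)})$ under the differential $d_1=\sum_{i=0}^{s+1}(-1)^i\delta_i$,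 where $\delta_i$ inserts the unit as the factor with index $i$ and the product multiplies the last factor of $x\in E_1^s$ with the first factor of $y\in E_1^t$, with the sign $(-1)^{t|x|}$ for $|x|$ the homological degree of $x$. Then there is a ring isomorphism $E_2\cong R[w_2,w_3,\dots]$ which on $R$ is given by $R\cong K(\xi_1)_{**}=E_1^0$ and under which $w_n$ is the class of $e_n\in E_1^1=\Gamma$. -/

import Mathlib

open scoped TensorProduct DirectSum

noncomputable section

/-- The ground field `k = 𝔽₃`. -/
abbrev F3 : Type := ZMod 3

/-- A commutative algebra `N` with a left coaction `N → H ⊗ N` of the bialgebra `H` that is a map of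
algebras (a left `H`-comodule algebra). -/
class ComodAlg (H N : Type) [CommRing H] [Bialgebra F3 H] [CommRing N] [Algebra F3 N] where
  coact : N →ₐ[F3] H ⊗[F3] N
  coassoc : (Algebra.TensorProduct.assoc F3 F3 F3 H H N).toAlgHom.comp
      ((Algebra.TensorProduct.map (Bialgebra.comulAlgHom F3 H) (AlgHom.id F3 N)).comp coact)
    = (Algebra.TensorProduct.map (AlgHom.id F3 H) coact).comp coact
  counit : (Algebra.TensorProduct.map (Bialgebra.counitAlgHom F3 H) (AlgHom.id F3 N)).comp coact
    = (Algebra.TensorProduct.lid F3 N).symm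

/-- The cochains of the cobar complex of `H` with coefficients in `N`, as the direct sum
`⨁ₛ H^{⊗ s} ⊗ N` over all homological degrees `s`; elements are sums of cochains `[a₁|…|aₛ]n`.
The complex is not normalized. -/
def Cobar (H N : Type) [CommRing H] [Bialgebra F3 H] [CommRing N] [Algebra F3 N] : Type :=
  TensorAlgebra F3 H ⊗[F3] N

namespace Cobar

section basic
variable {H N : Type} [CommRing H] [Bialgebra F3 H] [CommRing N] [Algebra F3 N]

instance : AddCommGroup (Cobar H N) := inferInstanceAs (AddCommGroup (TensorAlgebra F3 H ⊗[F3] N))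
instance : Module F3 (Cobar H N) := inferInstanceAs (Module F3 (TensorAlgebra F3 H ⊗[F3] N))

/-- The cochain `[ ]n` of degree `0`. -/
def ofN : N →ₗ[F3] Cobar H N := TensorProduct.mk F3 (TensorAlgebra F3 H) N 1

/-- `[a₁|…|aₛ]n ↦ [a|a₁|…|aₛ]n`. -/
def cons : H →ₗ[F3] Module.End F3 (Cobar H N) :=
  (LinearMap.rTensorHom N : _ →ₗ[F3] _) ∘ₗ
    (LinearMap.mul F3 (TensorAlgebra F3 H)) ∘ₗ TensorAlgebra.ι F3

/-- Recursion: the linear map `F` with `F([ ]n) = f n` and `F([a|w]) = g a (F w)`. -/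
def iter {V : Type} [AddCommGroup V] [Module F3 V] (f : N →ₗ[F3] V) (g : H →ₗ[F3] Module.End F3 V) :
    Cobar H N →ₗ[F3] V :=
  TensorProduct.lift (LinearMap.compl₂ (TensorAlgebra.lift F3 g).toLinearMap f)

theorem iter_ofN {V : Type} [AddCommGroup V] [Module F3 V] (f : N →ₗ[F3] V)
    (g : H →ₗ[F3] Module.End F3 V) (n : N) : iter f g (ofN n) = f n := by
  refine (TensorProduct.lift.tmul _ _).trans ?_
  simp

theorem iter_cons {V : Type} [AddCommGroup V] [Module F3 V] (f : N →ₗ[F3] V)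
    (g : H →ₗ[F3] Module.End F3 V) (a : H) (w : Cobar H N) :
    iter f g (cons a w) = g a (iter f g w) := by
  have : (iter f g) ∘ₗ cons a = g a ∘ₗ iter f g := by
    refine TensorProduct.ext' fun t n => ?_
    refine (TensorProduct.lift.tmul _ _).trans ?_
    refine Eq.trans ?_ (congrArg (g a) (TensorProduct.lift.tmul _ _).symm)
    simp
  exact LinearMap.congr_fun this w

/-- Induction on cochains. -/
@[elab_as_elim] theorem induct {p : Cobar H N → Prop} (w : Cobar H N)
    (h0 : ∀ n : N, p (ofN n)) (hc : ∀ a w, p w → p (cons a w))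
    (ha : ∀ v w, p v → p w → p (v + w)) : p w := by
  have hz : p 0 := by simpa using h0 0
  refine TensorProduct.induction_on (motive := p) w hz (fun t n => ?_) ha
  let L : TensorAlgebra F3 H →ₗ[F3] Cobar H N := (TensorProduct.mk F3 (TensorAlgebra F3 H) N).flip n
  have hs : ∀ (r : F3) w, p w → p (r • w) := by
    intro r w hw
    have : (r • w) = r.val • w := by
      rw [← Nat.cast_smul_eq_nsmul F3, ZMod.natCast_zmod_val]
    rw [this]
    induction r.val with
    | zero => simpa using hz
    | succ m ih => rw [succ_nsmul]; exact ha _ _ ih hw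
  change p (L t)
  have key : ∀ t, p (L t) ∧ ∀ u, p (L u) → p (L (t * u)) := by
    intro t
    induction t using TensorAlgebra.induction with
    | algebraMap r =>
      have : ∀ u, L (algebraMap F3 _ r * u) = r • L u := fun u => by
        rw [← Algebra.smul_def, map_smul]
      refine ⟨?_, fun u hu => by rw [this]; exact hs _ _ hu⟩
      rw [← mul_one (algebraMap F3 _ r), this]
      exact hs _ _ (h0 n)
    | ι a =>
      have : ∀ u, p (L u) → p (L (TensorAlgebra.ι F3 a * u)) := fun u hu => hc a _ hu
      refine ⟨?_, this⟩
      rw [← mul_one (TensorAlgebra.ι F3 a)]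
      exact this _ (h0 n)
    | mul s t hs ht =>
      refine ⟨hs.2 _ ht.1, fun u hu => ?_⟩
      rw [mul_assoc]
      exact hs.2 _ (ht.2 _ hu)
    | add s t hs ht =>
      refine ⟨by rw [map_add]; exact ha _ _ hs.1 ht.1, fun u hu => ?_⟩
      rw [add_mul, map_add]
      exact ha _ _ (hs.2 _ hu) (ht.2 _ hu)
  exact (key t).1

theorem hom_ext {V : Type} [AddCommGroup V] [Module F3 V] {f g : Cobar H N →ₗ[F3] V}
    (h0 : ∀ n, f (ofN n) = g (ofN n))
    (hc : ∀ a w, f w = g w → f (cons a w) = g (cons a w)) : f = g := by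
  ext w
  induction w using induct with
  | h0 n => exact h0 n
  | hc a w h => exact hc a w h
  | ha v w hv hw => rw [map_add, map_add, hv, hw]

/-- The sign automorphism, `(-1)ˢ` on cochains of homological degree `s`. -/
def sign : Cobar H N →ₗ[F3] Cobar H N := iter ofN (-cons)

@[simp] theorem sign_ofN (n : N) : sign (ofN n : Cobar H N) = ofN n := iter_ofN _ _ _
@[simp] theorem sign_cons (a : H) (w : Cobar H N) : sign (cons a w) = -cons a (sign w) := iter_cons _ _ _ _

theorem sign_sign (w : Cobar H N) : sign (sign w) = w := by
  induction w using induct with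
  | h0 n => simp
  | hc a w h => simp [h]
  | ha v w hv hw => simp [hv, hw]

/-- `h ⊗ n ↦ [h]n`. -/
def consN : H ⊗[F3] N →ₗ[F3] Cobar H N := TensorProduct.lift (LinearMap.compl₂ cons ofN)

@[simp] theorem consN_tmul (h : H) (n : N) : consN (h ⊗ₜ n) = cons h (ofN n) := rfl

/-- `h₁ ⊗ h₂, w ↦ [h₁|h₂|w]`. -/
def consH : H ⊗[F3] H →ₗ[F3] Module.End F3 (Cobar H N) :=
  TensorProduct.lift ((LinearMap.mul F3 (Module.End F3 (Cobar H N))).compl₁₂ cons cons)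

@[simp] theorem consH_tmul (h h' : H) (w : Cobar H N) : consH (h ⊗ₜ h') w = cons h (cons h' w) := rfl

/-- `T, b, f ↦ Σ [T' b] f(T'')`. -/
def actAux : H ⊗[F3] N →ₗ[F3] H →ₗ[F3] (N →ₗ[F3] Cobar H N) →ₗ[F3] Cobar H N :=
  TensorProduct.lift
    (LinearMap.mk₂ F3 (fun h n => LinearMap.mk₂ F3 (fun b f => cons (h * b) (f n))
      (by simp [mul_add]) (by simp) (by simp) (by simp))
      (by intros; ext; simp [add_mul]) (by intros; ext; simp)
      (by intros; ext; simp) (by intros; ext; simp))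

@[simp] theorem actAux_tmul (h : H) (n : N) (b : H) (f : N →ₗ[F3] Cobar H N) :
    actAux (h ⊗ₜ n) b f = cons (h * b) (f n) := rfl

end basic

section comod
variable {H N : Type} [CommRing H] [Bialgebra F3 H] [CommRing N] [Algebra F3 N] [ComodAlg H N]

/-- The action of `N` on the cobar complex through the iterated coaction: `act w n = n ▷ w`, where `n ▷ [b₁|…|bₜ]m = Σ [n⁽¹⁾b₁|…|n⁽ᵗ⁾bₜ]n⁽ᵗ⁺¹⁾m` -/
def act : Cobar H N →ₗ[F3] N →ₗ[F3] Cobar H N :=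
  iter ((LinearMap.mul F3 N).compr₂ ofN)
    (LinearMap.mk₂ F3 (fun b f => ((actAux.flip b).flip f) ∘ₗ (ComodAlg.coact (H := H) (N := N)).toLinearMap)
      (by intros; ext; simp) (by intros; ext; simp) (by intros; ext; simp) (by intros; ext; simp))

theorem act_ofN (m n : N) : act (ofN m : Cobar H N) n = ofN (n * m) := by
  simp [act, iter_ofN, mul_comm]

theorem act_cons (b : H) (w : Cobar H N) (n : N) :
    act (cons b w) n = actAux (ComodAlg.coact n) b (act w) := by
  simp [act, iter_cons]

/-- The product of the cobar complex,
`[a₁|…|aₛ]n · w = [a₁|…|aₛ](n ▷ w)`; it induces the product of `Ext_H(k, N)`. -/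
def mulT : Cobar H N →ₗ[F3] Cobar H N →ₗ[F3] Cobar H N :=
  LinearMap.flip
    { toFun := fun w => iter (act w) cons
      map_add' := fun v w => hom_ext (fun n => by simp [iter_ofN]) (fun a x h => by
        rw [iter_cons, h]; simp [iter_cons])
      map_smul' := fun r w => hom_ext (fun n => by simp [iter_ofN]) (fun a x h => by
        rw [iter_cons, h]; simp [iter_cons]) }

theorem mulT_apply (v w : Cobar H N) : mulT v w = iter (act w) cons v := rfl

theorem mulT_ofN (n : N) (w : Cobar H N) : mulT (ofN n) w = act w n := by
  rw [mulT_apply, iter_ofN]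

theorem mulT_cons (a : H) (v w : Cobar H N) : mulT (cons a v) w = cons a (mulT v w) := by
  rw [mulT_apply, iter_cons, mulT_apply]

theorem act_one (w : Cobar H N) : act w 1 = w := by
  induction w using induct with
  | h0 n => simp [act_ofN]
  | hc a w h => rw [act_cons, map_one, Algebra.TensorProduct.one_def, actAux_tmul, one_mul, h]
  | ha v w hv hw => simp [hv, hw]

theorem act_mul (w : Cobar H N) (n m : N) : act w (n * m) = act (act w m) n := by
  induction w using induct generalizing n m with
  | h0 x => simp [act_ofN, mul_assoc]
  | ha v w hv hw => simp [hv, hw]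
  | hc b w h =>
    rw [act_cons, act_cons, map_mul]
    induction (ComodAlg.coact m : H ⊗[F3] N) with
    | zero => simp
    | add x y hx hy => simp [mul_add, hx, hy]
    | tmul y z =>
      rw [actAux_tmul, act_cons]
      induction (ComodAlg.coact n : H ⊗[F3] N) with
      | zero => simp
      | add x y hx hy => simp [add_mul, hx, hy]
      | tmul p q => simp [h, mul_assoc]

theorem mulT_act (v w : Cobar H N) (n : N) : mulT (act v n) w = act (mulT v w) n := by
  induction v using induct generalizing n with
  | ha v v' h h' => simp [h, h']
  | h0 m => rw [mulT_ofN, act_ofN, ← act_mul, mulT_ofN]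
  | hc b v h =>
    rw [mulT_cons, act_cons, act_cons]
    induction (ComodAlg.coact n : H ⊗[F3] N) with
    | zero => simp
    | tmul a m => simp [mulT_cons, h]
    | add x y hx hy => simp [hx, hy]

theorem mulT_assoc (u v w : Cobar H N) : mulT (mulT u v) w = mulT u (mulT v w) := by
  induction u using induct with
  | ha u u' h h' => simp [h, h']
  | hc a u h => rw [mulT_cons, mulT_cons, mulT_cons, h]
  | h0 n => rw [mulT_ofN, mulT_ofN, mulT_act]

theorem mulT_one (w : Cobar H N) : mulT w (ofN (1 : N)) = w := by
  induction w using induct with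
  | ha u u' h h' => simp [h, h']
  | hc a u h => rw [mulT_cons, h]
  | h0 n => rw [mulT_ofN, act_ofN, mul_one]

instance : Ring (Cobar H N) :=
  { (inferInstance : AddCommGroup (Cobar H N)) with
    mul := fun x y => mulT x y
    one := ofN (1 : N)
    left_distrib := fun x y z => map_add _ _ _
    right_distrib := fun x y z => by
      change mulT _ _ = mulT _ _ + mulT _ _
      simp
    zero_mul := fun x => by change mulT 0 x = 0; simp
    mul_zero := fun x => by change mulT x 0 = 0; simp
    mul_assoc := mulT_assoc
    one_mul := fun x => (mulT_ofN 1 x).trans (act_one x)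
    mul_one := mulT_one }

theorem mul_def (x y : Cobar H N) : x * y = mulT x y := rfl
theorem one_def : (1 : Cobar H N) = ofN 1 := rfl
theorem ofN_mul (n : N) (w : Cobar H N) : ofN n * w = act w n := mulT_ofN _ _
theorem cons_mul (a : H) (v w : Cobar H N) : cons a v * w = cons a (v * w) := mulT_cons _ _ _

theorem sign_act (w : Cobar H N) (n : N) : sign (act w n) = act (sign w) n := by
  induction w using induct generalizing n with
  | ha u u' h h' => simp [h, h']
  | h0 m => simp [act_ofN]
  | hc b w h =>
    rw [act_cons, sign_cons, map_neg, LinearMap.neg_apply, act_cons]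
    induction (ComodAlg.coact n : H ⊗[F3] N) with
    | zero => simp
    | tmul a m => simp [h]
    | add x y hx hy => simp [hx, hy]; abel

theorem sign_mul (v w : Cobar H N) : sign (v * w) = sign v * sign w := by
  induction v using induct with
  | ha u u' h h' => simp [h, h', add_mul]
  | hc a u h => simp [cons_mul, h]
  | h0 n => rw [ofN_mul, sign_ofN, ofN_mul, sign_act]

/-- The pair of `w` and the inner part of its coboundary. -/
def innerPair : Cobar H N →ₗ[F3] Cobar H N × Cobar H N :=
  iter (ofN.prod (consN ∘ₗ (ComodAlg.coact (H := H) (N := N)).toLinearMap))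
    (LinearMap.mk₂ F3 (fun a p => (cons a p.1, consH (Coalgebra.comul (R := F3) a) p.1 - cons a p.2))
      (by intros; simp; abel) (by intros; simp [smul_sub]) (by intros; simp; abel)
      (by intros; simp [smul_sub]))

theorem innerPair_fst (w : Cobar H N) : (innerPair w).1 = w := by
  induction w using induct with
  | ha u u' h h' => simp [h, h']
  | hc a u h => simp [innerPair, iter_cons]; exact congrArg _ h
  | h0 n => simp [innerPair, iter_ofN]

/-- `[a₁|…|aₛ]n ↦ Σᵢ (-1)ⁱ⁻¹ [a₁|…|aᵢ'|aᵢ''|…|aₛ]n + (-1)ˢ [a₁|…|aₛ|n']n''`. -/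
def inner : Cobar H N →ₗ[F3] Cobar H N := LinearMap.snd F3 _ _ ∘ₗ innerPair

theorem inner_ofN (n : N) : inner (ofN n : Cobar H N) = consN (ComodAlg.coact n) := by
  simp [inner, innerPair, iter_ofN]

theorem inner_cons (a : H) (w : Cobar H N) :
    inner (cons a w) = consH (Coalgebra.comul (R := F3) a) w - cons a (inner w) := by
  have := innerPair_fst w
  simp only [inner, innerPair, LinearMap.comp_apply] at this ⊢
  rw [iter_cons]
  simp [this]

/-- The coboundary `d[a₁|…|aₛ]n = [1|a₁|…|aₛ]n + Σᵢ (-1)ⁱ [a₁|…|aᵢ'|aᵢ''|…|aₛ]n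
+ (-1)ˢ⁺¹ [a₁|…|aₛ|n']n''`. -/
def d : Cobar H N →ₗ[F3] Cobar H N := cons 1 - inner

theorem d_apply (w : Cobar H N) : d w = cons 1 w - inner w := rfl

theorem inner_act (w : Cobar H N) (n : N) : inner (act w n) = act (inner w) n := by
  have hco := DFunLike.congr_fun (ComodAlg.coassoc (H := H) (N := N)) n
  induction w using induct generalizing n with
  | ha u u' h h' => simp only [map_add, LinearMap.add_apply, h n hco, h' n hco]
  | h0 m =>
    rw [act_ofN, inner_ofN, inner_ofN, map_mul]
    induction (ComodAlg.coact m : H ⊗[F3] N) with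
    | zero => simp
    | add x y hx hy => simp [mul_add, hx, hy]
    | tmul a m =>
      rw [consN_tmul, act_cons]
      induction (ComodAlg.coact n : H ⊗[F3] N) with
      | zero => simp
      | add x y hx hy => simp [add_mul, hx, hy]
      | tmul p q => simp [act_ofN]
  | hc b w h =>
    rw [act_cons, inner_cons, map_sub, LinearMap.sub_apply, act_cons]
    let Q : H ⊗[F3] (H ⊗[F3] N) →ₗ[F3] (H ⊗[F3] H →ₗ[F3] Cobar H N) :=
      TensorProduct.lift (LinearMap.mk₂ F3
        (fun p T => TensorProduct.lift (LinearMap.mk₂ F3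
          (fun x y => cons (p * x) (actAux T y (act w)))
          (by intros; simp [mul_add]) (by intros; simp) (by intros; simp) (by intros; simp)))
        (by intros; ext; simp [add_mul]) (by intros; ext; simp)
        (by intros; ext; simp) (by intros; ext; simp))
    have hQ : ∀ p T x y, Q (p ⊗ₜ T) (x ⊗ₜ y) = cons (p * x) (actAux T y (act w)) :=
      fun p T x y => rfl
    have h1 : act (consH (Coalgebra.comul (R := F3) b) w) n
        = Q (Algebra.TensorProduct.map (AlgHom.id F3 H) ComodAlg.coact (ComodAlg.coact n))
            (Coalgebra.comul (R := F3) b) := by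
      induction (Coalgebra.comul (R := F3) b : H ⊗[F3] H) with
      | zero => simp
      | add x y hx hy => simp [hx, hy]
      | tmul x y =>
        rw [consH_tmul, act_cons]
        induction (ComodAlg.coact n : H ⊗[F3] N) with
        | zero => simp
        | add x y hx hy => simp [hx, hy]
        | tmul p q => simp [hQ, act_cons]
    have hco' := hco
    simp only [AlgHom.comp_apply] at hco'
    rw [h1, ← hco']
    induction (ComodAlg.coact n : H ⊗[F3] N) with
    | zero => simp
    | add x y hx hy =>
      simp only [map_add, LinearMap.add_apply, hx, hy]
      abel
    | tmul p q =>
      have hq := h q (DFunLike.congr_fun (ComodAlg.coassoc (H := H) (N := N)) q)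
      rw [actAux_tmul, inner_cons, Bialgebra.comul_mul, hq, actAux_tmul]
      congr 1
      rw [Algebra.TensorProduct.map_tmul]
      change _ = Q ((Algebra.TensorProduct.assoc F3 F3 F3 H H N)
        ((Coalgebra.comul (R := F3) p) ⊗ₜ q)) _
      induction (Coalgebra.comul (R := F3) p : H ⊗[F3] H) with
      | zero => simp
      | add x y hx hy => simp [add_mul, TensorProduct.add_tmul, hx, hy]
      | tmul p1 p2 =>
        induction (Coalgebra.comul (R := F3) b : H ⊗[F3] H) with
        | zero => simp
        | add x y hx hy => simp [mul_add, hx, hy]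
        | tmul x y => simp [hQ]

theorem act_cons_one (w : Cobar H N) (n : N) : act (cons 1 w) n = consN (ComodAlg.coact n) * w := by
  rw [act_cons]
  induction (ComodAlg.coact n : H ⊗[F3] N) with
  | zero => simp
  | add x y hx hy => simp [add_mul, hx, hy]
  | tmul p q => simp [cons_mul, ofN_mul]

theorem consH_mul (T : H ⊗[F3] H) (v w : Cobar H N) : consH T v * w = consH T (v * w) := by
  induction T with
  | zero => simp
  | add x y hx hy => simp [add_mul, hx, hy]
  | tmul p q => simp [cons_mul]

theorem inner_mul (v w : Cobar H N) :
    inner (v * w) = inner v * w - sign v * cons 1 w + sign v * inner w := by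
  induction v using induct with
  | ha u u' h h' => simp only [map_add, add_mul, h, h']; abel
  | h0 n =>
    rw [ofN_mul, inner_act, inner_ofN, sign_ofN, ofN_mul, ofN_mul, act_cons_one]
    abel
  | hc a v h =>
    simp only [cons_mul, inner_cons, h, sign_cons, sub_mul, neg_mul, map_add, map_sub, consH_mul]
    abel

theorem d_mul (v w : Cobar H N) : d (v * w) = d v * w + sign v * d w := by
  simp only [d_apply, inner_mul, sub_mul, mul_sub, cons_mul]
  abel

theorem inner_sign (w : Cobar H N) : inner (sign w) = - sign (inner w) := by
  have hN : ∀ T : H ⊗[F3] N, sign (consN T) = - consN T := by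
    intro T
    induction T with
    | zero => simp
    | add x y hx hy => simp [hx, hy]; abel
    | tmul p q => simp
  have hH : ∀ (T : H ⊗[F3] H) (w : Cobar H N), sign (consH T w) = consH T (sign w) := by
    intro T w
    induction T with
    | zero => simp
    | add x y hx hy => simp [hx, hy]
    | tmul p q => simp
  induction w using induct with
  | ha u u' h h' => simp only [map_add, h, h']; abel
  | h0 n => rw [sign_ofN, inner_ofN, hN]; simp
  | hc a w h =>
    simp only [sign_cons, map_neg, inner_cons, map_sub, hH, h]

theorem d_sign (w : Cobar H N) : d (sign w) = - sign (d w) := by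
  simp only [d_apply, inner_sign, map_sub, sign_cons]
  abel

theorem inner_inner (w : Cobar H N) : inner (inner w) = 0 := by
  have hA : ∀ a : H, ∀ w : Cobar H N, inner (consH (Coalgebra.comul (R := F3) a) w)
      = consH (Coalgebra.comul (R := F3) a) (inner w) := by
    intro a w
    let Q : H ⊗[F3] (H ⊗[F3] H) →ₗ[F3] Cobar H N :=
      TensorProduct.lift (LinearMap.mk₂ F3 (fun p T => cons p (consH T w))
        (by intros; simp) (by intros; simp) (by intros; simp) (by intros; simp))
    have hQ : ∀ p T, Q (p ⊗ₜ T) = cons p (consH T w) := fun p T => rfl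
    have key : ∀ T : H ⊗[F3] H, inner (consH T w) =
        Q (TensorProduct.assoc F3 H H H ((Coalgebra.comul (R := F3) (A := H)).rTensor H T))
        - Q ((Coalgebra.comul (R := F3) (A := H)).lTensor H T) + consH T (inner w) := by
      intro T
      induction T with
      | zero => simp
      | add x y hx hy => simp only [map_add, LinearMap.add_apply, hx, hy]; abel
      | tmul x y =>
        rw [consH_tmul, inner_cons, inner_cons, LinearMap.rTensor_tmul, LinearMap.lTensor_tmul, hQ,
          map_sub, consH_tmul]
        have : ∀ S : H ⊗[F3] H, consH S (cons y w) = Q (TensorProduct.assoc F3 H H H (S ⊗ₜ y)) := by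
          intro S
          induction S with
          | zero => simp
          | add a b ha hb => simp [TensorProduct.add_tmul, ha, hb]
          | tmul a b => simp [hQ]
        rw [this]
        abel
    rw [key, Coalgebra.coassoc_apply, sub_self, zero_add]
  induction w using induct with
  | ha u u' h h' => simp only [map_add, h, h', add_zero]
  | hc a w h => rw [inner_cons, map_sub, hA, inner_cons, h]; simp
  | h0 n =>
    rw [inner_ofN]
    let Q : H ⊗[F3] (H ⊗[F3] N) →ₗ[F3] Cobar H N :=
      TensorProduct.lift (LinearMap.compl₂ cons consN)
    have hQ : ∀ p T, Q (p ⊗ₜ T) = cons p (consN T) := fun p T => rfl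
    have key : ∀ T : H ⊗[F3] N, inner (consN T) =
        Q (Algebra.TensorProduct.assoc F3 F3 F3 H H N
          (Algebra.TensorProduct.map (Bialgebra.comulAlgHom F3 H) (AlgHom.id F3 N) T))
        - Q (Algebra.TensorProduct.map (AlgHom.id F3 H) (ComodAlg.coact (H := H) (N := N)) T) := by
      intro T
      induction T with
      | zero => simp
      | add x y hx hy => simp only [map_add, hx, hy]; abel
      | tmul x y =>
        rw [consN_tmul, inner_cons, inner_ofN, Algebra.TensorProduct.map_tmul,
          Algebra.TensorProduct.map_tmul, hQ]
        have : ∀ S : H ⊗[F3] H, consH S (ofN y)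
            = Q (Algebra.TensorProduct.assoc F3 F3 F3 H H N (S ⊗ₜ y)) := by
          intro S
          induction S with
          | zero => simp
          | add a b ha hb => simp [TensorProduct.add_tmul, ha, hb]
          | tmul a b => simp [hQ]
        rw [this]
        rfl
    have hco := DFunLike.congr_fun (ComodAlg.coassoc (H := H) (N := N)) n
    simp only [AlgHom.comp_apply] at hco
    rw [key, ← hco]
    exact sub_self _

theorem d_d (w : Cobar H N) : d (d w) = 0 := by
  simp [d_apply, inner_cons, inner_inner, Bialgebra.comul_one, Algebra.TensorProduct.one_def]

end comod

section map
variable {H N H' N' H'' N'' : Type} [CommRing H] [Bialgebra F3 H] [CommRing N] [Algebra F3 N]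
  [ComodAlg H N] [CommRing H'] [Bialgebra F3 H'] [CommRing N'] [Algebra F3 N'] [ComodAlg H' N']

/-- `(f, g)` is compatible with the coactions. -/
def Compat (f : H →ₐc[F3] H') (g : N →ₐ[F3] N') : Prop :=
  ∀ n, ComodAlg.coact (H := H') (g n) =
    Algebra.TensorProduct.map (f : H →ₐ[F3] H') g (ComodAlg.coact (H := H) n)

/-- `[a₁|…|aₛ]n ↦ [f a₁|…|f aₛ] g n`. -/
def map (f : H →ₐc[F3] H') (g : N →ₐ[F3] N') : Cobar H N →ₗ[F3] Cobar H' N' :=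
  iter (ofN ∘ₗ g.toLinearMap) (cons ∘ₗ (f : H →ₗ[F3] H'))

variable (f : H →ₐc[F3] H') (g : N →ₐ[F3] N')

@[simp] theorem map_ofN (n : N) : map f g (ofN n : Cobar H N) = ofN (g n) := iter_ofN _ _ _
@[simp] theorem map_cons (a : H) (w : Cobar H N) :
    map f g (cons a w) = cons (f a) (map f g w) := iter_cons _ _ _ _

theorem map_sign (w : Cobar H N) : map f g (sign w) = sign (map f g w) := by
  induction w using induct with
  | ha u u' h h' => simp only [_root_.map_add, h, h']
  | h0 n => simp
  | hc a w h => simp [h]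

variable {f g}

theorem map_act (hfg : Compat f g) (w : Cobar H N) (n : N) :
    map f g (act w n) = act (map f g w) (g n) := by
  induction w using induct generalizing n with
  | ha u u' h h' => simp [h, h']
  | h0 m => simp [act_ofN]
  | hc b w h =>
    rw [act_cons, map_cons, act_cons, hfg]
    induction (ComodAlg.coact n : H ⊗[F3] N) with
    | zero => simp
    | add x y hx hy => simp [hx, hy]
    | tmul p q => simp [h]

theorem map_mul' (hfg : Compat f g) (v w : Cobar H N) :
    map f g (v * w) = map f g v * map f g w := by
  induction v using induct with
  | ha u u' h h' => simp [h, h', add_mul]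
  | h0 n => rw [ofN_mul, map_act hfg, map_ofN, ofN_mul]
  | hc a v h => simp [cons_mul, h]

theorem map_d (hfg : Compat f g) (w : Cobar H N) : map f g (d w) = d (map f g w) := by
  have hN : ∀ T : H ⊗[F3] N, map f g (consN T) =
      consN (Algebra.TensorProduct.map (f : H →ₐ[F3] H') g T) := by
    intro T
    induction T with
    | zero => simp
    | add x y hx hy => simp [hx, hy]
    | tmul p q => simp
  have hH : ∀ (T : H ⊗[F3] H) (w : Cobar H N), map f g (consH T w) =
      consH (TensorProduct.map (f : H →ₗ[F3] H') (f : H →ₗ[F3] H') T) (map f g w) := by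
    intro T w
    induction T with
    | zero => simp
    | add x y hx hy => simp [hx, hy]
    | tmul p q => simp
  have hi : map f g (inner w) = inner (map f g w) := by
    induction w using induct with
    | ha u u' h h' => simp only [_root_.map_add, h, h']
    | h0 n => rw [inner_ofN, map_ofN, inner_ofN, hN, hfg]
    | hc a w h =>
      rw [inner_cons, map_cons, inner_cons, map_sub, map_cons, hH, h]
      congr 2
      exact congrArg _ (CoalgHomClass.map_comp_comul_apply f a)
  simp [d_apply, hi]

/-- The map of cobar complexes is a map of rings. -/
def mapHom (hfg : Compat f g) : Cobar H N →+* Cobar H' N' where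
  toFun := map f g
  map_one' := by simp [one_def]
  map_mul' := map_mul' hfg
  map_zero' := map_zero _
  map_add' := map_add _

end map
end Cobar

/-- A differential graded ring structure on the ring `A`, where the grading enters only through the
sign automorphism `sign`, `(-1)ˢ` in degree `s`. -/
structure DGRing (A : Type) [Ring A] where
  sign : A →+* A
  sign_sign : ∀ x, sign (sign x) = x
  d : A →+ A
  d_d : ∀ x, d (d x) = 0
  d_mul : ∀ x y, d (x * y) = d x * y + sign x * d y
  d_sign : ∀ x, d (sign x) = - sign (d x)

namespace DGRing
variable {A : Type} [Ring A] (G : DGRing A)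

/-- The subring of cocycles. -/
def cycles : Subring A where
  carrier := {x | G.d x = 0}
  mul_mem' := fun {x y} hx hy => by
    simp only [Set.mem_ofPred_eq] at hx hy ⊢
    rw [G.d_mul, hx, hy]; simp
  one_mem' := by
    have := G.d_mul 1 1
    simpa using this
  add_mem' := fun {x y} hx hy => by
    simp only [Set.mem_ofPred_eq] at hx hy ⊢
    rw [map_add, hx, hy, add_zero]
  zero_mem' := map_zero _
  neg_mem' := fun {x} hx => by
    simp only [Set.mem_ofPred_eq] at hx ⊢
    rw [map_neg, hx, neg_zero]

/-- The two-sided ideal of coboundaries in the ring of cocycles. -/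
def boundaries : Ideal G.cycles where
  carrier := {z | ∃ a, G.d a = z}
  add_mem' := by
    rintro x y ⟨a, ha⟩ ⟨b, hb⟩
    exact ⟨a + b, by rw [map_add, ha, hb]; rfl⟩
  zero_mem' := ⟨0, map_zero _⟩
  smul_mem' := by
    rintro ⟨z, hz⟩ y ⟨a, ha⟩
    refine ⟨G.sign z * a, ?_⟩
    have hz' : G.d z = 0 := hz
    rw [G.d_mul, G.d_sign, hz', G.sign_sign, ha]
    simp

instance : G.boundaries.IsTwoSided where
  mul_mem_of_left := by
    rintro y ⟨z, hz⟩ ⟨a, ha⟩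
    refine ⟨a * z, ?_⟩
    have hz' : G.d z = 0 := hz
    rw [G.d_mul, hz', ha]
    simp

/-- The cohomology ring. -/
def Coh : Type := G.cycles ⧸ G.boundaries

instance : Ring G.Coh := inferInstanceAs (Ring (G.cycles ⧸ G.boundaries))

/-- The projection from cocycles to cohomology. -/
def proj : G.cycles →+* G.Coh := Ideal.Quotient.mk G.boundaries

/-- The class of a cocycle. -/
def cls (x : A) (hx : G.d x = 0) : G.Coh := G.proj ⟨x, hx⟩

theorem proj_surjective : Function.Surjective G.proj := Ideal.Quotient.mk_surjective

variable {G} {A' : Type} [Ring A'] {G' : DGRing A'}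

/-- The ring homomorphism on cohomology induced by a ring homomorphism that preserves cocycles
and coboundaries. -/
def Coh.map (f : A →+* A') (hc : ∀ x, G.d x = 0 → G'.d (f x) = 0)
    (hb : ∀ x, ∃ y, f (G.d x) = G'.d y) : G.Coh →+* G'.Coh :=
  Ideal.Quotient.lift G.boundaries
    (G'.proj.comp (f.restrict G.cycles G'.cycles hc))
    (by
      rintro ⟨z, hz⟩ ⟨a, ha⟩
      obtain ⟨y, hy⟩ := hb a
      refine Ideal.Quotient.eq_zero_iff_mem.2 ⟨y, ?_⟩
      rw [← hy, ha]
      rfl)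

theorem Coh.map_cls (f : A →+* A') (hc : ∀ x, G.d x = 0 → G'.d (f x) = 0)
    (hb : ∀ x, ∃ y, f (G.d x) = G'.d y) (x : A) (hx : G.d x = 0) :
    Coh.map f hc hb (G.cls x hx) = G'.cls (f x) (hc x hx) := rfl

theorem Coh.hom_ext {S : Type} [Ring S] {f g : G.Coh →+* S}
    (h : ∀ x hx, f (G.cls x hx) = g (G.cls x hx)) : f = g := by
  ext z
  obtain ⟨⟨x, hx⟩, rfl⟩ := G.proj_surjective z
  exact h x hx

end DGRing

/-- The ring `A[b⁻¹]` obtained from `A` by adjoining a central inverse of `b`. It is the usual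
localization if `b` is central, as is the case for an element of even degree in a graded commutative
ring. -/
def Loc (A : Type) [Ring A] (b : A) : Type :=
  RingQuot (fun p q : Polynomial A => p = Polynomial.X * Polynomial.C b ∧ q = 1)

namespace Loc
variable {A : Type} [Ring A] {b : A}

instance : Ring (Loc A b) :=
  inferInstanceAs (Ring (RingQuot (fun p q : Polynomial A => p = Polynomial.X * Polynomial.C b ∧ q = 1)))

variable (b) in
/-- The projection from `A[X]`; the variable goes to the inverse of `b`. -/
def mk : Polynomial A →+* Loc A b := RingQuot.mkRingHom _

variable (b) in
/-- The localization map -/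
def of : A →+* Loc A b := (mk b).comp Polynomial.C

variable {A' : Type} [Ring A'] {b' : A'}

/-- The map of localizations. -/
def map (f : A →+* A') (h : f b = b') : Loc A b →+* Loc A' b' :=
  RingQuot.lift ⟨(mk b').comp (Polynomial.mapRingHom f), by
    rintro _ _ ⟨rfl, rfl⟩
    have : mk b' (Polynomial.X * Polynomial.C b') = mk b' 1 := RingQuot.mkRingHom_rel ⟨rfl, rfl⟩
    simpa [h] using this⟩

theorem map_mk (f : A →+* A') (h : f b = b') (p : Polynomial A) :
    map f h (mk b p) = mk b' (p.map f) := RingQuot.lift_mkRingHom_apply _ _ _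

theorem map_of (f : A →+* A') (h : f b = b') (a : A) : map f h (of b a) = of b' (f a) := by
  simp [of, map_mk]

theorem hom_ext {S : Type} [Ring S] {f g : Loc A b →+* S} (h : f.comp (of b) = g.comp (of b)) :
    f = g := by
  refine RingQuot.ringQuot_ext _ _ (Polynomial.ringHom_ext' h ?_)
  have hb : f (of b b) = g (of b b) := RingHom.congr_fun h b
  have h1 : mk b Polynomial.X * of b b = 1 := by
    have : mk b (Polynomial.X * Polynomial.C b) = mk b 1 := RingQuot.mkRingHom_rel ⟨rfl, rfl⟩
    rw [map_mul, map_one] at this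
    exact this
  have h2 : of b b * mk b Polynomial.X = 1 := by
    rw [← h1]
    simp only [of, RingHom.comp_apply, ← map_mul, Polynomial.X_mul_C]
  change f (mk b Polynomial.X) = g (mk b Polynomial.X)
  calc f (mk b Polynomial.X) = f (mk b Polynomial.X) * (g (of b b) * g (mk b Polynomial.X)) := by
        rw [← map_mul, h2, map_one, mul_one]
    _ = g (mk b Polynomial.X) := by rw [← hb, ← mul_assoc, ← map_mul, h1, map_one, one_mul]

theorem mk_surjective : Function.Surjective (mk b) := RingQuot.mkRingHom_surjective _

end Loc

namespace Cobar

variable (H N : Type) [CommRing H] [Bialgebra F3 H] [CommRing N] [Algebra F3 N] [ComodAlg H N]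

/-- The sign automorphism as a map of rings. -/
def signHom : Cobar H N →+* Cobar H N where
  toFun := sign
  map_one' := by simp [one_def]
  map_mul' := sign_mul
  map_zero' := map_zero _
  map_add' := map_add _

/-- The cobar complex as a differential graded ring. -/
def dg : DGRing (Cobar H N) where
  sign := signHom H N
  sign_sign := sign_sign
  d := d.toAddMonoidHom
  d_d := d_d
  d_mul := d_mul
  d_sign := d_sign

end Cobar

/-- The ring `Ext_H(k, N)`, the cohomology of the cobar complex. -/
abbrev ExtRing (H N : Type) [CommRing H] [Bialgebra F3 H] [CommRing N] [Algebra F3 N]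
    [ComodAlg H N] : Type := (Cobar.dg H N).Coh

/-- A bialgebra with a distinguished primitive element `ξ₁`. -/
class HasXi (H : Type) [CommRing H] [Bialgebra F3 H] where
  xi : H
  comul_xi : Coalgebra.comul (R := F3) xi = xi ⊗ₜ[F3] 1 + 1 ⊗ₜ[F3] xi

namespace Cobar
variable (H N : Type) [CommRing H] [Bialgebra F3 H] [CommRing N] [Algebra F3 N] [ComodAlg H N]
  [HasXi H]

/-- `h₁₀ = [ξ₁]1`. -/
def hCochain : Cobar H N := cons HasXi.xi (ofN 1)

/-- `b₁₀ = [ξ₁|ξ₁²]1 + [ξ₁²|ξ₁]1`. -/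
def bCochain : Cobar H N :=
  cons HasXi.xi (cons (HasXi.xi ^ 2) (ofN 1)) + cons (HasXi.xi ^ 2) (cons HasXi.xi (ofN 1))

theorem d_hCochain : (dg H N).d (hCochain H N) = 0 := by
  change cons 1 (hCochain H N) - inner (hCochain H N) = 0
  have h1 : (ComodAlg.coact (1 : N) : H ⊗[F3] N) = 1 ⊗ₜ 1 := map_one _
  rw [hCochain, inner_cons, HasXi.comul_xi, inner_ofN, h1]
  simp

theorem d_bCochain : (dg H N).d (bCochain H N) = 0 := by
  change cons 1 (bCochain H N) - inner (bCochain H N) = 0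
  have h1 : (ComodAlg.coact (1 : N) : H ⊗[F3] N) = 1 ⊗ₜ 1 := map_one _
  simp only [bCochain, map_add, inner_cons, pow_two, Bialgebra.comul_mul, HasXi.comul_xi, inner_ofN,
    h1, mul_add, add_mul, Algebra.TensorProduct.tmul_mul_tmul,
    mul_one, one_mul, LinearMap.add_apply, consH_tmul, consN_tmul, map_sub]
  abel

end Cobar

section BExt
variable (H N : Type) [CommRing H] [Bialgebra F3 H] [CommRing N] [Algebra F3 N] [ComodAlg H N]
  [HasXi H]

/-- The class `b₁₀ ∈ Ext²_H(k, N)`. -/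
def bClass : ExtRing H N := (Cobar.dg H N).cls _ (Cobar.d_bCochain H N)

/-- `b₁₀⁻¹ Ext_H(k, N)`. -/
def BExt : Type := Loc (ExtRing H N) (bClass H N)

namespace BExt
instance : Ring (BExt H N) := inferInstanceAs (Ring (Loc (ExtRing H N) (bClass H N)))

variable {H N} in
/-- The class of a cocycle in `b₁₀⁻¹ Ext_H(k, N)`. -/
def cls (x : Cobar H N) (hx : Cobar.d x = 0) : BExt H N :=
  Loc.of _ ((Cobar.dg H N).cls x hx)

/-- The class `h₁₀`. -/
def h10 : BExt H N := cls _ (Cobar.d_hCochain H N)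
/-- The class `b₁₀`. -/
def b10 : BExt H N := cls _ (Cobar.d_bCochain H N)

variable {H N} in
theorem hom_ext {S : Type} [Ring S] {f g : BExt H N →+* S}
    (h : ∀ x hx, f (cls x hx) = g (cls x hx)) : f = g := by
  exact Loc.hom_ext (DGRing.Coh.hom_ext h)

/-- The sign automorphism, `(-1)ᵗ` in homological degree `t`. -/
def sign : BExt H N →+* BExt H N :=
  Loc.map (DGRing.Coh.map (Cobar.signHom H N)
    (fun x hx => by
      change Cobar.d (Cobar.sign x) = 0
      have hx' : Cobar.d x = 0 := hx
      rw [Cobar.d_sign, hx']; simp)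
    (fun x => ⟨- Cobar.sign x, by
      change Cobar.sign (Cobar.d x) = Cobar.d (- Cobar.sign x)
      rw [map_neg, Cobar.d_sign, neg_neg]⟩)) (by
    refine congrArg (Cobar.dg H N).proj (Subtype.ext ?_)
    change Cobar.sign (Cobar.bCochain H N) = Cobar.bCochain H N
    simp [Cobar.bCochain])

variable {H N}
variable {H' N' : Type} [CommRing H'] [Bialgebra F3 H'] [CommRing N'] [Algebra F3 N']
  [ComodAlg H' N'] [HasXi H']

/-- The map `b₁₀⁻¹ Ext_H(k, N) → b₁₀⁻¹ Ext_{H'}(k, N')` induced by compatible maps of bialgebras and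
comodule algebras. -/
def map (f : H →ₐc[F3] H') (g : N →ₐ[F3] N') (hfg : Cobar.Compat f g)
    (hxi : f HasXi.xi = HasXi.xi) : BExt H N →+* BExt H' N' :=
  Loc.map (DGRing.Coh.map (Cobar.mapHom hfg)
    (fun x hx => by
      change Cobar.d (Cobar.map f g x) = 0
      have hx' : Cobar.d x = 0 := hx
      rw [← Cobar.map_d hfg, hx', map_zero])
    (fun x => ⟨Cobar.map f g x, Cobar.map_d hfg x⟩)) (by
    refine congrArg (Cobar.dg H' N').proj (Subtype.ext ?_)
    change Cobar.map f g (Cobar.bCochain H N) = Cobar.bCochain H' N'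
    simp [Cobar.bCochain, hxi])

end BExt
end BExt

/-- `P = 𝔽₃[ξ₁, ξ₂, …]`; the variable `X n` is `ξ_{n+1}`. -/
def DualP : Type := MvPolynomial ℕ F3

namespace DualP
instance : CommRing DualP := inferInstanceAs (CommRing (MvPolynomial ℕ F3))
instance : Algebra F3 DualP := inferInstanceAs (Algebra F3 (MvPolynomial ℕ F3))

/-- `ξ_n`, with `ξ₀ = 1`. -/
def xi : ℕ → DualP
  | 0 => 1
  | n + 1 => (MvPolynomial.X n : MvPolynomial ℕ F3)

theorem xi_zero : xi 0 = 1 := rfl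

/-- The map of algebras with `ξ_{n+1} ↦ x n`. -/
def eval {S : Type} [CommRing S] [Algebra F3 S] (x : ℕ → S) : DualP →ₐ[F3] S :=
  MvPolynomial.aeval x

theorem eval_xi {S : Type} [CommRing S] [Algebra F3 S] (x : ℕ → S) (n : ℕ) :
    eval x (xi (n + 1)) = x n := MvPolynomial.aeval_X _ _

theorem hom_ext {S : Type} [CommRing S] [Algebra F3 S] {f g : DualP →ₐ[F3] S}
    (h : ∀ n, f (xi (n + 1)) = g (xi (n + 1))) : f = g := MvPolynomial.algHom_ext h

/-- `Δ(ξ_n) = Σ_{i+j=n} ξ_i ⊗ ξ_j^{3^i}` -/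
def comul : DualP →ₐ[F3] DualP ⊗[F3] DualP :=
  eval fun n => ∑ i ∈ Finset.range (n + 2), xi i ⊗ₜ[F3] (xi (n + 1 - i) ^ 3 ^ i)

/-- `ε(ξ_n) = 0` -/
def counit : DualP →ₐ[F3] F3 := eval fun _ => 0

theorem comul_xi (n : ℕ) :
    comul (xi n) = ∑ i ∈ Finset.range (n + 1), xi i ⊗ₜ[F3] (xi (n - i) ^ 3 ^ i) := by
  cases n with
  | zero => simp [xi, Algebra.TensorProduct.one_def]
  | succ n => exact eval_xi _ _

theorem counit_xi (n : ℕ) : counit (xi n) = if n = 0 then 1 else 0 := by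
  cases n with
  | zero => simp [xi]
  | succ n => exact (eval_xi _ _).trans (by simp)

theorem sum_pow {S : Type} [CommRing S] [Algebra F3 S] {ι : Type} (s : Finset ι) (f : ι → S)
    (n : ℕ) : (∑ i ∈ s, f i) ^ 3 ^ n = ∑ i ∈ s, f i ^ 3 ^ n := by
  rcases subsingleton_or_nontrivial S with h | h
  · exact Subsingleton.elim _ _
  · have : CharP S 3 := charP_of_injective_algebraMap (algebraMap F3 S).injective 3
    exact sum_pow_char_pow 3 n s f

instance : Bialgebra F3 DualP := Bialgebra.ofAlgHom comul counit
  (by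
    refine hom_ext fun n => ?_
    simp only [AlgHom.comp_apply, comul_xi, map_sum, Algebra.TensorProduct.map_tmul,
      AlgHom.coe_id, id_eq, map_pow, sum_pow, TensorProduct.sum_tmul, TensorProduct.tmul_sum]
    simp only [AlgEquiv.toAlgHom, AlgHom.coe_mk, RingHom.coe_mk, MonoidHom.coe_mk, OneHom.coe_mk,
      Algebra.TensorProduct.tmul_pow, ← pow_mul, ← pow_add]
    rw [Finset.sum_sigma', Finset.sum_sigma']
    refine Finset.sum_bij' (fun x _ => ⟨x.2, x.1 - x.2⟩) (fun x _ => ⟨x.1 + x.2, x.1⟩) ?_ ?_ ?_ ?_ ?_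
    · rintro ⟨i, j⟩ h
      simp only [Finset.mem_sigma, Finset.mem_range] at h ⊢
      omega
    · rintro ⟨i, j⟩ h
      simp only [Finset.mem_sigma, Finset.mem_range] at h ⊢
      omega
    · rintro ⟨i, j⟩ h
      simp only [Finset.mem_sigma, Finset.mem_range] at h
      simp only [Sigma.mk.injEq, heq_eq_eq, and_true]
      omega
    · rintro ⟨i, j⟩ h
      simp only [Sigma.mk.injEq, heq_eq_eq, true_and]
      omega
    · rintro ⟨i, j⟩ h
      simp only [Finset.mem_sigma, Finset.mem_range] at h
      refine Eq.trans (Algebra.TensorProduct.assoc_tmul _ _ _ _ _ _) ?_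
      rw [show n + 1 - j - (i - j) = n + 1 - i by omega, show i - j + j = i by omega])
  (by
    refine hom_ext fun n => ?_
    rw [AlgHom.comp_apply, comul_xi, map_sum, Finset.sum_eq_single 0]
    · simp [counit_xi]
    · intro i _ h
      simp [counit_xi, h]
    · simp)
  (by
    refine hom_ext fun n => ?_
    rw [AlgHom.comp_apply, comul_xi, map_sum, Finset.sum_eq_single (n + 1)]
    · simp [counit_xi]
    · intro i hi h
      rw [Finset.mem_range] at hi
      have : n + 1 - i ≠ 0 := by omega
      simp [counit_xi, this]
    · simp)

end DualP

/-- `D = 𝔽₃[ξ₁]/(ξ₁³)`. -/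
def DualD : Type := AdjoinRoot (Polynomial.X ^ 3 : Polynomial F3)

namespace DualD
instance : CommRing DualD := inferInstanceAs (CommRing (AdjoinRoot (Polynomial.X ^ 3 : Polynomial F3)))
instance : Algebra F3 DualD :=
  inferInstanceAs (Algebra F3 (AdjoinRoot (Polynomial.X ^ 3 : Polynomial F3)))

def xi : DualD := AdjoinRoot.root (Polynomial.X ^ 3 : Polynomial F3)

theorem xi_pow : xi ^ 3 = 0 := by
  have := AdjoinRoot.eval₂_root (Polynomial.X ^ 3 : Polynomial F3)
  rwa [Polynomial.eval₂_X_pow] at this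

def eval {S : Type} [CommRing S] [Algebra F3 S] (x : S) (hx : x ^ 3 = 0) : DualD →ₐ[F3] S :=
  AdjoinRoot.liftAlgHom (Polynomial.X ^ 3 : Polynomial F3) (Algebra.ofId F3 S) x (by simp [hx])

theorem eval_xi {S : Type} [CommRing S] [Algebra F3 S] (x : S) (hx : x ^ 3 = 0) :
    eval x hx xi = x := AdjoinRoot.liftAlgHom_root _ _ _ _

theorem hom_ext {S : Type} [CommRing S] [Algebra F3 S] {f g : DualD →ₐ[F3] S}
    (h : f xi = g xi) : f = g := AdjoinRoot.algHom_ext h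

theorem cube_add {S : Type} [CommRing S] [Algebra F3 S] (x y : S) : (x + y) ^ 3 = x ^ 3 + y ^ 3 := by
  have h3 : (3 : S) = 0 := by
    have := map_ofNat (algebraMap F3 S) 3
    rw [← this, show (OfNat.ofNat 3 : F3) = 0 from rfl, map_zero]
  linear_combination (x ^ 2 * y + x * y ^ 2) * h3

def comul : DualD →ₐ[F3] DualD ⊗[F3] DualD :=
  eval (xi ⊗ₜ 1 + 1 ⊗ₜ xi) (by
    rw [cube_add, Algebra.TensorProduct.tmul_pow, Algebra.TensorProduct.tmul_pow, xi_pow]; simp)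

theorem comul_xi : comul xi = xi ⊗ₜ 1 + 1 ⊗ₜ xi := eval_xi _ _

def counit : DualD →ₐ[F3] F3 := eval 0 (by simp)

theorem counit_xi : counit xi = 0 := eval_xi _ _

instance : Bialgebra F3 DualD := Bialgebra.ofAlgHom comul counit
  (by
    refine hom_ext ?_
    simp [comul, eval_xi, TensorProduct.add_tmul, TensorProduct.tmul_add,
      Algebra.TensorProduct.one_def]
    abel)
  (by refine hom_ext ?_; simp [comul, counit, eval_xi])
  (by refine hom_ext ?_; simp [comul, counit, eval_xi])

end DualD

instance : HasXi DualP where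
  xi := DualP.xi 1
  comul_xi := by
    refine (DualP.comul_xi 1).trans ?_
    rw [Finset.sum_range_succ, Finset.sum_range_one, DualP.xi_zero, add_comm]
    simp

instance : HasXi DualD where
  xi := DualD.xi
  comul_xi := DualD.comul_xi

/-- The projection `π : P → D` with `ξ₁ ↦ ξ₁` and `ξ_n ↦ 0` for `n ≥ 2`, as a map of algebras. -/
def DualP.toDAlg : DualP →ₐ[F3] DualD := DualP.eval fun n => if n = 0 then DualD.xi else 0

theorem DualP.toDAlg_xi (n : ℕ) :
    DualP.toDAlg (DualP.xi n) = if n = 0 then 1 else if n = 1 then DualD.xi else 0 := by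
  cases n with
  | zero => simp [DualP.xi]
  | succ n => exact (DualP.eval_xi _ _).trans (by simp)

theorem DualP.counit_toDAlg :
    (Bialgebra.counitAlgHom F3 DualD).comp DualP.toDAlg = Bialgebra.counitAlgHom F3 DualP := by
  refine DualP.hom_ext fun n => ?_
  refine Eq.trans ?_ (DualP.counit_xi (n + 1)).symm
  rw [AlgHom.comp_apply, DualP.toDAlg_xi, if_neg (Nat.succ_ne_zero n), if_neg (Nat.succ_ne_zero n)]
  split_ifs
  · exact DualD.counit_xi
  · exact map_zero _

theorem DualP.comul_toDAlg :
    (Algebra.TensorProduct.map DualP.toDAlg DualP.toDAlg).comp (Bialgebra.comulAlgHom F3 DualP)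
      = (Bialgebra.comulAlgHom F3 DualD).comp DualP.toDAlg := by
    refine DualP.hom_ext fun n => ?_
    refine Eq.trans (congrArg (Algebra.TensorProduct.map DualP.toDAlg DualP.toDAlg)
      (DualP.comul_xi (n + 1))) ?_
    rw [map_sum, Finset.sum_range_succ, Finset.sum_range_succ', Finset.sum_eq_zero]
    · simp only [Algebra.TensorProduct.map_tmul, map_pow, DualP.toDAlg_xi, AlgHom.comp_apply]
      by_cases hn : n = 0
      · subst hn
        simp
        exact (add_comm _ _).trans DualD.comul_xi.symm
      · simp [hn]
    · intro i hi
      rw [Finset.mem_range] at hi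
      simp only [Algebra.TensorProduct.map_tmul, map_pow, DualP.toDAlg_xi]
      by_cases h0 : i = 0
      · subst h0
        by_cases h1 : n = 1
        · subst h1
          simp [DualD.xi_pow]
        · have hn : n ≠ 0 := by omega
          have h2 : n + 1 - (0 + 1) ≠ 1 := by omega
          have h3 : n + 1 - (0 + 1) ≠ 0 := by omega
          rw [if_neg h3, if_neg h2]
          simp
      · simp [h0]

/-- The projection `π : P → D`, as a map of bialgebras. -/
def DualP.toD : DualP →ₐc[F3] DualD :=
  BialgHom.ofAlgHom DualP.toDAlg DualP.counit_toDAlg DualP.comul_toDAlg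

namespace Cotensor
variable {H D : Type} [CommRing H] [Bialgebra F3 H] [CommRing D] [Bialgebra F3 D]

/-- The cotensor product `H □_D k = {x | (1 ⊗ π)(Δ x) = x ⊗ 1}`. -/
def coinv (π : H →ₐc[F3] D) : Subalgebra F3 H :=
  AlgHom.equalizer
    ((Algebra.TensorProduct.map (AlgHom.id F3 H) (π : H →ₐ[F3] D)).comp (Bialgebra.comulAlgHom F3 H))
    (Algebra.TensorProduct.includeLeft : H →ₐ[F3] H ⊗[F3] D)

variable (π : H →ₐc[F3] D)

/-- The inclusion `H ⊗ (H □_D k) → H ⊗ H`. -/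
def incl : H ⊗[F3] coinv π →ₐ[F3] H ⊗[F3] H :=
  Algebra.TensorProduct.map (AlgHom.id F3 H) (coinv π).val

theorem incl_injective : Function.Injective (incl π) :=
  Module.Flat.lTensor_preserves_injective_linearMap (M := H) (coinv π).val.toLinearMap
    Subtype.val_injective

theorem coassoc_alg : (Algebra.TensorProduct.assoc F3 F3 F3 H H H).toAlgHom.comp
      ((Algebra.TensorProduct.map (Bialgebra.comulAlgHom F3 H) (AlgHom.id F3 H)).comp
        (Bialgebra.comulAlgHom F3 H))
    = (Algebra.TensorProduct.map (AlgHom.id F3 H) (Bialgebra.comulAlgHom F3 H)).comp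
        (Bialgebra.comulAlgHom F3 H) :=
  AlgHom.ext fun x => Coalgebra.coassoc_apply x

theorem comul_mem (x : coinv π) : Bialgebra.comulAlgHom F3 H x ∈ (incl π).range := by
  let g : H →ₗ[F3] H ⊗[F3] D :=
    ((Algebra.TensorProduct.map (AlgHom.id F3 H) (π : H →ₐ[F3] D)).comp
      (Bialgebra.comulAlgHom F3 H)).toLinearMap -
    (Algebra.TensorProduct.includeLeft : H →ₐ[F3] H ⊗[F3] D).toLinearMap
  have hex : Function.Exact (coinv π).val.toLinearMap g := by
    intro y
    constructor
    · intro hy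
      exact ⟨⟨y, sub_eq_zero.1 hy⟩, rfl⟩
    · rintro ⟨z, rfl⟩
      exact sub_eq_zero.2 z.2
  have hex' := Module.Flat.lTensor_exact H hex
  refine (hex' _).1 ?_
  have hx : (Algebra.TensorProduct.map (AlgHom.id F3 H) (π : H →ₐ[F3] D))
      (Bialgebra.comulAlgHom F3 H (x : H)) = (x : H) ⊗ₜ 1 := x.2
  have hco := DFunLike.congr_fun (coassoc_alg (H := H)) (x : H)
  simp only [AlgHom.comp_apply] at hco
  have h1 : ∀ T : H ⊗[F3] H, g.lTensor H T =
      Algebra.TensorProduct.map (AlgHom.id F3 H)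
          (Algebra.TensorProduct.map (AlgHom.id F3 H) (π : H →ₐ[F3] D))
        (Algebra.TensorProduct.map (AlgHom.id F3 H) (Bialgebra.comulAlgHom F3 H) T)
      - Algebra.TensorProduct.assoc F3 F3 F3 H H D (T ⊗ₜ 1) := by
    intro T
    induction T with
    | zero => simp
    | add a b ha hb => simp only [map_add, TensorProduct.add_tmul, ha, hb]; abel
    | tmul a b =>
      rw [LinearMap.lTensor_tmul, Algebra.TensorProduct.map_tmul, Algebra.TensorProduct.map_tmul,
        Algebra.TensorProduct.assoc_tmul]
      exact TensorProduct.tmul_sub a _ _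
  have h2 : ∀ T : H ⊗[F3] H, Algebra.TensorProduct.map (AlgHom.id F3 H)
          (Algebra.TensorProduct.map (AlgHom.id F3 H) (π : H →ₐ[F3] D))
        (Algebra.TensorProduct.assoc F3 F3 F3 H H H
          (Algebra.TensorProduct.map (Bialgebra.comulAlgHom F3 H) (AlgHom.id F3 H) T)) =
      Algebra.TensorProduct.assoc F3 F3 F3 H H D
        (Algebra.TensorProduct.map (Bialgebra.comulAlgHom F3 H) (AlgHom.id F3 D)
          (Algebra.TensorProduct.map (AlgHom.id F3 H) (π : H →ₐ[F3] D) T)) := by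
    intro T
    induction T with
    | zero => simp
    | add a b ha hb => simp only [map_add, ha, hb]
    | tmul a b =>
      simp only [Algebra.TensorProduct.map_tmul, AlgHom.id_apply]
      induction (Bialgebra.comulAlgHom F3 H a) with
      | zero => simp
      | add p q hp hq => simp only [map_add, TensorProduct.add_tmul, hp, hq]
      | tmul p q => simp
  rw [h1, ← hco]
  refine sub_eq_zero.2 ((h2 _).trans ?_)
  rw [hx]
  simp

/-- The left coaction of `H` on `H □_D k`, the restriction of the comultiplication of `H`. -/
def coact : coinv π →ₐ[F3] H ⊗[F3] coinv π :=
  ((AlgEquiv.ofInjective (incl π) (incl_injective π)).symm : _ →ₐ[F3] _).comp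
    (((Bialgebra.comulAlgHom F3 H).comp (coinv π).val).codRestrict (incl π).range (comul_mem π))

theorem incl_coact (x : coinv π) : incl π (coact π x) = Bialgebra.comulAlgHom F3 H x := by
  have := (AlgEquiv.ofInjective (incl π) (incl_injective π)).apply_symm_apply
    ⟨Bialgebra.comulAlgHom F3 H x, comul_mem π x⟩
  exact congrArg Subtype.val this

instance : ComodAlg H (coinv π) where
  coact := coact π
  coassoc := by
    have hinj : Function.Injective (Algebra.TensorProduct.map (AlgHom.id F3 H) (incl π)) :=
      Module.Flat.lTensor_preserves_injective_linearMap (M := H) (incl π).toLinearMap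
        (incl_injective π)
    refine AlgHom.ext fun x => hinj ?_
    have hco := DFunLike.congr_fun (coassoc_alg (H := H)) (x : H)
    simp only [AlgHom.comp_apply] at hco ⊢
    have h1 : ∀ T : H ⊗[F3] coinv π, Algebra.TensorProduct.map (AlgHom.id F3 H) (incl π)
        (Algebra.TensorProduct.assoc F3 F3 F3 H H (coinv π)
          (Algebra.TensorProduct.map (Bialgebra.comulAlgHom F3 H) (AlgHom.id F3 (coinv π)) T))
        = Algebra.TensorProduct.assoc F3 F3 F3 H H H
          (Algebra.TensorProduct.map (Bialgebra.comulAlgHom F3 H) (AlgHom.id F3 H) (incl π T)) := by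
      intro T
      induction T with
      | zero => simp
      | add a b ha hb => simp only [map_add, ha, hb]
      | tmul a b =>
        simp only [Algebra.TensorProduct.map_tmul, AlgHom.id_apply, incl]
        induction (Bialgebra.comulAlgHom F3 H a) with
        | zero => simp
        | add p q hp hq => simp only [map_add, TensorProduct.add_tmul, hp, hq]
        | tmul p q => simp
    have h2 : ∀ T : H ⊗[F3] coinv π, Algebra.TensorProduct.map (AlgHom.id F3 H) (incl π)
        (Algebra.TensorProduct.map (AlgHom.id F3 H) (coact π) T)
        = Algebra.TensorProduct.map (AlgHom.id F3 H) (Bialgebra.comulAlgHom F3 H) (incl π T) := by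
      intro T
      induction T with
      | zero => simp
      | add a b ha hb => simp only [map_add, ha, hb]
      | tmul a b =>
        simp only [Algebra.TensorProduct.map_tmul, AlgHom.id_apply, incl_coact]
        simp [incl]
    refine (h1 _).trans (Eq.trans ?_ (h2 _).symm)
    rw [incl_coact]
    exact hco
  counit := by
    refine AlgHom.ext fun x => (Algebra.TensorProduct.lid F3 (coinv π)).injective
      (Subtype.val_injective ?_)
    simp only [AlgHom.comp_apply]
    have h1 : ∀ T : H ⊗[F3] coinv π, ((Algebra.TensorProduct.lid F3 (coinv π)
        (Algebra.TensorProduct.map (Bialgebra.counitAlgHom F3 H) (AlgHom.id F3 (coinv π)) T)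
          : coinv π) : H)
        = TensorProduct.lid F3 H ((Coalgebra.counit (R := F3) (A := H)).rTensor H (incl π T)) := by
      intro T
      induction T with
      | zero => simp
      | add a b ha hb => simp only [map_add, ← ha, ← hb]; rfl
      | tmul a b => simp [incl]
    rw [h1, incl_coact]
    simp

end Cotensor

/-- The `D`-comodule algebra obtained from an `H`-comodule algebra through `π : H → D`. -/
@[reducible] def ComodAlg.push {H D N : Type} [CommRing H] [Bialgebra F3 H] [CommRing D] [Bialgebra F3 D]
    [CommRing N] [Algebra F3 N] [ComodAlg H N] (π : H →ₐc[F3] D) : ComodAlg D N where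
  coact := (Algebra.TensorProduct.map (π : H →ₐ[F3] D) (AlgHom.id F3 N)).comp ComodAlg.coact
  coassoc := by
    refine AlgHom.ext fun n => ?_
    have hco := DFunLike.congr_fun (ComodAlg.coassoc (H := H) (N := N)) n
    let Q : H ⊗[F3] (H ⊗[F3] N) →ₐ[F3] D ⊗[F3] (D ⊗[F3] N) :=
      Algebra.TensorProduct.map (π : H →ₐ[F3] D)
        (Algebra.TensorProduct.map (π : H →ₐ[F3] D) (AlgHom.id F3 N))
    have := congrArg Q hco
    simp only [AlgHom.comp_apply] at this ⊢
    refine Eq.trans ?_ (this.trans ?_)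
    · induction (ComodAlg.coact n : H ⊗[F3] N) with
      | zero => simp
      | add a b ha hb => simp only [map_add, ha, hb]
      | tmul a b =>
        simp only [Algebra.TensorProduct.map_tmul, AlgHom.id_apply]
        have hπ : Bialgebra.comulAlgHom F3 D ((π : H →ₐ[F3] D) a) =
            Algebra.TensorProduct.map (π : H →ₐ[F3] D) (π : H →ₐ[F3] D)
              (Bialgebra.comulAlgHom F3 H a) :=
          (CoalgHomClass.map_comp_comul_apply π a).symm
        rw [hπ]
        induction (Bialgebra.comulAlgHom F3 H a) with
        | zero => simp
        | add p q hp hq => simp only [map_add, TensorProduct.add_tmul, hp, hq]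
        | tmul p q => simp [Q]
    · induction (ComodAlg.coact n : H ⊗[F3] N) with
      | zero => simp
      | add a b ha hb => simp only [map_add, ha, hb]
      | tmul a b => simp [Q]
  counit := by
    refine AlgHom.ext fun n => ?_
    refine Eq.trans ?_ (DFunLike.congr_fun (ComodAlg.counit (H := H) (N := N)) n)
    simp only [AlgHom.comp_apply]
    induction (ComodAlg.coact n : H ⊗[F3] N) with
    | zero => simp
    | add a b ha hb => simp only [map_add, ha, hb]
    | tmul a b => simp

section Pow
variable (N : Type) [CommRing N] [Algebra F3 N]

/-- `N^{⊗ n}`. -/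
abbrev TPow (n : ℕ) : Type := ⨂[F3] _ : Fin n, N

namespace TPow
variable {N}

/-- The inclusion of the `i`-th factor. -/
def incl {n : ℕ} (i : Fin n) : N →ₐ[F3] TPow N n := PiTensorProduct.singleAlgHom (R := F3) (A := fun _ : Fin n => N) i

/-- `x₁ ⊗ … ⊗ xₙ ↦ ∏ fᵢ(xᵢ)`. -/
def lift {n : ℕ} {S : Type} [CommRing S] [Algebra F3 S] (f : Fin n → (N →ₐ[F3] S)) :
    TPow N n →ₐ[F3] S :=
  PiTensorProduct.liftAlgHom
    ((MultilinearMap.mkPiAlgebra F3 (Fin n) S).compLinearMap fun i => (f i).toLinearMap)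
    (by simp) (by intro x y; simp [Finset.prod_mul_distrib])

theorem lift_tprod {n : ℕ} {S : Type} [CommRing S] [Algebra F3 S] (f : Fin n → (N →ₐ[F3] S))
    (x : Fin n → N) : lift f (PiTensorProduct.tprod F3 x) = ∏ i, f i (x i) := by
  refine (PiTensorProduct.lift.tprod _).trans ?_
  simp

theorem lift_incl {n : ℕ} {S : Type} [CommRing S] [Algebra F3 S] (f : Fin n → (N →ₐ[F3] S))
    (i : Fin n) (x : N) : lift f (incl i x) = f i x := by
  refine (lift_tprod f _).trans ?_
  rw [Finset.prod_eq_single i]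
  · simp
  · intro j _ hj
    simp [MonoidHom.mulSingle_apply, Pi.mulSingle_eq_of_ne hj]
  · simp

theorem hom_ext {n : ℕ} {S : Type} [CommRing S] [Algebra F3 S] {f g : TPow N n →ₐ[F3] S}
    (h : ∀ i x, f (incl i x) = g (incl i x)) : f = g :=
  PiTensorProduct.algHom_ext fun i => AlgHom.ext (h i)

/-- The map of algebras that sends the `i`-th factor to the factor `f i` by the identity; a factor
that is not hit is filled by the unit, factors with the same image are multiplied. -/
def map {m n : ℕ} (f : Fin m → Fin n) : TPow N m →ₐ[F3] TPow N n := lift fun i => incl (f i)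

variable {H : Type} [CommRing H] [Bialgebra F3 H] [ComodAlg H N]

/-- The diagonal coaction on `N^{⊗ n}`. -/
instance (n : ℕ) : ComodAlg H (TPow N n) where
  coact := lift fun i => (Algebra.TensorProduct.map (AlgHom.id F3 H) (incl i)).comp ComodAlg.coact
  coassoc := by
    refine hom_ext fun i x => ?_
    have hco := DFunLike.congr_fun (ComodAlg.coassoc (H := H) (N := N)) x
    let Q : H ⊗[F3] (H ⊗[F3] N) →ₐ[F3] H ⊗[F3] (H ⊗[F3] TPow N n) :=
      Algebra.TensorProduct.map (AlgHom.id F3 H)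
        (Algebra.TensorProduct.map (AlgHom.id F3 H) (incl i))
    have := congrArg Q hco
    simp only [AlgHom.comp_apply, lift_incl] at this ⊢
    refine Eq.trans ?_ (this.trans ?_)
    · induction (ComodAlg.coact x : H ⊗[F3] N) with
      | zero => simp
      | add a b ha hb => simp only [map_add, ha, hb]
      | tmul a b =>
        simp only [Algebra.TensorProduct.map_tmul, AlgHom.id_apply]
        induction (Bialgebra.comulAlgHom F3 H a) with
        | zero => simp
        | add p q hp hq => simp only [map_add, TensorProduct.add_tmul, hp, hq]
        | tmul p q => simp [Q]
    · induction (ComodAlg.coact x : H ⊗[F3] N) with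
      | zero => simp
      | add a b ha hb => simp only [map_add, ha, hb]
      | tmul a b => simp [Q, lift_incl]
  counit := by
    refine hom_ext fun i x => ?_
    have hco := congrArg (Algebra.TensorProduct.map (AlgHom.id F3 F3) (incl (n := n) i))
      (DFunLike.congr_fun (ComodAlg.counit (H := H) (N := N)) x)
    simp only [AlgHom.comp_apply, lift_incl] at hco ⊢
    refine Eq.trans ?_ (hco.trans ?_)
    · induction (ComodAlg.coact x : H ⊗[F3] N) with
      | zero => simp
      | add a b ha hb => simp only [map_add, ha, hb]
      | tmul a b => simp
    · simp

theorem map_compat {m n : ℕ} (f : Fin m → Fin n) :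
    Cobar.Compat (BialgHom.id F3 H) (map (N := N) f) := by
  intro x
  let L : TPow N m →ₐ[F3] H ⊗[F3] TPow N n := (ComodAlg.coact (H := H)).comp (map f)
  let R : TPow N m →ₐ[F3] H ⊗[F3] TPow N n :=
    (Algebra.TensorProduct.map (BialgHom.id F3 H : H →ₐ[F3] H) (map f)).comp (ComodAlg.coact (H := H))
  refine DFunLike.congr_fun (show L = R from hom_ext fun i y => ?_) x
  simp only [L, R, AlgHom.comp_apply, map, lift_incl, ComodAlg.coact]
  induction (ComodAlg.coact y : H ⊗[F3] N) with
  | zero => simp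
  | add a b ha hb => simp only [map_add, ha, hb]
  | tmul a b => simp [lift_incl]

end TPow
end Pow

/-- The left `P`-comodule algebra `B = P □_D k`. -/
abbrev BB : Type := Cotensor.coinv DualP.toD

/-- `B` as a left `D`-comodule algebra. -/
instance BB.comodAlgD : ComodAlg DualD BB := ComodAlg.push DualP.toD

theorem BB.inclD_injective : Function.Injective
    (Algebra.TensorProduct.map (AlgHom.id F3 DualD) (Cotensor.coinv DualP.toD).val) :=
  Module.Flat.lTensor_preserves_injective_linearMap (M := DualD)
    (Cotensor.coinv DualP.toD).val.toLinearMap Subtype.val_injective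

theorem BB.inclD_coact (x : BB) :
    Algebra.TensorProduct.map (AlgHom.id F3 DualD) (Cotensor.coinv DualP.toD).val
      (ComodAlg.coact (H := DualD) x) =
    Algebra.TensorProduct.map DualP.toDAlg (AlgHom.id F3 DualP)
      (Bialgebra.comulAlgHom F3 DualP (x : DualP)) := by
  rw [← Cotensor.incl_coact]
  change Algebra.TensorProduct.map (AlgHom.id F3 DualD) (Cotensor.coinv DualP.toD).val
    (Algebra.TensorProduct.map DualP.toDAlg (AlgHom.id F3 BB) (Cotensor.coact DualP.toD x)) = _
  induction (Cotensor.coact DualP.toD x) with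
  | zero => simp
  | add a b ha hb => simp only [map_add, ha, hb]
  | tmul a b => simp [Cotensor.incl]

theorem DualP.comul_right (n : ℕ) :
    Algebra.TensorProduct.map (AlgHom.id F3 DualP) DualP.toDAlg
      (Bialgebra.comulAlgHom F3 DualP (xi (n + 1))) =
    xi (n + 1) ⊗ₜ 1 + xi n ⊗ₜ (DualD.xi ^ 3 ^ n) := by
  refine Eq.trans (congrArg (Algebra.TensorProduct.map (AlgHom.id F3 DualP) DualP.toDAlg)
    (DualP.comul_xi (n + 1))) ?_
  rw [map_sum, Finset.sum_range_succ, Finset.sum_range_succ, Finset.sum_eq_zero]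
  · simp [DualP.toDAlg_xi, add_comm]
  · intro i hi
    rw [Finset.mem_range] at hi
    have h1 : n + 1 - i ≠ 0 := by omega
    have h2 : n + 1 - i ≠ 1 := by omega
    simp only [Algebra.TensorProduct.map_tmul, map_pow, DualP.toDAlg_xi, if_neg h1, if_neg h2]
    simp

theorem DualP.comul_left (n : ℕ) :
    Algebra.TensorProduct.map DualP.toDAlg (AlgHom.id F3 DualP)
      (Bialgebra.comulAlgHom F3 DualP (xi (n + 1))) =
    1 ⊗ₜ xi (n + 1) + DualD.xi ⊗ₜ (xi n ^ 3) := by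
  refine Eq.trans (congrArg (Algebra.TensorProduct.map DualP.toDAlg (AlgHom.id F3 DualP))
    (DualP.comul_xi (n + 1))) ?_
  rw [map_sum, Finset.sum_range_succ', Finset.sum_range_succ', Finset.sum_eq_zero]
  · simp [DualP.toDAlg_xi, add_comm]
  · intro i hi
    simp only [Algebra.TensorProduct.map_tmul, DualP.toDAlg_xi]
    simp

theorem DualD.xi_pow_three_pow (n : ℕ) : DualD.xi ^ 3 ^ (n + 1) = 0 := by
  rw [pow_succ, mul_comm, pow_mul, DualD.xi_pow, zero_pow (by positivity)]

theorem DualP.add_cube {S : Type} [CommRing S] [Algebra F3 S] (x y : S) :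
    (x + y) ^ 3 = x ^ 3 + y ^ 3 := by
  simpa using DualP.sum_pow Finset.univ ![x, y] 1

/-- `ξ_{n+2}` as an element of `B`. -/
def BB.xi (n : ℕ) : BB := ⟨DualP.xi (n + 2), by
  refine (DualP.comul_right (n + 1)).trans ?_
  rw [DualD.xi_pow_three_pow]
  simp⟩

/-- `ξ_{n+1}³` as an element of `B`. -/
def BB.xiCube (n : ℕ) : BB := ⟨DualP.xi (n + 1) ^ 3, by
  refine Eq.trans ?_ (?_ : (DualP.xi (n + 1) ⊗ₜ[F3] (1 : DualD) +
    DualP.xi n ⊗ₜ (DualD.xi ^ 3 ^ n)) ^ 3 = _)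
  · rw [← DualP.comul_right]
    exact map_pow _ _ _
  · rw [DualP.add_cube, Algebra.TensorProduct.tmul_pow, Algebra.TensorProduct.tmul_pow, ← pow_mul,
      ← pow_succ, DualD.xi_pow_three_pow]
    simp⟩

theorem BB.coact_xi (n : ℕ) : (ComodAlg.coact (BB.xi n) : DualD ⊗[F3] BB) =
    1 ⊗ₜ BB.xi n + DualD.xi ⊗ₜ BB.xiCube n := by
  refine BB.inclD_injective ((BB.inclD_coact _).trans ((DualP.comul_left (n + 1)).trans ?_))
  rw [map_add, Algebra.TensorProduct.map_tmul, Algebra.TensorProduct.map_tmul]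
  rfl

theorem BB.coact_xiCube (n : ℕ) : (ComodAlg.coact (BB.xiCube n) : DualD ⊗[F3] BB) =
    1 ⊗ₜ BB.xiCube n := by
  refine BB.inclD_injective ((BB.inclD_coact _).trans ?_)
  refine Eq.trans (b := (1 ⊗ₜ DualP.xi (n + 1) + DualD.xi ⊗ₜ (DualP.xi n ^ 3)) ^ 3) ?_ ?_
  · rw [← DualP.comul_left]
    refine Eq.trans ?_ (map_pow _ _ _)
    exact congrArg _ (map_pow _ _ _)
  · rw [Algebra.TensorProduct.map_tmul]
    rw [DualP.add_cube, Algebra.TensorProduct.tmul_pow, Algebra.TensorProduct.tmul_pow,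
      DualD.xi_pow, one_pow, TensorProduct.zero_tmul, add_zero]
    rfl

/-- The cochain `[ξ₁]ξ_{n+2} − [ξ₁²]ξ_{n+1}³`. -/
def eCochain (n : ℕ) : Cobar DualD BB :=
  Cobar.cons DualD.xi (Cobar.ofN (BB.xi n)) - Cobar.cons (DualD.xi ^ 2) (Cobar.ofN (BB.xiCube n))

theorem d_eCochain (n : ℕ) : Cobar.d (eCochain n) = 0 := by
  have hD : Coalgebra.comul (R := F3) DualD.xi = DualD.xi ⊗ₜ[F3] 1 + 1 ⊗ₜ[F3] DualD.xi :=
    HasXi.comul_xi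
  rw [Cobar.d_apply, eCochain]
  simp only [map_sub, Cobar.inner_cons, pow_two, Bialgebra.comul_mul, hD,
    Cobar.inner_ofN, BB.coact_xi, BB.coact_xiCube, mul_add, add_mul,
    Algebra.TensorProduct.tmul_mul_tmul, mul_one, one_mul, map_add, LinearMap.add_apply,
    Cobar.consH_tmul, Cobar.consN_tmul]
  have h3 : ∀ w : Cobar DualD BB, w + w + w = 0 := fun w => by
    have : (3 : F3) • w = 0 := by
      rw [show (3 : F3) = 0 from rfl, zero_smul]
    rw [← this, show (3 : F3) = 1 + 1 + 1 from rfl, add_smul, add_smul, one_smul]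
  rw [← h3 (Cobar.cons DualD.xi (Cobar.cons DualD.xi (Cobar.ofN (BB.xiCube n))))]
  abel

section BExtFunctor
variable {H N H' N' : Type} [CommRing H] [Bialgebra F3 H] [CommRing N] [Algebra F3 N]
  [ComodAlg H N] [HasXi H] [CommRing H'] [Bialgebra F3 H'] [CommRing N'] [Algebra F3 N']
  [ComodAlg H' N'] [HasXi H']

theorem BExt.cls_congr {x y : Cobar H N} (h : x = y) (hx : Cobar.d x = 0) (hy : Cobar.d y = 0) :
    BExt.cls x hx = BExt.cls y hy := by
  subst h; rfl

theorem BExt.map_cls (f : H →ₐc[F3] H') (g : N →ₐ[F3] N') (hfg : Cobar.Compat f g)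
    (hxi : f HasXi.xi = HasXi.xi) (x : Cobar H N) (hx : Cobar.d x = 0) :
    BExt.map f g hfg hxi (BExt.cls x hx) =
      BExt.cls (Cobar.map f g x) (by rw [← Cobar.map_d hfg, hx, _root_.map_zero]) :=
  Loc.map_of _ _ _

theorem BExt.sign_cls (x : Cobar H N) (hx : Cobar.d x = 0) :
    BExt.sign H N (BExt.cls x hx) =
      BExt.cls (Cobar.sign x) (by rw [Cobar.d_sign, hx, _root_.map_zero, neg_zero]) :=
  Loc.map_of _ _ _

theorem BExt.sign_sign (x : BExt H N) : BExt.sign H N (BExt.sign H N x) = x := by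
  have : (BExt.sign H N).comp (BExt.sign H N) = RingHom.id _ := by
    refine BExt.hom_ext fun x hx => ?_
    rw [RingHom.comp_apply, BExt.sign_cls, BExt.sign_cls]
    exact BExt.cls_congr (Cobar.sign_sign x) _ _
  exact RingHom.congr_fun this x

theorem BExt.map_sign (f : H →ₐc[F3] H') (g : N →ₐ[F3] N') (hfg : Cobar.Compat f g)
    (hxi : f HasXi.xi = HasXi.xi) (x : BExt H N) :
    BExt.map f g hfg hxi (BExt.sign H N x) = BExt.sign H' N' (BExt.map f g hfg hxi x) := by
  have : (BExt.map f g hfg hxi).comp (BExt.sign H N) =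
      (BExt.sign H' N').comp (BExt.map f g hfg hxi) := by
    refine BExt.hom_ext fun x hx => ?_
    rw [RingHom.comp_apply, RingHom.comp_apply, BExt.sign_cls, BExt.map_cls, BExt.map_cls,
      BExt.sign_cls]
    exact BExt.cls_congr (Cobar.map_sign f g x) _ _
  exact RingHom.congr_fun this x

end BExtFunctor

/-- For `K = K(ξ₁) = b₁₀⁻¹B`, the ring `π_{**}(K^{⊗ n}) = b₁₀⁻¹ Ext_P(k, B^{⊗ n})`, where `P` acts
diagonally; so `KX 1` is `K_{**}` and `KX 2` is the ring `K_{**}K` of co-operations. -/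
abbrev KX (n : ℕ) : Type := BExt DualP (TPow BB n)

namespace KX

/-- The map of rings induced by the map `B^{⊗ m} → B^{⊗ n}` of `f`. -/
def map {m n : ℕ} (f : Fin m → Fin n) : KX m →+* KX n :=
  BExt.map (BialgHom.id F3 DualP) (TPow.map f) (TPow.map_compat f) rfl

/-- The sign automorphism, `(-1)ᵗ` in homological degree `t`. -/
abbrev sign (n : ℕ) : KX n →+* KX n := BExt.sign DualP (TPow BB n)

theorem map_sign {m n : ℕ} (f : Fin m → Fin n) (x : KX m) :
    map f (sign m x) = sign n (map f x) := BExt.map_sign _ _ _ _ _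

theorem sign_sign {n : ℕ} (x : KX n) : sign n (sign n x) = x := BExt.sign_sign x

theorem map_map {l m n : ℕ} (f : Fin l → Fin m) (g : Fin m → Fin n) (x : KX l) :
    map g (map f x) = map (g ∘ f) x := by
  have : (map g).comp (map f) = map (g ∘ f) := by
    refine BExt.hom_ext fun x hx => ?_
    rw [RingHom.comp_apply]
    refine Eq.trans (congrArg (map g) (BExt.map_cls _ _ _ _ _ _)) ?_
    refine (BExt.map_cls _ _ _ _ _ _).trans ((BExt.cls_congr ?_ _ _).trans
      (BExt.map_cls _ _ _ _ _ _).symm)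
    have h : (TPow.map (N := BB) g).comp (TPow.map f) = TPow.map (g ∘ f) :=
      TPow.hom_ext fun i y => by simp [TPow.map, TPow.lift_incl]
    clear hx
    induction x using Cobar.induct with
    | h0 n => simp only [Cobar.map_ofN, ← h]; rfl
    | hc a w hw => simp only [Cobar.map_cons, hw]; rfl
    | ha v w hv hw => simp only [_root_.map_add, hv, hw]
  exact RingHom.congr_fun this x

theorem map_id {n : ℕ} (x : KX n) : map id x = x := by
  have : map id = RingHom.id (KX n) := by
    refine BExt.hom_ext fun x hx => ?_
    refine (BExt.map_cls _ _ _ _ _ _).trans (BExt.cls_congr ?_ _ _)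
    have h : TPow.map (N := BB) (id : Fin n → Fin n) = AlgHom.id F3 _ :=
      TPow.hom_ext fun i y => by simp [TPow.map, TPow.lift_incl]
    clear hx
    induction x using Cobar.induct with
    | h0 n => simp only [Cobar.map_ofN, h]; rfl
    | hc a w hw => simp only [Cobar.map_cons, hw]; rfl
    | ha v w hv hw => simp only [_root_.map_add, hv, hw]
  exact RingHom.congr_fun this x

end KX

theorem BB.toD_eq_counit (x : BB) :
    DualP.toDAlg (x : DualP) = algebraMap F3 DualD (Bialgebra.counitAlgHom F3 DualP (x : DualP)) := by
  let M : DualP ⊗[F3] DualD →ₐ[F3] DualD :=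
    Algebra.TensorProduct.lift ((Algebra.ofId F3 DualD).comp (Bialgebra.counitAlgHom F3 DualP))
      (AlgHom.id F3 DualD) (fun _ _ => Commute.all _ _)
  have hx : Algebra.TensorProduct.map (AlgHom.id F3 DualP) DualP.toDAlg
      (Bialgebra.comulAlgHom F3 DualP (x : DualP)) = (x : DualP) ⊗ₜ 1 := x.2
  have h1 : ∀ T : DualP ⊗[F3] DualP, M (Algebra.TensorProduct.map (AlgHom.id F3 DualP)
      DualP.toDAlg T) = DualP.toDAlg (TensorProduct.lid F3 DualP
        ((Coalgebra.counit (R := F3) (A := DualP)).rTensor DualP T)) := by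
    intro T
    induction T with
    | zero => simp
    | add a b ha hb => simp only [map_add, ha, hb]
    | tmul a b =>
      rw [Algebra.TensorProduct.map_tmul, LinearMap.rTensor_tmul, TensorProduct.lid_tmul, map_smul,
        Algebra.smul_def]
      exact Algebra.TensorProduct.lift_tmul _ _ _ _ _
  have h2 := h1 (Bialgebra.comulAlgHom F3 DualP (x : DualP))
  rw [hx] at h2
  refine Eq.trans ?_ (h2.symm.trans ?_)
  · simp
  · exact (Algebra.TensorProduct.lift_tmul _ _ _ _ _).trans (mul_one _)

/-! ### The Hopf algebroid `(K_{**}, K_{**}K)` -/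
namespace KK

/-- `η_L : b ↦ b ⊗ 1` -/
def etaL : KX 1 →+* KX 2 := KX.map ![0]
/-- `η_R : b ↦ 1 ⊗ b` -/
def etaR : KX 1 →+* KX 2 := KX.map ![1]
/-- The counit `ε`, induced by the multiplication `B ⊗ B → B`. -/
def counit : KX 2 →+* KX 1 := KX.map ![0, 0]
/-- The antipode, induced by the interchange `B ⊗ B → B ⊗ B`. -/
def conj : KX 2 →+* KX 2 := KX.map ![1, 0]
/-- The map induced by `a ⊗ b ↦ a ⊗ 1 ⊗ b`. -/
def alpha : KX 2 →+* KX 3 := KX.map ![0, 2]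
/-- The map induced by `a ⊗ b ↦ a ⊗ b ⊗ 1`. -/
def front : KX 2 →+* KX 3 := KX.map ![0, 1]
/-- The map induced by `a ⊗ b ↦ 1 ⊗ a ⊗ b`. -/
def back : KX 2 →+* KX 3 := KX.map ![1, 2]

/-- The relations `x η_R(a) ⊗ y = x ⊗ η_L(a) y` of the tensor product over `K_{**}`. -/
def balRel : AddSubgroup (KX 2 ⊗[ℤ] KX 2) :=
  AddSubgroup.closure {z | ∃ (x y : KX 2) (a : KX 1),
    z = (x * etaR a) ⊗ₜ[ℤ] y - x ⊗ₜ[ℤ] (etaL a * y)}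

/-- The tensor product `Γ ⊗_A Γ` for `A = K_{**}` and `Γ = K_{**}K`, with `A` acting through `η_R` on
the left factor and through `η_L` on the right factor. -/
def Bal : Type := (KX 2 ⊗[ℤ] KX 2) ⧸ balRel

instance : AddCommGroup Bal := inferInstanceAs (AddCommGroup ((KX 2 ⊗[ℤ] KX 2) ⧸ balRel))

/-- `x ⊗ y` in `Γ ⊗_A Γ`. -/
def Bal.tmul (x y : KX 2) : Bal := QuotientAddGroup.mk (s := balRel) (x ⊗ₜ[ℤ] y)

/-- `Γ ⊗_ℤ Γ → π_{**}(K ⊗ K ⊗ K)`, `x ⊗ y ↦ (x ⊗ 1)(1 ⊗ y)`. -/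
def betaAux : KX 2 ⊗[ℤ] KX 2 →+ KX 3 :=
  (TensorProduct.lift (((LinearMap.mul ℤ (KX 3)).compl₁₂ front.toAddMonoidHom.toIntLinearMap
    back.toAddMonoidHom.toIntLinearMap))).toAddMonoidHom

theorem front_etaR (a : KX 1) : front (etaR a) = back (etaL a) := by
  rw [front, etaR, back, etaL, KX.map_map, KX.map_map]
  refine congrArg (fun f => KX.map f a) (funext fun i => ?_)
  fin_cases i
  rfl

/-- The Künneth map `β : Γ ⊗_A Γ → π_{**}(K ⊗ K ⊗ K)`. If it is bijective then the comultiplication of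
`Γ` is `β⁻¹ ∘ α`. -/
def beta : Bal →+ KX 3 := QuotientAddGroup.lift balRel betaAux (by
  refine (AddSubgroup.closure_le _).2 ?_
  rintro _ ⟨x, y, a, rfl⟩
  change betaAux _ = 0
  rw [map_sub, sub_eq_zero]
  change front (x * etaR a) * back y = front x * back (etaL a * y)
  rw [map_mul, map_mul, front_etaR, mul_assoc])

theorem beta_tmul (x y : KX 2) : beta (Bal.tmul x y) = front x * back y := rfl

/-- The map of `D`-comodule algebras `ε ⊗ id : B ⊗ B → B`. -/
def shear : TPow BB 2 →ₐ[F3] BB :=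
  TPow.lift ![(Algebra.ofId F3 BB).comp ((Bialgebra.counitAlgHom F3 DualP).comp
    (Cotensor.coinv DualP.toD).val), AlgHom.id F3 BB]

theorem shear_compat : Cobar.Compat DualP.toD shear := by
  intro x
  let L : TPow BB 2 →ₐ[F3] DualD ⊗[F3] BB := (ComodAlg.coact (H := DualD)).comp shear
  let R : TPow BB 2 →ₐ[F3] DualD ⊗[F3] BB :=
    (Algebra.TensorProduct.map DualP.toDAlg shear).comp (ComodAlg.coact (H := DualP))
  have h0 : ∀ y : BB, shear (TPow.incl 0 y) =
      algebraMap F3 BB (Bialgebra.counitAlgHom F3 DualP (y : DualP)) := fun y =>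
    TPow.lift_incl _ _ _
  have h1 : ∀ y : BB, shear (TPow.incl 1 y) = y := fun y => TPow.lift_incl _ _ _
  have hR : ∀ (i : Fin 2) (y : BB), (ComodAlg.coact (TPow.incl i y) : DualP ⊗[F3] TPow BB 2) =
      Algebra.TensorProduct.map (AlgHom.id F3 DualP) (TPow.incl i)
        (Cotensor.coact DualP.toD y) := fun i y => TPow.lift_incl _ _ _
  refine DFunLike.congr_fun (show L = R from TPow.hom_ext fun i y => ?_) x
  simp only [L, R, AlgHom.comp_apply, hR]
  fin_cases i
  · change ComodAlg.coact (shear (TPow.incl 0 y)) = Algebra.TensorProduct.map DualP.toDAlg shear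
      (Algebra.TensorProduct.map (AlgHom.id F3 DualP) (TPow.incl 0) (Cotensor.coact DualP.toD y))
    have hc : ∀ T : DualP ⊗[F3] BB, Algebra.TensorProduct.map DualP.toDAlg shear
        (Algebra.TensorProduct.map (AlgHom.id F3 DualP) (TPow.incl 0) T) =
        DualP.toDAlg (TensorProduct.rid F3 DualP ((Coalgebra.counit (R := F3) (A := DualP)).lTensor
          DualP (Cotensor.incl DualP.toD T))) ⊗ₜ 1 := by
      intro T
      induction T with
      | zero => simp
      | add a b ha hb => simp only [map_add, ha, hb, TensorProduct.add_tmul]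
      | tmul a b =>
        simp only [Algebra.TensorProduct.map_tmul, h0, AlgHom.id_apply, Cotensor.incl,
          LinearMap.lTensor_tmul, TensorProduct.rid_tmul, map_smul]
        rw [Algebra.algebraMap_eq_smul_one, TensorProduct.tmul_smul, TensorProduct.smul_tmul']
        rfl
    rw [h0, AlgHom.commutes, hc, Cotensor.incl_coact]
    have hy := BB.toD_eq_counit y
    have hz : TensorProduct.rid F3 DualP ((Coalgebra.counit (R := F3) (A := DualP)).lTensor
          DualP (Bialgebra.comulAlgHom F3 DualP (y : DualP))) = y := by
      simp
    rw [hz, hy]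
    rfl
  · change ComodAlg.coact (shear (TPow.incl 1 y)) = Algebra.TensorProduct.map DualP.toDAlg shear
      (Algebra.TensorProduct.map (AlgHom.id F3 DualP) (TPow.incl 1) (Cotensor.coact DualP.toD y))
    rw [h1]
    change Algebra.TensorProduct.map DualP.toDAlg (AlgHom.id F3 BB) (Cotensor.coact DualP.toD y) = _
    induction (Cotensor.coact DualP.toD y) with
    | zero => simp
    | add a b ha hb => simp only [map_add, ha, hb]
    | tmul a b => simp [h1]

theorem toD_xi : DualP.toD (HasXi.xi : DualP) = HasXi.xi := by
  exact (DualP.toDAlg_xi 1).trans (by simp; rfl)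

/-- The change-of-rings map `K_{**}K = b₁₀⁻¹ Ext_P(k, B ⊗ B) → b₁₀⁻¹ Ext_D(k, B)`: restriction to `D`
followed by `ε ⊗ id`. -/
def theta : KX 2 →+* BExt DualD BB := BExt.map DualP.toD shear shear_compat toD_xi

end KK

/-! ### The `E₁` page of the `K(ξ₁)`-based Adams spectral sequence -/
namespace E1

/-- The column `π_{**}(K^{⊗ (s+1)})` of the `E₁` page. -/
abbrev Page (s : ℕ) : Type := KX (s + 1)

/-- The first `s + 1` of `s + t + 1` factors. -/
def front (s t : ℕ) : Fin (s + 1) → Fin (s + t + 1) := fun i => ⟨i, by omega⟩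
/-- The last `t + 1` of `s + t + 1` factors. -/
def back (s t : ℕ) : Fin (t + 1) → Fin (s + t + 1) := fun i => ⟨s + i, by omega⟩
/-- The injection that omits `i`; the induced map inserts the unit as the factor `i`. -/
def coface (s i : ℕ) : Fin (s + 1) → Fin (s + 2) :=
  fun j => ⟨if (j : ℕ) < i then j else j + 1, by split_ifs <;> omega⟩

theorem front_val {s t : ℕ} (i : Fin (s + 1)) : (front s t i : ℕ) = i := rfl
theorem back_val {s t : ℕ} (i : Fin (t + 1)) : (back s t i : ℕ) = s + i := rfl
theorem coface_val {s i : ℕ} {j : Fin (s + 1)} {a : ℕ} (h : (j : ℕ) = a) :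
    (coface s i j : ℕ) = if a < i then a else a + 1 := by
  subst h; rfl

/-- The product `E₁^s × E₁^t → E₁^{s+t}`: the last factor of `x` is multiplied with the first factor of
`y`, with the sign `(-1)^{t |x|}` for `|x|` the homological degree of `x`. -/
def mul {s t : ℕ} (x : Page s) (y : Page t) : Page (s + t) :=
  KX.map (front s t) ((KX.sign (s + 1) ^ t) x) * KX.map (back s t) y

theorem map_sign_pow {m n : ℕ} (f : Fin m → Fin n) (t : ℕ) (x : KX m) :
    KX.map f ((KX.sign m ^ t) x) = (KX.sign n ^ t) (KX.map f x) := by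
  induction t generalizing x with
  | zero => rfl
  | succ t ih =>
    rw [pow_succ, pow_succ]
    change KX.map f ((KX.sign m ^ t) (KX.sign m x)) = (KX.sign n ^ t) (KX.sign n (KX.map f x))
    rw [ih, KX.map_sign]

theorem mk_eq {m n : ℕ} (h : m = n) (x : Page m) (y : Page n)
    (hy : KX.map (fun i => ⟨i, by omega⟩ : Fin (m + 1) → Fin (n + 1)) x = y) :
    (GradedMonoid.mk m x : GradedMonoid Page) = GradedMonoid.mk n y := by
  subst h
  rw [← hy]
  exact congrArg _ (KX.map_id x).symm

theorem map_congr {m n : ℕ} {f g : Fin m → Fin n} (h : ∀ i, (f i : ℕ) = g i) (x : KX m) :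
    KX.map f x = KX.map g x := congrArg (fun f => KX.map f x) (funext fun i => Fin.ext (h i))

theorem sign_pow_add {n : ℕ} (t u : ℕ) (x : KX n) :
    (KX.sign n ^ (t + u)) x = (KX.sign n ^ u) ((KX.sign n ^ t) x) := by
  rw [add_comm, pow_add]; rfl

theorem sign_pow_succ_sign {n : ℕ} (t : ℕ) (x : KX n) :
    (KX.sign n ^ (t + 1)) (KX.sign n x) = (KX.sign n ^ t) x := by
  rw [pow_succ]
  change (KX.sign n ^ t) (KX.sign n (KX.sign n x)) = _
  rw [KX.sign_sign]

theorem one_mul' {s : ℕ} (x : Page s) :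
    KX.map (fun i => ⟨i, by omega⟩ : Fin (0 + s + 1) → Fin (s + 1)) (mul (1 : KX 1) x) = x := by
  simp only [mul, map_mul]
  rw [KX.map_map, map_one, map_one, one_mul, KX.map_map]
  exact (map_congr (by simp [back]) x).trans (KX.map_id x)

theorem mul_one' {s : ℕ} (x : Page s) :
    KX.map (fun i => ⟨i, by omega⟩ : Fin (s + 0 + 1) → Fin (s + 1)) (mul (t := 0) x (1 : KX 1)) = x := by
  simp only [mul, map_mul]
  rw [KX.map_map, KX.map_map, map_one, mul_one]
  exact (map_congr (by simp [front]) _).trans (KX.map_id x)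

theorem mul_assoc' {s t u : ℕ} (x : Page s) (y : Page t) (z : Page u) :
    KX.map (fun i => ⟨i, by omega⟩ : Fin (s + t + u + 1) → Fin (s + (t + u) + 1))
      (mul (mul x y) z) = mul x (mul y z) := by
  simp only [mul, map_mul, map_sign_pow, KX.map_map, mul_assoc, sign_pow_add]
  refine congrArg₂ (· * ·) ?_ (congrArg₂ (· * ·) ?_ ?_)
  · exact congrArg (fun w => (KX.sign _ ^ u) ((KX.sign _ ^ t) w)) (map_congr (by simp [front]) x)
  · exact congrArg (fun w => (KX.sign _ ^ u) w) (map_congr (by simp [front, back]) y)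
  · exact map_congr (by simp [back, add_assoc]) z

instance : GradedMonoid.GMul Page where
  mul := mul

instance : GradedMonoid.GOne Page where
  one := (1 : KX 1)

instance : DirectSum.GRing Page where
  mul_zero x := by simp [GradedMonoid.GMul.mul, mul]
  zero_mul x := by simp [GradedMonoid.GMul.mul, mul]
  mul_add x y z := by simp [GradedMonoid.GMul.mul, mul, mul_add]
  add_mul x y z := by simp [GradedMonoid.GMul.mul, mul, add_mul]
  one_mul := fun ⟨s, x⟩ => mk_eq (zero_add s) (mul (1 : KX 1) x) x (one_mul' x)
  mul_one := fun ⟨s, x⟩ => mk_eq (add_zero s) (mul (t := 0) x (1 : KX 1)) x (mul_one' x)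
  mul_assoc := fun ⟨s, x⟩ ⟨t, y⟩ ⟨u, z⟩ =>
    mk_eq (add_assoc s t u) (mul (mul x y) z) (mul x (mul y z)) (mul_assoc' x y z)
  natCast n := (n : KX 1)
  natCast_zero := Nat.cast_zero
  natCast_succ n := Nat.cast_succ n
  intCast n := (n : KX 1)
  intCast_ofNat n := Int.cast_natCast n
  intCast_negSucc_ofNat n := Int.cast_negSucc n

theorem of_mul_of {s t : ℕ} (x : Page s) (y : Page t) :
    DirectSum.of Page s x * DirectSum.of Page t y = DirectSum.of Page (s + t) (mul x y) :=
  DirectSum.of_mul_of x y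

/-- The total `E₁` page. -/
abbrev Total : Type := ⨁ s, Page s


/-- The differential `d₁`, the alternating sum of the maps that insert the unit. -/
def d1 (s : ℕ) : Page s →+ Page (s + 1) :=
  ∑ i ∈ Finset.range (s + 2), (-1 : ℤ) ^ i • (KX.map (coface s i)).toAddMonoidHom

theorem d1_apply (s : ℕ) (x : Page s) :
    d1 s x = ∑ i ∈ Finset.range (s + 2), (-1 : ℤ) ^ i • KX.map (coface s i) x := by
  simp [d1]

/-- The differential of the total `E₁` page. -/
def d : Total →+ Total :=
  DirectSum.toAddMonoid fun s => (DirectSum.of Page (s + 1)).comp (d1 s)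

theorem d_of (s : ℕ) (x : Page s) : d (DirectSum.of Page s x) = DirectSum.of Page (s + 1) (d1 s x) :=
  DirectSum.toAddMonoid_of _ _ _

/-- The sign of the total degree `s + t`. -/
def tau : Total →+ Total :=
  DirectSum.toAddMonoid fun s =>
    (DirectSum.of Page s).comp ((-1 : ℤ) ^ s • (KX.sign (s + 1)).toAddMonoidHom)

theorem tau_of (s : ℕ) (x : Page s) :
    tau (DirectSum.of Page s x) = DirectSum.of Page s ((-1 : ℤ) ^ s • KX.sign (s + 1) x) :=
  DirectSum.toAddMonoid_of _ _ _

theorem of_eq {m n : ℕ} (h : m = n) (x : Page m) : DirectSum.of Page m x =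
    DirectSum.of Page n (KX.map (fun i => ⟨i, by omega⟩ : Fin (m + 1) → Fin (n + 1)) x) := by
  subst h
  exact congrArg _ (KX.map_id x).symm

theorem d1_d1 (s : ℕ) (x : Page s) : d1 (s + 1) (d1 s x) = 0 := by
  simp only [d1_apply, map_sum, map_zsmul, Finset.smul_sum, KX.map_map, smul_smul]
  rw [← Finset.sum_product']
  refine Finset.sum_involution
    (fun p _ => if p.1 < p.2 then (p.2 - 1, p.1) else (p.2, p.1 + 1)) ?_ ?_ ?_ ?_
  · rintro ⟨i, j⟩ hp
    by_cases h : i < j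
    · obtain ⟨j, rfl⟩ : ∃ k, j = k + 1 := ⟨j - 1, by omega⟩
      simp only [if_pos h, Nat.add_sub_cancel]
      rw [map_congr (f := coface (s + 1) (j + 1) ∘ coface s i)
        (g := coface (s + 1) i ∘ coface s j), ← add_smul, pow_succ]
      · rw [mul_comm ((-1 : ℤ) ^ i)]; simp
      · intro a
        rw [Function.comp_apply, Function.comp_apply, coface_val (coface_val rfl), coface_val (coface_val rfl)]
        split_ifs <;> omega
    · simp only [if_neg h]
      rw [map_congr (f := coface (s + 1) j ∘ coface s i)
        (g := coface (s + 1) (i + 1) ∘ coface s j), ← add_smul, pow_succ]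
      · rw [mul_comm ((-1 : ℤ) ^ i)]; simp
      · intro a
        rw [Function.comp_apply, Function.comp_apply, coface_val (coface_val rfl), coface_val (coface_val rfl)]
        split_ifs <;> omega
  · rintro ⟨i, j⟩ hp h0 h1
    by_cases h : i < j
    · rw [if_pos h] at h1
      have h2 : i = j := congrArg Prod.snd h1
      exact absurd h2 h.ne
    · rw [if_neg h] at h1
      have h2 : j = i := congrArg Prod.fst h1
      have h3 : i + 1 = j := congrArg Prod.snd h1
      omega
  · rintro ⟨i, j⟩ hp
    simp only [Finset.mem_product, Finset.mem_range] at hp ⊢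
    split_ifs <;> constructor <;> simp only <;> omega
  · rintro ⟨i, j⟩ hp
    by_cases h : i < j
    · have h' : ¬ j - 1 < i := by omega
      simp only [if_pos h, if_neg h']
      exact Prod.ext rfl (Nat.sub_add_cancel (by omega))
    · have h' : j < i + 1 := by omega
      simp only [if_neg h, if_pos h']
      exact Prod.ext (Nat.add_sub_cancel _ _) rfl

theorem d1_sign (s : ℕ) (x : Page s) : d1 s (KX.sign (s + 1) x) = KX.sign (s + 2) (d1 s x) := by
  simp only [d1_apply, map_sum, map_zsmul, KX.map_sign]

theorem d1_mul {s t : ℕ} (x : Page s) (y : Page t) : d1 (s + t) (mul x y) =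
    KX.map (fun i => ⟨i, by omega⟩ : Fin (s + 1 + t + 1) → Fin (s + t + 1 + 1)) (mul (d1 s x) y) +
    mul (t := t + 1) ((-1 : ℤ) ^ s • KX.sign (s + 1) x) (d1 t y) := by
  have e1 : KX.map (fun i => ⟨i, by omega⟩ : Fin (s + 1 + t + 1) → Fin (s + t + 1 + 1))
      (mul (d1 s x) y) = (∑ i ∈ Finset.range (s + 1), (-1 : ℤ) ^ i •
        KX.map (coface (s + t) i ∘ front s t) ((KX.sign (s + 1) ^ t) x) + (-1 : ℤ) ^ (s + 1) •
        KX.map (front s (t + 1)) ((KX.sign (s + 1) ^ t) x)) *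
        KX.map (fun i => ⟨s + 1 + i, by omega⟩) y := by
    simp only [mul, map_mul, map_sign_pow, d1_apply, map_sum, map_zsmul, KX.map_map]
    rw [Finset.sum_range_succ]
    refine congrArg₂ (· * ·) (congrArg₂ (· + ·) (Finset.sum_congr rfl fun i hi => ?_) ?_) ?_
    · refine congrArg _ (congrArg _ (map_congr (fun j => ?_) x))
      rw [Function.comp_apply, Function.comp_apply, Function.comp_apply, coface_val (front_val _)]
      exact coface_val rfl
    · refine congrArg _ (congrArg _ (map_congr (fun j => ?_) x))
      rw [Function.comp_apply, Function.comp_apply, front_val]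
      exact (coface_val rfl).trans (if_pos (by omega))
    · exact map_congr (fun j => by simp [back]) y
  have e2 : mul (t := t + 1) ((-1 : ℤ) ^ s • KX.sign (s + 1) x) (d1 t y) =
      (-1 : ℤ) ^ s • (KX.map (front s (t + 1)) ((KX.sign (s + 1) ^ t) x) *
        (∑ i ∈ Finset.range (t + 1), (-1 : ℤ) ^ (i + 1) •
          KX.map (coface (s + t) (s + 1 + i) ∘ back s t) y +
          KX.map (fun i => ⟨s + 1 + i, by omega⟩) y)) := by
    simp only [mul, map_zsmul, sign_pow_succ_sign, smul_mul_assoc, d1_apply, map_sum, KX.map_map]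
    rw [Finset.sum_range_succ']
    refine congrArg _ (congrArg _ (congrArg₂ (· + ·) (Finset.sum_congr rfl fun i hi => ?_) ?_))
    · refine congrArg _ (map_congr (fun j => ?_) y)
      rw [Function.comp_apply, Function.comp_apply, back_val, coface_val rfl, coface_val (back_val _)]
      split_ifs <;> omega
    · rw [pow_zero, one_smul]
      refine map_congr (fun j => ?_) y
      rw [Function.comp_apply, back_val, coface_val rfl]
      change _ = s + 1 + (j : ℕ)
      split_ifs <;> omega
  have e0 : ∀ f : ℕ → KX (s + t + 2), ∑ i ∈ Finset.range (s + t + 2), f i =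
      ∑ i ∈ Finset.range (s + 1), f i + ∑ i ∈ Finset.range (t + 1), f (s + 1 + i) := fun f => by
    rw [← Finset.sum_range_add]
    exact congrArg (fun m => ∑ i ∈ Finset.range m, f i) (by ring)
  rw [e1, e2, d1_apply, e0, add_mul,
    mul_add, smul_add, smul_mul_assoc, Finset.sum_mul, Finset.mul_sum, Finset.smul_sum]
  have e3 : ∀ z : KX (s + t + 2), (-1 : ℤ) ^ (s + 1) • z + (-1 : ℤ) ^ s • z = 0 := fun z => by
    rw [← add_smul, pow_succ]; simp
  have e4 : ∀ u v w z : KX (s + t + 2), w + z = 0 → u + w + (v + z) = u + v := by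
    intro u v w z h
    rw [add_add_add_comm, h, add_zero]
  refine Eq.symm ((e4 _ _ _ _ (e3 _)).trans ?_)
  refine congrArg₂ (· + ·) (Finset.sum_congr rfl fun i hi => ?_)
    (Finset.sum_congr rfl fun i hi => ?_)
  · rw [Finset.mem_range] at hi
    simp only [mul, map_mul, KX.map_map, smul_mul_assoc]
    refine congrArg _ (congrArg _ (map_congr (fun j => ?_) y))
    rw [Function.comp_apply, coface_val (back_val _)]
    change s + 1 + (j : ℕ) = _
    split_ifs <;> omega
  · simp only [mul, map_mul, KX.map_map, mul_smul_comm, smul_smul]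
    refine congrArg₂ (· • ·) (by ring) (congrArg₂ (· * ·) (map_congr (fun j => ?_) _) rfl)
    rw [Function.comp_apply, coface_val (front_val _), front_val]
    split_ifs <;> omega

theorem sum_ext {f g : Total →+ Total}
    (h : ∀ s x, f (DirectSum.of Page s x) = g (DirectSum.of Page s x)) (x : Total) : f x = g x :=
  DFunLike.congr_fun (DirectSum.addHom_ext h : f = g) x

theorem sum_ext₂ {f g : Total →+ Total →+ Total}
    (h : ∀ s x t y, f (DirectSum.of Page s x) (DirectSum.of Page t y) =
      g (DirectSum.of Page s x) (DirectSum.of Page t y)) (x y : Total) : f x y = g x y := by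
  refine sum_ext (f := f x) (g := g x) (fun t y => ?_) y
  exact sum_ext (f := f.flip (DirectSum.of Page t y)) (g := g.flip (DirectSum.of Page t y))
    (fun s x => h s x t y) x

theorem tau_mul (x y : Total) : tau (x * y) = tau x * tau y := by
  refine sum_ext₂ (f := AddMonoidHom.mul.compr₂ tau)
    (g := (AddMonoidHom.mul.comp tau).compl₂ tau) (fun s x t y => ?_) x y
  change tau (DirectSum.of Page s x * DirectSum.of Page t y) =
    tau (DirectSum.of Page s x) * tau (DirectSum.of Page t y)
  rw [of_mul_of, tau_of, tau_of, tau_of, of_mul_of]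
  refine congrArg _ ?_
  simp only [mul, map_zsmul, smul_mul_assoc, mul_smul_comm, smul_smul, map_mul, KX.map_sign, pow_add,
    mul_comm ((-1 : ℤ) ^ t)]
  refine congrArg _ (congrArg (fun z => z * KX.sign _ (KX.map (back s t) y)) ?_)
  rw [map_sign_pow, map_sign_pow, KX.map_sign]
  change (KX.sign (s + t + 1) * KX.sign (s + t + 1) ^ t) (KX.map (front s t) x) =
    (KX.sign (s + t + 1) ^ t * KX.sign (s + t + 1)) (KX.map (front s t) x)
  rw [(Commute.self_pow (KX.sign (s + t + 1)) t).eq]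

/-- The `E₁` page as a differential graded ring. Its cohomology ring is the `E₂` page. -/
def dg : DGRing Total where
  sign := { tau with
    map_one' := by
      change tau (DirectSum.of Page 0 (1 : KX 1)) = DirectSum.of Page 0 (1 : KX 1)
      rw [tau_of, map_one, pow_zero, one_smul]
    map_mul' := tau_mul }
  sign_sign x := by
    refine sum_ext (f := tau.comp tau) (g := AddMonoidHom.id _) (fun s x => ?_) x
    rw [AddMonoidHom.comp_apply, AddMonoidHom.id_apply, tau_of, tau_of, map_zsmul, map_zsmul, KX.sign_sign, map_zsmul,
      smul_smul, ← mul_pow,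
      neg_one_mul, neg_neg, one_pow, one_smul]
  d := d
  d_d x := by
    refine sum_ext (f := d.comp d) (g := 0) (fun s x => ?_) x
    rw [AddMonoidHom.comp_apply, AddMonoidHom.zero_apply, d_of, d_of, d1_d1, map_zero]
  d_mul x y := by
    refine sum_ext₂ (f := AddMonoidHom.mul.compr₂ d)
      (g := AddMonoidHom.mul.comp d + (AddMonoidHom.mul.comp tau).compl₂ d) (fun s x t y => ?_) x y
    change d (DirectSum.of Page s x * DirectSum.of Page t y) =
      d (DirectSum.of Page s x) * DirectSum.of Page t y +
      tau (DirectSum.of Page s x) * d (DirectSum.of Page t y)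
    rw [of_mul_of, d_of, d_of, d_of, tau_of, of_mul_of, of_mul_of, d1_mul, map_add,
      of_eq (show s + 1 + t = s + t + 1 by ring)]
    rfl
  d_sign x := by
    refine sum_ext (f := d.comp tau) (g := -(tau.comp d)) (fun s x => ?_) x
    rw [AddMonoidHom.neg_apply, AddMonoidHom.comp_apply, AddMonoidHom.comp_apply, tau_of, d_of, d_of, tau_of, map_zsmul, d1_sign, pow_succ, ← map_neg]
    congr 1
    simp

end E1

/-- `R = E[h] ⊗ k[b, b⁻¹]`, the dual numbers over the Laurent polynomials. -/
abbrev RR : Type := DualNumber (LaurentPolynomial F3)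

namespace RR

/-- The class `h ∈ R`. -/
def h : RR := DualNumber.eps
/-- The class `b ∈ R`. -/
def b : RR := TrivSqZeroExt.inl (LaurentPolynomial.T 1)

/-- The grading of `R` by parity: `b` is even and `h` is odd. -/
def parity (i : ZMod 2) : Submodule F3 RR :=
  if i = 0 then LinearMap.ker (TrivSqZeroExt.sndHom (LaurentPolynomial F3) (LaurentPolynomial F3) |>.restrictScalars F3)
  else LinearMap.ker (TrivSqZeroExt.fstHom F3 (LaurentPolynomial F3) (LaurentPolynomial F3)).toLinearMap

theorem mem_even {x : RR} : x ∈ parity 0 ↔ x.snd = 0 := by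
  simp [parity]

theorem mem_odd {x : RR} : x ∈ parity 1 ↔ x.fst = 0 := by
  simp [parity]

instance : SetLike.GradedMonoid parity where
  one_mem := mem_even.2 TrivSqZeroExt.snd_one
  mul_mem := by
    intro i j x y hx hy
    fin_cases i <;> fin_cases j
    · replace hx := mem_even.1 hx
      replace hy := mem_even.1 hy
      exact mem_even.2 (by simp [hx, hy])
    · replace hx := mem_even.1 hx
      replace hy := mem_odd.1 hy
      exact mem_odd.2 (by simp [hy])
    · replace hx := mem_odd.1 hx
      replace hy := mem_even.1 hy
      exact mem_odd.2 (by simp [hx])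
    · replace hx := mem_odd.1 hx
      replace hy := mem_odd.1 hy
      exact mem_even.2 (by simp [hx, hy])

/-- The even part. -/
def evenPart : RR →+ parity 0 where
  toFun x := ⟨TrivSqZeroExt.inl x.fst, mem_even.2 (TrivSqZeroExt.snd_inl _ _)⟩
  map_zero' := rfl
  map_add' _ _ := Subtype.ext (TrivSqZeroExt.inl_add _ _ _)

/-- The odd part. -/
def oddPart : RR →+ parity 1 where
  toFun x := ⟨TrivSqZeroExt.inr x.snd, mem_odd.2 (TrivSqZeroExt.fst_inr _ _)⟩
  map_zero' := rfl
  map_add' _ _ := Subtype.ext (TrivSqZeroExt.inr_add _ _ _)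

instance : DirectSum.Decomposition parity :=
  DirectSum.Decomposition.ofAddHom parity
    ((DirectSum.of (fun i => parity i) 0).comp evenPart +
      (DirectSum.of (fun i => parity i) 1).comp oddPart)
    (by
      refine AddMonoidHom.ext fun x => ?_
      change DirectSum.coeAddMonoidHom parity (DirectSum.of (fun i => parity i) 0 (evenPart x) +
        DirectSum.of (fun i => parity i) 1 (oddPart x)) = x
      rw [map_add, DirectSum.coeAddMonoidHom_of, DirectSum.coeAddMonoidHom_of]
      exact TrivSqZeroExt.inl_fst_add_inr_snd_eq x)
    (by
      refine DirectSum.addHom_ext fun i x => ?_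
      rw [AddMonoidHom.comp_apply, DirectSum.coeAddMonoidHom_of, AddMonoidHom.id_apply,
        AddMonoidHom.add_apply, AddMonoidHom.comp_apply, AddMonoidHom.comp_apply]
      obtain ⟨x, hx⟩ := x
      rcases (show ∀ i : ZMod 2, i = 0 ∨ i = 1 by decide) i with rfl | rfl
      · have h0 := mem_even.1 hx
        have h1 : evenPart x = ⟨x, hx⟩ := Subtype.ext (TrivSqZeroExt.ext rfl h0.symm)
        have h2 : oddPart x = 0 := Subtype.ext (TrivSqZeroExt.ext rfl h0)
        rw [h1, h2, map_zero, add_zero]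
      · have h0 := mem_odd.1 hx
        have h1 : oddPart x = ⟨x, hx⟩ := Subtype.ext (TrivSqZeroExt.ext h0.symm rfl)
        have h2 : evenPart x = 0 := Subtype.ext (TrivSqZeroExt.ext h0 rfl)
        rw [h1, h2, map_zero, zero_add])

instance : GradedAlgebra parity where

end RR

/-- The exterior algebra `E[e₂, e₃, …]` over `k`. -/
abbrev EE : Type := ExteriorAlgebra F3 (ℕ →₀ F3)

namespace EE

/-- The generator `e_{n+2}`. -/
def gen (n : ℕ) : EE := ExteriorAlgebra.ι F3 (Finsupp.single n 1)

/-- The grading of `E[e₂, e₃, …]` by parity: all `e_n` are odd. -/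
abbrev parity : ZMod 2 → Submodule F3 EE :=
  CliffordAlgebra.evenOdd (0 : QuadraticForm F3 (ℕ →₀ F3))

/-- The comultiplication with `e_n ↦ e_n ⊗ 1 + 1 ⊗ e_n`. -/
def comul : EE →ₐ[F3] parity ᵍ⊗[F3] parity :=
  ExteriorAlgebra.lift F3 ⟨
    (GradedTensorProduct.includeLeft parity parity).toLinearMap ∘ₗ ExteriorAlgebra.ι F3 +
    (GradedTensorProduct.includeRight parity parity).toLinearMap ∘ₗ ExteriorAlgebra.ι F3, by
      intro m
      have hm : ExteriorAlgebra.ι F3 m * ExteriorAlgebra.ι F3 m = 0 :=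
        ExteriorAlgebra.ι_sq_zero m
      have h1 : ExteriorAlgebra.ι F3 m ∈ parity 1 := CliffordAlgebra.ι_mem_evenOdd_one _ m
      have h2 := GradedTensorProduct.tmul_coe_mul_coe_tmul (R := F3) parity parity 1
        ⟨_, h1⟩ ⟨_, h1⟩ 1
      have h3 := GradedTensorProduct.tmul_one_mul_one_tmul (R := F3) parity parity
        (ExteriorAlgebra.ι F3 m) (ExteriorAlgebra.ι F3 m)
      simp only [LinearMap.add_apply, LinearMap.comp_apply, AlgHom.toLinearMap_apply, add_mul,
        mul_add]
      rw [← map_mul (GradedTensorProduct.includeLeft parity parity),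
        ← map_mul (GradedTensorProduct.includeRight parity parity), hm, map_zero, map_zero, zero_add, add_zero]
      refine (congrArg₂ (· + ·) h2 h3).trans ?_
      simp⟩

/-- The counit with `e_n ↦ 0`. -/
def counit : EE →ₐ[F3] F3 := ExteriorAlgebra.algebraMapInv

/-- The antipode with `e_n ↦ -e_n`. -/
def conj : EE →ₐ[F3] EE := ExteriorAlgebra.map (-LinearMap.id)

end EE

/-- `R ⊗ E[e₂, e₃, …]`, as the tensor product of graded algebras with the usual signs. -/
abbrev RE : Type := RR.parity ᵍ⊗[F3] EE.parity

/-- The element `r ⊗ x` of `R ⊗ E[e₂, e₃, …]`. -/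
def RE.tmul (r : RR) (x : EE) : RE := r ᵍ⊗ₜ[F3] x

/-! ### Degrees -/

/-- The elements of internal degree `u` in `P`, where `|ξ_n| = 2(3ⁿ − 1)`. -/
def DualP.degree (u : ℕ) : Submodule F3 DualP :=
  MvPolynomial.weightedHomogeneousSubmodule F3 (fun n : ℕ => 2 * (3 ^ (n + 1) - 1)) u

/-- The elements of internal degree `u` in `D`. -/
def DualD.degree (u : ℕ) : Submodule F3 DualD :=
  (DualP.degree u).map DualP.toDAlg.toLinearMap

/-- The elements of internal degree `u` in `B`. -/
def BB.degree (u : ℕ) : Submodule F3 BB :=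
  (DualP.degree u).comap (Cotensor.coinv DualP.toD).val.toLinearMap

/-- The elements of internal degree `u` in `B^{⊗ n}`. -/
def TPow.degree (n u : ℕ) : Submodule F3 (TPow BB n) :=
  Submodule.span F3 {z | ∃ (v : Fin n → ℕ) (x : Fin n → BB),
    (∀ i, x i ∈ BB.degree (v i)) ∧ ∑ i, v i = u ∧ z = PiTensorProduct.tprod F3 x}

/-- The cochains of homological degree `s` and internal degree `u`, for gradings `gH` and `gN`
of `H` and `N`. -/
def Cobar.bidegree {H N : Type} [CommRing H] [Bialgebra F3 H] [CommRing N] [Algebra F3 N]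
    (gH : ℕ → Submodule F3 H) (gN : ℕ → Submodule F3 N) : ℕ → ℕ → Submodule F3 (Cobar H N)
  | 0, u => (gN u).map Cobar.ofN
  | s + 1, u => ⨆ p ∈ Finset.HasAntidiagonal.antidiagonal u,
      Submodule.map₂ Cobar.cons (gH p.1) (Cobar.bidegree gH gN s p.2)

/-- `x ∈ b₁₀⁻¹ Ext_H(k, N)` is homogeneous of homological degree `t` and internal degree `u`:
for some `m`, the element `b₁₀ᵐ x`, of bidegree `(t + 2m, u + 12m)`, is the class of a cocycle
of that bidegree. -/
def BExt.IsBihomogeneous {H N : Type} [CommRing H] [Bialgebra F3 H] [CommRing N] [Algebra F3 N]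
    [ComodAlg H N] [HasXi H] (gH : ℕ → Submodule F3 H) (gN : ℕ → Submodule F3 N) (t u : ℤ)
    (x : BExt H N) : Prop :=
  ∃ m s v : ℕ, (s : ℤ) = t + 2 * m ∧ (v : ℤ) = u + 12 * m ∧
    ∃ z ∈ Cobar.bidegree gH gN s v, ∃ hz : Cobar.d z = 0, BExt.b10 H N ^ m * x = BExt.cls z hz

end

/-!
The localized rings `b₁₀⁻¹ Ext_H(k, M)` are computed by a periodic resolution, with no spectral sequence.
For a suitable comodule algebra `N` with the derivation `δ` that is dual to `ξ₁`, `M` is the kernel of the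
derivation `∂ = 1 ⊗ δ - D ⊗ 1` of the coinduced comodule algebra `H ⊗ N`, where `D` is the derivative with
respect to `ξ₁`. This applies to `H = D` with `M = N = B`, and to `H = P` with `M = B^{⊗(n+1)}` and
`N = B^{⊗n}`. In characteristic `3`, `∂³ = 0` and `ker ∂² = im ∂`, so that
there are exact sequences `0 → M → H ⊗ N → im ∂ → 0` and `0 → im ∂ → H ⊗ N → M → 0` with `∂` and `∂²`
as second maps. The cobar complex of `H ⊗ N` is contractible onto `N`, and the composite of the two connecting
homomorphisms is the multiplication by `-b₁₀`. Hence each element of the localization is a finite sum of terms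
`bᵏ (c0 n + c1 u)` with `δ n = 0` and `δ² u = 0`, where `n` is unique up to `im δ²` and `u` up to `im δ`
(`PeriodicRes.exists_decomp`, `PeriodicRes.decomp_unique`, `PeriodicRes.tate`). The products are
`c0 m · c0 n = c0 (m n)`, `c1 u · c0 n = c1 (u n)` and `c1 u · c1 v = b · c0 (δ u · v - u · δ v)`; the class
`h₁₀` is `c1 1`.

The ring `B` with `δ ξ_{m+1} = ξ_m³` is a polynomial ring in which the monomials are products of powers of
`x_m = ξ_m³` and of `y_m = ξ_{m+1}` with exponent at most `2`, where `δ y_m = x_m`; and similarly for `B^{⊗n}`,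
with the differences of the generators of neighbouring factors. A single pair `x, y` contributes a free exterior
class `e = c1 y` (`PairLayer.ker_δ`, `PairLayer.ker_δδ`, `TateRing.indep`). Therefore the localized ring is the
exterior algebra over `R` on these classes: it is generated by them (`TateRing.G_univ`, `TateRing.G_expand`), each
is free over the others (`TateRing.G_indep`), and `R` embeds (`TateRing.coeffHom_injective`). For `n = 0` there
are no pairs and the ring is `R`; for `n = 1` one finds `E[e₂, e₃, …]` over `R`, and the change-of-rings map sends
generators to generators.

For the Hopf algebra structure, `e_n` needs a cocycle over `P`. An element of `B ⊗ B` with coaction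
`1 ⊗ a + ξ₁ ⊗ q` and `q` primitive is found recursively (`TPow.coprim`, `TPow.prim`), and `[ξ₁]a - [ξ₁²]q`
represents `e_n`. Its correction terms are products with ninth powers `ξ_i⁹ = δ²(-ξ_{i+1}² ξ_i³)`, which vanish
in cohomology. Thus the map induced by a map `f` of factors sends `e_n` to the difference of the classes of
`ξ_n` in the factors `f 1` and `f 0` (`KX.map_e`). For the multiplication and the interchange this gives
`ε e_n = 0` and `c e_n = -e_n`, and for `a ⊗ b ↦ a ⊗ 1 ⊗ b` it gives primitivity. The map `β` is bijective since
`π_{**}(K^{⊗3})` is exterior on the images of the `e_n` under its two factors.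

The `E₂` page is computed one generator at a time. On `E₁^s`, a fixed `e_a` gives the `s` exterior
generators that are the differences of neighbouring factors. The cofaces with large index act on the
coefficient of the first of these that occurs, and a codegeneracy contracts this part of the differential
(`E1.eq_dUpper_codegen`); so every element whose differential is of the form `z + w · e_a`, with `z` free of `e_a`,
is itself of this form up to a boundary (`E1.exists_eq_add_mul_e`), and the form is unique (`E1.mul_e_indep`). For
cocycles this shows that the classes `w_a` generate over `R` (`E1.closure_eq_top`), and for cochains that bound
`x · e_a + y` that they are algebraically independent (`E1.algebraicIndependent_w`). They commute because the
differential of `e_m e_k` is the commutator of `e_m` and `e_k` in the `E₁` page (`E1.W_mul_W`).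
-/

noncomputable section

/-! ### Periodic resolutions of differential graded rings -/

namespace DGRing
variable {A : Type} [Ring A] {G : DGRing A}

theorem cls_eq_of {x y : A} (hx : G.d x = 0) (hy : G.d y = 0) {w : A} (h : G.d w = x - y) :
    G.cls x hx = G.cls y hy :=
  Ideal.Quotient.eq.2 ⟨w, h⟩

theorem cls_zero_iff {x : A} (hx : G.d x = 0) : G.cls x hx = 0 ↔ ∃ w, G.d w = x :=
  Ideal.Quotient.eq_zero_iff_mem

theorem cls_congr {x y : A} (h : x = y) (hx : G.d x = 0) (hy : G.d y = 0) :
    G.cls x hx = G.cls y hy := by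
  subst h; rfl

theorem exists_cls (z : G.Coh) : ∃ x hx, z = G.cls x hx := by
  obtain ⟨⟨x, hx⟩, rfl⟩ := G.proj_surjective z
  exact ⟨x, hx, rfl⟩

theorem d_add_eq {x y : A} (hx : G.d x = 0) (hy : G.d y = 0) : G.d (x + y) = 0 := by
  rw [map_add, hx, hy, add_zero]

theorem d_mul_eq {x y : A} (hx : G.d x = 0) (hy : G.d y = 0) : G.d (x * y) = 0 := by
  rw [G.d_mul, hx, hy]; simp

theorem d_neg_eq {x : A} (hx : G.d x = 0) : G.d (-x) = 0 := by
  rw [map_neg, hx, neg_zero]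

theorem d_one : G.d 1 = 0 := G.cycles.one_mem

theorem cls_add {x y : A} (hx : G.d x = 0) (hy : G.d y = 0) :
    G.cls (x + y) (d_add_eq hx hy) = G.cls x hx + G.cls y hy := rfl

theorem cls_mul {x y : A} (hx : G.d x = 0) (hy : G.d y = 0) :
    G.cls (x * y) (d_mul_eq hx hy) = G.cls x hx * G.cls y hy := rfl

theorem cls_neg {x : A} (hx : G.d x = 0) : G.cls (-x) (d_neg_eq hx) = -G.cls x hx := rfl

end DGRing

/-- A two-step periodic resolution of the differential graded ring `A` by an acyclic one. The ring
`C` carries a derivation `par` over the differential whose kernel is `A` and with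
`ker par² = im par`; the complex `C` is contracted by `S` onto the ring `N` of cocycles, on which `par` is the
derivation `δ`. Since `b = d β`, `par β = d γ` and `par² γ = -1`, the two connecting homomorphisms of
`A → C → im par` and `im par → C → A` compose to the multiplication by `-b`. -/
structure PeriodicRes (A C N : Type) [Ring A] [Ring C] [CommRing N] (G : DGRing A)
    (G' : DGRing C) where
  j : A →+* C
  j_inj : Function.Injective j
  j_d : ∀ x, j (G.d x) = G'.d (j x)
  par : C →+ C
  par_d : ∀ x, par (G'.d x) = G'.d (par x)
  par_mul : ∀ x y, par (x * y) = par x * y + x * par y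
  par_eq_zero : ∀ x, par x = 0 ↔ ∃ a, j a = x
  par_par_par : ∀ x, par (par (par x)) = 0
  exact : ∀ x, par (par x) = 0 → ∃ y, par y = x
  iota : N →+* C
  p : C →+ N
  p_iota : ∀ n, p (iota n) = n
  p_d : ∀ x, p (G'.d x) = 0
  d_iota : ∀ n, G'.d (iota n) = 0
  j_sign : ∀ x, j (G.sign x) = G'.sign (j x)
  par_sign : ∀ x, par (G'.sign x) = G'.sign (par x)
  sign_iota : ∀ n, G'.sign (iota n) = iota n
  δ : N →+ N
  par_iota : ∀ n, par (iota n) = iota (δ n)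
  three : (3 : N) = 0
  S : C →+ C
  S_d : ∀ x, G'.d (S x) + S (G'.d x) = x - iota (p x)
  fil : ℕ → AddSubgroup C
  fil_S : ∀ s x, x ∈ fil (s + 1) → S x ∈ fil s
  fil_S_zero : ∀ x, x ∈ fil 0 → S x = 0
  fil_par : ∀ s x, x ∈ fil s → par x ∈ fil s
  fil_exists : ∀ x, ∃ s, x ∈ fil s
  b : A
  d_b : G.d b = 0
  sign_b : G'.sign (j b) = j b
  b_iota : ∀ n, iota n * j b = j b * iota n
  β : C
  γ : C
  d_β : G'.d β = j b
  par_β : par β = G'.d γ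
  par_par_γ : par (par γ) = -1

namespace PeriodicRes
variable {A C N : Type} [Ring A] [Ring C] [CommRing N] {G : DGRing A} {G' : DGRing C}
  (X : PeriodicRes A C N G G')

theorem iota_inj : Function.Injective X.iota := fun x y h => by
  rw [← X.p_iota x, h, X.p_iota]

theorem par_j (a : A) : X.par (X.j a) = 0 := (X.par_eq_zero _).2 ⟨a, rfl⟩

theorem δ_mul (m n : N) : X.δ (m * n) = X.δ m * n + m * X.δ n := by
  apply X.iota_inj
  rw [← X.par_iota, map_mul, X.par_mul, X.par_iota, X.par_iota]
  simp

theorem δ_δ_δ (n : N) : X.δ (X.δ (X.δ n)) = 0 := by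
  apply X.iota_inj
  rw [← X.par_iota, ← X.par_iota, ← X.par_iota, X.par_par_par, map_zero]

theorem d_eq_zero_iff (a : A) : G.d a = 0 ↔ G'.d (X.j a) = 0 := by
  rw [← X.j_d, map_eq_zero_iff _ X.j_inj]

theorem d_mul_cocycle (x : C) {a : A} (ha : G.d a = 0) :
    G'.d (x * X.j a) = G'.d x * X.j a := by
  rw [G'.d_mul, (X.d_eq_zero_iff a).1 ha, mul_zero, add_zero]

/-- The composite of the two connecting homomorphisms is the multiplication by `-b`. -/
theorem cls_eq_neg_b_mul {a a₁ : A} (ha : G.d a = 0) (ha₁ : G.d a₁ = 0) {y y' : C}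
    (hy : X.j a = G'.d y) (hy' : X.par y = G'.d y') (h : X.j a₁ = X.par (X.par y')) :
    G.cls a ha = -(G.cls X.b X.d_b * G.cls a₁ ha₁) := by
  -- Adding `γ a₁` to `y'` and `β a₁` to `y` makes both connecting homomorphisms trivial.
  obtain ⟨w, hw⟩ := X.exact (y' + X.γ * X.j a₁) (by
    rw [map_add, map_add, X.par_mul, X.par_j, mul_zero, add_zero, X.par_mul, X.par_j, mul_zero,
      add_zero, X.par_par_γ, ← h]
    simp)
  obtain ⟨c, hc⟩ := (X.par_eq_zero (y + X.β * X.j a₁ - G'.d w)).1 (by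
    rw [map_sub, map_add, X.par_mul, X.par_j, X.par_d, hw, hy', X.par_β, map_add,
      X.d_mul_cocycle _ ha₁]
    simp)
  rw [← DGRing.cls_mul, ← DGRing.cls_neg]
  refine DGRing.cls_eq_of _ _ (w := c) (X.j_inj ?_)
  rw [X.j_d, hc, map_sub, map_add, G'.d_d, X.d_mul_cocycle _ ha₁, X.d_β, ← hy]
  simp

/-- The kernel of `δ`, a subring. -/
def Z0 : Subring N where
  carrier := {n | X.δ n = 0}
  mul_mem' {x y} hx hy := by
    simp only [Set.mem_ofPred_eq] at hx hy ⊢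
    rw [X.δ_mul, hx, hy]; simp
  one_mem' := by
    have := X.δ_mul 1 1
    simpa using this
  add_mem' {x y} hx hy := by
    simp only [Set.mem_ofPred_eq] at hx hy ⊢
    rw [map_add, hx, hy, add_zero]
  zero_mem' := map_zero _
  neg_mem' {x} hx := by
    simp only [Set.mem_ofPred_eq] at hx ⊢
    rw [map_neg, hx, neg_zero]

/-- The kernel of `δ²`. -/
def Z1 : AddSubgroup N := (X.δ.comp X.δ).ker

theorem mem_Z0 {n : N} : n ∈ X.Z0 ↔ X.δ n = 0 := Iff.rfl
theorem mem_Z1 {n : N} : n ∈ X.Z1 ↔ X.δ (X.δ n) = 0 := Iff.rfl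

theorem exists_zero (n : X.Z0) : ∃ a, X.j a = X.iota n :=
  (X.par_eq_zero _).1 (by rw [X.par_iota, X.mem_Z0.1 n.2, map_zero])

theorem exists_Y (u : X.Z1) : ∃ Y, X.par Y = X.iota u :=
  X.exact _ (by rw [X.par_iota, X.par_iota, X.mem_Z1.1 u.2, map_zero])

theorem exists_one (u : X.Z1) : ∃ a Y, X.par Y = X.iota u ∧ X.j a = G'.d Y := by
  obtain ⟨Y, hY⟩ := X.exists_Y u
  obtain ⟨a, ha⟩ := (X.par_eq_zero (G'.d Y)).1 (by rw [X.par_d, hY, X.d_iota])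
  exact ⟨a, Y, hY, ha⟩

theorem d_of_zero {a : A} {n : N} (h : X.j a = X.iota n) : G.d a = 0 :=
  (X.d_eq_zero_iff a).2 (by rw [h, X.d_iota])

theorem d_of_one {a : A} {Y : C} (h : X.j a = G'.d Y) : G.d a = 0 :=
  (X.d_eq_zero_iff a).2 (by rw [h, G'.d_d])

/-- The class of degree `0` of `n ∈ ker δ`. -/
def c0 : X.Z0 →+* G.Coh where
  toFun n := G.cls _ (X.d_of_zero (X.exists_zero n).choose_spec)
  map_one' := DGRing.cls_congr (X.j_inj (by
    rw [(X.exists_zero 1).choose_spec]; simp)) _ DGRing.d_one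
  map_mul' m n := DGRing.cls_congr (X.j_inj (by
    rw [(X.exists_zero (m * n)).choose_spec, map_mul, (X.exists_zero m).choose_spec,
      (X.exists_zero n).choose_spec]; simp)) _
        (DGRing.d_mul_eq (X.d_of_zero (X.exists_zero m).choose_spec)
          (X.d_of_zero (X.exists_zero n).choose_spec))
  map_zero' := DGRing.cls_congr (X.j_inj (by
    rw [(X.exists_zero 0).choose_spec]; simp)) _ (map_zero _)
  map_add' m n := DGRing.cls_congr (X.j_inj (by
    rw [(X.exists_zero (m + n)).choose_spec, map_add, (X.exists_zero m).choose_spec,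
      (X.exists_zero n).choose_spec]; simp)) _
        (DGRing.d_add_eq (X.d_of_zero (X.exists_zero m).choose_spec)
          (X.d_of_zero (X.exists_zero n).choose_spec))

theorem c0_eq {a : A} (n : X.Z0) (h : X.j a = X.iota n) : X.c0 n = G.cls a (X.d_of_zero h) :=
  DGRing.cls_congr (X.j_inj (by rw [(X.exists_zero n).choose_spec, h])) _ _

theorem cls_one_congr {a a' : A} {Y Y' : C} (h : X.par Y = X.par Y') (ha : X.j a = G'.d Y)
    (ha' : X.j a' = G'.d Y') : G.cls a (X.d_of_one ha) = G.cls a' (X.d_of_one ha') := by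
  obtain ⟨c, hc⟩ := (X.par_eq_zero (Y - Y')).1 (by rw [map_sub, h, sub_self])
  exact DGRing.cls_eq_of _ _ (w := c) (X.j_inj (by rw [X.j_d, hc, map_sub, map_sub, ha, ha']))

/-- The class of `u ∈ ker δ²`, of degree `1`: the image of `u` under a connecting homomorphism. -/
def c1 : X.Z1 →+ G.Coh where
  toFun u := G.cls _ (X.d_of_one (X.exists_one u).choose_spec.choose_spec.2)
  map_zero' := by
    refine (X.cls_one_congr (Y' := 0) ?_ (X.exists_one 0).choose_spec.choose_spec.2 (a' := 0)
      (by simp)).trans rfl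
    rw [(X.exists_one 0).choose_spec.choose_spec.1]
    simp
  map_add' u v := by
    have hu := (X.exists_one u).choose_spec.choose_spec
    have hv := (X.exists_one v).choose_spec.choose_spec
    refine X.cls_one_congr (Y' := (X.exists_one u).choose_spec.choose +
      (X.exists_one v).choose_spec.choose) ?_ (X.exists_one (u + v)).choose_spec.choose_spec.2 ?_
    · rw [(X.exists_one (u + v)).choose_spec.choose_spec.1, map_add, hu.1, hv.1]
      simp
    · exact ((map_add X.j _ _).trans (congrArg₂ (· + ·) hu.2 hv.2)).trans (map_add G'.d _ _).symm

theorem c1_eq {a : A} {Y : C} (u : X.Z1) (hY : X.par Y = X.iota u) (h : X.j a = G'.d Y) :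
    X.c1 u = G.cls a (X.d_of_one h) :=
  X.cls_one_congr ((X.exists_one u).choose_spec.choose_spec.1.trans hY.symm)
    (X.exists_one u).choose_spec.choose_spec.2 h

/-- The class of `b`. -/
def bb : G.Coh := G.cls X.b X.d_b

theorem δ_mem_Z0 (n : N) : X.δ (X.δ n) ∈ X.Z0 := X.δ_δ_δ n
theorem δ_mem_Z1 (n : N) : X.δ n ∈ X.Z1 := X.δ_δ_δ n

theorem c1_δ (n : N) : X.c1 ⟨X.δ n, X.δ_mem_Z1 n⟩ = 0 := by
  refine (X.c1_eq (a := 0) (Y := X.iota n) _ (X.par_iota n) ?_).trans rfl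
  rw [map_zero, X.d_iota]

theorem bb_mul_c0_δ (n : N) : X.bb * X.c0 ⟨X.δ (X.δ n), X.δ_mem_Z0 n⟩ = 0 := by
  obtain ⟨a, ha⟩ := X.exists_zero ⟨X.δ (X.δ n), X.δ_mem_Z0 n⟩
  rw [X.c0_eq _ ha, ← neg_eq_zero]
  refine (X.cls_eq_neg_b_mul (a := 0) (y := 0) (y' := X.iota n) (map_zero _) _ ?_ ?_ ?_).symm.trans rfl
  · simp
  · rw [map_zero, X.d_iota]
  · rw [ha, X.par_iota, X.par_iota]

theorem p_par_d (x : C) : X.p (X.par (G'.d x)) = 0 := by rw [X.par_d, X.p_d]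

/-- A cocycle is equal to `ι (p x)` up to a coboundary. -/
theorem eq_d_S {x : C} (h : G'.d x = 0) : x = G'.d (X.S x) + X.iota (X.p x) := by
  have := X.S_d x
  rw [h, map_zero, add_zero] at this
  rw [this]; abel

/-- Every class of filtration `s` is of the form `c0 n + c1 u + b z` with `z` of filtration `s - 2`. -/
theorem exists_decomp {a : A} (ha : G.d a = 0) : ∃ (n : X.Z0) (u : X.Z1) (a₁ : A)
    (h₁ : G.d a₁ = 0), G.cls a ha = X.c0 n + X.c1 u + X.bb * G.cls a₁ h₁ ∧
      (X.j a ∈ X.fil 0 → a₁ = 0) ∧ (X.j a ∈ X.fil 1 → a₁ = 0) ∧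
      ∀ s, X.j a ∈ X.fil (s + 2) → X.j a₁ ∈ X.fil s := by
  -- The contraction writes `a = d (S a) + n`, then `t = par (S a)` is a cocycle and `t = d (S t) + u`.
  -- What is left after `n` and `u` is a double connecting image of `a₁ = par² (S t)`.
  have hja := (X.d_eq_zero_iff a).1 ha
  have e := X.eq_d_S hja
  have hn : X.p (X.j a) ∈ X.Z0 := by
    have h1 := congrArg (fun z => X.p (X.par z)) e
    simp only [X.par_j, map_zero, map_add, X.p_par_d, X.par_iota, X.p_iota, zero_add] at h1
    exact h1.symm
  set t := X.par (X.S (X.j a)) with ht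
  have hdt : G'.d t = 0 := by
    rw [ht, ← X.par_d, eq_sub_of_add_eq e.symm, map_sub, X.par_j, X.par_iota, X.mem_Z0.1 hn]
    simp
  have et := X.eq_d_S hdt
  have hu : X.p t ∈ X.Z1 := by
    have h1 := congrArg (fun z => X.p (X.par (X.par z))) et
    simp only [ht, X.par_par_par, map_zero, map_add, X.par_d, X.p_d, X.par_iota, X.p_iota,
      zero_add] at h1
    exact h1.symm
  obtain ⟨an, han⟩ := X.exists_zero ⟨_, hn⟩
  obtain ⟨au, Y, hY, hau⟩ := X.exists_one ⟨_, hu⟩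
  obtain ⟨a₁, ha₁⟩ := (X.par_eq_zero (X.par (X.par (X.S t)))).1 (X.par_par_par _)
  have hd₁ : G.d a₁ = 0 := (X.d_eq_zero_iff _).2 (by
    rw [ha₁, ← X.par_d, ← X.par_d, eq_sub_of_add_eq et.symm, map_sub, map_sub, ht, X.par_par_par,
      X.par_iota, X.par_iota, X.mem_Z1.1 hu]
    simp)
  have key := X.cls_eq_neg_b_mul (a := a - an - au) (a₁ := a₁) (y := X.S (X.j a) - Y) (y' := X.S t)
    ((X.d_eq_zero_iff _).2 (by
      rw [map_sub, map_sub, map_sub, map_sub, hja, han, X.d_iota, hau, G'.d_d]; simp)) hd₁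
    (by rw [map_sub, map_sub, map_sub, han, hau]; nth_rewrite 1 [e]; simp)
    (by rw [map_sub, hY, ← ht]; nth_rewrite 1 [et]; simp) ha₁
  refine ⟨⟨_, hn⟩, ⟨_, hu⟩, -a₁, DGRing.d_neg_eq hd₁, ?_, ?_, ?_, ?_⟩
  · rw [X.c0_eq _ han, X.c1_eq _ hY hau, DGRing.cls_neg hd₁, mul_neg]
    change _ = _ + _ + -(G.cls X.b X.d_b * _)
    rw [← key]
    refine (DGRing.cls_congr (y := an + au + (a - an - au)) ?_ _ ?_).trans ?_
    · abel
    · rw [show an + au + (a - an - au) = a by abel, ha]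
    · rfl
  · intro h
    refine X.j_inj ?_
    rw [map_neg, ha₁, ht, X.fil_S_zero _ h]
    simp
  · intro h
    refine X.j_inj ?_
    rw [map_neg, ha₁, X.fil_S_zero _ (X.fil_par _ _ (X.fil_S _ _ h))]
    simp
  · intro s h
    rw [map_neg, ha₁]
    exact neg_mem (X.fil_par _ _ (X.fil_par _ _ (X.fil_S _ _ (X.fil_par _ _ (X.fil_S _ _ h)))))

/-- The decomposition `c0 n + c1 u + b z` is unique up to the relations `c1 (δ n) = 0` and
`b c0 (δ² n) = 0`. -/
theorem decomp_unique {n : X.Z0} {u : X.Z1} {z : G.Coh} (h : X.c0 n + X.c1 u + X.bb * z = 0) :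
    n = 0 ∧ (∃ m, (u : N) = X.δ m) ∧ ∃ m, z = X.c0 ⟨X.δ (X.δ m), X.δ_mem_Z0 m⟩ := by
  obtain ⟨a₁, ha₁, rfl⟩ := DGRing.exists_cls z
  obtain ⟨an, han⟩ := X.exists_zero n
  obtain ⟨au, Y, hY, hau⟩ := X.exists_one u
  rw [X.c0_eq _ han, X.c1_eq _ hY hau, bb, ← DGRing.cls_add, ← DGRing.cls_mul, ← DGRing.cls_add,
    DGRing.cls_zero_iff] at h
  obtain ⟨c, hc⟩ := h
  have hc' := congrArg X.j hc
  rw [X.j_d, map_add, map_add, map_mul, han, hau, ← X.d_β, ← X.d_mul_cocycle _ ha₁] at hc'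
  have hn : n = 0 := by
    have := congrArg X.p hc'
    simp only [map_add, X.p_d, X.p_iota, add_zero] at this
    exact Subtype.ext this.symm
  have hx : G'.d (Y + X.β * X.j a₁ - X.j c) = 0 := by
    rw [map_sub, hc', hn, map_add]; simp
  have ex := congrArg X.par (X.eq_d_S hx)
  set x := Y + X.β * X.j a₁ - X.j c with hxx
  have lx : X.par x = X.iota u + G'.d (X.γ * X.j a₁) := by
    rw [hxx, map_sub, map_add, X.par_mul, X.par_j, X.par_j, hY, X.par_β, X.d_mul_cocycle _ ha₁]
    simp
  rw [lx, map_add, X.par_d, X.par_iota] at ex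
  have hu : (u : N) = X.δ (X.p x) := by
    have := congrArg X.p ex
    simpa only [map_add, X.p_d, X.p_iota, add_zero, zero_add] using this
  refine ⟨hn, ⟨_, hu⟩, ?_⟩
  have hx2 : G'.d (X.γ * X.j a₁ - X.par (X.S x)) = 0 := by
    rw [hu] at ex
    rw [map_sub, sub_eq_zero]
    exact add_left_cancel (ex.trans (add_comm _ _))
  have ex2 := congrArg (fun z => X.par (X.par z)) (X.eq_d_S hx2)
  set x2 := X.γ * X.j a₁ - X.par (X.S x) with hxx2
  have lx2 : X.par (X.par x2) = - X.j a₁ := by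
    rw [hxx2, map_sub, map_sub, X.par_mul, X.par_j, mul_zero, add_zero, X.par_mul, X.par_j,
      mul_zero, add_zero, X.par_par_γ, X.par_par_par]
    simp
  simp only [lx2, map_add, X.par_d, X.par_iota] at ex2
  obtain ⟨e, he⟩ := (X.par_eq_zero (X.par (X.par (X.S x2)))).1 (X.par_par_par _)
  obtain ⟨a₂, ha₂⟩ := X.exists_zero ⟨_, X.δ_mem_Z0 (-X.p x2)⟩
  refine ⟨-X.p x2, ?_⟩
  rw [X.c0_eq _ ha₂]
  refine DGRing.cls_eq_of _ _ (w := -e) (X.j_inj ?_)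
  rw [X.j_d, map_neg, map_neg, map_sub, he, ha₂]
  simp only [map_neg]
  rw [← neg_neg (X.j a₁), ex2]
  abel

theorem mul_mem_Z1 {n u : N} (hu : u ∈ X.Z1) (hn : n ∈ X.Z0) : u * n ∈ X.Z1 := by
  rw [mem_Z1] at hu ⊢
  rw [mem_Z0] at hn
  rw [X.δ_mul, hn, mul_zero, add_zero, X.δ_mul, hn, hu]; simp

theorem bracket_mem_Z0 {u v : N} (hu : u ∈ X.Z1) (hv : v ∈ X.Z1) :
    X.δ u * v - u * X.δ v ∈ X.Z0 := by
  rw [mem_Z1] at hu hv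
  rw [mem_Z0, map_sub, X.δ_mul, X.δ_mul, hu, hv]; simp

theorem c1_mul_c0 (u : X.Z1) (n : X.Z0) :
    X.c1 u * X.c0 n = X.c1 ⟨u * n, X.mul_mem_Z1 u.2 n.2⟩ := by
  obtain ⟨an, han⟩ := X.exists_zero n
  obtain ⟨au, Y, hY, hau⟩ := X.exists_one u
  rw [X.c0_eq _ han, X.c1_eq _ hY hau]
  refine (X.c1_eq (a := au * an) (Y := Y * X.iota n) _ ?_ ?_).symm
  · rw [X.par_mul, hY, X.par_iota, X.mem_Z0.1 n.2]; simp
  · rw [map_mul, han, hau, G'.d_mul, X.d_iota]; simp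

theorem c0_mul_c1 (u : X.Z1) (n : X.Z0) :
    X.c0 n * X.c1 u = X.c1 ⟨u * n, X.mul_mem_Z1 u.2 n.2⟩ := by
  obtain ⟨an, han⟩ := X.exists_zero n
  obtain ⟨au, Y, hY, hau⟩ := X.exists_one u
  rw [X.c0_eq _ han, X.c1_eq _ hY hau]
  refine (X.c1_eq (a := an * au) (Y := X.iota n * Y) _ ?_ ?_).symm
  · rw [X.par_mul, hY, X.par_iota, X.mem_Z0.1 n.2, map_zero, zero_mul, zero_add, ← map_mul, mul_comm]
  · rw [map_mul, han, hau, G'.d_mul, X.d_iota, X.sign_iota]; simp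

theorem c1_mul_c1 (u v : X.Z1) :
    X.c1 u * X.c1 v = X.bb * X.c0 ⟨X.δ u * v - u * X.δ v, X.bracket_mem_Z0 u.2 v.2⟩ := by
  obtain ⟨au, Y, hY, hau⟩ := X.exists_one u
  obtain ⟨av, Y', hY', hav⟩ := X.exists_one v
  obtain ⟨a, ha⟩ := X.exists_zero (-⟨X.δ u * v - u * X.δ v, X.bracket_mem_Z0 u.2 v.2⟩)
  rw [← neg_neg ((⟨_, _⟩ : X.Z0)), map_neg, X.c0_eq _ ha, X.c1_eq _ hY hau, X.c1_eq _ hY' hav, mul_neg]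
  refine X.cls_eq_neg_b_mul (y := Y * G'.d Y') (y' := X.iota u * Y')
    (DGRing.d_mul_eq (X.d_of_one hau) (X.d_of_one hav)) _ ?_ ?_ ?_
  · rw [map_mul, hau, hav, G'.d_mul, G'.d_d, mul_zero, add_zero]
  · rw [X.par_mul, hY, X.par_d, hY', X.d_iota, G'.d_mul, X.d_iota, X.sign_iota]; simp
  · have e3 : ∀ m : N, X.iota m + X.iota m + X.iota m = 0 := fun m => by
      rw [← map_add, ← map_add, show m + m + m = 3 * m by ring, X.three, zero_mul, map_zero]
    rw [ha, X.par_mul, map_add, X.par_mul, X.par_mul, hY', X.par_iota, X.par_iota, X.par_iota,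
      X.mem_Z1.1 u.2, ← sub_eq_zero]
    simp only [NegMemClass.coe_neg, map_neg, map_sub, map_mul, map_zero, zero_mul, zero_add]
    have := e3 (X.δ u * v)
    simp only [map_mul] at this
    rw [← neg_eq_zero, ← this]
    abel

theorem bb_mul_c0 (n : X.Z0) : X.bb * X.c0 n = X.c0 n * X.bb := by
  obtain ⟨an, han⟩ := X.exists_zero n
  rw [X.c0_eq _ han, bb, ← DGRing.cls_mul, ← DGRing.cls_mul]
  exact DGRing.cls_congr (X.j_inj (by rw [map_mul, map_mul, han, X.b_iota])) _ _

theorem bb_mul_c1 (u : X.Z1) : X.bb * X.c1 u = X.c1 u * X.bb := by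
  obtain ⟨au, Y, hY, hau⟩ := X.exists_one u
  rw [X.c1_eq _ hY hau, bb, ← DGRing.cls_mul, ← DGRing.cls_mul]
  refine X.cls_one_congr (Y := X.j X.b * Y) (Y' := Y * X.j X.b) ?_ ?_ ?_
  · rw [X.par_mul, X.par_mul, X.par_j, hY, zero_mul, zero_add, mul_zero, add_zero, X.b_iota]
  · rw [map_mul, G'.d_mul, X.sign_b, hau, (X.d_eq_zero_iff _).1 X.d_b]; simp
  · rw [map_mul, X.d_mul_cocycle _ X.d_b, hau]

/-- Induction on cohomology classes. -/
theorem coh_induction {q : G.Coh → Prop} (h0 : q 0)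
    (h : ∀ n u z, q z → q (X.c0 n + X.c1 u + X.bb * z)) (z : G.Coh) : q z := by
  obtain ⟨a, ha, rfl⟩ := DGRing.exists_cls z
  obtain ⟨s, hs⟩ := X.fil_exists (X.j a)
  induction s using Nat.strong_induction_on generalizing a with
  | _ s ih =>
    obtain ⟨n, u, a₁, h₁, e, f0, f1, f2⟩ := X.exists_decomp ha
    rw [e]
    refine h _ _ _ ?_
    match s, hs, ih with
    | 0, hs, _ =>
      obtain rfl := f0 hs
      exact h0
    | 1, hs, _ =>
      obtain rfl := f1 hs
      exact h0
    | s + 2, hs, ih => exact ih s (by omega) a₁ h₁ (f2 s hs)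

theorem bb_comm (z : G.Coh) : X.bb * z = z * X.bb := by
  refine X.coh_induction (q := fun z => X.bb * z = z * X.bb) (by simp) (fun n u z hz => ?_) z
  rw [mul_add, mul_add, add_mul, add_mul, X.bb_mul_c0, X.bb_mul_c1, mul_assoc, ← hz]

/-- The sign automorphism of the cohomology ring is `(-1)ˢ` on `c0` (`s = 0`) and `c1` (`s = 1`). -/
theorem sign_c0 {σ : G.Coh →+* G.Coh} (hσ : ∀ x hx hx', σ (G.cls x hx) = G.cls (G.sign x) hx')
    (n : X.Z0) : σ (X.c0 n) = X.c0 n := by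
  obtain ⟨an, han⟩ := X.exists_zero n
  have h : X.j (G.sign an) = X.iota n := by rw [X.j_sign, han, X.sign_iota]
  rw [X.c0_eq _ han, hσ _ _ (X.d_of_zero h), ← X.c0_eq _ h, ← X.c0_eq _ han]

theorem sign_c1 {σ : G.Coh →+* G.Coh} (hσ : ∀ x hx hx', σ (G.cls x hx) = G.cls (G.sign x) hx')
    (u : X.Z1) : σ (X.c1 u) = -X.c1 u := by
  obtain ⟨au, Y, hY, hau⟩ := X.exists_one u
  have h : X.j (-G.sign au) = G'.d (G'.sign Y) := by
    rw [map_neg, X.j_sign, hau, G'.d_sign]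
  have h' : X.par (G'.sign Y) = X.iota u := by rw [X.par_sign, hY, X.sign_iota]
  have hd : G.d (G.sign au) = 0 := by rw [G.d_sign, X.d_of_one hau]; simp
  rw [X.c1_eq _ hY hau, hσ _ _ hd, ← X.c1_eq _ hY hau, X.c1_eq _ h' h, DGRing.cls_neg hd, neg_neg]

end PeriodicRes

/-! ### Comodule algebras with a derivation -/

/-- A derivation `D` of the bialgebra `H` that commutes with the left coaction of `H` on itself,
with `D ξ₁ = 1` and `D³ = 0`. -/
structure CoDer (H : Type) [CommRing H] [Bialgebra F3 H] [HasXi H] where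
  D : H →ₗ[F3] H
  mul : ∀ x y, D (x * y) = D x * y + x * D y
  comul : ∀ x, Coalgebra.comul (R := F3) (D x) = D.lTensor H (Coalgebra.comul (R := F3) x)
  xi : D HasXi.xi = 1
  three : ∀ x, D (D (D x)) = 0

theorem three_eq_zero (N : Type) [CommRing N] [Algebra F3 N] : (3 : N) = 0 := by
  have := map_ofNat (algebraMap F3 N) 3
  rw [← this, show (OfNat.ofNat 3 : F3) = 0 from rfl, map_zero]

namespace CoDer
variable {H : Type} [CommRing H] [Bialgebra F3 H] [HasXi H] (E : CoDer H)

theorem D_one : E.D 1 = 0 := by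
  have := E.mul 1 1
  simpa using this

/-- The functional `ε ∘ D`. -/
def χ : H →ₗ[F3] F3 := (Coalgebra.counit (R := F3) (A := H)) ∘ₗ E.D

theorem χ_mul (x y : H) : E.χ (x * y) =
    E.χ x * Coalgebra.counit (R := F3) y + Coalgebra.counit (R := F3) x * E.χ y := by
  simp [χ, E.mul]

variable (N : Type) [CommRing N] [Algebra F3 N] [ComodAlg H N]

/-- The derivation `n ↦ Σ (ε ∘ D)(n') n''` of an `H`-comodule algebra. -/
def δ : N →ₗ[F3] N :=
  (TensorProduct.lid F3 N).toLinearMap ∘ₗ E.χ.rTensor N ∘ₗ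
    (ComodAlg.coact (H := H) (N := N)).toLinearMap

variable {N}

theorem δ_apply (n : N) : E.δ N n = TensorProduct.lid F3 N (E.χ.rTensor N (ComodAlg.coact n)) := rfl

theorem counit_coact (n : N) : TensorProduct.lid F3 N
    ((Coalgebra.counit (R := F3) (A := H)).rTensor N (ComodAlg.coact n)) = n := by
  have h := DFunLike.congr_fun (ComodAlg.counit (H := H) (N := N)) n
  have h2 := congrArg (TensorProduct.lid F3 N) h
  refine Eq.trans ?_ (h2.trans ?_)
  · rfl
  · simp

theorem δ_mul (m n : N) : E.δ N (m * n) = E.δ N m * n + m * E.δ N n := by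
  have key : ∀ S T : H ⊗[F3] N, TensorProduct.lid F3 N (E.χ.rTensor N (S * T)) =
      TensorProduct.lid F3 N (E.χ.rTensor N S) *
        TensorProduct.lid F3 N ((Coalgebra.counit (R := F3) (A := H)).rTensor N T) +
      TensorProduct.lid F3 N ((Coalgebra.counit (R := F3) (A := H)).rTensor N S) *
        TensorProduct.lid F3 N (E.χ.rTensor N T) := by
    intro S T
    induction S with
    | zero => simp
    | add a b ha hb => simp only [add_mul, map_add, ha, hb]; ring
    | tmul a b =>
      induction T with
      | zero => simp
      | add x y hx hy => simp only [mul_add, map_add, hx, hy]; ring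
      | tmul x y =>
        simp only [Algebra.TensorProduct.tmul_mul_tmul, LinearMap.rTensor_tmul, TensorProduct.lid_tmul,
          χ_mul, add_smul, mul_smul_comm, smul_smul, mul_comm]
  simp only [δ_apply, map_mul, key, counit_coact]

theorem δ_one : E.δ N 1 = 0 := by
  have := E.δ_mul (1 : N) 1
  simpa using this

/-- The coaction intertwines `1 ⊗ δ` and `D ⊗ 1`. -/
theorem lTensor_δ_coact (n : N) : (E.δ N).lTensor H (ComodAlg.coact n) =
    E.D.rTensor N (ComodAlg.coact n) := by
  have hco := DFunLike.congr_fun (ComodAlg.coassoc (H := H) (N := N)) n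
  let Q : H ⊗[F3] (H ⊗[F3] N) →ₗ[F3] H ⊗[F3] N :=
    ((TensorProduct.lid F3 N).toLinearMap ∘ₗ E.χ.rTensor N).lTensor H
  have h := congrArg Q hco
  simp only [AlgHom.comp_apply] at h
  have h1 : ∀ T : H ⊗[F3] N, Q (Algebra.TensorProduct.map (AlgHom.id F3 H)
      (ComodAlg.coact (H := H) (N := N)) T) = (E.δ N).lTensor H T := fun T => by
    induction T with
    | zero => simp
    | add a b ha hb => simp only [map_add, ha, hb]
    | tmul a b => simp [Q, δ]
  have h2 : ∀ T : H ⊗[F3] N, Q (Algebra.TensorProduct.assoc F3 F3 F3 H H N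
      (Algebra.TensorProduct.map (Bialgebra.comulAlgHom F3 H) (AlgHom.id F3 N) T)) =
      E.D.rTensor N T := fun T => by
    induction T with
    | zero => simp
    | add a b ha hb => simp only [map_add, ha, hb]
    | tmul a b =>
      have h3 : ∀ S : H ⊗[F3] H, Q (Algebra.TensorProduct.assoc F3 F3 F3 H H N (S ⊗ₜ b)) =
          (TensorProduct.rid F3 H ((Coalgebra.counit (R := F3) (A := H)).lTensor H
            (E.D.lTensor H S))) ⊗ₜ b := fun S => by
        induction S with
        | zero => simp
        | add x y hx hy => simp only [TensorProduct.add_tmul, map_add, hx, hy]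
        | tmul x y => simp [Q, χ, TensorProduct.smul_tmul]
      refine (h3 _).trans ?_
      change (TensorProduct.rid F3 H ((Coalgebra.counit (R := F3) (A := H)).lTensor H
            (E.D.lTensor H (Coalgebra.comul (R := F3) a)))) ⊗ₜ b = _
      rw [← E.comul, Coalgebra.lTensor_counit_comul]
      simp
  rw [← h1, ← h2]
  exact h.symm

theorem δ_lid (φ : H →ₗ[F3] F3) (n : N) :
    E.δ N (TensorProduct.lid F3 N (φ.rTensor N (ComodAlg.coact n))) =
    TensorProduct.lid F3 N ((φ ∘ₗ E.D).rTensor N (ComodAlg.coact n)) := by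
  rw [LinearMap.rTensor_comp, LinearMap.comp_apply, ← lTensor_δ_coact]
  induction (ComodAlg.coact n : H ⊗[F3] N) with
  | zero => simp
  | add a b ha hb => simp only [map_add, ha, hb]
  | tmul a b => simp

theorem δ_δ_δ (n : N) : E.δ N (E.δ N (E.δ N n)) = 0 := by
  rw [δ_apply E n, δ_lid, δ_lid]
  have : (E.χ ∘ₗ E.D) ∘ₗ E.D = 0 := by
    ext x
    simp [χ, E.three]
  rw [this]
  simp

end CoDer

/-! ### The coinduced comodule algebra `H ⊗ N` -/

section Coind
variable {H N : Type} [CommRing H] [Bialgebra F3 H] [CommRing N] [Algebra F3 N]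

/-- `H ⊗ N` with the coaction on the first factor. -/
instance ComodAlg.coind : ComodAlg H (H ⊗[F3] N) where
  coact := (Algebra.TensorProduct.assoc F3 F3 F3 H H N).toAlgHom.comp
    (Algebra.TensorProduct.map (Bialgebra.comulAlgHom F3 H) (AlgHom.id F3 N))
  coassoc := by
    refine AlgHom.ext fun T => ?_
    simp only [AlgHom.comp_apply]
    induction T with
    | zero => simp
    | add a b ha hb => simp only [map_add, ha, hb]
    | tmul a b =>
      have hc := DFunLike.congr_fun (Cotensor.coassoc_alg (H := H)) a
      let Q : H ⊗[F3] (H ⊗[F3] H) →ₗ[F3] H ⊗[F3] (H ⊗[F3] (H ⊗[F3] N)) :=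
        ((TensorProduct.assoc F3 H H N).toLinearMap ∘ₗ (TensorProduct.mk F3 (H ⊗[F3] H) N).flip b).lTensor H
      have h := congrArg Q hc
      simp only [AlgHom.comp_apply] at h
      rw [Algebra.TensorProduct.map_tmul]
      change (Algebra.TensorProduct.assoc F3 F3 F3 H H (H ⊗[F3] N))
        (Algebra.TensorProduct.map (Bialgebra.comulAlgHom F3 H) (AlgHom.id F3 (H ⊗[F3] N))
        (Algebra.TensorProduct.assoc F3 F3 F3 H H N (Bialgebra.comulAlgHom F3 H a ⊗ₜ b))) =
        Algebra.TensorProduct.map (AlgHom.id F3 H) _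
        (Algebra.TensorProduct.assoc F3 F3 F3 H H N (Bialgebra.comulAlgHom F3 H a ⊗ₜ b))
      refine Eq.trans ?_ (h.trans ?_)
      · induction (Bialgebra.comulAlgHom F3 H a) with
        | zero => simp
        | add x y hx hy => simp only [map_add, TensorProduct.add_tmul, hx, hy]
        | tmul x y =>
          simp only [Algebra.TensorProduct.assoc_tmul, Algebra.TensorProduct.map_tmul, AlgHom.id_apply]
          induction (Bialgebra.comulAlgHom F3 H x) with
          | zero => simp
          | add p q hp hq => simp only [map_add, TensorProduct.add_tmul, hp, hq]
          | tmul p q => simp [Q]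
      · induction (Bialgebra.comulAlgHom F3 H a) with
        | zero => simp
        | add x y hx hy => simp only [map_add, TensorProduct.add_tmul, hx, hy]
        | tmul x y => rfl
  counit := by
    refine AlgHom.ext fun T => ?_
    simp only [AlgHom.comp_apply]
    induction T with
    | zero => simp
    | add a b ha hb => simp only [map_add, ha, hb]
    | tmul a b =>
      change Algebra.TensorProduct.map (Bialgebra.counitAlgHom F3 H) (AlgHom.id F3 (H ⊗[F3] N))
        (Algebra.TensorProduct.assoc F3 F3 F3 H H N (Bialgebra.comulAlgHom F3 H a ⊗ₜ b)) = 1 ⊗ₜ (a ⊗ₜ b)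
      have h : ∀ S : H ⊗[F3] H, Algebra.TensorProduct.map (Bialgebra.counitAlgHom F3 H)
          (AlgHom.id F3 (H ⊗[F3] N)) (Algebra.TensorProduct.assoc F3 F3 F3 H H N (S ⊗ₜ b)) =
          (1 : F3) ⊗ₜ (TensorProduct.lid F3 H
            ((Coalgebra.counit (R := F3) (A := H)).rTensor H S) ⊗ₜ b) := fun S => by
        induction S with
        | zero => simp
        | add x y hx hy => simp only [TensorProduct.add_tmul, map_add, hx, hy, TensorProduct.tmul_add]
        | tmul x y =>
          simp only [Algebra.TensorProduct.assoc_tmul, Algebra.TensorProduct.map_tmul,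
            LinearMap.rTensor_tmul, TensorProduct.lid_tmul, AlgHom.id_apply]
          rw [← TensorProduct.smul_tmul', TensorProduct.tmul_smul, TensorProduct.smul_tmul',
            smul_eq_mul, mul_one]
          rfl
      rw [h]
      congr 2
      exact (congrArg (TensorProduct.lid F3 H) (Coalgebra.rTensor_counit_comul a)).trans (by simp)

theorem ComodAlg.coind_coact (h : H) (n : N) :
    (ComodAlg.coact (h ⊗ₜ[F3] n) : H ⊗[F3] (H ⊗[F3] N)) =
      Algebra.TensorProduct.assoc F3 F3 F3 H H N (Coalgebra.comul (R := F3) h ⊗ₜ n) := rfl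

end Coind

/-! ### The kernel of `∂` and the cobar complex of a coinduced comodule algebra -/

namespace CoDer
variable {H : Type} [CommRing H] [Bialgebra F3 H] [HasXi H] (E : CoDer H)
variable (N : Type) [CommRing N] [Algebra F3 N] [ComodAlg H N]

/-- The derivation `∂ = 1 ⊗ δ - D ⊗ 1` of `H ⊗ N`. -/
def par : H ⊗[F3] N →ₗ[F3] H ⊗[F3] N := (E.δ N).lTensor H - E.D.rTensor N

variable {N}

theorem par_tmul (h : H) (n : N) : E.par N (h ⊗ₜ n) = h ⊗ₜ E.δ N n - E.D h ⊗ₜ n := rfl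

theorem par_mul (x y : H ⊗[F3] N) : E.par N (x * y) = E.par N x * y + x * E.par N y := by
  induction x with
  | zero => simp
  | add a b ha hb => simp only [add_mul, map_add, ha, hb]; abel
  | tmul a b =>
    induction y with
    | zero => simp
    | add x y hx hy => simp only [mul_add, map_add, hx, hy]; abel
    | tmul x y =>
      simp only [Algebra.TensorProduct.tmul_mul_tmul, par_tmul, E.mul, E.δ_mul, sub_mul, mul_sub,
        TensorProduct.add_tmul, TensorProduct.tmul_add]
      abel

theorem par_par_par (x : H ⊗[F3] N) : E.par N (E.par N (E.par N x)) = 0 := by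
  induction x with
  | zero => simp
  | add a b ha hb => simp only [map_add, ha, hb, add_zero]
  | tmul a b =>
    have h3 : ∀ w : H ⊗[F3] N, w + w + w = 0 := fun w => by
      have := three_eq_zero (H ⊗[F3] N)
      linear_combination w * this
    simp only [par_tmul, map_sub, E.δ_δ_δ, E.three, TensorProduct.tmul_zero, TensorProduct.zero_tmul]
    have h1 := h3 (E.D a ⊗ₜ[F3] E.δ N (E.δ N b))
    have h2 := h3 (E.D (E.D a) ⊗ₜ[F3] E.δ N b)
    refine Eq.trans ?_ ((congrArg₂ (fun x y => y - x) h1 h2).trans (sub_zero _))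
    abel

variable (H N) in
/-- The element `-ξ₁ ⊗ 1`, on which `∂` is `1`. -/
def X : H ⊗[F3] N := -(HasXi.xi ⊗ₜ 1)

theorem par_X : E.par N (X H N) = 1 := by
  rw [X, map_neg, par_tmul, E.δ_one, E.xi, Algebra.TensorProduct.one_def]
  simp

theorem par_one : E.par N 1 = 0 := by
  have := E.par_mul (1 : H ⊗[F3] N) 1
  simpa using this

/-- The kernel of `∂²` is the image of `∂`: with `X = -ξ₁ ⊗ 1` and `φ z = X² ∂² (X² z)`, one has
`∂²φ + ∂φ∂ + φ∂² = 1`. -/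
theorem par_exact (z : H ⊗[F3] N) (hz : E.par N (E.par N z) = 0) : ∃ y, E.par N y = z := by
  have h3 := three_eq_zero (H ⊗[F3] N)
  have hX := E.par_X (N := N)
  have h1 := E.par_one (N := N)
  generalize hx : X H N = x at *
  let φ : H ⊗[F3] N → H ⊗[F3] N := fun w => x * x * E.par N (E.par N (x * x * w))
  refine ⟨E.par N (φ z) + φ (E.par N z), ?_⟩
  simp only [φ, par_mul, map_add, hX, h1, hz, one_mul, mul_one, mul_zero, zero_mul, add_zero, zero_add,
    map_zero]
  generalize E.par N z = w
  linear_combination (z + 12 * x * w) * h3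

/-- The derivation `∂` commutes with the coaction of the coinduced comodule algebra. -/
theorem coact_par (x : H ⊗[F3] N) : ComodAlg.coact (H := H) (E.par N x) =
    (E.par N).lTensor H (ComodAlg.coact (H := H) x) := by
  induction x with
  | zero => simp
  | add a b ha hb => simp only [map_add, ha, hb]
  | tmul a b =>
    rw [par_tmul, map_sub, ComodAlg.coind_coact, ComodAlg.coind_coact, ComodAlg.coind_coact, E.comul]
    induction (Coalgebra.comul (R := F3) a : H ⊗[F3] H) with
    | zero => simp
    | add x y hx hy =>
      simp only [map_add, TensorProduct.add_tmul, ← hx, ← hy]; abel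
    | tmul x y =>
      simp only [LinearMap.lTensor_tmul, Algebra.TensorProduct.assoc_tmul, par_tmul,
        TensorProduct.tmul_sub]

end CoDer

/-- A description of the comodule algebra `M` as the kernel of `∂` on the coinduced comodule algebra
`H ⊗ N`. -/
structure CoRes {H : Type} [CommRing H] [Bialgebra F3 H] [HasXi H] (E : CoDer H)
    (N M : Type) [CommRing N] [Algebra F3 N] [ComodAlg H N] [CommRing M] [Algebra F3 M]
    [ComodAlg H M] where
  j : M →ₐ[F3] H ⊗[F3] N
  inj : Function.Injective j
  compat : Cobar.Compat (BialgHom.id F3 H) j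
  range : ∀ x, E.par N x = 0 ↔ ∃ m, j m = x

namespace Cobar

section
variable {H N : Type} [CommRing H] [Bialgebra F3 H] [CommRing N] [Algebra F3 N]

/-- Application of the linear map `f` to the last entry of each cochain. -/
def last {N' : Type} [CommRing N'] [Algebra F3 N'] (f : N →ₗ[F3] N') :
    Cobar H N →ₗ[F3] Cobar H N' := LinearMap.lTensor (TensorAlgebra F3 H) f

theorem last_ofN {N' : Type} [CommRing N'] [Algebra F3 N'] (f : N →ₗ[F3] N') (n : N) :
    last f (ofN n : Cobar H N) = ofN (f n) := rfl

theorem last_cons {N' : Type} [CommRing N'] [Algebra F3 N'] (f : N →ₗ[F3] N') (a : H)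
    (w : Cobar H N) : last f (cons a w) = cons a (last f w) := by
  have : last f ∘ₗ cons a = cons a ∘ₗ last f := TensorProduct.ext' fun x y => rfl
  exact LinearMap.congr_fun this w

/-- The evaluation `[ ](h ⊗ n) ↦ ε(h) n` of cochains of degree `0`. -/
def aug : Cobar H (H ⊗[F3] N) →ₗ[F3] N :=
  iter ((TensorProduct.lid F3 N).toLinearMap ∘ₗ (Coalgebra.counit (R := F3) (A := H)).rTensor N) 0

@[simp] theorem aug_ofN (x : H ⊗[F3] N) : aug (ofN x) =
    TensorProduct.lid F3 N ((Coalgebra.counit (R := F3) (A := H)).rTensor N x) := iter_ofN _ _ _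

@[simp] theorem aug_cons (a : H) (w : Cobar H (H ⊗[F3] N)) : aug (cons a w) = 0 := by
  rw [aug, iter_cons]; rfl

theorem aug_consH (T : H ⊗[F3] H) (w : Cobar H (H ⊗[F3] N)) : aug (consH T w) = 0 := by
  induction T with
  | zero => simp
  | add x y hx hy => simp [hx, hy]
  | tmul p q => simp

theorem aug_consN (T : H ⊗[F3] (H ⊗[F3] N)) : aug (consN T) = 0 := by
  induction T with
  | zero => simp
  | add x y hx hy => simp [hx, hy]
  | tmul p q => simp

theorem aug_inner (w : Cobar H (H ⊗[F3] N)) : aug (inner w) = 0 := by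
  induction w using induct with
  | h0 n => rw [inner_ofN, aug_consN]
  | hc a w h => rw [inner_cons, map_sub, aug_consH, aug_cons, sub_zero]
  | ha v w hv hw => simp [hv, hw]

theorem aug_d (w : Cobar H (H ⊗[F3] N)) : aug (d w) = 0 := by
  rw [d_apply, map_sub, aug_cons, aug_inner, sub_zero]

/-- The pair of the augmentation and the contraction. -/
def contractPair : Cobar H (H ⊗[F3] N) →ₗ[F3] N × Cobar H (H ⊗[F3] N) :=
  iter (((TensorProduct.lid F3 N).toLinearMap ∘ₗ
    (Coalgebra.counit (R := F3) (A := H)).rTensor N).prod 0)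
    (LinearMap.mk₂ F3 (fun a q => (0, -ofN (a ⊗ₜ q.1) - cons a q.2))
      (by intros; simp [TensorProduct.add_tmul]; abel)
      (by intros; simp [← TensorProduct.smul_tmul', smul_sub])
      (by intros; simp [TensorProduct.tmul_add]; abel)
      (by intros; simp [smul_sub]))

/-- The contraction `[a₁|…|aₛ](h ⊗ n) ↦ (-1)ˢ [a₁|…|aₛ₋₁](aₛ ⊗ ε(h) n)` of the cobar complex of a
coinduced comodule. -/
def contract : Cobar H (H ⊗[F3] N) →ₗ[F3] Cobar H (H ⊗[F3] N) :=
  LinearMap.snd F3 _ _ ∘ₗ contractPair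

theorem contractPair_fst (w : Cobar H (H ⊗[F3] N)) : (contractPair w).1 = aug w := by
  induction w using induct with
  | h0 n => simp [contractPair, iter_ofN]
  | hc a w h => rw [contractPair, iter_cons, aug_cons]; rfl
  | ha v w hv hw => simp [hv, hw]

@[simp] theorem contract_ofN (x : H ⊗[F3] N) : contract (ofN x) = 0 := by
  simp [contract, contractPair, iter_ofN]

@[simp] theorem contract_cons (a : H) (w : Cobar H (H ⊗[F3] N)) :
    contract (cons a w) = -ofN (a ⊗ₜ aug w) - cons a (contract w) := by
  rw [← contractPair_fst w]
  rw [contract, LinearMap.comp_apply, contractPair, iter_cons]; rfl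

theorem contract_consH (T : H ⊗[F3] H) (w : Cobar H (H ⊗[F3] N)) :
    contract (consH T w) =
      consN (Algebra.TensorProduct.assoc F3 F3 F3 H H N (T ⊗ₜ aug w)) + consH T (contract w) := by
  induction T with
  | zero => simp
  | add x y hx hy => simp only [map_add, LinearMap.add_apply, hx, hy, TensorProduct.add_tmul]; abel
  | tmul p q => simp [add_comm]

/-- The operator `contract` is a homotopy from the identity to the projection to `N`. -/
theorem contract_d (w : Cobar H (H ⊗[F3] N)) :
    d (contract w) + contract (d w) = w - ofN (1 ⊗ₜ aug w) := by
  induction w using induct with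
  | ha v w hv hw =>
    simp only [map_add, TensorProduct.tmul_add]
    rw [add_add_add_comm, hv, hw]; abel
  | h0 n =>
    rw [contract_ofN, map_zero, zero_add, d_apply, map_sub, contract_cons, contract_ofN, map_zero,
      sub_zero, inner_ofN]
    induction n with
    | zero => simp
    | add x y hx hy =>
      simp only [map_add, TensorProduct.tmul_add] at hx hy ⊢
      have := congrArg₂ (· + ·) hx hy
      refine Eq.trans ?_ (this.trans ?_) <;> abel
    | tmul h n =>
      rw [ComodAlg.coind_coact]
      have key : ∀ T : H ⊗[F3] H, contract (consN (Algebra.TensorProduct.assoc F3 F3 F3 H H N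
          (T ⊗ₜ n))) = -ofN (TensorProduct.rid F3 H
            ((Coalgebra.counit (R := F3) (A := H)).lTensor H T) ⊗ₜ n) := fun T => by
        induction T with
        | zero => simp
        | add x y hx hy => simp only [TensorProduct.add_tmul, map_add, hx, hy]; abel
        | tmul x y => simp [TensorProduct.smul_tmul]
      rw [key, Coalgebra.lTensor_counit_comul]
      simp
      abel
  | hc a w h =>
    rw [d_apply, d_apply] at h
    rw [d_apply (cons a w), inner_cons, map_sub contract, map_sub contract, contract_cons 1,
      contract_cons a w, contract_consH, contract_cons, aug_inner, aug_cons, d_apply,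
      map_sub inner, map_neg inner, inner_cons, inner_ofN, ComodAlg.coind_coact]
    have h' : w = -inner (contract w) - contract (inner w) := by
      rw [map_sub, contract_cons] at h
      have := congrArg (fun z => z + ofN (1 ⊗ₜ aug w)) h
      simp only [sub_add_cancel] at this
      refine this.symm.trans ?_
      abel
    have h'' := congrArg (cons a) h'
    rw [map_sub, map_neg] at h''
    simp only [map_neg, map_sub, TensorProduct.tmul_zero, map_zero] at h'' ⊢
    refine Eq.trans ?_ ((sub_zero _).trans h'').symm
    abel

/-- The cochains of degree at most `s`. -/
def deg (H N : Type) [CommRing H] [Bialgebra F3 H] [CommRing N] [Algebra F3 N] :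
    ℕ → AddSubgroup (Cobar H N)
  | 0 => AddMonoidHom.range (ofN (H := H) (N := N)).toAddMonoidHom
  | s + 1 => AddMonoidHom.range (ofN (H := H) (N := N)).toAddMonoidHom ⊔
      AddSubgroup.closure {z | ∃ a, ∃ w ∈ deg H N s, z = cons a w}

theorem ofN_mem_deg (s : ℕ) (n : N) : (ofN n : Cobar H N) ∈ deg H N s := by
  cases s with
  | zero => exact ⟨n, rfl⟩
  | succ s => exact AddSubgroup.mem_sup_left ⟨n, rfl⟩

theorem cons_mem_deg {s : ℕ} (a : H) {w : Cobar H N} (h : w ∈ deg H N s) :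
    cons a w ∈ deg H N (s + 1) :=
  AddSubgroup.mem_sup_right (AddSubgroup.subset_closure ⟨a, w, h, rfl⟩)

theorem deg_induction {s : ℕ} {q : Cobar H N → Prop} {w : Cobar H N} (hw : w ∈ deg H N (s + 1))
    (h0 : ∀ n, q (ofN n)) (hc : ∀ a w, w ∈ deg H N s → q (cons a w))
    (ha : ∀ v w, q v → q w → q (v + w)) (hn : ∀ v, q v → q (-v)) : q w := by
  rw [deg, AddSubgroup.mem_sup] at hw
  obtain ⟨_, ⟨n, rfl⟩, y, hy, rfl⟩ := hw
  refine ha _ _ (h0 n) ?_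
  induction hy using AddSubgroup.closure_induction with
  | mem x hx => obtain ⟨a, w, hw, rfl⟩ := hx; exact hc a w hw
  | zero => simpa using h0 0
  | add x y _ _ hx hy => exact ha _ _ hx hy
  | neg x _ hx => exact hn _ hx

theorem deg_mono (s : ℕ) : deg H N s ≤ deg H N (s + 1) := by
  induction s with
  | zero => exact le_sup_left
  | succ s ih =>
    intro w hw
    refine deg_induction hw (ofN_mem_deg _) (fun a w hw => cons_mem_deg a (ih hw))
      (fun _ _ => add_mem) (fun _ => neg_mem)

theorem exists_mem_deg (w : Cobar H N) : ∃ s, w ∈ deg H N s := by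
  have mono : Monotone (deg H N) := monotone_nat_of_le_succ deg_mono
  induction w using induct with
  | h0 n => exact ⟨0, n, rfl⟩
  | hc a w h => obtain ⟨s, h⟩ := h; exact ⟨s + 1, cons_mem_deg a h⟩
  | ha v w hv hw =>
    obtain ⟨s, hs⟩ := hv
    obtain ⟨t, ht⟩ := hw
    exact ⟨max s t, add_mem (mono (le_max_left _ _) hs) (mono (le_max_right _ _) ht)⟩

theorem contract_mem_deg (s : ℕ) (x : Cobar H (H ⊗[F3] N)) (hx : x ∈ deg H (H ⊗[F3] N) (s + 1)) :
    contract x ∈ deg H (H ⊗[F3] N) s := by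
  induction s generalizing x with
  | zero =>
    refine deg_induction (q := fun z => contract z ∈ deg _ _ _) hx (fun n => by rw [contract_ofN]; exact zero_mem _) (fun a w hw => ?_)
      (fun v w hv hw => by rw [map_add]; exact add_mem hv hw)
      (fun v hv => by rw [map_neg]; exact neg_mem hv)
    obtain ⟨n, rfl⟩ := hw
    rw [contract_cons]
    exact sub_mem (neg_mem (ofN_mem_deg _ _)) (by
      have : contract (ofN n : Cobar H (H ⊗[F3] N)) = 0 := contract_ofN n
      change cons a (contract (ofN n)) ∈ _
      rw [this, map_zero]; exact zero_mem _)
  | succ s ih =>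
    refine deg_induction (q := fun z => contract z ∈ deg _ _ _) hx (fun n => by rw [contract_ofN]; exact zero_mem _) (fun a w hw => ?_)
      (fun v w hv hw => by rw [map_add]; exact add_mem hv hw)
      (fun v hv => by rw [map_neg]; exact neg_mem hv)
    rw [contract_cons]
    exact sub_mem (neg_mem (ofN_mem_deg _ _)) (cons_mem_deg a (ih _ hw))

theorem last_mem_deg (f : N →ₗ[F3] N) (s : ℕ) (x : Cobar H N) (hx : x ∈ deg H N s) :
    last f x ∈ deg H N s := by
  induction s generalizing x with
  | zero => obtain ⟨n, rfl⟩ := hx; exact ⟨f n, rfl⟩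
  | succ s ih =>
    refine deg_induction (q := fun z => last f z ∈ deg _ _ _) hx (fun n => ofN_mem_deg _ _) (fun a w hw => ?_)
      (fun v w hv hw => by rw [map_add]; exact add_mem hv hw)
      (fun v hv => by rw [map_neg]; exact neg_mem hv)
    rw [last_cons]
    exact cons_mem_deg a (ih _ hw)

end

section comod
variable {H N : Type} [CommRing H] [Bialgebra F3 H] [CommRing N] [Algebra F3 N] [ComodAlg H N]

theorem last_consH (f : N →ₗ[F3] N) (T : H ⊗[F3] H) (w : Cobar H N) :
    last f (consH T w) = consH T (last f w) := by
  induction T with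
  | zero => simp
  | add x y hx hy => simp only [map_add, LinearMap.add_apply, hx, hy]
  | tmul p q => simp [last_cons]

theorem last_d (f : N →ₗ[F3] N) (hf : ∀ n, ComodAlg.coact (H := H) (f n) =
    f.lTensor H (ComodAlg.coact n)) (w : Cobar H N) : last f (d w) = d (last f w) := by
  have h : last f (inner w) = inner (last f w) := by
    induction w using induct with
    | ha v w hv hw => simp only [map_add, hv, hw]
    | hc a w h => rw [inner_cons, map_sub, last_consH, last_cons, h, last_cons, inner_cons]
    | h0 n =>
      rw [inner_ofN, last_ofN, inner_ofN, hf]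
      induction (ComodAlg.coact n : H ⊗[F3] N) with
      | zero => simp
      | add x y hx hy => simp only [map_add, hx, hy]
      | tmul x y => rw [consN_tmul, last_cons]; rfl
  rw [d_apply, map_sub, last_cons, h, d_apply]

theorem last_act (f : N →ₗ[F3] N) (hf : ∀ n, ComodAlg.coact (H := H) (f n) =
    f.lTensor H (ComodAlg.coact n)) (hm : ∀ x y, f (x * y) = f x * y + x * f y) (w : Cobar H N)
    (n : N) : last f (act w n) = act w (f n) + act (last f w) n := by
  induction w using induct generalizing n with
  | ha v w hv hw => simp only [map_add, LinearMap.add_apply, hv, hw]; abel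
  | h0 m =>
    rw [act_ofN, act_ofN, last_ofN, last_ofN, act_ofN, hm, map_add]
  | hc a w h =>
    rw [act_cons, last_cons, act_cons, act_cons, hf]
    induction (ComodAlg.coact n : H ⊗[F3] N) with
    | zero => simp
    | add x y hx hy => simp only [map_add, LinearMap.add_apply, hx, hy]; abel
    | tmul x y => rw [actAux_tmul, last_cons, h, map_add]; rfl

theorem last_mul (f : N →ₗ[F3] N) (hf : ∀ n, ComodAlg.coact (H := H) (f n) =
    f.lTensor H (ComodAlg.coact n)) (hm : ∀ x y, f (x * y) = f x * y + x * f y) (v w : Cobar H N) :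
    last f (v * w) = last f v * w + v * last f w := by
  induction v using induct with
  | ha u u' h h' => simp only [map_add, add_mul, h, h']; abel
  | hc a v h => rw [cons_mul, last_cons, h, last_cons, cons_mul, cons_mul, map_add]
  | h0 n => rw [ofN_mul, last_act f hf hm, last_ofN, ofN_mul, ofN_mul]

end comod
end Cobar

/-! ### The periodic resolution of a cobar complex -/

namespace CoRes
variable {H : Type} [CommRing H] [Bialgebra F3 H] [HasXi H] {E : CoDer H}
  {N M : Type} [CommRing N] [Algebra F3 N] [ComodAlg H N] [CommRing M] [Algebra F3 M]
  [ComodAlg H M] (Y : CoRes E N M)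

/-- The map `h ⊗ n ↦ ε(h) n` restricted to `M`. -/
def ev : M →ₐ[F3] N :=
  ((Algebra.TensorProduct.lid F3 N : _ →ₐ[F3] N).comp
    (Algebra.TensorProduct.map (Bialgebra.counitAlgHom F3 H) (AlgHom.id F3 N))).comp Y.j

theorem ev_apply (m : M) : Y.ev m =
    TensorProduct.lid F3 N ((Coalgebra.counit (R := F3) (A := H)).rTensor N (Y.j m)) := rfl

theorem map_j_eq_last (w : Cobar H M) :
    Cobar.map (BialgHom.id F3 H) Y.j w = LinearMap.lTensor (TensorAlgebra F3 H) Y.j.toLinearMap w := by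
  induction w using Cobar.induct with
  | h0 n => rw [Cobar.map_ofN]; rfl
  | hc a w h => rw [Cobar.map_cons, h]; exact (Cobar.last_cons Y.j.toLinearMap a w).symm
  | ha v w hv hw => rw [_root_.map_add, hv, hw]; exact (map_add _ _ _).symm

theorem exact_j : Function.Exact Y.j.toLinearMap (E.par N) := fun x => by
  rw [Y.range]; rfl

theorem exact_par : Function.Exact (E.par N) (E.par N ∘ₗ E.par N) := fun x => by
  constructor
  · exact fun h => E.par_exact x h
  · rintro ⟨y, rfl⟩; exact E.par_par_par y

/-- Tensoring over a field with the tensor algebra keeps the sequences for `∂` exact. -/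
theorem last_par_eq_zero (x : Cobar H (H ⊗[F3] N)) : Cobar.last (E.par N) x = 0 ↔
    ∃ a : Cobar H M, Cobar.map (BialgHom.id F3 H) Y.j a = x := by
  refine (Module.Flat.lTensor_exact (TensorAlgebra F3 H) Y.exact_j x).trans ?_
  exact exists_congr fun a => iff_of_eq (congrArg (· = x) (Y.map_j_eq_last a).symm)

theorem last_exact (E : CoDer H) (x : Cobar H (H ⊗[F3] N))
    (h : Cobar.last (E.par N) (Cobar.last (E.par N) x) = 0) :
    ∃ y, Cobar.last (E.par N) y = x := by
  refine (Module.Flat.lTensor_exact (TensorAlgebra F3 H) (exact_par (E := E) (N := N)) x).1 ?_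
  rw [LinearMap.lTensor_comp]; exact h

/-- The periodic resolution of the cobar complex of `M` by that of the coinduced comodule algebra. The
class `b₁₀` becomes a coboundary there: it is the differential of `[ξ₁²]ξ₁ + [ξ₁]ξ₁²`, and `∂` of this
cochain is the differential of `[ ]ξ₁²`. -/
def res : PeriodicRes (Cobar H M) (Cobar H (H ⊗[F3] N)) N (Cobar.dg H M)
    (Cobar.dg H (H ⊗[F3] N)) where
  j := Cobar.mapHom Y.compat
  j_inj := fun x y h => by
    refine Module.Flat.lTensor_preserves_injective_linearMap (M := TensorAlgebra F3 H)
      Y.j.toLinearMap Y.inj ?_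
    rw [← map_j_eq_last, ← map_j_eq_last]; exact h
  j_d := Cobar.map_d Y.compat
  par := (Cobar.last (E.par N)).toAddMonoidHom
  par_d := Cobar.last_d _ E.coact_par
  par_mul := Cobar.last_mul _ E.coact_par E.par_mul
  par_eq_zero := Y.last_par_eq_zero
  par_par_par x := by
    change Cobar.last (E.par N) (Cobar.last (E.par N) (Cobar.last (E.par N) x)) = 0
    induction x using Cobar.induct with
    | h0 n => rw [Cobar.last_ofN, Cobar.last_ofN, Cobar.last_ofN, E.par_par_par, map_zero]
    | hc a w h => rw [Cobar.last_cons, Cobar.last_cons, Cobar.last_cons, h, map_zero]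
    | ha v w hv hw => rw [map_add, map_add, map_add, hv, hw, add_zero]
  exact := last_exact E
  iota :=
    { toFun := fun n => Cobar.ofN (1 ⊗ₜ n)
      map_one' := rfl
      map_mul' := fun m n => by
        rw [Cobar.ofN_mul, Cobar.act_ofN, Algebra.TensorProduct.tmul_mul_tmul, one_mul]
      map_zero' := by rw [TensorProduct.tmul_zero, map_zero]
      map_add' := fun m n => by rw [TensorProduct.tmul_add, map_add] }
  p := Cobar.aug.toAddMonoidHom
  p_iota n := by
    refine (Cobar.aug_ofN _).trans ?_
    simp
  p_d := Cobar.aug_d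
  d_iota n := by
    change Cobar.d (Cobar.ofN (1 ⊗ₜ n)) = 0
    rw [Cobar.d_apply, Cobar.inner_ofN, ComodAlg.coind_coact, Bialgebra.comul_one,
      Algebra.TensorProduct.one_def, Algebra.TensorProduct.assoc_tmul, Cobar.consN_tmul, sub_self]
  sign_iota n := Cobar.sign_ofN _
  δ := (E.δ N).toAddMonoidHom
  par_iota n := by
    refine (Cobar.last_ofN _ _).trans (congrArg _ ?_)
    rw [E.par_tmul, E.D_one, TensorProduct.zero_tmul, sub_zero]; rfl
  three := three_eq_zero N
  S := Cobar.contract.toAddMonoidHom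
  S_d := Cobar.contract_d
  fil := Cobar.deg H (H ⊗[F3] N)
  fil_S := Cobar.contract_mem_deg
  fil_S_zero x hx := by
    obtain ⟨n, rfl⟩ := hx
    exact Cobar.contract_ofN n
  fil_par := Cobar.last_mem_deg _
  fil_exists := Cobar.exists_mem_deg
  b := Cobar.bCochain H M
  d_b := Cobar.d_bCochain H M
  j_sign := Cobar.map_sign _ _
  par_sign x := by
    change Cobar.last (E.par N) (Cobar.sign x) = Cobar.sign (Cobar.last (E.par N) x)
    induction x using Cobar.induct with
    | h0 n => rw [Cobar.sign_ofN, Cobar.last_ofN, Cobar.sign_ofN]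
    | hc a w h => rw [Cobar.sign_cons, map_neg, Cobar.last_cons, h, Cobar.last_cons, Cobar.sign_cons]
    | ha v w hv hw => simp only [map_add, hv, hw]
  sign_b := by
    change Cobar.sign (Cobar.map _ _ (Cobar.bCochain H M)) = Cobar.map _ _ (Cobar.bCochain H M)
    simp [Cobar.bCochain]
  b_iota n := by
    change Cobar.ofN (1 ⊗ₜ n) * Cobar.map _ _ (Cobar.bCochain H M) =
      Cobar.map _ _ (Cobar.bCochain H M) * Cobar.ofN (1 ⊗ₜ n)
    have h : (ComodAlg.coact (1 ⊗ₜ[F3] n) : H ⊗[F3] (H ⊗[F3] N)) = 1 ⊗ₜ (1 ⊗ₜ n) := by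
      rw [ComodAlg.coind_coact, Bialgebra.comul_one, Algebra.TensorProduct.one_def,
        Algebra.TensorProduct.assoc_tmul]
    simp only [Cobar.bCochain, map_add, Cobar.map_cons, Cobar.map_ofN, map_one, mul_add, add_mul,
      Cobar.cons_mul, Cobar.ofN_mul, Cobar.act_cons, h, Cobar.actAux_tmul, one_mul, Cobar.act_ofN, mul_one]
  β := Cobar.cons (HasXi.xi ^ 2) (Cobar.ofN (HasXi.xi ⊗ₜ 1)) +
    Cobar.cons HasXi.xi (Cobar.ofN ((HasXi.xi ^ 2) ⊗ₜ 1))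
  γ := Cobar.ofN ((HasXi.xi ^ 2) ⊗ₜ 1)
  d_β := by
    change Cobar.d _ = Cobar.map _ _ (Cobar.bCochain H M)
    simp only [Cobar.bCochain, Cobar.d_apply, map_add, Cobar.map_cons, Cobar.map_ofN, map_one,
      Cobar.inner_cons, Cobar.inner_ofN, ComodAlg.coind_coact, pow_two, Bialgebra.comul_mul,
      HasXi.comul_xi, mul_add, add_mul, TensorProduct.add_tmul, Algebra.TensorProduct.assoc_tmul,
      Algebra.TensorProduct.tmul_mul_tmul, mul_one, one_mul, LinearMap.add_apply,
      Cobar.consH_tmul, Cobar.consN_tmul, BialgHom.id_apply, Algebra.TensorProduct.one_def]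
    abel
  par_β := by
    change Cobar.last (E.par N) (Cobar.cons (HasXi.xi ^ 2) (Cobar.ofN ((HasXi.xi : H) ⊗ₜ[F3] (1 : N))) +
      Cobar.cons HasXi.xi (Cobar.ofN (((HasXi.xi : H) ^ 2) ⊗ₜ[F3] (1 : N)))) =
      Cobar.d (Cobar.ofN (((HasXi.xi : H) ^ 2) ⊗ₜ[F3] (1 : N)) : Cobar H (H ⊗[F3] N))
    have h3 : ∀ w : Cobar H (H ⊗[F3] N), w + w + w = 0 := fun w => by
      have : (3 : F3) • w = 0 := by
        rw [show (3 : F3) = 0 from rfl, zero_smul]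
      rw [← this, show (3 : F3) = 1 + 1 + 1 from rfl, add_smul, add_smul, one_smul]
    simp only [Cobar.d_apply, map_add, map_neg, Cobar.last_cons, Cobar.last_ofN, E.par_tmul, E.δ_one,
      E.xi, E.mul,
      Cobar.inner_ofN, ComodAlg.coind_coact, pow_two, Bialgebra.comul_mul,
      HasXi.comul_xi, mul_add, add_mul, TensorProduct.add_tmul, Algebra.TensorProduct.assoc_tmul,
      Algebra.TensorProduct.tmul_mul_tmul, mul_one, one_mul,
      Cobar.consN_tmul, TensorProduct.tmul_zero, zero_sub, TensorProduct.add_tmul]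
    abel
  par_par_γ := by
    change Cobar.last (H := H) (E.par N) (Cobar.last (E.par N)
      (Cobar.ofN ((HasXi.xi ^ 2) ⊗ₜ 1))) = -1
    rw [Cobar.last_ofN, Cobar.last_ofN]
    have : E.par N (E.par N ((HasXi.xi ^ 2) ⊗ₜ 1)) = -1 := by
      have h3 := three_eq_zero (H ⊗[F3] N)
      simp only [E.par_tmul, E.δ_one, pow_two, E.mul, E.xi, one_mul, mul_one, TensorProduct.tmul_zero, zero_sub,
        map_neg, TensorProduct.add_tmul, map_add, ← Algebra.TensorProduct.one_def]
      linear_combination h3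
    rw [this, map_neg]; rfl

theorem res_j_apply (w : Cobar H M) : Y.res.j w = Cobar.map (BialgHom.id F3 H) Y.j w := rfl
theorem res_δ_apply (n : N) : Y.res.δ n = E.δ N n := rfl

theorem j_eq_of_coact {m m' : M} (h : (ComodAlg.coact m : H ⊗[F3] M) = 1 ⊗ₜ m + HasXi.xi ⊗ₜ m') :
    Y.j m = 1 ⊗ₜ Y.ev m + HasXi.xi ⊗ₜ Y.ev m' := by
  have h1 := Y.compat m
  rw [h] at h1
  have h2 := congrArg (((TensorProduct.lid F3 N).toLinearMap ∘ₗ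
    (Coalgebra.counit (R := F3) (A := H)).rTensor N).lTensor H) h1
  have h3 : ∀ T : H ⊗[F3] N, (((TensorProduct.lid F3 N).toLinearMap ∘ₗ
      (Coalgebra.counit (R := F3) (A := H)).rTensor N).lTensor H) (ComodAlg.coact T) = T := fun T => by
    induction T with
    | zero => simp
    | add x y hx hy => simp only [map_add, hx, hy]
    | tmul a b =>
      rw [ComodAlg.coind_coact]
      have h4 : ∀ S : H ⊗[F3] H, (((TensorProduct.lid F3 N).toLinearMap ∘ₗ
        (Coalgebra.counit (R := F3) (A := H)).rTensor N).lTensor H)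
          (Algebra.TensorProduct.assoc F3 F3 F3 H H N (S ⊗ₜ b)) =
          (TensorProduct.rid F3 H ((Coalgebra.counit (R := F3) (A := H)).lTensor H S)) ⊗ₜ b :=
        fun S => by
          induction S with
          | zero => simp
          | add x y hx hy => simp only [TensorProduct.add_tmul, map_add, hx, hy]
          | tmul x y => simp [TensorProduct.smul_tmul]
      rw [h4, Coalgebra.lTensor_counit_comul]
      simp
  rw [h3] at h2
  rw [h2]
  simp [ev_apply]

theorem δ_ev_of_coact {m m' : M} (h : (ComodAlg.coact m : H ⊗[F3] M) = 1 ⊗ₜ m + HasXi.xi ⊗ₜ m') :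
    E.δ N (Y.ev m) = Y.ev m' := by
  have h1 : E.par N (Y.j m) = 0 := (Y.range _).2 ⟨m, rfl⟩
  rw [Y.j_eq_of_coact h, map_add, E.par_tmul, E.par_tmul, E.D_one, E.xi, TensorProduct.zero_tmul,
    sub_zero] at h1
  have h2 := congrArg (TensorProduct.lid F3 N ∘ (Coalgebra.counit (R := F3) (A := H)).rTensor N) h1
  have h0 : Coalgebra.counit (R := F3) (HasXi.xi : H) = 0 := by
    have := congrArg (TensorProduct.lid F3 H ∘ (Coalgebra.counit (R := F3) (A := H)).rTensor H)
      (HasXi.comul_xi (H := H))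
    simp at this
    rcases this with h | h
    · exact h
    · rw [← mul_one HasXi.xi, h, mul_zero, map_zero]
  rw [← sub_eq_zero, sub_eq_add_neg]
  simpa [h0] using h2

theorem d_pair {m m' : M} (h : (ComodAlg.coact m : H ⊗[F3] M) = 1 ⊗ₜ m + HasXi.xi ⊗ₜ m')
    (h' : (ComodAlg.coact m' : H ⊗[F3] M) = 1 ⊗ₜ m') :
    Y.res.j (Cobar.cons HasXi.xi (Cobar.ofN m) - Cobar.cons (HasXi.xi ^ 2) (Cobar.ofN m')) =
      Cobar.d (-(Cobar.ofN (HasXi.xi ⊗ₜ Y.ev m) - Cobar.ofN ((HasXi.xi ^ 2) ⊗ₜ Y.ev m'))) := by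
  have h1 := Y.j_eq_of_coact h
  have h2 := Y.j_eq_of_coact (m := m') (m' := 0) (by rw [h', TensorProduct.tmul_zero, add_zero])
  rw [map_zero, TensorProduct.tmul_zero, add_zero] at h2
  have h3 : ∀ w : Cobar H (H ⊗[F3] N), w + w + w = 0 := fun w => by
    have : (3 : F3) • w = 0 := by
      rw [show (3 : F3) = 0 from rfl, zero_smul]
    rw [← this, show (3 : F3) = 1 + 1 + 1 from rfl, add_smul, add_smul, one_smul]
  rw [res_j_apply]
  simp only [Cobar.d_apply, map_sub, map_add, map_neg, Cobar.map_cons, Cobar.map_ofN, h1, h2, Cobar.inner_ofN,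
    ComodAlg.coind_coact, pow_two, Bialgebra.comul_mul,
      HasXi.comul_xi, mul_add, add_mul, TensorProduct.add_tmul, Algebra.TensorProduct.assoc_tmul,
      Algebra.TensorProduct.tmul_mul_tmul, mul_one, one_mul,
      Cobar.consN_tmul, BialgHom.id_apply]
  have e := h3 (Cobar.cons HasXi.xi (Cobar.ofN (HasXi.xi ⊗ₜ[F3] Y.ev m')))
  rw [← sub_eq_zero]
  refine Eq.trans ?_ e
  abel

theorem ev_mem_Z1 {m m' : M} (h : (ComodAlg.coact m : H ⊗[F3] M) = 1 ⊗ₜ m + HasXi.xi ⊗ₜ m')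
    (h' : (ComodAlg.coact m' : H ⊗[F3] M) = 1 ⊗ₜ m') : Y.ev m ∈ Y.res.Z1 := by
  rw [PeriodicRes.mem_Z1, res_δ_apply, res_δ_apply, Y.δ_ev_of_coact h,
    Y.δ_ev_of_coact (m := m') (m' := 0) (by rw [h', TensorProduct.tmul_zero, add_zero]), map_zero]

/-- If `m` has coaction `1 ⊗ m + ξ₁ ⊗ m'` with `m'` primitive then `ev m` represents the class of
`[ξ₁]m - [ξ₁²]m'`. -/
theorem cls_pair {m m' : M} (h : (ComodAlg.coact m : H ⊗[F3] M) = 1 ⊗ₜ m + HasXi.xi ⊗ₜ m')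
    (h' : (ComodAlg.coact m' : H ⊗[F3] M) = 1 ⊗ₜ m') :
    Y.res.c1 ⟨Y.ev m, Y.ev_mem_Z1 h h'⟩ =
    (Cobar.dg H M).cls (Cobar.cons HasXi.xi (Cobar.ofN m) - Cobar.cons (HasXi.xi ^ 2) (Cobar.ofN m'))
      (Y.res.d_of_one (Y.d_pair h h')) := by
  refine Y.res.c1_eq _ ?_ (Y.d_pair h h')
  change Cobar.last (E.par N) (-(Cobar.ofN ((HasXi.xi : H) ⊗ₜ[F3] Y.ev m) -
    Cobar.ofN (((HasXi.xi : H) ^ 2) ⊗ₜ[F3] Y.ev m')) : Cobar H (H ⊗[F3] N)) =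
      Cobar.ofN ((1 : H) ⊗ₜ Y.ev m)
  have h3 := three_eq_zero (H ⊗[F3] N)
  have e1 := Y.δ_ev_of_coact h
  have e2 := Y.δ_ev_of_coact (m := m') (m' := 0) (by rw [h', TensorProduct.tmul_zero, add_zero])
  rw [map_neg, map_sub, Cobar.last_ofN, Cobar.last_ofN, ← map_sub, ← map_neg]
  refine congrArg _ ?_
  simp only [E.par_tmul, e1, e2, E.xi, E.mul, pow_two, one_mul, mul_one, map_zero,
    TensorProduct.tmul_zero, TensorProduct.add_tmul]
  linear_combination -(HasXi.xi ⊗ₜ[F3] Y.ev m') * h3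

end CoRes

/-! ### Localization at a central element -/

namespace Loc
variable {A : Type} [Ring A] {b : A}

/-- The powers of a central element form an Ore set. -/
@[reducible] def oreSet (hb : ∀ a, b * a = a * b) : OreLocalization.OreSet (Submonoid.powers b) where
  ore_right_cancel r₁ r₂ s h := ⟨s, by
    obtain ⟨_, m, rfl⟩ := s
    have hc : ∀ a, b ^ m * a = a * b ^ m := fun a => ((show Commute b a from hb a).pow_left m).eq
    change b ^ m * r₁ = b ^ m * r₂
    rw [hc, hc]; exact h⟩
  oreNum r _ := r
  oreDenom _ s := s
  ore_eq r s := by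
    obtain ⟨_, m, rfl⟩ := s
    exact ((show Commute b r from hb r).pow_left m).eq

theorem of_eq_zero (hb : ∀ a, b * a = a * b) {a : A} (h : of b a = 0) : ∃ m : ℕ, b ^ m * a = 0 := by
  let := oreSet hb
  let ν : A →+* OreLocalization (Submonoid.powers b) A := OreLocalization.numeratorRingHom
  let β : (OreLocalization (Submonoid.powers b) A)ˣ :=
    OreLocalization.numeratorUnit ⟨b, Submonoid.mem_powers b⟩
  have hβ : (β : OreLocalization (Submonoid.powers b) A) = ν b := rfl
  have hc : ∀ a, Commute (ν a) (↑β⁻¹ : OreLocalization (Submonoid.powers b) A) := fun a => by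
    refine Commute.units_inv_right ?_
    rw [hβ, Commute, SemiconjBy, ← map_mul, ← map_mul, hb]
  let F : Loc A b →+* OreLocalization (Submonoid.powers b) A :=
    RingQuot.lift ⟨Polynomial.eval₂RingHom' ν _ hc, by
      rintro _ _ ⟨rfl, rfl⟩
      rw [map_mul, map_one]
      change Polynomial.eval₂ _ _ _ * Polynomial.eval₂ _ _ _ = 1
      rw [Polynomial.eval₂_X, Polynomial.eval₂_C, ← hβ, Units.inv_mul]⟩
  have hF : F (of b a) = ν a := by
    refine (RingQuot.lift_mkRingHom_apply _ _ _).trans ?_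
    exact Polynomial.eval₂_C _ _
  rw [h, map_zero] at hF
  have h0 : (OreLocalization.oreDiv a 1 : OreLocalization (Submonoid.powers b) A) =
      OreLocalization.oreDiv 0 1 := hF.symm.trans (map_zero ν).symm
  rw [OreLocalization.oreDiv_eq_iff] at h0
  obtain ⟨⟨_, m, rfl⟩, v, h1, h2⟩ := h0
  refine ⟨m, ?_⟩
  simp only [OneMemClass.coe_one, mul_one] at h2
  rw [smul_zero] at h1
  change b ^ m = v at h2
  rw [h2]
  exact h1.symm

/-- The image of `b` in the localization, a unit. -/
def unit (b : A) : (Loc A b)ˣ where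
  val := of b b
  inv := mk b Polynomial.X
  val_inv := by
    have : mk b (Polynomial.X * Polynomial.C b) = mk b 1 := RingQuot.mkRingHom_rel ⟨rfl, rfl⟩
    rw [Polynomial.X_mul_C, map_mul, map_one] at this
    exact this
  inv_val := by
    have : mk b (Polynomial.X * Polynomial.C b) = mk b 1 := RingQuot.mkRingHom_rel ⟨rfl, rfl⟩
    rw [map_mul, map_one] at this
    exact this

theorem unit_comm (hb : ∀ a, b * a = a * b) (w : Loc A b) :
    Commute ((unit b : (Loc A b)ˣ) : Loc A b) w := by
  obtain ⟨p, rfl⟩ := mk_surjective w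
  change mk b (Polynomial.C b) * _ = _ * mk b (Polynomial.C b)
  rw [← map_mul, ← map_mul]
  refine congrArg _ (Polynomial.ext fun n => ?_)
  rw [Polynomial.coeff_C_mul, Polynomial.coeff_mul_C, hb]

theorem exists_eq (w : Loc A b) : w ∈ AddSubgroup.closure
    {x | ∃ (k : ℤ) (a : A), x = ((unit b ^ k : (Loc A b)ˣ) : Loc A b) * of b a} := by
  obtain ⟨p, rfl⟩ := mk_surjective w
  induction p using Polynomial.induction_on' with
  | add p q hp hq => rw [map_add]; exact add_mem hp hq
  | monomial n a =>
    refine AddSubgroup.subset_closure ⟨-n, a, ?_⟩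
    rw [← Polynomial.C_mul_X_pow_eq_monomial, ← Polynomial.X_pow_mul_C, map_mul, map_pow, zpow_neg,
      zpow_natCast, ← inv_pow]
    rfl

end Loc

/-! ### Localized cohomology and its representatives -/

/-- A ring `W` with central unit `b`, and classes `c0 n` for `n ∈ ker δ` and `c1 u` for `u ∈ ker δ²`, where
`δ` is a derivation of `N` with `δ³ = 0`. The values of `c0` and `c1` outside of these kernels are not
used. -/
structure TatePre (N W : Type) [CommRing N] [Ring W] where
  δ : N →+ N
  δ_mul : ∀ m n, δ (m * n) = δ m * n + m * δ n
  δ_three : ∀ n, δ (δ (δ n)) = 0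
  c0 : N → W
  c1 : N → W
  c0_one : c0 1 = 1
  c0_add : ∀ {m n}, δ m = 0 → δ n = 0 → c0 (m + n) = c0 m + c0 n
  c0_mul : ∀ {m n}, δ m = 0 → δ n = 0 → c0 (m * n) = c0 m * c0 n
  c1_add : ∀ {m n}, δ (δ m) = 0 → δ (δ n) = 0 → c1 (m + n) = c1 m + c1 n
  c0_δδ : ∀ n, c0 (δ (δ n)) = 0
  c1_δ : ∀ n, c1 (δ n) = 0
  c1_mul_c0 : ∀ {u n}, δ (δ u) = 0 → δ n = 0 → c1 u * c0 n = c1 (u * n)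
  c0_mul_c1 : ∀ {u n}, δ (δ u) = 0 → δ n = 0 → c0 n * c1 u = c1 (u * n)
  b : Wˣ
  b_comm : ∀ w : W, Commute (b : W) w
  c1_mul_c1 : ∀ {u v}, δ (δ u) = 0 → δ (δ v) = 0 → c1 u * c1 v = b * c0 (δ u * v - u * δ v)
  sign : W →+* W
  sign_b : sign b = b
  sign_c0 : ∀ {n}, δ n = 0 → sign (c0 n) = c0 n
  sign_c1 : ∀ {u}, δ (δ u) = 0 → sign (c1 u) = -c1 u

namespace TatePre
variable {N W : Type} [CommRing N] [Ring W] (T : TatePre N W)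

/-- The element `w` is equal to `Σ bᵏ (c0 (n k) + c1 (u k))`, a finite sum. -/
def Rep (w : W) (n u : ℤ → N) : Prop :=
  (∀ k, T.δ (n k) = 0) ∧ (∀ k, T.δ (T.δ (u k)) = 0) ∧ ∃ s : Finset ℤ,
    (∀ k, k ∉ s → n k = 0 ∧ u k = 0) ∧
    w = ∑ k ∈ s, ((T.b ^ k : Wˣ) : W) * (T.c0 (n k) + T.c1 (u k))

theorem c0_zero : T.c0 0 = 0 := by simpa using T.c0_δδ 0
theorem c1_zero : T.c1 0 = 0 := by simpa using T.c1_δ 0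

theorem c0_neg {n : N} (h : T.δ n = 0) : T.c0 (-n) = -T.c0 n := by
  have := T.c0_add h (n := -n) (by rw [map_neg, h, neg_zero])
  rw [add_neg_cancel, c0_zero] at this
  exact eq_neg_of_add_eq_zero_right this.symm

theorem c1_neg {n : N} (h : T.δ (T.δ n) = 0) : T.c1 (-n) = -T.c1 n := by
  have := T.c1_add h (n := -n) (by rw [map_neg, map_neg, h, neg_zero])
  rw [add_neg_cancel, c1_zero] at this
  exact eq_neg_of_add_eq_zero_right this.symm

variable {T}

theorem Rep.sum_eq {w : W} {n u : ℤ → N} {s t : Finset ℤ} (hst : s ⊆ t)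
    (hs : ∀ k, k ∉ s → n k = 0 ∧ u k = 0)
    (hw : w = ∑ k ∈ s, ((T.b ^ k : Wˣ) : W) * (T.c0 (n k) + T.c1 (u k))) :
    w = ∑ k ∈ t, ((T.b ^ k : Wˣ) : W) * (T.c0 (n k) + T.c1 (u k)) := by
  rw [hw]
  refine Finset.sum_subset hst fun k _ hk => ?_
  rw [(hs k hk).1, (hs k hk).2, c0_zero, c1_zero, add_zero, mul_zero]

theorem Rep.add {w w' : W} {n u n' u' : ℤ → N} (h : T.Rep w n u) (h' : T.Rep w' n' u') :
    T.Rep (w + w') (n + n') (u + u') := by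
  obtain ⟨h0, h1, s, hs, hw⟩ := h
  obtain ⟨h0', h1', s', hs', hw'⟩ := h'
  refine ⟨fun k => by rw [Pi.add_apply, map_add, h0, h0', add_zero],
    fun k => by rw [Pi.add_apply, map_add, map_add, h1, h1', add_zero], s ∪ s', fun k hk => ?_, ?_⟩
  · rw [Finset.notMem_union] at hk
    simp [hs k hk.1, hs' k hk.2]
  · rw [Rep.sum_eq Finset.subset_union_left hs hw, Rep.sum_eq Finset.subset_union_right hs' hw',
      ← Finset.sum_add_distrib]
    refine Finset.sum_congr rfl fun k _ => ?_
    rw [Pi.add_apply, Pi.add_apply, T.c0_add (h0 k) (h0' k), T.c1_add (h1 k) (h1' k), ← mul_add]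
    congr 1; abel

theorem Rep.neg {w : W} {n u : ℤ → N} (h : T.Rep w n u) : T.Rep (-w) (-n) (-u) := by
  obtain ⟨h0, h1, s, hs, hw⟩ := h
  refine ⟨fun k => by rw [Pi.neg_apply, map_neg, h0, neg_zero],
    fun k => by rw [Pi.neg_apply, map_neg, map_neg, h1, neg_zero], s, fun k hk => ?_, ?_⟩
  · simp [hs k hk]
  · rw [hw, ← Finset.sum_neg_distrib]
    refine Finset.sum_congr rfl fun k _ => ?_
    rw [Pi.neg_apply, Pi.neg_apply, T.c0_neg (h0 k), T.c1_neg (h1 k), ← mul_neg]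
    congr 1; abel

theorem Rep.single (k : ℤ) {n u : N} (h0 : T.δ n = 0) (h1 : T.δ (T.δ u) = 0) :
    T.Rep (((T.b ^ k : Wˣ) : W) * (T.c0 n + T.c1 u)) (Pi.single k n) (Pi.single k u) := by
  refine ⟨fun l => ?_, fun l => ?_, {k}, fun l hl => ?_, ?_⟩
  · rcases eq_or_ne l k with rfl | h
    · simpa
    · simp [h]
  · rcases eq_or_ne l k with rfl | h
    · simpa
    · simp [h]
  · rw [Finset.mem_singleton] at hl
    simp [hl]
  · simp

theorem Rep.zero : T.Rep 0 0 0 := ⟨fun _ => by simp, fun _ => by simp, ∅, fun _ _ => ⟨rfl, rfl⟩, by simp⟩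

end TatePre

/-- A `TatePre` in which each element has a representation that is unique up to `im δ²` and `im δ`. -/
structure TateRing (N W : Type) [CommRing N] [Ring W] extends TatePre N W where
  exists_rep : ∀ w, ∃ n u, toTatePre.Rep w n u
  rep_zero : ∀ n u, toTatePre.Rep 0 n u → ∀ k, (∃ m, δ (δ m) = n k) ∧ ∃ m, δ m = u k

namespace PeriodicRes
variable {A C N : Type} [Ring A] [Ring C] [CommRing N] {G : DGRing A} {G' : DGRing C}
  (X : PeriodicRes A C N G G')

open Classical in
/-- The class `c0 n` in the localization, extended by zero. -/
def l0 (n : N) : Loc G.Coh X.bb := if h : X.δ n = 0 then Loc.of _ (X.c0 ⟨n, h⟩) else 0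

open Classical in
/-- The class `c1 u` in the localization, extended by zero. -/
def l1 (u : N) : Loc G.Coh X.bb :=
  if h : X.δ (X.δ u) = 0 then Loc.of _ (X.c1 ⟨u, h⟩) else 0

theorem l0_eq {n : N} (h : X.δ n = 0) : X.l0 n = Loc.of _ (X.c0 ⟨n, h⟩) := dif_pos h
theorem l1_eq {u : N} (h : X.δ (X.δ u) = 0) : X.l1 u = Loc.of _ (X.c1 ⟨u, h⟩) := dif_pos h

/-- The localized cohomology ring with its classes `c0` and `c1`. -/
def tatePre (σ : Loc G.Coh X.bb →+* Loc G.Coh X.bb) (τ : G.Coh →+* G.Coh)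
    (hσ : ∀ x, σ (Loc.of _ x) = Loc.of _ (τ x))
    (hτ : ∀ x hx hx', τ (G.cls x hx) = G.cls (G.sign x) hx') : TatePre N (Loc G.Coh X.bb) where
  δ := X.δ
  δ_mul := X.δ_mul
  δ_three := X.δ_δ_δ
  c0 := X.l0
  c1 := X.l1
  c0_one := by
    rw [X.l0_eq (X.Z0.one_mem : X.δ 1 = 0)]
    exact (congrArg _ (map_one X.c0)).trans (map_one _)
  c0_add hm hn := by
    rw [X.l0_eq hm, X.l0_eq hn, X.l0_eq (X.Z0.add_mem hm hn), ← map_add, ← map_add]; rfl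
  c0_mul hm hn := by
    rw [X.l0_eq hm, X.l0_eq hn, X.l0_eq (X.Z0.mul_mem hm hn), ← map_mul, ← map_mul]; rfl
  c1_add hm hn := by
    rw [X.l1_eq hm, X.l1_eq hn, X.l1_eq (X.Z1.add_mem hm hn), ← map_add, ← map_add]; rfl
  c0_δδ n := by
    rw [X.l0_eq (X.δ_mem_Z0 n)]
    have h := congrArg (Loc.of X.bb) (X.bb_mul_c0_δ n)
    rw [map_mul, map_zero] at h
    exact (Units.mul_right_eq_zero (Loc.unit X.bb)).1 h
  c1_δ n := by
    rw [X.l1_eq (X.δ_mem_Z1 n), X.c1_δ, map_zero]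
  c1_mul_c0 hu hn := by
    rw [X.l0_eq hn, X.l1_eq hu, X.l1_eq (X.mul_mem_Z1 hu hn), ← map_mul, X.c1_mul_c0]
  c0_mul_c1 hu hn := by
    rw [X.l0_eq hn, X.l1_eq hu, X.l1_eq (X.mul_mem_Z1 hu hn), ← map_mul, X.c0_mul_c1]
  b := Loc.unit X.bb
  b_comm := Loc.unit_comm X.bb_comm
  c1_mul_c1 hu hv := by
    rw [X.l0_eq (X.bracket_mem_Z0 hu hv), X.l1_eq hu, X.l1_eq hv, ← map_mul, X.c1_mul_c1, map_mul]
    rfl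
  sign := σ
  sign_b := by
    refine (hσ _).trans (congrArg _ ?_)
    have h : G.sign X.b = X.b := X.j_inj (by rw [X.j_sign, X.sign_b])
    refine (hτ _ X.d_b (by rw [h, X.d_b])).trans (DGRing.cls_congr h _ _)
  sign_c0 hn := by rw [X.l0_eq hn, hσ, X.sign_c0 hτ]
  sign_c1 hu := by rw [X.l1_eq hu, hσ, X.sign_c1 hτ, map_neg]

/-- A polynomial in `b` with values in the image of `c0 ∘ δ²` has trivial coefficients. -/
theorem horner (K : ℕ) (f : ℕ → X.Z0) (g : ℕ → X.Z1) (w : N)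
    (h : ∑ i ∈ Finset.range K, X.bb ^ i * (X.c0 (f i) + X.c1 (g i)) =
      X.c0 ⟨X.δ (X.δ w), X.δ_mem_Z0 w⟩) (i : ℕ) (hi : i < K) :
    (∃ m, X.δ (X.δ m) = f i) ∧ ∃ m, X.δ m = g i := by
  induction K generalizing f g w i with
  | zero => omega
  | succ K ih =>
    rw [Finset.sum_range_succ'] at h
    simp only [pow_succ', pow_zero, one_mul, mul_assoc] at h
    rw [← Finset.mul_sum, ← sub_eq_zero] at h
    have h' : X.c0 (f 0 - ⟨X.δ (X.δ w), X.δ_mem_Z0 w⟩) + X.c1 (g 0) + X.bb *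
        ∑ i ∈ Finset.range K, X.bb ^ i * (X.c0 (f (i + 1)) + X.c1 (g (i + 1))) = 0 := by
      rw [map_sub, ← h]; abel
    obtain ⟨h1, ⟨m, hm⟩, m', hm'⟩ := X.decomp_unique h'
    cases i with
    | zero =>
      refine ⟨⟨w, ?_⟩, m, hm.symm⟩
      exact (congrArg Subtype.val (sub_eq_zero.1 h1)).symm
    | succ i => exact ih (fun i => f (i + 1)) (fun i => g (i + 1)) m' hm' i (by omega)

/-- The `b`-torsion consists of the classes `c0 (δ² w)`. -/
theorem bb_pow_cancel (m : ℕ) {z : G.Coh} {w : N}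
    (h : X.bb ^ m * z = X.c0 ⟨X.δ (X.δ w), X.δ_mem_Z0 w⟩) :
    ∃ w', z = X.c0 ⟨X.δ (X.δ w'), X.δ_mem_Z0 w'⟩ := by
  induction m generalizing w with
  | zero => exact ⟨w, by simpa using h⟩
  | succ m ih =>
    rw [pow_succ', mul_assoc, ← sub_eq_zero] at h
    have h' : X.c0 (-⟨X.δ (X.δ w), X.δ_mem_Z0 w⟩) + X.c1 0 + X.bb * (X.bb ^ m * z) = 0 := by
      rw [map_neg, map_zero, add_zero, neg_add_eq_sub]; exact h
    obtain ⟨_, _, w', hw'⟩ := X.decomp_unique h'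
    exact ih hw'

/-- The localized cohomology ring, with the representation of its elements: `exists_decomp` is iterated
until the filtration is exhausted, and uniqueness comes from `horner` after the multiplication by a power
of `b`. -/
def tate (σ : Loc G.Coh X.bb →+* Loc G.Coh X.bb) (τ : G.Coh →+* G.Coh)
    (hσ : ∀ x, σ (Loc.of _ x) = Loc.of _ (τ x))
    (hτ : ∀ x hx hx', τ (G.cls x hx) = G.cls (G.sign x) hx') : TateRing N (Loc G.Coh X.bb) where
  toTatePre := X.tatePre σ τ hσ hτ
  exists_rep w := by
    have key : ∀ z : G.Coh, ∀ k : ℤ, ∃ n u, (X.tatePre σ τ hσ hτ).Rep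
        (((Loc.unit X.bb ^ k : (Loc G.Coh X.bb)ˣ) : Loc G.Coh X.bb) * Loc.of _ z) n u := fun z => by
      refine X.coh_induction (q := fun z => ∀ k : ℤ, ∃ n u, (X.tatePre σ τ hσ hτ).Rep
        (((Loc.unit X.bb ^ k : (Loc G.Coh X.bb)ˣ) : Loc G.Coh X.bb) * Loc.of _ z) n u) ?_ ?_ z
      · intro k
        exact ⟨0, 0, by rw [map_zero, mul_zero]; exact TatePre.Rep.zero⟩
      · intro n u z hz k
        obtain ⟨n', u', h⟩ := hz (k + 1)
        refine ⟨Pi.single k n.1 + n', Pi.single k u.1 + u', ?_⟩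
        rw [map_add, map_mul, mul_add, map_add]
        refine TatePre.Rep.add (n' := n') (u' := u')
          (?_ : (X.tatePre σ τ hσ hτ).Rep _ (Pi.single k n.1) (Pi.single k u.1)) ?_
        · have h2 := TatePre.Rep.single (T := X.tatePre σ τ hσ hτ) k (n := n.1) (u := u.1) n.2 u.2
          rw [show Loc.of X.bb (X.c0 n) = (X.tatePre σ τ hσ hτ).c0 n.1 from (X.l0_eq n.2).symm,
            show Loc.of X.bb (X.c1 u) = (X.tatePre σ τ hσ hτ).c1 u.1 from (X.l1_eq u.2).symm]
          exact h2
        · rw [zpow_add_one, Units.val_mul, mul_assoc] at h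
          exact h
    have hw := Loc.exists_eq w
    induction hw using AddSubgroup.closure_induction with
    | mem x hx => obtain ⟨k, a, rfl⟩ := hx; exact key a k
    | zero => exact ⟨0, 0, TatePre.Rep.zero⟩
    | add x y _ _ hx hy =>
      obtain ⟨n, u, h⟩ := hx
      obtain ⟨n', u', h'⟩ := hy
      exact ⟨_, _, h.add h'⟩
    | neg x _ hx => obtain ⟨n, u, h⟩ := hx; exact ⟨_, _, h.neg⟩
  rep_zero n u h k := by
    obtain ⟨h0, h1, s, hs, hw⟩ := h
    obtain ⟨K, hK⟩ : ∃ K : ℕ, ∀ l ∈ insert k s, -(K : ℤ) ≤ l ∧ l < K := by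
      refine ⟨∑ l ∈ insert k s, (l.natAbs + 1), fun l hl => ?_⟩
      have := Finset.single_le_sum (f := fun k : ℤ => k.natAbs + 1) (fun _ _ => Nat.zero_le _) hl
      omega
    have hz : Loc.of X.bb (∑ i ∈ Finset.range (2 * K), X.bb ^ i *
        (X.c0 ⟨n ((i : ℤ) - K), h0 _⟩ + X.c1 ⟨u ((i : ℤ) - K), h1 _⟩)) = 0 := by
      have hsub : s ⊆ Finset.image (fun i : ℕ => (i : ℤ) - K) (Finset.range (2 * K)) := fun l hl => by
        have := hK l (Finset.mem_insert_of_mem hl)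
        exact Finset.mem_image.2 ⟨(l + K).toNat, by rw [Finset.mem_range]; omega, by omega⟩
      have h2 := TatePre.Rep.sum_eq (T := X.tatePre σ τ hσ hτ) hsub hs hw
      rw [Finset.sum_image (fun a _ b _ h => by
        have : (a : ℤ) - K = b - K := h
        omega)] at h2
      rw [map_sum]
      have h3 := congrArg (fun x => ((Loc.unit X.bb ^ (K : ℤ) : (Loc G.Coh X.bb)ˣ) : Loc G.Coh X.bb) * x) h2
      simp only [mul_zero, Finset.mul_sum] at h3
      rw [h3]
      refine Finset.sum_congr rfl fun i _ => ?_
      change _ = _ * (((Loc.unit X.bb ^ ((i : ℤ) - K) : (Loc G.Coh X.bb)ˣ) : Loc G.Coh X.bb) *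
        (X.l0 _ + X.l1 _))
      rw [← mul_assoc, ← Units.val_mul, ← zpow_add, add_sub_cancel, zpow_natCast, map_mul, map_pow,
        map_add, X.l0_eq (h0 _), X.l1_eq (h1 _), Units.val_pow_eq_pow_val]
      rfl
    obtain ⟨m, hm⟩ := Loc.of_eq_zero X.bb_comm hz
    obtain ⟨w', hw'⟩ := X.bb_pow_cancel m (w := 0) (hm.trans (by
      refine (map_zero X.c0).symm.trans (congrArg _ (Subtype.ext ?_))
      simp))
    have h4 := X.horner (2 * K) (fun i => ⟨n ((i : ℤ) - K), h0 _⟩)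
      (fun i => ⟨u ((i : ℤ) - K), h1 _⟩) w' hw' (k + K).toNat (by
        have := hK k (Finset.mem_insert_self _ _); omega)
    have h5 : (((k + K).toNat : ℕ) : ℤ) - K = k := by
      have := hK k (Finset.mem_insert_self _ _); omega
    simp only [h5] at h4
    exact h4

end PeriodicRes

namespace CoRes
variable {H : Type} [CommRing H] [Bialgebra F3 H] [HasXi H] {E : CoDer H}
  {N M : Type} [CommRing N] [Algebra F3 N] [ComodAlg H N] [CommRing M] [Algebra F3 M]
  [ComodAlg H M] (Y : CoRes E N M)

/-- The ring `b₁₀⁻¹ Ext_H(k, M)`, in terms of the derivation `δ` of `N`. -/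
def tate : TateRing N (BExt H M) :=
  Y.res.tate (BExt.sign H M)
    (DGRing.Coh.map (Cobar.signHom H M)
    (fun x hx => by
      change Cobar.d (Cobar.sign x) = 0
      have hx' : Cobar.d x = 0 := hx
      rw [Cobar.d_sign, hx']; simp)
    (fun x => ⟨- Cobar.sign x, by
      change Cobar.sign (Cobar.d x) = Cobar.d (- Cobar.sign x)
      rw [map_neg, Cobar.d_sign, neg_neg]⟩))
    (fun _ => Loc.map_of _ _ _) (fun _ _ _ => rfl)

theorem tate_c1_pair {m m' : M} (h : (ComodAlg.coact m : H ⊗[F3] M) = 1 ⊗ₜ m + HasXi.xi ⊗ₜ m')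
    (h' : (ComodAlg.coact m' : H ⊗[F3] M) = 1 ⊗ₜ m') (hd) : BExt.cls (Cobar.cons HasXi.xi (Cobar.ofN m) -
      Cobar.cons (HasXi.xi ^ 2) (Cobar.ofN m')) hd = Y.tate.c1 (Y.ev m) := by
  refine Eq.trans ?_ (Y.res.l1_eq (Y.ev_mem_Z1 h h')).symm
  exact congrArg (Loc.of _) (Y.cls_pair h h').symm

theorem tate_h : BExt.h10 H M = Y.tate.c1 1 := by
  have e := Y.tate_c1_pair (m := 1) (m' := 0) (by rw [map_one, TensorProduct.tmul_zero, add_zero]; rfl)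
    (by rw [map_zero, TensorProduct.tmul_zero]) (by
      rw [map_zero, map_zero, sub_zero]; exact Cobar.d_hCochain H M)
  rw [map_one Y.ev] at e
  rw [← e]
  exact BExt.cls_congr (by rw [map_zero, map_zero, sub_zero]; rfl) _ _

end CoRes

/-! ### The case of `D` -/

namespace DualD

theorem induct {p : DualD → Prop} (hC : ∀ r : F3, p (algebraMap F3 DualD r))
    (ha : ∀ x y, p x → p y → p (x + y)) (hx : ∀ x, p x → p (xi * x)) (x : DualD) : p x := by
  refine AdjoinRoot.induction_on (Polynomial.X ^ 3 : Polynomial F3) (C := p) x fun q => ?_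
  induction q using Polynomial.induction_on' with
  | add a b h h' => rw [map_add]; exact ha _ _ h h'
  | monomial n r =>
    induction n with
    | zero => exact hC r
    | succ n ih =>
      have := hx _ ih
      rw [← Polynomial.X_mul_monomial, map_mul]; exact this

theorem taylorHom_aux : (TrivSqZeroExt.inl xi + DualNumber.eps : DualNumber DualD) ^ 3 = 0 := by
  rw [cube_add, show (TrivSqZeroExt.inl xi : DualNumber DualD) ^ 3 = TrivSqZeroExt.inl (xi ^ 3) from
    (map_pow (TrivSqZeroExt.inlHom DualD DualD) xi 3).symm, xi_pow, pow_succ, pow_two,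
    DualNumber.eps_mul_eps, zero_mul, add_zero, TrivSqZeroExt.inl_zero]

/-- The map `D → D[ε]` with `ξ₁ ↦ ξ₁ + ε`. -/
def taylorHom : DualD →ₐ[F3] DualNumber DualD :=
  eval (TrivSqZeroExt.inl xi + DualNumber.eps) taylorHom_aux

theorem taylorHom_xi : taylorHom xi = TrivSqZeroExt.inl xi + DualNumber.eps := eval_xi _ _

theorem fst_taylorHom (x : DualD) : (taylorHom x).fst = x := by
  have : (TrivSqZeroExt.fstHom F3 DualD DualD).comp taylorHom = AlgHom.id F3 DualD := by
    refine hom_ext ?_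
    rw [AlgHom.comp_apply, taylorHom_xi]
    change (TrivSqZeroExt.inl xi + DualNumber.eps : DualNumber DualD).fst = xi
    rw [TrivSqZeroExt.fst_add, TrivSqZeroExt.fst_inl, DualNumber.fst_eps, add_zero]
  exact DFunLike.congr_fun this x

/-- The derivation `d/dξ₁` of `D`. -/
def pd : DualD →ₗ[F3] DualD :=
  (TrivSqZeroExt.sndHom DualD DualD).restrictScalars F3 ∘ₗ taylorHom.toLinearMap

theorem pd_mul (x y : DualD) : pd (x * y) = pd x * y + x * pd y := by
  refine (congrArg TrivSqZeroExt.snd (map_mul taylorHom x y)).trans ?_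
  rw [DualNumber.snd_mul, fst_taylorHom, fst_taylorHom, add_comm]
  rfl

theorem pd_xi : pd xi = 1 := by
  refine (congrArg TrivSqZeroExt.snd taylorHom_xi).trans ?_
  rw [TrivSqZeroExt.snd_add, TrivSqZeroExt.snd_inl, DualNumber.snd_eps, zero_add]

theorem pd_algebraMap (r : F3) : pd (algebraMap F3 DualD r) = 0 := by
  rw [Algebra.algebraMap_eq_smul_one, map_smul]
  have := pd_mul 1 1
  rw [mul_one, mul_one, one_mul, left_eq_add] at this
  rw [this, smul_zero]

theorem pd_comul (x : DualD) : Coalgebra.comul (R := F3) (pd x) =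
    pd.lTensor DualD (Coalgebra.comul (R := F3) x) := by
  have hm : ∀ S T : DualD ⊗[F3] DualD, pd.lTensor DualD (S * T) =
      pd.lTensor DualD S * T + S * pd.lTensor DualD T := fun S T => by
    induction S with
    | zero => simp
    | add a b ha hb => simp only [add_mul, map_add, ha, hb]; abel
    | tmul a b =>
      induction T with
      | zero => simp
      | add x y hx hy => simp only [mul_add, map_add, hx, hy]; abel
      | tmul x y =>
        simp [pd_mul, TensorProduct.tmul_add]
  have hx : Coalgebra.comul (R := F3) xi = xi ⊗ₜ[F3] 1 + 1 ⊗ₜ[F3] xi := HasXi.comul_xi (H := DualD)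
  have h1 : pd 1 = 0 := by simpa using pd_algebraMap 1
  induction x using induct with
  | hC r =>
    rw [pd_algebraMap, map_zero, Algebra.algebraMap_eq_smul_one, map_smul, Bialgebra.comul_one, map_smul,
      Algebra.TensorProduct.one_def, LinearMap.lTensor_tmul, h1]
    simp
  | ha x y h h' => simp only [map_add, h, h']
  | hx x h =>
    rw [pd_mul, pd_xi, one_mul, map_add, Bialgebra.comul_mul, Bialgebra.comul_mul, hm, h, hx, map_add,
      LinearMap.lTensor_tmul, LinearMap.lTensor_tmul, h1, pd_xi, TensorProduct.tmul_zero, zero_add,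
      ← Algebra.TensorProduct.one_def, one_mul]

theorem pd_three (x : DualD) : pd (pd (pd x)) = 0 := by
  have h1 : pd 1 = 0 := by simpa using pd_algebraMap 1
  induction x using induct with
  | hC r => simp [pd_algebraMap]
  | ha x y h h' => simp only [map_add, h, h', add_zero]
  | hx x h =>
    simp only [pd_mul, pd_xi, map_add, h, one_mul, mul_zero, add_zero]
    have := three_eq_zero DualD
    linear_combination (pd (pd x)) * this

/-- The derivation `d/dξ₁` of `D`. -/
def coDer : CoDer DualD where
  D := pd
  mul := pd_mul
  comul := pd_comul
  xi := pd_xi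
  three := pd_three

/-- The Taylor expansion of the elements of `D`. -/
theorem taylor (x : DualD) : x = algebraMap F3 DualD (Coalgebra.counit (R := F3) x) +
    Coalgebra.counit (R := F3) (pd x) • xi - Coalgebra.counit (R := F3) (pd (pd x)) • xi ^ 2 := by
  have h1 : pd 1 = 0 := by simpa using pd_algebraMap 1
  have h0 : Coalgebra.counit (R := F3) xi = 0 := counit_xi
  induction x using induct with
  | hC r =>
    simp [pd_algebraMap]
  | ha x y h h' =>
    nth_rewrite 1 [h, h']
    simp only [map_add, add_smul]; ring
  | hx x h =>
    nth_rewrite 1 [h]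
    simp only [pd_mul, pd_xi, one_mul, map_add, Bialgebra.counit_mul, h0, zero_mul, map_zero,
      add_zero, add_smul]
    have h3 := three_eq_zero DualD
    have h4 := xi_pow
    simp only [Algebra.smul_def]
    linear_combination (-algebraMap F3 DualD (Coalgebra.counit (R := F3) (pd (pd x)))) * h4 +
      (algebraMap F3 DualD (Coalgebra.counit (R := F3) (pd x)) * xi ^ 2) * h3

variable (N : Type) [CommRing N] [Algebra F3 N] [ComodAlg DualD N]

theorem coact_mem_ker (n : N) : coDer.par N (ComodAlg.coact n) = 0 := by
  rw [CoDer.par, LinearMap.sub_apply, CoDer.lTensor_δ_coact, sub_self]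

/-- A `D`-comodule algebra `N` is the kernel of `∂` on `D ⊗ N`. -/
def coRes : CoRes coDer N N where
  j := ComodAlg.coact
  inj x y h := by
    rw [← CoDer.counit_coact (H := DualD) x, h, CoDer.counit_coact]
  compat n := by
    have h := DFunLike.congr_fun (ComodAlg.coassoc (H := DualD) (N := N)) n
    simp only [AlgHom.comp_apply] at h
    exact h
  range x := by
    constructor
    · intro hx
      let ε : DualD ⊗[F3] N →ₗ[F3] N := (TensorProduct.lid F3 N).toLinearMap ∘ₗ
        (Coalgebra.counit (R := F3) (A := DualD)).rTensor N
      suffices h : ∀ y, coDer.par N y = 0 → ε y = 0 → y = 0 by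
        refine ⟨ε x, (sub_eq_zero.1 (h (x - ComodAlg.coact (ε x)) ?_ ?_)).symm⟩
        · rw [map_sub, hx, coact_mem_ker, sub_zero]
        · rw [map_sub, sub_eq_zero]
          exact (CoDer.counit_coact (ε x)).symm
      intro y hy hε
      have e1 : pd.rTensor N y = (coDer.δ N).lTensor DualD y := (sub_eq_zero.1 hy).symm
      have comm : ∀ z : DualD ⊗[F3] N, ε ((coDer.δ N).lTensor DualD z) = coDer.δ N (ε z) := fun z => by
        induction z with
        | zero => simp
        | add a b ha hb => simp only [map_add, ha, hb]
        | tmul a b => simp [ε]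
      have comm2 : ∀ z : DualD ⊗[F3] N, pd.rTensor N ((coDer.δ N).lTensor DualD z) =
          (coDer.δ N).lTensor DualD (pd.rTensor N z) := fun z => by
        induction z with
        | zero => simp
        | add a b ha hb => simp only [map_add, ha, hb]
        | tmul a b => simp
      have k1 : ε (pd.rTensor N y) = 0 := by rw [e1, comm, hε, map_zero]
      have k2 : ε (pd.rTensor N (pd.rTensor N y)) = 0 := by
        rw [e1, comm2, comm, e1, comm, hε, map_zero, map_zero]
      have t : ∀ z : DualD ⊗[F3] N, z = 1 ⊗ₜ ε z + xi ⊗ₜ ε (pd.rTensor N z) -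
          (xi ^ 2) ⊗ₜ ε (pd.rTensor N (pd.rTensor N z)) := fun z => by
        induction z with
        | zero => simp
        | add a b ha hb =>
          nth_rewrite 1 [ha, hb]
          simp only [map_add, TensorProduct.tmul_add]; abel
        | tmul a b =>
          nth_rewrite 1 [taylor a]
          simp only [ε, LinearMap.rTensor_tmul, LinearMap.comp_apply, LinearEquiv.coe_coe,
            TensorProduct.lid_tmul, TensorProduct.tmul_smul, TensorProduct.sub_tmul,
            TensorProduct.add_tmul, Algebra.algebraMap_eq_smul_one, TensorProduct.smul_tmul']
      rw [t y, hε, k1, k2]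
      simp
    · rintro ⟨n, rfl⟩
      exact coact_mem_ker N n

end DualD

/-! ### The case of `P` -/

namespace DualP

theorem induct {p : DualP → Prop} (hC : ∀ r : F3, p (algebraMap F3 DualP r))
    (ha : ∀ x y, p x → p y → p (x + y)) (hx : ∀ x n, p x → p (x * xi (n + 1))) (x : DualP) : p x :=
  MvPolynomial.induction_on (motive := p) x hC ha hx

/-- The derivation `∂/∂ξ₁` of `P`. -/
def pd : DualP →ₗ[F3] DualP := (MvPolynomial.pderiv (R := F3) (σ := ℕ) 0).toLinearMap

theorem pd_mul (x y : DualP) : pd (x * y) = pd x * y + x * pd y := by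
  exact ((MvPolynomial.pderiv (R := F3) (σ := ℕ) 0).leibniz x y).trans
    ((add_comm _ _).trans (congrArg₂ (· + ·) (mul_comm _ _) rfl))

theorem pd_xi (n : ℕ) : pd (xi (n + 1)) = if n = 0 then 1 else 0 := by
  refine (MvPolynomial.pderiv_X _ _).trans ?_
  simp only [Pi.single_apply]
  rfl

theorem pd_algebraMap (r : F3) : pd (algebraMap F3 DualP r) = 0 := by
  exact Derivation.map_algebraMap (MvPolynomial.pderiv (R := F3) (σ := ℕ) 0) r

theorem pd_one : pd 1 = 0 := by simpa using pd_algebraMap 1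

theorem pd_cube (x : DualP) : pd (x ^ 3) = 0 := by
  have h3 := three_eq_zero DualP
  rw [pow_succ, pow_two, pd_mul, pd_mul]
  linear_combination (x ^ 2 * pd x) * h3

theorem pd_comul (x : DualP) : Coalgebra.comul (R := F3) (pd x) =
    pd.lTensor DualP (Coalgebra.comul (R := F3) x) := by
  have hm : ∀ S T : DualP ⊗[F3] DualP, pd.lTensor DualP (S * T) =
      pd.lTensor DualP S * T + S * pd.lTensor DualP T := fun S T => by
    induction S with
    | zero => simp
    | add a b ha hb => simp only [add_mul, map_add, ha, hb]; abel
    | tmul a b =>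
      induction T with
      | zero => simp
      | add x y hx hy => simp only [mul_add, map_add, hx, hy]; abel
      | tmul x y => simp [pd_mul, TensorProduct.tmul_add]
  have hx : ∀ n, Coalgebra.comul (R := F3) (pd (xi (n + 1))) =
      pd.lTensor DualP (Coalgebra.comul (R := F3) (xi (n + 1))) := fun n => by
    rw [show Coalgebra.comul (R := F3) (xi (n + 1)) = _ from comul_xi (n + 1), map_sum,
      Finset.sum_range_succ', Finset.sum_eq_zero]
    · rw [LinearMap.lTensor_tmul, pow_zero, pow_one, Nat.sub_zero, zero_add, pd_xi, xi_zero]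
      split_ifs
      · exact Bialgebra.comul_one
      · simp
    · intro i _
      rw [LinearMap.lTensor_tmul, pow_succ, pow_mul, pd_cube, TensorProduct.tmul_zero]
  induction x using induct with
  | hC r =>
    rw [pd_algebraMap, map_zero, Algebra.algebraMap_eq_smul_one, map_smul, Bialgebra.comul_one, map_smul,
      Algebra.TensorProduct.one_def, LinearMap.lTensor_tmul, pd_one]
    simp
  | ha x y h h' => simp only [map_add, h, h']
  | hx x n h => rw [pd_mul, map_add, Bialgebra.comul_mul, Bialgebra.comul_mul, h, hx,
      Bialgebra.comul_mul, hm]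

theorem pd_three (x : DualP) : pd (pd (pd x)) = 0 := by
  have h1 : ∀ n, pd (pd (xi (n + 1))) = 0 := fun n => by
    rw [pd_xi]; split_ifs
    · exact pd_one
    · exact map_zero _
  induction x using induct with
  | hC r => simp [pd_algebraMap]
  | ha x y h h' => simp only [map_add, h, h', add_zero]
  | hx x n h =>
    simp only [pd_mul, map_add, h, h1, mul_zero, zero_mul, add_zero, zero_add]
    have := three_eq_zero DualP
    linear_combination (pd (pd x) * pd (xi (n + 1))) * this

/-- The derivation `∂/∂ξ₁` of `P`. -/
def coDer : CoDer DualP where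
  D := pd
  mul := pd_mul
  comul := pd_comul
  xi := (pd_xi 0).trans (if_pos rfl)
  three := pd_three

/-- A left convolution inverse of the identity of `P`, on the generators. -/
def antiL : ℕ → DualP
  | 0 => 1
  | n + 1 => -∑ i : Fin (n + 1), antiL i * xi (n + 1 - i) ^ 3 ^ (i : ℕ)

/-- A right convolution inverse of the identity of `P`, on the generators. -/
def antiR : ℕ → DualP
  | 0 => 1
  | n + 1 => -∑ i : Fin (n + 1), xi (n + 1 - i) * antiR i ^ 3 ^ (n + 1 - i : ℕ)

theorem antiL_zero : antiL 0 = 1 := by rw [antiL.eq_def]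
theorem antiL_succ (n : ℕ) : antiL (n + 1) =
    -∑ i : Fin (n + 1), antiL i * xi (n + 1 - i) ^ 3 ^ (i : ℕ) := by rw [antiL.eq_def]
theorem antiR_zero : antiR 0 = 1 := by rw [antiR.eq_def]
theorem antiR_succ (n : ℕ) : antiR (n + 1) =
    -∑ i : Fin (n + 1), xi (n + 1 - i) * antiR i ^ 3 ^ (n + 1 - i : ℕ) := by rw [antiR.eq_def]

theorem eval_eq {a : ℕ → DualP} (h0 : a 0 = 1) (n : ℕ) : eval (fun n => a (n + 1)) (xi n) = a n := by
  cases n with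
  | zero => rw [xi_zero, map_one, h0]
  | succ n => exact eval_xi _ _

theorem antiL_spec (x : DualP) : Algebra.TensorProduct.lift (eval fun n => antiL (n + 1))
    (AlgHom.id F3 DualP) (fun _ _ => Commute.all _ _) (Bialgebra.comulAlgHom F3 DualP x) =
    algebraMap F3 DualP (Coalgebra.counit (R := F3) x) := by
  have : (Algebra.TensorProduct.lift (eval fun n => antiL (n + 1))
      (AlgHom.id F3 DualP) (fun _ _ => Commute.all _ _)).comp (Bialgebra.comulAlgHom F3 DualP) =
      (Algebra.ofId F3 DualP).comp (Bialgebra.counitAlgHom F3 DualP) := by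
    refine hom_ext fun n => ?_
    rw [AlgHom.comp_apply, AlgHom.comp_apply, show Bialgebra.comulAlgHom F3 DualP (xi (n + 1)) = _
      from comul_xi (n + 1), show Bialgebra.counitAlgHom F3 DualP (xi (n + 1)) = _ from
      counit_xi (n + 1), if_neg (Nat.succ_ne_zero n), map_zero, map_sum, Finset.sum_range_succ]
    simp only [Algebra.TensorProduct.lift_tmul, eval_eq (a := antiL) antiL_zero, AlgHom.id_apply]
    rw [Nat.sub_self, xi_zero, one_pow, mul_one]
    rw [antiL_succ]
    rw [Finset.sum_range fun i => antiL i * xi (n + 1 - i) ^ 3 ^ i, add_neg_cancel]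
  exact DFunLike.congr_fun this x

theorem antiR_spec (x : DualP) : Algebra.TensorProduct.lift (AlgHom.id F3 DualP)
    (eval fun n => antiR (n + 1)) (fun _ _ => Commute.all _ _) (Bialgebra.comulAlgHom F3 DualP x) =
    algebraMap F3 DualP (Coalgebra.counit (R := F3) x) := by
  have : (Algebra.TensorProduct.lift (AlgHom.id F3 DualP)
      (eval fun n => antiR (n + 1)) (fun _ _ => Commute.all _ _)).comp (Bialgebra.comulAlgHom F3 DualP) =
      (Algebra.ofId F3 DualP).comp (Bialgebra.counitAlgHom F3 DualP) := by
    refine hom_ext fun n => ?_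
    rw [AlgHom.comp_apply, AlgHom.comp_apply, show Bialgebra.comulAlgHom F3 DualP (xi (n + 1)) = _
      from comul_xi (n + 1), show Bialgebra.counitAlgHom F3 DualP (xi (n + 1)) = _ from
      counit_xi (n + 1), if_neg (Nat.succ_ne_zero n), map_zero, map_sum, ← Finset.sum_range_reflect,
      Finset.sum_range_succ]
    simp only [Algebra.TensorProduct.lift_tmul, map_pow, eval_eq (a := antiR) antiR_zero, AlgHom.id_apply]
    rw [show n + 1 + 1 - 1 - (n + 1) = 0 by omega, pow_zero, pow_one, xi_zero, one_mul, Nat.sub_zero]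
    rw [antiR_succ]
    rw [Finset.sum_range fun i => xi (n + 1 + 1 - 1 - i) * antiR (n + 1 - (n + 1 + 1 - 1 - i)) ^
      3 ^ (n + 1 + 1 - 1 - i), ← sub_eq_add_neg, sub_eq_zero]
    refine Finset.sum_congr rfl fun i _ => ?_
    have := i.2
    rw [show n + 1 + 1 - 1 - (i : ℕ) = n + 1 - i by omega, show n + 1 - (n + 1 - (i : ℕ)) = i by omega]
  exact DFunLike.congr_fun this x

section untwist
variable (N : Type) [CommRing N] [Algebra F3 N] [ComodAlg DualP N]

/-- The map `p ⊗ n ↦ Σ p n' ⊗ n''`. -/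
def untwist : DualP ⊗[F3] N →ₐ[F3] DualP ⊗[F3] N :=
  Algebra.TensorProduct.lift Algebra.TensorProduct.includeLeft ComodAlg.coact
    (fun _ _ => Commute.all _ _)

/-- The map `p ⊗ n ↦ Σ p c(n') ⊗ n''`. -/
def twist (c : DualP →ₐ[F3] DualP) : DualP ⊗[F3] N →ₐ[F3] DualP ⊗[F3] N :=
  Algebra.TensorProduct.lift Algebra.TensorProduct.includeLeft
    ((Algebra.TensorProduct.map c (AlgHom.id F3 N)).comp ComodAlg.coact)
    (fun _ _ => Commute.all _ _)

variable {N}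

theorem untwist_tmul (p : DualP) (n : N) : untwist N (p ⊗ₜ n) = p ⊗ₜ 1 * ComodAlg.coact n :=
  Algebra.TensorProduct.lift_tmul _ _ _ _ _

theorem twist_tmul (c : DualP →ₐ[F3] DualP) (p : DualP) (n : N) : twist N c (p ⊗ₜ n) =
    p ⊗ₜ 1 * Algebra.TensorProduct.map c (AlgHom.id F3 N) (ComodAlg.coact n) :=
  Algebra.TensorProduct.lift_tmul _ _ _ _ _

theorem collapse_coact (F : DualP ⊗[F3] DualP →ₐ[F3] DualP)
    (hF : ∀ x, F (Bialgebra.comulAlgHom F3 DualP x) =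
      algebraMap F3 DualP (Coalgebra.counit (R := F3) x)) (n : N) :
    Algebra.TensorProduct.map F (AlgHom.id F3 N) ((Algebra.TensorProduct.assoc F3 F3 F3 DualP DualP N).symm
      (Algebra.TensorProduct.map (AlgHom.id F3 DualP) (ComodAlg.coact (H := DualP) (N := N))
        (ComodAlg.coact n))) = 1 ⊗ₜ n := by
  have h := DFunLike.congr_fun (ComodAlg.coassoc (H := DualP) (N := N)) n
  simp only [AlgHom.comp_apply] at h
  rw [← h]
  have h2 : ∀ T : DualP ⊗[F3] N, Algebra.TensorProduct.map F (AlgHom.id F3 N)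
      ((Algebra.TensorProduct.assoc F3 F3 F3 DualP DualP N).symm
      ((Algebra.TensorProduct.assoc F3 F3 F3 DualP DualP N).toAlgHom
      (Algebra.TensorProduct.map (Bialgebra.comulAlgHom F3 DualP) (AlgHom.id F3 N) T))) =
      1 ⊗ₜ TensorProduct.lid F3 N ((Coalgebra.counit (R := F3) (A := DualP)).rTensor N T) := fun T => by
    induction T with
    | zero => simp
    | add a b ha hb => simp only [map_add, ha, hb, TensorProduct.tmul_add]
    | tmul a b =>
      rw [Algebra.TensorProduct.map_tmul]
      refine (congrArg _ (AlgEquiv.symm_apply_apply _ _)).trans ?_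
      rw [Algebra.TensorProduct.map_tmul, hF, Algebra.algebraMap_eq_smul_one,
        ← TensorProduct.smul_tmul', LinearMap.rTensor_tmul, TensorProduct.lid_tmul, TensorProduct.tmul_smul]
      rfl
  rw [h2, CoDer.counit_coact]

theorem untwist_bijective : Function.Bijective (untwist N) := by
  have e1 : (twist N (eval fun n => antiR (n + 1))).comp (untwist N) = AlgHom.id F3 _ := by
    refine Algebra.TensorProduct.ext' fun p n => ?_
    rw [AlgHom.comp_apply, untwist_tmul, map_mul, twist_tmul, map_one, map_one, mul_one,
      AlgHom.id_apply]
    have h := collapse_coact _ antiR_spec n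
    have h2 : ∀ T : DualP ⊗[F3] N, twist N (eval fun n => antiR (n + 1)) T =
        Algebra.TensorProduct.map (Algebra.TensorProduct.lift (AlgHom.id F3 DualP)
          (eval fun n => antiR (n + 1)) (fun _ _ => Commute.all _ _)) (AlgHom.id F3 N)
          ((Algebra.TensorProduct.assoc F3 F3 F3 DualP DualP N).symm
      (Algebra.TensorProduct.map (AlgHom.id F3 DualP) (ComodAlg.coact (H := DualP) (N := N)) T)) :=
      fun T => by
        induction T with
        | zero => simp
        | add a b ha hb => simp only [map_add, ha, hb]
        | tmul a b =>
          rw [twist_tmul, Algebra.TensorProduct.map_tmul]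
          induction (ComodAlg.coact b : DualP ⊗[F3] N) with
          | zero => simp
          | add x y hx hy => simp only [map_add, mul_add, TensorProduct.tmul_add, hx, hy]
          | tmul x y => simp
    rw [h2, h]; simp
  have e2 : (untwist N).comp (twist N (eval fun n => antiL (n + 1))) = AlgHom.id F3 _ := by
    refine Algebra.TensorProduct.ext' fun p n => ?_
    rw [AlgHom.comp_apply, twist_tmul, map_mul, untwist_tmul, map_one, mul_one,
      AlgHom.id_apply]
    have h := collapse_coact _ antiL_spec n
    have h2 : ∀ T : DualP ⊗[F3] N, untwist N (Algebra.TensorProduct.map (eval fun n => antiL (n + 1))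
          (AlgHom.id F3 N) T) =
        Algebra.TensorProduct.map (Algebra.TensorProduct.lift (eval fun n => antiL (n + 1))
          (AlgHom.id F3 DualP) (fun _ _ => Commute.all _ _)) (AlgHom.id F3 N)
          ((Algebra.TensorProduct.assoc F3 F3 F3 DualP DualP N).symm
      (Algebra.TensorProduct.map (AlgHom.id F3 DualP) (ComodAlg.coact (H := DualP) (N := N)) T)) :=
      fun T => by
        induction T with
        | zero => simp
        | add a b ha hb => simp only [map_add, ha, hb]
        | tmul a b =>
          rw [Algebra.TensorProduct.map_tmul, untwist_tmul, Algebra.TensorProduct.map_tmul,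
            AlgHom.id_apply, AlgHom.id_apply]
          induction (ComodAlg.coact b : DualP ⊗[F3] N) with
          | zero => simp
          | add x y hx hy => simp only [map_add, mul_add, TensorProduct.tmul_add, hx, hy]
          | tmul x y => simp
    rw [h2, h]; simp
  exact ⟨fun x y h => by
    have := congrArg (twist N (eval fun n => antiR (n + 1))) h
    have h1 := fun z => DFunLike.congr_fun e1 z
    simp only [AlgHom.comp_apply, AlgHom.id_apply] at h1
    rwa [h1, h1] at this, fun x => ⟨_, DFunLike.congr_fun e2 x⟩⟩

/-- Under `untwist`, the derivation `∂` becomes `-∂/∂ξ₁` on the left factor: this identifies its kernel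
with a tensor product of `B`. -/
theorem par_untwist (x : DualP ⊗[F3] N) :
    coDer.par N (untwist N x) = -untwist N (pd.rTensor N x) := by
  induction x with
  | zero => simp
  | add a b ha hb => simp only [map_add, ha, hb]; abel
  | tmul p n =>
    rw [untwist_tmul, CoDer.par_mul, CoDer.par_tmul, CoDer.δ_one]
    have h : coDer.par N (ComodAlg.coact n) = 0 := by
      rw [CoDer.par, LinearMap.sub_apply, CoDer.lTensor_δ_coact, sub_self]
    rw [h, LinearMap.rTensor_tmul, untwist_tmul, TensorProduct.tmul_zero, mul_zero, add_zero, zero_sub,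
      neg_mul]
    rfl

end untwist
end DualP

/-! ### The algebra `B` -/

namespace BB

/-- The generators `ξ₁³, ξ₂, ξ₃, …` of `B`. -/
def gen : ℕ → BB
  | 0 => xiCube 0
  | n + 1 => xi n

/-- The map from the polynomial algebra to `B`. -/
def pres : MvPolynomial ℕ F3 →ₐ[F3] BB := MvPolynomial.aeval gen

theorem pres_X (n : ℕ) : pres (MvPolynomial.X n) = gen n := MvPolynomial.aeval_X _ _

theorem pd_pres (q : MvPolynomial ℕ F3) : DualP.pd (pres q : BB) = 0 := by
  induction q using MvPolynomial.induction_on with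
  | C r =>
    rw [← MvPolynomial.algebraMap_eq, AlgHom.commutes]
    exact DualP.pd_algebraMap r
  | add p q hp hq =>
    rw [map_add]
    exact (map_add DualP.pd _ _).trans (by rw [hp, hq, add_zero])
  | mul_X p n hp =>
    rw [map_mul, pres_X]
    refine (DualP.pd_mul _ _).trans ?_
    have h : DualP.pd (gen n : BB) = 0 := by
      cases n with
      | zero => exact DualP.pd_cube _
      | succ n => exact (DualP.pd_xi (n + 1)).trans (if_neg (Nat.succ_ne_zero n))
    rw [hp, h]; simp

/-- `P` is generated by `1, ξ₁, ξ₁²` over the subalgebra of the generators of `B`. -/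
theorem exists_expansion (x : DualP) : ∃ q₀ q₁ q₂ : MvPolynomial ℕ F3,
    x = (pres q₀ : BB) + DualP.xi 1 * (pres q₁ : BB) + DualP.xi 1 ^ 2 * (pres q₂ : BB) := by
  have hX : ∀ (q : MvPolynomial ℕ F3) n,
      ((pres (q * MvPolynomial.X n) : BB) : DualP) = (pres q : BB) * (gen n : BB) := fun q n =>
    congrArg Subtype.val ((map_mul pres _ _).trans (congrArg _ (pres_X n)))
  have hadd : ∀ q q' : MvPolynomial ℕ F3, ((pres (q + q') : BB) : DualP) =
      (pres q : BB) + (pres q' : BB) := fun q q' => congrArg Subtype.val (map_add pres q q')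
  induction x using DualP.induct with
  | hC r =>
    refine ⟨MvPolynomial.C r, 0, 0, ?_⟩
    rw [← MvPolynomial.algebraMap_eq, AlgHom.commutes, map_zero, ZeroMemClass.coe_zero, mul_zero,
      mul_zero, add_zero, add_zero]
    rfl
  | ha x y hx hy =>
    obtain ⟨a, b, c, hx⟩ := hx
    obtain ⟨a', b', c', hy⟩ := hy
    refine ⟨a + a', b + b', c + c', ?_⟩
    rw [hx, hy, hadd, hadd, hadd]
    ring
  | hx x n hx =>
    obtain ⟨a, b, c, hx⟩ := hx
    cases n with
    | zero =>
      refine ⟨c * MvPolynomial.X 0, a, b, ?_⟩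
      rw [hX, hx, show ((gen 0 : BB) : DualP) = DualP.xi 1 ^ 3 from rfl, zero_add]
      ring
    | succ n =>
      refine ⟨a * MvPolynomial.X (n + 1), b * MvPolynomial.X (n + 1), c * MvPolynomial.X (n + 1), ?_⟩
      rw [hX, hX, hX, hx, show ((gen (n + 1) : BB) : DualP) = DualP.xi (n + 1 + 1) from rfl]
      ring

/-- Comparing coefficients of `ξ₁`, the kernel of `∂/∂ξ₁` on `P` is the algebra generated by `ξ₁³, ξ₂, ξ₃, …`. -/
theorem exists_pres_of_pd {x : DualP} (h : DualP.pd x = 0) : ∃ q, ((pres q : BB) : DualP) = x := by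
  obtain ⟨a, b, c, rfl⟩ := exists_expansion x
  have h3 := three_eq_zero DualP
  have hxi : DualP.pd (DualP.xi 1) = 1 := (DualP.pd_xi 0).trans (if_pos rfl)
  have h1 : ((pres b : BB) : DualP) + 2 * DualP.xi 1 * (pres c : BB) = 0 := by
    rw [← h]
    simp only [map_add, DualP.pd_mul, pow_two, pd_pres, hxi]
    ring
  have h2 : ((pres c : BB) : DualP) = 0 := by
    have := congrArg DualP.pd h1
    have h2 : DualP.pd 2 = 0 := by
      rw [show (2 : DualP) = 1 + 1 by norm_num, map_add, DualP.pd_one, add_zero]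
    simp only [map_add, DualP.pd_mul, pd_pres, hxi, map_zero, h2] at this
    linear_combination ((pres c : BB) : DualP) * h3 - this
  rw [h2, mul_zero, add_zero] at h1
  exact ⟨a, by rw [h1, h2]; ring⟩

theorem toDAlg_pd (x : DualP) : DualP.toDAlg (DualP.pd x) = DualD.pd (DualP.toDAlg x) := by
  have hx : ∀ n, DualP.toDAlg (DualP.pd (DualP.xi (n + 1))) =
      DualD.pd (DualP.toDAlg (DualP.xi (n + 1))) := fun n => by
    have h1 : DualD.pd 1 = 0 := by simpa using DualD.pd_algebraMap 1
    rw [DualP.pd_xi, DualP.toDAlg_xi, if_neg (Nat.succ_ne_zero n)]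
    by_cases h : n = 0
    · rw [if_pos h, if_pos (by omega), map_one, DualD.pd_xi]
    · rw [if_neg h, if_neg (by omega), map_zero, map_zero]
  induction x using DualP.induct with
  | hC r => rw [DualP.pd_algebraMap, AlgHom.commutes, DualD.pd_algebraMap, map_zero]
  | ha x y h h' => rw [map_add, map_add, map_add, map_add, h, h']
  | hx x n h => rw [DualP.pd_mul, map_add, map_mul, map_mul, map_mul, DualD.pd_mul, h, hx]

/-- The elements of `B`, defined by a coaction of `D`, are killed by `∂/∂ξ₁`. -/
theorem pd_coe (x : BB) : DualP.pd (x : DualP) = 0 := by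
  have hx : Algebra.TensorProduct.map (AlgHom.id F3 DualP) DualP.toDAlg
      (Bialgebra.comulAlgHom F3 DualP (x : DualP)) = (x : DualP) ⊗ₜ 1 := x.2
  have h := congrArg (DualD.pd.lTensor DualP) hx
  have h1 : DualD.pd 1 = 0 := by simpa using DualD.pd_algebraMap 1
  rw [LinearMap.lTensor_tmul, h1, TensorProduct.tmul_zero] at h
  have key : ∀ T : DualP ⊗[F3] DualP, TensorProduct.rid F3 DualP
      ((Coalgebra.counit (R := F3) (A := DualD)).lTensor DualP (DualD.pd.lTensor DualP
        (Algebra.TensorProduct.map (AlgHom.id F3 DualP) DualP.toDAlg T))) =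
      TensorProduct.rid F3 DualP ((Coalgebra.counit (R := F3) (A := DualP)).lTensor DualP
        (DualP.pd.lTensor DualP T)) := fun T => by
    induction T with
    | zero => simp
    | add a b ha hb => simp only [map_add, ha, hb]
    | tmul a b =>
      simp only [Algebra.TensorProduct.map_tmul, LinearMap.lTensor_tmul, TensorProduct.rid_tmul,
        ← toDAlg_pd, AlgHom.id_apply]
      congr 1
      exact DFunLike.congr_fun DualP.counit_toDAlg (DualP.pd b)
  have h2 := (key (Bialgebra.comulAlgHom F3 DualP (x : DualP))).symm
  rw [h, map_zero, map_zero] at h2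
  have h3 : DualP.pd.lTensor DualP (Bialgebra.comulAlgHom F3 DualP (x : DualP)) =
    Coalgebra.comul (R := F3) (DualP.pd (x : DualP)) := (DualP.pd_comul _).symm
  rw [h3, Coalgebra.lTensor_counit_comul] at h2
  simpa using h2

theorem pres_surjective : Function.Surjective pres := fun x => by
  obtain ⟨q, hq⟩ := exists_pres_of_pd (pd_coe x)
  exact ⟨q, Subtype.ext hq⟩

theorem exact_pd : Function.Exact (Cotensor.coinv DualP.toD).val.toLinearMap DualP.pd := fun x => by
  constructor
  · intro h
    obtain ⟨q, hq⟩ := exists_pres_of_pd h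
    exact ⟨pres q, hq⟩
  · rintro ⟨y, rfl⟩
    exact pd_coe y

theorem pres_injective : Function.Injective pres := by
  classical
  let f : ℕ → MvPolynomial ℕ F3 := fun n => Polynomial.aeval (MvPolynomial.X n : MvPolynomial ℕ F3)
    (if n = 0 then (Polynomial.X ^ 3 : Polynomial F3) else Polynomial.X)
  have h1 : AlgebraicIndependent F3 f := by
    refine AlgebraicIndependent.polynomial_aeval_of_transcendental
      (MvPolynomial.algebraicIndependent_X ℕ F3) (fun n => ?_)
    split_ifs
    · exact (Polynomial.transcendental_X F3).pow (by norm_num)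
    · exact Polynomial.transcendental_X F3
  let v : BB →ₐ[F3] MvPolynomial ℕ F3 := (Cotensor.coinv DualP.toD).val
  have h2 : v.comp pres = MvPolynomial.aeval f := by
    refine MvPolynomial.algHom_ext fun n => ?_
    rw [AlgHom.comp_apply, pres_X, MvPolynomial.aeval_X]
    cases n with
    | zero =>
      simp only [f, if_pos, map_pow, Polynomial.aeval_X]
      rfl
    | succ n =>
      simp only [f, if_neg (Nat.succ_ne_zero n), Polynomial.aeval_X]
      rfl
  refine Function.Injective.of_comp (f := v) ?_
  rw [← AlgHom.coe_comp, h2]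
  exact h1

/-- `B` is a polynomial algebra. -/
def polyEquiv : MvPolynomial ℕ F3 ≃ₐ[F3] BB :=
  AlgEquiv.ofBijective pres ⟨pres_injective, pres_surjective⟩

theorem polyEquiv_X (n : ℕ) : polyEquiv (MvPolynomial.X n) = gen n := pres_X n

end BB

/-! ### The tensor powers of `B` -/

namespace TPow

theorem coact_incl {n : ℕ} (i : Fin n) (x : BB) :
    (ComodAlg.coact (incl i x) : DualP ⊗[F3] TPow BB n) =
      Algebra.TensorProduct.map (AlgHom.id F3 DualP) (incl i) (Cotensor.coact DualP.toD x) :=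
  lift_incl _ _ _

section split
variable {N : Type} [CommRing N] [Algebra F3 N]

/-- The map `N^{⊗(n+1)} → N ⊗ N^{⊗ n}` that splits off the first factor. -/
def split (n : ℕ) : TPow N (n + 1) →ₐ[F3] N ⊗[F3] TPow N n :=
  lift (Fin.cons Algebra.TensorProduct.includeLeft
    fun i => Algebra.TensorProduct.includeRight.comp (incl i))

theorem split_zero {n : ℕ} (x : N) : split (N := N) n (incl 0 x) = x ⊗ₜ 1 := lift_incl _ _ _
theorem split_succ {n : ℕ} (i : Fin n) (x : N) : split (N := N) n (incl i.succ x) = 1 ⊗ₜ incl i x :=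
  lift_incl _ _ _

theorem split_bijective (n : ℕ) : Function.Bijective (split (N := N) n) := by
  let g : N ⊗[F3] TPow N n →ₐ[F3] TPow N (n + 1) :=
    Algebra.TensorProduct.lift (incl 0) (map Fin.succ) (fun _ _ => Commute.all _ _)
  have hm : ∀ (i : Fin n) x, map (N := N) Fin.succ (incl i x) = incl i.succ x :=
    fun i x => lift_incl _ _ _
  have e1 : g.comp (split (N := N) n) = AlgHom.id F3 _ := hom_ext fun i x => by
    refine Fin.cases ?_ (fun i => ?_) i
    · rw [AlgHom.comp_apply, split_zero]
      refine (Algebra.TensorProduct.lift_tmul _ _ _ _ _).trans ?_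
      rw [map_one, mul_one]; rfl
    · rw [AlgHom.comp_apply, split_succ]
      refine (Algebra.TensorProduct.lift_tmul _ _ _ _ _).trans ?_
      rw [map_one, one_mul]; exact hm _ _
  have e2 : (split (N := N) n).comp g = AlgHom.id F3 _ := by
    refine Algebra.TensorProduct.ext ?_ ?_
    · refine AlgHom.ext fun x => ?_
      change split (N := N) n (g (x ⊗ₜ 1)) = x ⊗ₜ 1
      rw [show g (x ⊗ₜ 1) = incl 0 x * map Fin.succ 1 from Algebra.TensorProduct.lift_tmul _ _ _ _ _,
        map_one, mul_one, split_zero]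
    · refine hom_ext fun i x => ?_
      change split (N := N) n (g (1 ⊗ₜ incl i x)) = 1 ⊗ₜ incl i x
      rw [show g (1 ⊗ₜ incl i x) = incl 0 1 * map Fin.succ (incl i x) from
        Algebra.TensorProduct.lift_tmul _ _ _ _ _, map_one, one_mul, hm, split_succ]
  exact ⟨Function.LeftInverse.injective (g := g) fun x => DFunLike.congr_fun e1 x,
    Function.RightInverse.surjective (g := g) fun x => DFunLike.congr_fun e2 x⟩

end split

/-- The embedding of `B^{⊗(n+1)}` into the coinduced comodule algebra `P ⊗ B^{⊗ n}`. -/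
def coind (n : ℕ) : TPow BB (n + 1) →ₐ[F3] DualP ⊗[F3] TPow BB n :=
  (DualP.untwist (TPow BB n)).comp ((Algebra.TensorProduct.map (Cotensor.coinv DualP.toD).val
    (AlgHom.id F3 (TPow BB n))).comp (split n))

theorem coind_zero {n : ℕ} (x : BB) : coind n (incl 0 x) = (x : DualP) ⊗ₜ 1 := by
  rw [coind, AlgHom.comp_apply, AlgHom.comp_apply, split_zero, Algebra.TensorProduct.map_tmul,
    map_one, DualP.untwist_tmul, map_one, mul_one]
  rfl

theorem coind_succ {n : ℕ} (i : Fin n) (x : BB) : coind n (incl i.succ x) =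
    ComodAlg.coact (incl i x) := by
  rw [coind, AlgHom.comp_apply, AlgHom.comp_apply, split_succ, Algebra.TensorProduct.map_tmul,
    map_one, DualP.untwist_tmul, ← Algebra.TensorProduct.one_def, one_mul]
  rfl

theorem map_id_map {H A B C : Type} [CommRing H] [Algebra F3 H] [CommRing A] [Algebra F3 A]
    [CommRing B] [Algebra F3 B] [CommRing C] [Algebra F3 C] (f : A →ₐ[F3] B) (g : B →ₐ[F3] C)
    (T : H ⊗[F3] A) : Algebra.TensorProduct.map (AlgHom.id F3 H) g
      (Algebra.TensorProduct.map (AlgHom.id F3 H) f T) =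
    Algebra.TensorProduct.map (AlgHom.id F3 H) (g.comp f) T := by
  induction T with
  | zero => simp only [map_zero]
  | add a b ha hb => simp only [map_add, ha, hb]
  | tmul a b => rfl

theorem assoc_map_one {H A B C : Type} [CommRing H] [Algebra F3 H] [CommRing A] [Algebra F3 A]
    [CommRing B] [Algebra F3 B] [CommRing C] [Algebra F3 C] (f : A →ₐ[F3] B) (T : H ⊗[F3] A) :
    Algebra.TensorProduct.assoc F3 F3 F3 H B C
      (Algebra.TensorProduct.map (AlgHom.id F3 H) f T ⊗ₜ 1) =
    Algebra.TensorProduct.map (AlgHom.id F3 H)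
      ((Algebra.TensorProduct.includeLeft : B →ₐ[F3] B ⊗[F3] C).comp f) T := by
  induction T with
  | zero => simp only [map_zero, TensorProduct.zero_tmul]
  | add a b ha hb => simp only [map_add, TensorProduct.add_tmul, ha, hb]
  | tmul a b => rfl

theorem coind_compat (n : ℕ) : Cobar.Compat (BialgHom.id F3 DualP) (coind n) := by
  intro x
  let L : TPow BB (n + 1) →ₐ[F3] DualP ⊗[F3] (DualP ⊗[F3] TPow BB n) :=
    (ComodAlg.coact (H := DualP)).comp (coind n)
  let R : TPow BB (n + 1) →ₐ[F3] DualP ⊗[F3] (DualP ⊗[F3] TPow BB n) :=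
    (Algebra.TensorProduct.map (AlgHom.id F3 DualP) (coind n)).comp (ComodAlg.coact (H := DualP))
  refine DFunLike.congr_fun (show L = R from hom_ext fun i y => ?_) x
  refine Fin.cases ?_ (fun i => ?_) i
  · change ComodAlg.coact (coind n (incl 0 y)) = Algebra.TensorProduct.map (AlgHom.id F3 DualP)
      (coind n) (ComodAlg.coact (incl 0 y))
    have e : (Algebra.TensorProduct.includeLeft : DualP →ₐ[F3] DualP ⊗[F3] TPow BB n).comp
        (Cotensor.coinv DualP.toD).val = (coind n).comp (incl 0) :=
      AlgHom.ext fun z => (coind_zero z).symm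
    rw [coact_incl, coind_zero, ComodAlg.coind_coact, map_id_map, ← e, ← assoc_map_one]
    exact congrArg (fun z => Algebra.TensorProduct.assoc F3 F3 F3 DualP DualP (TPow BB n) (z ⊗ₜ 1))
      (Cotensor.incl_coact DualP.toD y).symm
  · change ComodAlg.coact (coind n (incl i.succ y)) = Algebra.TensorProduct.map (AlgHom.id F3 DualP)
      (coind n) (ComodAlg.coact (incl i.succ y))
    rw [coind_succ]
    have h := DFunLike.congr_fun (ComodAlg.coassoc (H := DualP) (N := TPow BB n)) (incl i y)
    have e : (ComodAlg.coact (H := DualP) (N := TPow BB n)).comp (incl i) =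
        (coind n).comp (incl i.succ) := AlgHom.ext fun z => (coind_succ i z).symm
    refine h.trans ?_
    rw [AlgHom.comp_apply, coact_incl, coact_incl, map_id_map, map_id_map, e]

/-- `B^{⊗(n+1)}` is the kernel of `∂` on `P ⊗ B^{⊗ n}`. -/
def coRes (n : ℕ) : CoRes DualP.coDer (TPow BB n) (TPow BB (n + 1)) where
  j := coind n
  inj := by
    refine (DualP.untwist_bijective (N := TPow BB n)).1.comp (Function.Injective.comp
      (g := Algebra.TensorProduct.map (Cotensor.coinv DualP.toD).val
        (AlgHom.id F3 (TPow BB n))) ?_ (split_bijective n).1)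
    exact Module.Flat.rTensor_preserves_injective_linearMap (M := TPow BB n)
      (Cotensor.coinv DualP.toD).val.toLinearMap Subtype.val_injective
  compat := coind_compat n
  range x := by
    obtain ⟨y, rfl⟩ := (DualP.untwist_bijective (N := TPow BB n)).2 x
    rw [DualP.par_untwist, neg_eq_zero, map_eq_zero_iff _ (DualP.untwist_bijective (N := TPow BB n)).1]
    refine (Module.Flat.rTensor_exact (TPow BB n) BB.exact_pd y).trans ?_
    constructor
    · rintro ⟨z, rfl⟩
      obtain ⟨m, rfl⟩ := (split_bijective n).2 z
      exact ⟨m, rfl⟩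
    · rintro ⟨m, hm⟩
      exact ⟨split (N := BB) n m, (DualP.untwist_bijective (N := TPow BB n)).1 hm⟩

theorem ev_zero {n : ℕ} (x : BB) : (coRes n).ev (incl 0 x) =
    algebraMap F3 _ (Coalgebra.counit (R := F3) (x : DualP)) := by
  rw [CoRes.ev_apply]
  refine (congrArg _ (congrArg _ (coind_zero x))).trans ?_
  rw [LinearMap.rTensor_tmul, TensorProduct.lid_tmul, Algebra.algebraMap_eq_smul_one]

theorem ev_succ {n : ℕ} (i : Fin n) (x : BB) : (coRes n).ev (incl i.succ x) = incl i x := by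
  rw [CoRes.ev_apply]
  refine (congrArg _ (congrArg _ (coind_succ i x))).trans ?_
  exact CoDer.counit_coact _

end TPow

theorem DualD.ev_coRes (x : BB) : (DualD.coRes BB).ev x = x := by
  rw [CoRes.ev_apply]
  exact CoDer.counit_coact _

/-! ### The derivation on the generators -/

namespace BB

theorem δ_D_xi (n : ℕ) : DualD.coDer.δ BB (xi n) = xiCube n := by
  rw [CoDer.δ_apply, coact_xi, map_add, map_add, LinearMap.rTensor_tmul, LinearMap.rTensor_tmul,
    TensorProduct.lid_tmul, TensorProduct.lid_tmul]
  have h1 : DualD.coDer.χ 1 = 0 := by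
    rw [CoDer.χ, LinearMap.comp_apply, CoDer.D_one, map_zero]
  have h2 : DualD.coDer.χ DualD.xi = 1 := by
    refine (congrArg (Coalgebra.counit (R := F3)) DualD.coDer.xi).trans ?_
    exact Bialgebra.counit_one
  rw [h1, h2, zero_smul, one_smul, zero_add]

theorem δ_D_xiCube (n : ℕ) : DualD.coDer.δ BB (xiCube n) = 0 := by
  rw [CoDer.δ_apply, coact_xiCube, LinearMap.rTensor_tmul, TensorProduct.lid_tmul]
  have h1 : DualD.coDer.χ 1 = 0 := by
    rw [CoDer.χ, LinearMap.comp_apply, CoDer.D_one, map_zero]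
  rw [h1, zero_smul]

/-- The derivations of `B` as a `P`-comodule and as a `D`-comodule agree. -/
theorem δ_P (x : BB) : DualP.coDer.δ BB x = DualD.coDer.δ BB x := by
  rw [CoDer.δ_apply, CoDer.δ_apply]
  change _ = TensorProduct.lid F3 BB (DualD.coDer.χ.rTensor BB
    (Algebra.TensorProduct.map DualP.toDAlg (AlgHom.id F3 BB) (ComodAlg.coact (H := DualP) x)))
  induction (ComodAlg.coact x : DualP ⊗[F3] BB) with
  | zero => simp
  | add a b ha hb => simp only [map_add, ha, hb]
  | tmul a b =>
    rw [Algebra.TensorProduct.map_tmul, LinearMap.rTensor_tmul, LinearMap.rTensor_tmul]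
    have h : DualP.coDer.χ a = DualD.coDer.χ (DualP.toDAlg a) := by
      change _ = Coalgebra.counit (R := F3) (DualD.pd (DualP.toDAlg a))
      rw [← toDAlg_pd]
      exact (DFunLike.congr_fun DualP.counit_toDAlg (DualP.pd a)).symm
    rw [h]
    rfl

theorem δ_incl {n : ℕ} (i : Fin n) (x : BB) : DualP.coDer.δ (TPow BB n) (TPow.incl i x) =
    TPow.incl i (DualD.coDer.δ BB x) := by
  rw [← δ_P, CoDer.δ_apply, CoDer.δ_apply, TPow.coact_incl]
  change _ = TPow.incl i (TensorProduct.lid F3 BB (DualP.coDer.χ.rTensor BB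
    (Cotensor.coact DualP.toD x)))
  induction (Cotensor.coact DualP.toD x) with
  | zero => simp
  | add a b ha hb => simp only [map_add, ha, hb]
  | tmul a b => simp

end BB

/-! ### Homology of `δ` and `δ²` when one pair of variables is added -/

/-- Subgroups `V ≤ U` of a ring with a derivation `δ`, and elements `x = δ y`, such that
`U = V ⊕ xU` and the sum `U + Uy + Uy²` is direct. -/
structure PairLayer {N : Type} [CommRing N] (δ : N →+ N) (x y : N) (V U : AddSubgroup N) : Prop where
  δ_mul : ∀ m n, δ (m * n) = δ m * n + m * δ n
  three : (3 : N) = 0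
  δ_y : δ y = x
  δ_x : δ x = 0
  le : V ≤ U
  δ_V : ∀ n ∈ V, δ n ∈ V
  δ_U : ∀ n ∈ U, δ n ∈ U
  x_U : ∀ n ∈ U, n * x ∈ U
  split : ∀ n ∈ U, ∃ v ∈ V, ∃ u ∈ U, n = v + u * x
  indep₂ : ∀ v ∈ V, ∀ u ∈ U, v + u * x = 0 → v = 0 ∧ u = 0
  indep₃ : ∀ α ∈ U, ∀ β ∈ U, ∀ γ ∈ U, α + β * y + γ * y ^ 2 = 0 → α = 0 ∧ β = 0 ∧ γ = 0

namespace PairLayer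
variable {N : Type} [CommRing N] {δ : N →+ N} {x y : N} {V U : AddSubgroup N}
  (L : PairLayer δ x y V U)
include L

theorem eq₂ {v v' u u' : N} (hv : v ∈ V) (hu : u ∈ U) (hv' : v' ∈ V) (hu' : u' ∈ U)
    (h : v + u * x = v' + u' * x) : v = v' ∧ u = u' := by
  have := L.indep₂ _ (V.sub_mem hv hv') _ (U.sub_mem hu hu') (by linear_combination h)
  exact ⟨sub_eq_zero.1 this.1, sub_eq_zero.1 this.2⟩

theorem eq₃ {α β γ α' β' γ' : N} (h1 : α ∈ U) (h2 : β ∈ U) (h3 : γ ∈ U) (h1' : α' ∈ U) (h2' : β' ∈ U)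
    (h3' : γ' ∈ U) (h : α + β * y + γ * y ^ 2 = α' + β' * y + γ' * y ^ 2) :
    α = α' ∧ β = β' ∧ γ = γ' := by
  have := L.indep₃ _ (U.sub_mem h1 h1') _ (U.sub_mem h2 h2') _ (U.sub_mem h3 h3')
    (by linear_combination h)
  exact ⟨sub_eq_zero.1 this.1, sub_eq_zero.1 this.2.1, sub_eq_zero.1 this.2.2⟩

theorem δ_mul_x (u : N) : δ (u * x) = δ u * x := by
  rw [L.δ_mul, L.δ_x, mul_zero, add_zero]

theorem δ_expand (α β γ : N) : δ (α + β * y + γ * y ^ 2) =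
    (δ α + β * x) + (δ β - γ * x) * y + δ γ * y ^ 2 := by
  have h3 := L.three
  rw [map_add, map_add, L.δ_mul, L.δ_mul, pow_two, L.δ_mul, L.δ_y]
  linear_combination (γ * x * y) * h3

theorem δδ_expand (α β γ : N) : δ (δ (α + β * y + γ * y ^ 2)) =
    (δ (δ α) - δ β * x - γ * x * x) + (δ (δ β) + δ γ * x) * y + δ (δ γ) * y ^ 2 := by
  have h3 := L.three
  rw [L.δ_expand, L.δ_expand, map_add, map_sub, L.δ_mul_x, L.δ_mul_x]
  linear_combination (δ β * x - δ γ * x * y) * h3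

/-- An element of the form `v + p x + q y` lies in the image of `δ²` only if each of its coefficients lies
in an image over `V`: no new relation arises. -/
theorem of_δδ {v p q α β γ : N} (hv : v ∈ V) (hp : p ∈ V) (hq : q ∈ V) (hα : α ∈ U) (hβ : β ∈ U)
    (hγ : γ ∈ U) (h : v + p * x + q * y = δ (δ (α + β * y + γ * y ^ 2))) :
    (∃ m ∈ V, δ (δ m) = v) ∧ (∃ m ∈ V, δ m = p) ∧ ∃ m ∈ V, δ (δ m) = q := by
  have hδ := L.δ_U
  have hV := L.δ_V
  have hx := L.x_U
  rw [L.δδ_expand] at h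
  obtain ⟨e1, e2, -⟩ := L.eq₃ (γ := 0) (U.add_mem (L.le hv) (hx _ (L.le hp))) (L.le hq) U.zero_mem
    (U.sub_mem (U.sub_mem (hδ _ (hδ _ hα)) (hx _ (hδ _ hβ))) (hx _ (hx _ hγ)))
    (U.add_mem (hδ _ (hδ _ hβ)) (hx _ (hδ _ hγ))) (hδ _ (hδ _ hγ)) (by linear_combination h)
  obtain ⟨a, ha, α', hα', rfl⟩ := L.split _ hα
  obtain ⟨b, hb, β', hβ', rfl⟩ := L.split _ hβ
  obtain ⟨a', ha', α'', hα'', rfl⟩ := L.split _ hα'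
  simp only [map_add, L.δ_mul_x] at e1 e2
  obtain ⟨f1, f2⟩ := L.eq₂ (v' := δ (δ a)) (u' := δ (δ a') + δ (δ α'') * x - δ b - δ β' * x - γ * x)
    hv (L.le hp) (hV _ (hV _ ha))
    (U.sub_mem (U.sub_mem (U.sub_mem (U.add_mem (L.le (hV _ (hV _ ha'))) (hx _ (hδ _ (hδ _ hα''))))
      (L.le (hV _ hb))) (hx _ (hδ _ hβ'))) (hx _ hγ)) (by linear_combination e1)
  obtain ⟨g1, -⟩ := L.eq₂ (u := 0) (v' := δ (δ a') - δ b) (u' := δ (δ α'') - δ β' - γ)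
    hp U.zero_mem (V.sub_mem (hV _ (hV _ ha')) (hV _ hb))
    (U.sub_mem (U.sub_mem (hδ _ (hδ _ hα'')) (hδ _ hβ')) hγ) (by linear_combination f2)
  obtain ⟨k1, -⟩ := L.eq₂ (u := 0) (v' := δ (δ b)) (u' := δ (δ β') + δ γ)
    hq U.zero_mem (hV _ (hV _ hb)) (U.add_mem (hδ _ (hδ _ hβ')) (hδ _ hγ)) (by linear_combination e2)
  exact ⟨⟨a, ha, f1.symm⟩, ⟨δ a' - b, V.sub_mem (hV _ ha') hb, by rw [map_sub, g1]⟩, ⟨b, hb, k1.symm⟩⟩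

/-- An element of the form `v + q y` lies in the image of `δ` only if each of its coefficients lies in an
image over `V`. -/
theorem of_δ {v q α β γ : N} (hv : v ∈ V) (hq : q ∈ V) (hα : α ∈ U) (hβ : β ∈ U)
    (hγ : γ ∈ U) (h : v + q * y = δ (α + β * y + γ * y ^ 2)) :
    (∃ m ∈ V, δ m = v) ∧ ∃ m ∈ V, δ (δ m) = q := by
  have hδ := L.δ_U
  have hV := L.δ_V
  have hx := L.x_U
  rw [L.δ_expand] at h
  obtain ⟨e1, e2, -⟩ := L.eq₃ (γ := 0) (L.le hv) (L.le hq) U.zero_mem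
    (U.add_mem (hδ _ hα) (hx _ hβ)) (U.sub_mem (hδ _ hβ) (hx _ hγ)) (hδ _ hγ) (by linear_combination h)
  obtain ⟨a, ha, α', hα', rfl⟩ := L.split _ hα
  obtain ⟨a', ha', α'', hα'', rfl⟩ := L.split _ hα'
  simp only [map_add, L.δ_mul_x] at e1
  obtain ⟨f1, f2⟩ := L.eq₂ (u := 0) (v' := δ a) (u' := δ a' + δ α'' * x + β) hv U.zero_mem (hV _ ha)
    (U.add_mem (U.add_mem (L.le (hV _ ha')) (hx _ (hδ _ hα''))) hβ) (by linear_combination e1)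
  have hβ' : β = -(δ a' + δ α'' * x) := by linear_combination -f2
  rw [hβ', map_neg, map_add, L.δ_mul_x] at e2
  obtain ⟨g1, -⟩ := L.eq₂ (u := 0) (v' := -δ (δ a')) (u' := -δ (δ α'') - γ)
    hq U.zero_mem (V.neg_mem (hV _ (hV _ ha')))
    (U.sub_mem (U.neg_mem (hδ _ (hδ _ hα''))) hγ) (by linear_combination e2)
  exact ⟨⟨a, ha, f1.symm⟩, ⟨-a', V.neg_mem ha', by rw [map_neg, map_neg, g1]⟩⟩

/-- Up to the image of `δ²`, the kernel of `δ` consists of the elements `v + (p x - δ p y)` over `V`. -/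
theorem ker_δ {α β γ : N} (hα : α ∈ U) (hβ : β ∈ U) (hγ : γ ∈ U)
    (h : δ (α + β * y + γ * y ^ 2) = 0) :
    ∃ v ∈ V, ∃ p ∈ V, ∃ m, δ v = 0 ∧ δ (δ p) = 0 ∧
      α + β * y + γ * y ^ 2 = v + (p * x - δ p * y) - δ (δ m) := by
  have hδ := L.δ_U
  have hV := L.δ_V
  have hx := L.x_U
  rw [L.δ_expand] at h
  obtain ⟨e1, e2, -⟩ := L.indep₃ _ (U.add_mem (hδ _ hα) (hx _ hβ)) _ (U.sub_mem (hδ _ hβ) (hx _ hγ)) _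
    (hδ _ hγ) h
  obtain ⟨a, ha, α', hα', rfl⟩ := L.split _ hα
  obtain ⟨p, hp, α'', hα'', rfl⟩ := L.split _ hα'
  simp only [map_add, L.δ_mul_x] at e1
  obtain ⟨f1, f2⟩ := L.indep₂ _ (hV _ ha) (δ p + δ α'' * x + β)
    (U.add_mem (U.add_mem (L.le (hV _ hp)) (hx _ (hδ _ hα''))) hβ) (by linear_combination e1)
  have hβ' : β = -(δ p + δ α'' * x) := by linear_combination f2
  rw [hβ', map_neg, map_add, L.δ_mul_x] at e2
  obtain ⟨g1, g2⟩ := L.indep₂ _ (V.neg_mem (hV _ (hV _ hp))) (-δ (δ α'') - γ)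
    (U.sub_mem (U.neg_mem (hδ _ (hδ _ hα''))) hγ) (by linear_combination e2)
  refine ⟨a, ha, p, hp, α'' * y ^ 2, f1, neg_eq_zero.1 g1, ?_⟩
  have hm := L.δδ_expand 0 0 α''
  rw [map_zero, map_zero, zero_mul, zero_add, zero_add] at hm
  rw [hm, hβ']
  linear_combination -y ^ 2 * g2

/-- Up to the image of `δ`, the kernel of `δ²` consists of the elements `v + q y` over `V`. -/
theorem ker_δδ {α β γ : N} (hα : α ∈ U) (hβ : β ∈ U) (hγ : γ ∈ U)
    (h : δ (δ (α + β * y + γ * y ^ 2)) = 0) :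
    ∃ v ∈ V, ∃ q ∈ V, ∃ m, δ (δ v) = 0 ∧ δ q = 0 ∧
      α + β * y + γ * y ^ 2 = v + q * y + δ m := by
  have h3 := L.three
  have hδ := L.δ_U
  have hV := L.δ_V
  have hx := L.x_U
  rw [L.δδ_expand] at h
  obtain ⟨e1, -, -⟩ := L.indep₃ _ (U.sub_mem (U.sub_mem (hδ _ (hδ _ hα)) (hx _ (hδ _ hβ))) (hx _ (hx _ hγ))) _
    (U.add_mem (hδ _ (hδ _ hβ)) (hx _ (hδ _ hγ))) _ (hδ _ (hδ _ hγ)) h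
  obtain ⟨a, ha, α', hα', rfl⟩ := L.split _ hα
  obtain ⟨b, hb, β', hβ', rfl⟩ := L.split _ hβ
  obtain ⟨a', ha', α'', hα'', rfl⟩ := L.split _ hα'
  simp only [map_add, L.δ_mul_x] at e1
  obtain ⟨f1, f2⟩ := L.indep₂ _ (hV _ (hV _ ha)) (δ (δ a') + δ (δ α'') * x - δ b - δ β' * x - γ * x)
    (U.sub_mem (U.sub_mem (U.sub_mem (U.add_mem (L.le (hV _ (hV _ ha'))) (hx _ (hδ _ (hδ _ hα''))))
      (L.le (hV _ hb))) (hx _ (hδ _ hβ'))) (hx _ hγ)) (by linear_combination e1)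
  obtain ⟨g1, g2⟩ := L.indep₂ (δ (δ a') - δ b) (V.sub_mem (hV _ (hV _ ha')) (hV _ hb))
    (δ (δ α'') - δ β' - γ) (U.sub_mem (U.sub_mem (hδ _ (hδ _ hα'')) (hδ _ hβ')) hγ)
    (by linear_combination f2)
  refine ⟨a, ha, b - δ a', V.sub_mem hb (hV _ ha'), (a' + α'' * x) * y - (β' - δ α'') * y ^ 2, f1,
    by rw [map_sub]; linear_combination -g1, ?_⟩
  have hm := L.δ_expand 0 (a' + α'' * x) (-(β' - δ α''))
  rw [zero_add, map_zero, map_neg, neg_mul, ← sub_eq_add_neg] at hm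
  rw [hm]
  simp only [map_add, map_sub, L.δ_mul_x]
  linear_combination -y ^ 2 * g2

end PairLayer

/-! ### Rings built up from pairs of variables -/

/-- A ring with a derivation that is exhausted by subgroups `S J`, for `J` a finite set of indices,
where `S (insert a J)` is `S J` with a pair of variables `x a = δ (y a)` added. -/
structure Layering {N : Type} [CommRing N] (ι : Type) [DecidableEq ι] (δ : N →+ N) where
  x : ι → N
  y : ι → N
  S : Finset ι → AddSubgroup N
  U : Finset ι → ι → AddSubgroup N
  layer : ∀ J a, a ∉ J → PairLayer δ (x a) (y a) (S J) (U J a)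
  U_le : ∀ J a, a ∉ J → U J a ≤ S (insert a J)
  mul_y : ∀ J a, a ∉ J → ∀ n ∈ U J a, n * y a ∈ S (insert a J)
  expand : ∀ J a, a ∉ J → ∀ n ∈ S (insert a J), ∃ α ∈ U J a, ∃ β ∈ U J a, ∃ γ ∈ U J a,
    n = α + β * y a + γ * y a ^ 2
  exhaust : ∀ n, ∃ J, n ∈ S J
  δ_S : ∀ J, ∀ n ∈ S J, δ n ∈ S J
  one_mem : ∀ J, 1 ∈ S J
  const : ∀ n ∈ S ∅, δ n = 0

namespace Layering
variable {N ι : Type} [CommRing N] [DecidableEq ι] {δ : N →+ N} (L : Layering ι δ)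

theorem mono_insert {J : Finset ι} {a : ι} (ha : a ∉ J) : L.S J ≤ L.S (insert a J) :=
  (L.layer J a ha).le.trans (L.U_le J a ha)

theorem mono {J K : Finset ι} (h : J ⊆ K) : L.S J ≤ L.S K := by
  have key : ∀ M : Finset ι, L.S J ≤ L.S (J ∪ M) := fun M => by
    induction M using Finset.induction_on with
    | empty => rw [Finset.union_empty]
    | insert a M ha ih =>
      by_cases h : a ∈ J ∪ M
      · rw [Finset.union_insert, Finset.insert_eq_of_mem h]; exact ih
      · rw [Finset.union_insert]; exact ih.trans (L.mono_insert h)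
  rw [← Finset.union_eq_right.2 h]
  exact key K

theorem descend {q : N →+ N} (J : Finset ι) (hq : ∀ K a, a ∉ K → ∀ n ∈ L.S K,
    (∃ w ∈ L.S (insert a K), q w = n) → ∃ w ∈ L.S K, q w = n) {n : N} (hn : n ∈ L.S J)
    (h : ∃ w, q w = n) : ∃ w ∈ L.S J, q w = n := by
  obtain ⟨w, hw⟩ := h
  obtain ⟨K, hK⟩ := L.exhaust w
  have key : ∀ M : Finset ι, (∃ w ∈ L.S (J ∪ M), q w = n) → ∃ w ∈ L.S J, q w = n := fun M => by
    induction M using Finset.induction_on with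
    | empty => rw [Finset.union_empty]; exact id
    | insert a M ha ih =>
      by_cases h : a ∈ J ∪ M
      · rw [Finset.union_insert, Finset.insert_eq_of_mem h]; exact ih
      · rw [Finset.union_insert]
        exact fun h' => ih (hq _ a h n (L.mono Finset.subset_union_left hn) h')
  exact key K ⟨w, L.mono Finset.subset_union_right hK, hw⟩

/-- An element of `S J` in the image of `δ²` is in `δ²(S J)`. -/
theorem descend_δδ {J : Finset ι} {n : N} (hn : n ∈ L.S J) (h : ∃ w, δ (δ w) = n) :
    ∃ w ∈ L.S J, δ (δ w) = n := by
  refine L.descend (q := δ.comp δ) J (fun K a ha n hn ⟨w, hw, e⟩ => ?_) hn h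
  obtain ⟨α, hα, β, hβ, γ, hγ, rfl⟩ := L.expand K a ha w hw
  exact ((L.layer K a ha).of_δδ hn (zero_mem _) (zero_mem _) hα hβ hγ (by
    rw [zero_mul, zero_mul, add_zero, add_zero]; exact e.symm)).1

/-- An element of `S J` in the image of `δ` is in `δ(S J)`. -/
theorem descend_δ {J : Finset ι} {n : N} (hn : n ∈ L.S J) (h : ∃ w, δ w = n) :
    ∃ w ∈ L.S J, δ w = n := by
  refine L.descend (q := δ) J (fun K a ha n hn ⟨w, hw, e⟩ => ?_) hn h
  obtain ⟨α, hα, β, hβ, γ, hγ, rfl⟩ := L.expand K a ha w hw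
  exact ((L.layer K a ha).of_δ hn (zero_mem _) hα hβ hγ (by
    rw [zero_mul, add_zero]; exact e.symm)).1

end Layering

namespace TatePre
variable {N W ι : Type} [CommRing N] [Ring W] [DecidableEq ι] (T : TatePre N W)

/-- The subgroup of the classes that are represented in `S`. -/
def H (S : AddSubgroup N) : AddSubgroup W :=
  AddSubgroup.closure ({w | ∃ (k : ℤ), ∃ n ∈ S, T.δ n = 0 ∧ w = ((T.b ^ k : Wˣ) : W) * T.c0 n} ∪
    {w | ∃ (k : ℤ), ∃ u ∈ S, T.δ (T.δ u) = 0 ∧ w = ((T.b ^ k : Wˣ) : W) * T.c1 u})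

variable {T}

theorem c0_mem_H {S : AddSubgroup N} (k : ℤ) {n : N} (hn : n ∈ S) (h : T.δ n = 0) :
    ((T.b ^ k : Wˣ) : W) * T.c0 n ∈ T.H S := AddSubgroup.subset_closure (Or.inl ⟨k, n, hn, h, rfl⟩)

theorem c1_mem_H {S : AddSubgroup N} (k : ℤ) {u : N} (hu : u ∈ S) (h : T.δ (T.δ u) = 0) :
    ((T.b ^ k : Wˣ) : W) * T.c1 u ∈ T.H S := AddSubgroup.subset_closure (Or.inr ⟨k, u, hu, h, rfl⟩)

theorem H_induction {S : AddSubgroup N} {p : W → Prop}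
    (h0 : ∀ (k : ℤ), ∀ n ∈ S, T.δ n = 0 → p (((T.b ^ k : Wˣ) : W) * T.c0 n))
    (h1 : ∀ (k : ℤ), ∀ u ∈ S, T.δ (T.δ u) = 0 → p (((T.b ^ k : Wˣ) : W) * T.c1 u))
    (hz : p 0) (ha : ∀ v w, p v → p w → p (v + w)) (hn : ∀ w, p w → p (-w)) {w : W} (hw : w ∈ T.H S) :
    p w := by
  refine AddSubgroup.closure_induction (fun w hw => ?_) hz (fun v w _ _ => ha v w)
    (fun w _ => hn w) hw
  rcases hw with ⟨k, n, hn, h, rfl⟩ | ⟨k, n, hn, h, rfl⟩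
  · exact h0 k n hn h
  · exact h1 k n hn h

theorem H_mono {S S' : AddSubgroup N} (h : S ≤ S') : T.H S ≤ T.H S' := fun _ hw =>
  H_induction (fun k _ hn h' => c0_mem_H k (h hn) h') (fun k _ hn h' => c1_mem_H k (h hn) h')
    (zero_mem _) (fun _ _ => add_mem) (fun _ => neg_mem) hw

theorem exists_rep_mem {S : AddSubgroup N} {w : W} (hw : w ∈ T.H S) :
    ∃ n u, (∀ k, n k ∈ S) ∧ (∀ k, u k ∈ S) ∧ T.Rep w n u := by
  have hs : ∀ (k l : ℤ) (n : N), n ∈ S → (Pi.single k n : ℤ → N) l ∈ S := fun k l n hn => by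
    rcases eq_or_ne l k with rfl | h
    · simpa
    · simp [h]
  refine H_induction (p := fun w => ∃ n u, (∀ k, n k ∈ S) ∧ (∀ k, u k ∈ S) ∧ T.Rep w n u)
    (fun k n hn h => ?_) (fun k u hu h => ?_) ?_ ?_ ?_ hw
  · refine ⟨Pi.single k n, Pi.single k 0, fun l => hs _ _ _ hn, fun l => hs _ _ _ S.zero_mem, ?_⟩
    have := Rep.single (T := T) k h (u := 0) (by simp)
    rwa [T.c1_zero, add_zero] at this
  · refine ⟨Pi.single k 0, Pi.single k u, fun l => hs _ _ _ S.zero_mem, fun l => hs _ _ _ hu, ?_⟩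
    have := Rep.single (T := T) k (n := 0) (by simp) h
    rwa [T.c0_zero, zero_add] at this
  · exact ⟨0, 0, fun _ => S.zero_mem, fun _ => S.zero_mem, Rep.zero⟩
  · rintro v w ⟨n, u, hn, hu, h⟩ ⟨n', u', hn', hu', h'⟩
    exact ⟨n + n', u + u', fun k => S.add_mem (hn k) (hn' k), fun k => S.add_mem (hu k) (hu' k), h.add h'⟩
  · rintro v ⟨n, u, hn, hu, h⟩
    exact ⟨-n, -u, fun k => S.neg_mem (hn k), fun k => S.neg_mem (hu k), h.neg⟩

theorem b_zpow_comm (k : ℤ) (w : W) : Commute ((T.b ^ k : Wˣ) : W) w :=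
  (T.b_comm w).units_zpow_left k

theorem b_zpow_mul_mem_H {S : AddSubgroup N} (k : ℤ) {w : W} (hw : w ∈ T.H S) :
    ((T.b ^ k : Wˣ) : W) * w ∈ T.H S := by
  refine H_induction (p := fun w => ((T.b ^ k : Wˣ) : W) * w ∈ T.H S)
    (fun l n hn h => ?_) (fun l u hu h => ?_) ?_ ?_ ?_ hw
  · rw [← mul_assoc, ← Units.val_mul, ← zpow_add]; exact c0_mem_H _ hn h
  · rw [← mul_assoc, ← Units.val_mul, ← zpow_add]; exact c1_mem_H _ hu h
  · rw [mul_zero]; exact zero_mem _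
  · intro v w hv hw; rw [mul_add]; exact add_mem hv hw
  · intro w hw; rw [mul_neg]; exact neg_mem hw

section layers
variable (L : Layering ι T.δ)

/-- The class `[y]` of a variable with `δ² y = 0`. -/
def e (T : TatePre N W) (L : Layering ι T.δ) (a : ι) : W := T.c1 (L.y a)

theorem δ_y (a : ι) : T.δ (L.y a) = L.x a := (L.layer ∅ a (Finset.notMem_empty a)).δ_y
theorem δ_x (a : ι) : T.δ (L.x a) = 0 := (L.layer ∅ a (Finset.notMem_empty a)).δ_x
theorem δδ_y (a : ι) : T.δ (T.δ (L.y a)) = 0 := by rw [δ_y, δ_x]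

theorem c1_mul_e {p : N} (h : T.δ (T.δ p) = 0) (a : ι) :
    T.c1 p * T.e L a = T.b * T.c0 (T.δ p * L.y a - p * L.x a) := by
  rw [e, T.c1_mul_c1 h (δδ_y L a), δ_y]

theorem c0_mul_e {q : N} (h : T.δ q = 0) (a : ι) : T.c0 q * T.e L a = T.c1 (q * L.y a) := by
  rw [e, T.c0_mul_c1 (δδ_y L a) h, mul_comm]

theorem δ_pair {p : N} (h : T.δ (T.δ p) = 0) (a : ι) : T.δ (T.δ p * L.y a - p * L.x a) = 0 := by
  rw [map_sub, T.δ_mul, T.δ_mul, δ_x, δ_y, h]; ring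

theorem δδ_mul_y {q : N} (h : T.δ q = 0) (a : ι) : T.δ (T.δ (q * L.y a)) = 0 := by
  rw [T.δ_mul, h, δ_y, zero_mul, zero_add, T.δ_mul, h, δ_x, zero_mul, mul_zero, add_zero]

theorem mul_e_mem_H {J : Finset ι} {a : ι} (ha : a ∉ J) {w : W} (hw : w ∈ T.H (L.S J)) :
    w * T.e L a ∈ T.H (L.S (insert a J)) := by
  have hl := L.layer J a ha
  refine H_induction (p := fun w => w * T.e L a ∈ T.H (L.S (insert a J)))
    (fun k q hq h => ?_) (fun k p hp h => ?_) ?_ ?_ ?_ hw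
  · rw [mul_assoc, c0_mul_e L h]
    exact c1_mem_H k (L.mul_y J a ha _ (hl.le hq)) (δδ_mul_y L h a)
  · rw [mul_assoc, c1_mul_e L h, ← mul_assoc, ← Units.val_mul, ← zpow_add_one]
    exact c0_mem_H _ (sub_mem (L.mul_y J a ha _ (hl.le (hl.δ_V _ hp)))
      (L.U_le J a ha (hl.x_U _ (hl.le hp)))) (δ_pair L h a)
  · rw [zero_mul]; exact zero_mem _
  · intro v w hv hw; rw [add_mul]; exact add_mem hv hw
  · intro w hw; rw [neg_mul]; exact neg_mem hw

/-- The classes represented in `S (insert a J)` are those of `S J` and their multiples by `e a`. -/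
theorem exists_eq_add_mul_e {J : Finset ι} {a : ι} (ha : a ∉ J) {w : W}
    (hw : w ∈ T.H (L.S (insert a J))) :
    ∃ v ∈ T.H (L.S J), ∃ v' ∈ T.H (L.S J), w = v + v' * T.e L a := by
  have hl := L.layer J a ha
  refine H_induction (p := fun w => ∃ v ∈ T.H (L.S J), ∃ v' ∈ T.H (L.S J), w = v + v' * T.e L a)
    (fun k n hn h => ?_) (fun k u hu h => ?_) ?_ ?_ ?_ hw
  · obtain ⟨α, hα, β, hβ, γ, hγ, rfl⟩ := L.expand J a ha n hn
    obtain ⟨v, hv, p, hp, m, h1, h2, h3⟩ := hl.ker_δ hα hβ hγ h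
    refine ⟨_, c0_mem_H k hv h1, _, neg_mem (c1_mem_H (k - 1) hp h2), ?_⟩
    have e1 : T.δ (-T.δ (T.δ m)) = 0 := by rw [map_neg, T.δ_three, neg_zero]
    have e2 := δ_pair L h2 a
    have e3 : T.δ (-(T.δ p * L.y a - p * L.x a)) = 0 := by rw [map_neg, e2, neg_zero]
    rw [h3, show v + (p * L.x a - T.δ p * L.y a) - T.δ (T.δ m) =
      v + -(T.δ p * L.y a - p * L.x a) + -T.δ (T.δ m) by ring, T.c0_add (by rw [map_add, h1, e3, add_zero]) e1,
      T.c0_add h1 e3, T.c0_neg e2, T.c0_neg (T.δ_three m), T.c0_δδ, neg_zero, add_zero, mul_add,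
      neg_mul, mul_assoc, c1_mul_e L h2, ← mul_assoc, ← Units.val_mul, ← zpow_add_one, sub_add_cancel,
      mul_neg]
  · obtain ⟨α, hα, β, hβ, γ, hγ, rfl⟩ := L.expand J a ha u hu
    obtain ⟨v, hv, q, hq, m, h1, h2, h3⟩ := hl.ker_δδ hα hβ hγ h
    refine ⟨_, c1_mem_H k hv h1, _, c0_mem_H k hq h2, ?_⟩
    have e1 := δδ_mul_y L h2 a
    rw [h3, T.c1_add (by rw [map_add, map_add, h1, e1, add_zero]) (T.δ_three m), T.c1_add h1 e1, T.c1_δ,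
      add_zero, mul_add, mul_assoc, c0_mul_e L h2]
  · exact ⟨0, zero_mem _, 0, zero_mem _, by rw [zero_mul, add_zero]⟩
  · rintro v w ⟨x, hx, y, hy, rfl⟩ ⟨x', hx', y', hy', rfl⟩
    exact ⟨_, add_mem hx hx', _, add_mem hy hy', by rw [add_mul]; abel⟩
  · rintro v ⟨x, hx, y, hy, rfl⟩
    exact ⟨_, neg_mem hx, _, neg_mem hy, by rw [neg_mul]; abel⟩

theorem Rep.mul_e {w : W} {q p : ℤ → N} (h : T.Rep w q p) (a : ι) :
    T.Rep (w * T.e L a) (fun k => T.δ (p (k - 1)) * L.y a - p (k - 1) * L.x a)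
      (fun k => q k * L.y a) := by
  obtain ⟨h0, h1, s, hs, hw⟩ := h
  refine ⟨fun k => δ_pair L (h1 _) a, fun k => δδ_mul_y L (h0 k) a,
    s ∪ s.map (Equiv.addRight (1 : ℤ)).toEmbedding, fun k hk => ?_, ?_⟩
  · rw [Finset.notMem_union, Finset.mem_map_equiv] at hk
    have h2 : p (k - 1) = 0 := (hs _ hk.2).2
    simp only [h2, (hs k hk.1).1, map_zero, zero_mul, sub_zero, and_self]
  · simp only [mul_add, Finset.sum_add_distrib]
    rw [hw, Finset.sum_mul]
    simp only [mul_add, add_mul, Finset.sum_add_distrib]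
    rw [add_comm]
    congr 1
    · rw [← Finset.sum_subset (Finset.subset_union_right (s₁ := s)), Finset.sum_map]
      · refine Finset.sum_congr rfl fun k _ => ?_
        rw [mul_assoc, c1_mul_e L (h1 k), Equiv.coe_toEmbedding, Equiv.coe_addRight, add_sub_cancel_right,
          ← mul_assoc, ← Units.val_mul, ← zpow_add_one]
      · intro k _ hk
        rw [Finset.mem_map_equiv] at hk
        have h2 : p (k - 1) = 0 := (hs _ hk).2
        rw [h2, map_zero, zero_mul, zero_mul, sub_zero, c0_zero, mul_zero]
    · rw [← Finset.sum_subset (Finset.subset_union_left (s₂ := s.map _))]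
      · refine Finset.sum_congr rfl fun k _ => ?_
        rw [mul_assoc, c0_mul_e L (h0 k)]
      · intro k _ hk
        rw [(hs k hk).1, zero_mul, c1_zero, mul_zero]

end layers
end TatePre

namespace TateRing
variable {N W ι : Type} [CommRing N] [Ring W] [DecidableEq ι] (T : TateRing N W)

theorem exists_mem_H (L : Layering ι T.δ) (w : W) : ∃ J, w ∈ T.H (L.S J) := by
  obtain ⟨n, u, h0, h1, s, -, rfl⟩ := T.exists_rep w
  choose f hf using fun k => L.exhaust (n k)
  choose g hg using fun k => L.exhaust (u k)
  refine ⟨s.biUnion fun k => f k ∪ g k, sum_mem fun k hk => ?_⟩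
  rw [mul_add]
  have hsub := Finset.subset_biUnion_of_mem (fun k => f k ∪ g k) hk
  exact add_mem (TatePre.c0_mem_H k (L.mono (Finset.subset_union_left.trans hsub) (hf k)) (h0 k))
    (TatePre.c1_mem_H k (L.mono (Finset.subset_union_right.trans hsub) (hg k)) (h1 k))

theorem eq_zero_of_rep {w : W} {n u : ℤ → N} (h : T.Rep w n u) (hn : ∀ k, ∃ m, T.δ (T.δ m) = n k)
    (hu : ∀ k, ∃ m, T.δ m = u k) : w = 0 := by
  obtain ⟨-, -, s, -, rfl⟩ := h
  refine Finset.sum_eq_zero fun k _ => ?_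
  obtain ⟨m, hm⟩ := hn k
  obtain ⟨m', hm'⟩ := hu k
  rw [← hm, ← hm', T.c0_δδ, T.c1_δ, add_zero, mul_zero]

variable (L : Layering ι T.δ)

/-- The class `e a` is free over the classes represented in `S J`. -/
theorem indep {J : Finset ι} {a : ι} (ha : a ∉ J) {v v' : W} (hv : v ∈ T.H (L.S J))
    (hv' : v' ∈ T.H (L.S J)) (h : v + v' * T.e L a = 0) : v = 0 ∧ v' = 0 := by
  have hl := L.layer J a ha
  obtain ⟨n, u, hn, hu, h1⟩ := TatePre.exists_rep_mem hv
  obtain ⟨q, p, hq, hp, h2⟩ := TatePre.exists_rep_mem hv'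
  have h3 := h1.add (h2.mul_e L a)
  rw [h] at h3
  have h4 := T.rep_zero _ _ h3
  have k1 : ∀ k, (∃ m ∈ L.S J, T.δ (T.δ m) = n k) ∧ ∃ m ∈ L.S J, T.δ m = -p (k - 1) := fun k => by
    obtain ⟨w, hw, e⟩ := L.descend_δδ (J := insert a J) (n := n k + (T.δ (p (k - 1)) * L.y a - p (k - 1) * L.x a))
      (add_mem (L.mono_insert ha (hn k)) (sub_mem (L.mul_y J a ha _ (hl.le (hl.δ_V _ (hp _))))
        (L.U_le J a ha (hl.x_U _ (hl.le (hp _)))))) (h4 k).1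
    obtain ⟨α, hα, β, hβ, γ, hγ, rfl⟩ := L.expand J a ha w hw
    have := hl.of_δδ (hn k) (neg_mem (hp (k - 1))) (hl.δ_V _ (hp (k - 1))) hα hβ hγ
      (by rw [e]; ring)
    exact ⟨this.1, this.2.1⟩
  have k2 : ∀ k, (∃ m ∈ L.S J, T.δ m = u k) ∧ ∃ m ∈ L.S J, T.δ (T.δ m) = q k := fun k => by
    obtain ⟨w, hw, e⟩ := L.descend_δ (J := insert a J) (n := u k + q k * L.y a)
      (add_mem (L.mono_insert ha (hu k)) (L.mul_y J a ha _ (hl.le (hq _)))) (h4 k).2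
    obtain ⟨α, hα, β, hβ, γ, hγ, rfl⟩ := L.expand J a ha w hw
    exact hl.of_δ (hu k) (hq k) hα hβ hγ (by rw [e])
  refine ⟨T.eq_zero_of_rep h1 (fun k => ?_) (fun k => ?_), T.eq_zero_of_rep h2 (fun k => ?_) (fun k => ?_)⟩
  · obtain ⟨m, -, hm⟩ := (k1 k).1; exact ⟨m, hm⟩
  · obtain ⟨m, -, hm⟩ := (k2 k).1; exact ⟨m, hm⟩
  · obtain ⟨m, -, hm⟩ := (k2 k).2; exact ⟨m, hm⟩
  · obtain ⟨m, -, hm⟩ := (k1 (k + 1)).2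
    rw [add_sub_cancel_right] at hm
    exact ⟨-m, by rw [map_neg, hm, neg_neg]⟩

/-- A representation of `0` by constants is trivial. -/
theorem rep_const {n u : ℤ → N} (hn : ∀ k, n k ∈ L.S ∅) (hu : ∀ k, u k ∈ L.S ∅) (h : T.Rep 0 n u) (k : ℤ) :
    n k = 0 ∧ u k = 0 := by
  have h' := T.rep_zero _ _ h k
  obtain ⟨m, hm, e⟩ := L.descend_δδ (hn k) h'.1
  obtain ⟨m', hm', e'⟩ := L.descend_δ (hu k) h'.2
  rw [L.const m hm, map_zero] at e
  rw [L.const m' hm'] at e'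
  exact ⟨e.symm, e'.symm⟩

end TateRing

/-! ### The polynomial ring in pairs of variables -/

namespace PairPoly
open MvPolynomial
open scoped Pointwise
variable {κ : Type} [DecidableEq κ]

set_option linter.unusedSectionVars false

/-- The exponent of `x a` in a monomial. -/
def qe (a : κ × ℕ) (g : κ × ℕ →₀ ℕ) : ℕ := if a.2 = 0 then g a else g a / 3

/-- The exponent of `y a` in a monomial, which is less than `3`. -/
def re (a : κ × ℕ) (g : κ × ℕ →₀ ℕ) : ℕ := g (a.1, a.2 + 1) % 3

/-- The exponent vector of `x a`. -/
def xexp (a : κ × ℕ) : κ × ℕ →₀ ℕ := Finsupp.single a (if a.2 = 0 then 1 else 3)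

/-- The exponent vector of `y a`. -/
def yexp (a : κ × ℕ) : κ × ℕ →₀ ℕ := Finsupp.single (a.1, a.2 + 1) 1

theorem succ_ne {a b : κ × ℕ} (h : a ≠ b) : (a.1, a.2 + 1) ≠ (b.1, b.2 + 1) := fun e => by
  rw [Prod.mk.injEq] at e
  exact h (Prod.ext e.1 (Nat.succ_injective e.2))

theorem qe_add_xexp (a b : κ × ℕ) (g : κ × ℕ →₀ ℕ) :
    qe a (g + xexp b) = qe a g + if a = b then 1 else 0 := by
  rw [qe, qe, xexp, Finsupp.add_apply, Finsupp.single_apply]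
  by_cases h : a = b
  · subst h
    simp only [if_true]
    split_ifs <;> omega
  · rw [if_neg (Ne.symm h), if_neg h]; simp

theorem re_add_xexp (a b : κ × ℕ) (g : κ × ℕ →₀ ℕ) : re a (g + xexp b) = re a g := by
  rw [re, re, xexp, Finsupp.add_apply, Finsupp.single_apply]
  by_cases h : b = (a.1, a.2 + 1)
  · subst h
    simp
  · rw [if_neg h, add_zero]

theorem qe_add_yexp (a b : κ × ℕ) {g : κ × ℕ →₀ ℕ} (hg : re b g < 2) : qe a (g + yexp b) = qe a g := by
  rw [qe, qe, yexp, Finsupp.add_apply, Finsupp.single_apply]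
  rw [re] at hg
  by_cases h : (b.1, b.2 + 1) = a
  · subst h
    rw [if_neg (Nat.succ_ne_zero b.2), if_neg (Nat.succ_ne_zero b.2), if_pos rfl]
    omega
  · rw [if_neg h, add_zero]

theorem re_add_yexp (a b : κ × ℕ) {g : κ × ℕ →₀ ℕ} (hg : re b g < 2) :
    re a (g + yexp b) = re a g + if a = b then 1 else 0 := by
  rw [re, re, yexp, Finsupp.add_apply, Finsupp.single_apply]
  rw [re] at hg
  by_cases h : a = b
  · subst h
    simp only [if_true]
    omega
  · rw [if_neg (succ_ne (Ne.symm h)), if_neg h]; rfl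

/-- The variable `x a`, which is `z` or a cube. -/
def x (a : κ × ℕ) : MvPolynomial (κ × ℕ) F3 := monomial (xexp a) 1

/-- The variable `y a`. -/
def y (a : κ × ℕ) : MvPolynomial (κ × ℕ) F3 := X (a.1, a.2 + 1)

theorem y_eq (a : κ × ℕ) : y a = monomial (yexp a) (1 : F3) := rfl

/-- The value of the derivation on the variables. -/
def dX (a : κ × ℕ) : MvPolynomial (κ × ℕ) F3 := if a.2 = 0 then 0 else x (a.1, a.2 - 1)

/-- The derivation with `δ (y a) = x a` and `δ (x a) = 0`. -/
def der : Derivation F3 (MvPolynomial (κ × ℕ) F3) (MvPolynomial (κ × ℕ) F3) := mkDerivation F3 dX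

/-- The derivation `der` as a map of additive groups. -/
def δ : MvPolynomial (κ × ℕ) F3 →+ MvPolynomial (κ × ℕ) F3 :=
  (der : Derivation F3 (MvPolynomial (κ × ℕ) F3) (MvPolynomial (κ × ℕ) F3)).toLinearMap.toAddMonoidHom

theorem δ_apply (p : MvPolynomial (κ × ℕ) F3) : δ p = der p := rfl

theorem δ_mul (p q : MvPolynomial (κ × ℕ) F3) : δ (p * q) = δ p * q + p * δ q := by
  rw [δ_apply, Derivation.leibniz, smul_eq_mul, smul_eq_mul, δ_apply, δ_apply]; ring

theorem δ_X (a : κ × ℕ) : δ (X a) = dX a := mkDerivation_X _ _ _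

theorem δ_y (a : κ × ℕ) : δ (y a) = x a := (δ_X _).trans (by simp [dX])

theorem x_eq (a : κ × ℕ) : x a = X a ^ (if a.2 = 0 then 1 else 3) := by
  rw [x, X_pow_eq_monomial, xexp]

theorem δ_x (a : κ × ℕ) : δ (x a) = 0 := by
  rw [x_eq, δ_apply, Derivation.leibniz_pow]
  by_cases h : a.2 = 0
  · rw [if_pos h, ← δ_apply, δ_X, dX, if_pos h, smul_zero, smul_zero]
  · rw [if_neg h, ← Nat.cast_smul_eq_nsmul F3, show ((3 : ℕ) : F3) = 0 from rfl, zero_smul]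

theorem δ_C (r : F3) : δ (C r : MvPolynomial (κ × ℕ) F3) = 0 := by
  rw [δ_apply, ← algebraMap_eq, Derivation.map_algebraMap]

/-- The monomials that only involve the pairs of variables in `J`. -/
def setS (J : Finset (κ × ℕ)) : Set (κ × ℕ →₀ ℕ) := {g | ∀ a ∉ J, qe a g = 0 ∧ re a g = 0}

/-- The monomials that only involve the pairs of variables in `J` and `x a`. -/
def setU (J : Finset (κ × ℕ)) (a : κ × ℕ) : Set (κ × ℕ →₀ ℕ) :=
  {g | (∀ b ∉ J, b ≠ a → qe b g = 0 ∧ re b g = 0) ∧ re a g = 0}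

section support
variable {A B C : Set (κ × ℕ →₀ ℕ)}

theorem monomial_mem {g : κ × ℕ →₀ ℕ} {r : F3} (h : g ∈ A) : monomial g r ∈ restrictSupport F3 A :=
  (monomial_mem_restrictSupport F3).2 (Or.inl h)

theorem mul_monomial_mem {e : κ × ℕ →₀ ℕ} (h : ∀ g ∈ A, g + e ∈ B) {p : MvPolynomial (κ × ℕ) F3}
    (hp : p ∈ restrictSupport F3 A) : p * monomial e 1 ∈ restrictSupport F3 B := by
  refine restrictSupport_mono F3 (s := A + ({e} : Set (κ × ℕ →₀ ℕ))) ?_ ?_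
  · rintro _ ⟨g, hg, _, rfl, rfl⟩
    exact h g hg
  · rw [restrictSupport_add]
    exact Submodule.mul_mem_mul hp (monomial_mem (Set.mem_singleton e))

theorem eq_zero_of_add {p q : MvPolynomial (κ × ℕ) F3} (hp : p ∈ restrictSupport F3 A)
    (hq : q ∈ restrictSupport F3 B) (h : ∀ g ∈ A, g ∉ B) (e : p + q = 0) : p = 0 := by
  ext g
  rw [coeff_zero]
  by_contra hg
  have hA : g ∈ A := hp (mem_support_iff.2 hg)
  have hB : coeff g q = 0 := by
    by_contra hg'
    exact h g hA (hq (mem_support_iff.2 hg'))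
  have := congrArg (coeff g) e
  rw [coeff_add, hB, add_zero, coeff_zero] at this
  exact hg this

theorem restrict_induction {P : MvPolynomial (κ × ℕ) F3 → Prop} (h0 : P 0)
    (hadd : ∀ p q, P p → P q → P (p + q)) (hm : ∀ g ∈ A, ∀ r : F3, P (monomial g r))
    {p : MvPolynomial (κ × ℕ) F3} (hp : p ∈ restrictSupport F3 A) : P p := by
  rw [p.as_sum]
  exact Finset.sum_induction _ P hadd h0 fun g hg => hm g (hp hg) _

theorem δ_mem (h : ∀ g a, re a g < 2 → g + yexp a ∈ A → g + xexp a ∈ A)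
    {p : MvPolynomial (κ × ℕ) F3} (hp : p ∈ restrictSupport F3 A) : δ p ∈ restrictSupport F3 A := by
  refine restrict_induction (P := fun p => δ p ∈ restrictSupport F3 A) (by rw [map_zero]; exact zero_mem _)
    (fun p q hp hq => by rw [map_add]; exact add_mem hp hq) (fun g hg r => ?_) hp
  rw [δ_apply, der, mkDerivation_monomial]
  refine Submodule.smul_mem _ _ (sum_mem fun i hi => ?_)
  obtain ⟨c, m⟩ := i
  cases m with
  | zero =>
    change monomial _ _ • dX (c, 0) ∈ _
    rw [show dX (c, 0) = 0 from if_pos rfl, smul_zero]; exact zero_mem _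
  | succ m =>
    change monomial _ _ • dX (c, m + 1) ∈ _
    rw [show dX (c, m + 1) = x (c, m) from if_neg (Nat.succ_ne_zero m), x, smul_eq_mul, monomial_mul]
    rw [monomial_mem_restrictSupport]
    by_cases h3 : g (c, m + 1) % 3 = 0
    · right
      rw [mul_one]
      exact (ZMod.natCast_eq_zero_iff _ _).2 (Nat.dvd_of_mod_eq_zero h3)
    · left
      have e : g - Finsupp.single (c, m + 1) 1 + yexp (c, m) = g := by
        refine tsub_add_cancel_of_le ?_
        rw [Finsupp.single_le_iff]
        exact Nat.one_le_iff_ne_zero.2 (Finsupp.mem_support_iff.1 hi)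
      refine h _ _ ?_ (by rw [e]; exact hg)
      rw [re, Finsupp.tsub_apply, Finsupp.single_eq_same]
      change (g (c, m + 1) - 1) % 3 < 2
      omega

end support

/-- The span of the monomials in the pairs of variables in `J`. -/
def S (J : Finset (κ × ℕ)) : AddSubgroup (MvPolynomial (κ × ℕ) F3) :=
  (restrictSupport F3 (setS J)).toAddSubgroup

/-- The span of the monomials in the pairs of variables in `J` and `x a`. -/
def U (J : Finset (κ × ℕ)) (a : κ × ℕ) : AddSubgroup (MvPolynomial (κ × ℕ) F3) :=
  (restrictSupport F3 (setU J a)).toAddSubgroup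

theorem setS_sub {J : Finset (κ × ℕ)} {a : κ × ℕ} (ha : a ∉ J) : setS J ⊆ setU J a :=
  fun _ hg => ⟨fun b hb _ => hg b hb, (hg a ha).2⟩

theorem setU_sub (J : Finset (κ × ℕ)) (a : κ × ℕ) : setU J a ⊆ setS (insert a J) := fun g hg b hb => by
  rw [Finset.mem_insert, not_or] at hb
  exact hg.1 b hb.2 hb.1

theorem add_xexp_mem_setU {J : Finset (κ × ℕ)} {a : κ × ℕ} {g : κ × ℕ →₀ ℕ} (hg : g ∈ setU J a) :
    g + xexp a ∈ setU J a := by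
  refine ⟨fun b hb hba => ?_, by rw [re_add_xexp]; exact hg.2⟩
  rw [qe_add_xexp, re_add_xexp, if_neg hba]
  exact hg.1 b hb hba

theorem δ_mem_S (J : Finset (κ × ℕ)) {p : MvPolynomial (κ × ℕ) F3} (hp : p ∈ S J) : δ p ∈ S J := by
  refine δ_mem (A := setS J) (fun g a hr hg b hb => ?_) hp
  have h1 := hg b hb
  rw [qe_add_yexp _ _ hr, re_add_yexp _ _ hr] at h1
  rw [qe_add_xexp, re_add_xexp]
  by_cases hba : b = a
  · rw [if_pos hba] at h1; omega
  · rw [if_neg hba] at h1 ⊢; exact h1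

theorem δ_mem_U (J : Finset (κ × ℕ)) (c : κ × ℕ) {p : MvPolynomial (κ × ℕ) F3} (hp : p ∈ U J c) :
    δ p ∈ U J c := by
  refine δ_mem (A := setU J c) (fun g a hr hg => ⟨fun b hb hbc => ?_, ?_⟩) hp
  · have h1 := hg.1 b hb hbc
    rw [qe_add_yexp _ _ hr, re_add_yexp _ _ hr] at h1
    rw [qe_add_xexp, re_add_xexp]
    by_cases hba : b = a
    · rw [if_pos hba] at h1; omega
    · rw [if_neg hba] at h1 ⊢; exact h1
  · have h1 := hg.2
    rw [re_add_yexp _ _ hr] at h1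
    rw [re_add_xexp]; omega

/-- A monomial in which `x a` has positive exponent is divisible by `x a`. -/
theorem exists_add_xexp {a : κ × ℕ} {g : κ × ℕ →₀ ℕ} (h : qe a g ≠ 0) : ∃ g', g = g' + xexp a := by
  refine ⟨g - xexp a, (tsub_add_cancel_of_le ?_).symm⟩
  rw [xexp, Finsupp.single_le_iff]
  rw [qe] at h
  split_ifs at h ⊢ <;> omega

theorem exists_add_yexp {a : κ × ℕ} {g : κ × ℕ →₀ ℕ} (h : re a g ≠ 0) :
    ∃ g', g = g' + yexp a ∧ re a g' + 1 = re a g := by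
  rw [re] at h
  refine ⟨g - yexp a, (tsub_add_cancel_of_le ?_).symm, ?_⟩
  · rw [yexp, Finsupp.single_le_iff]
    omega
  · rw [re, re, yexp, Finsupp.tsub_apply, Finsupp.single_eq_same]
    omega

theorem re_lt (a : κ × ℕ) (g : κ × ℕ →₀ ℕ) : re a g < 3 := Nat.mod_lt _ (by norm_num)

theorem split {J : Finset (κ × ℕ)} {a : κ × ℕ} (ha : a ∉ J) {p : MvPolynomial (κ × ℕ) F3} (hp : p ∈ U J a) :
    ∃ v ∈ S J, ∃ u ∈ U J a, p = v + u * x a := by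
  refine restrict_induction (P := fun p => ∃ v ∈ S J, ∃ u ∈ U J a, p = v + u * x a)
    ⟨0, zero_mem _, 0, zero_mem _, by ring⟩ ?_ (fun g hg r => ?_) hp
  · rintro _ _ ⟨v, hv, u, hu, rfl⟩ ⟨v', hv', u', hu', rfl⟩
    exact ⟨_, add_mem hv hv', _, add_mem hu hu', by ring⟩
  · by_cases h : qe a g = 0
    · refine ⟨monomial g r, monomial_mem (A := setS _) (fun b hb => ?_), 0, zero_mem _, by ring⟩
      rcases eq_or_ne b a with rfl | hba
      · exact ⟨h, hg.2⟩
      · exact hg.1 b hb hba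
    · obtain ⟨g', rfl⟩ := exists_add_xexp h
      refine ⟨0, zero_mem _, monomial g' r, monomial_mem (A := setU _ _) (⟨fun b hb hba => ?_, ?_⟩), ?_⟩
      · have := hg.1 b hb hba
        rwa [qe_add_xexp, re_add_xexp, if_neg hba, add_zero] at this
      · have := hg.2
        rwa [re_add_xexp] at this
      · rw [x, monomial_mul, mul_one, zero_add]

theorem expand {J : Finset (κ × ℕ)} {a : κ × ℕ} {p : MvPolynomial (κ × ℕ) F3}
    (hp : p ∈ S (insert a J)) : ∃ α ∈ U J a, ∃ β ∈ U J a, ∃ γ ∈ U J a, p = α + β * y a + γ * y a ^ 2 := by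
  have hU : ∀ g ∈ setS (insert a J), re a g = 0 → g ∈ setU J a := fun g hg h =>
    ⟨fun b hb hba => hg b (by rw [Finset.mem_insert, not_or]; exact ⟨hba, hb⟩), h⟩
  have hy : ∀ g, re a g < 2 → g + yexp a ∈ setS (insert a J) → g ∈ setS (insert a J) :=
    fun g hr hg b hb => by
      have h1 := hg b hb
      rw [Finset.mem_insert, not_or] at hb
      rwa [qe_add_yexp _ _ hr, re_add_yexp _ _ hr, if_neg hb.1] at h1
  have hm : ∀ g (r : F3), monomial (g + yexp a) r = monomial g r * y a := fun g r => by
    rw [y_eq, monomial_mul, mul_one]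
  refine restrict_induction (P := fun p => ∃ α ∈ U J a, ∃ β ∈ U J a, ∃ γ ∈ U J a,
    p = α + β * y a + γ * y a ^ 2)
    ⟨0, zero_mem _, 0, zero_mem _, 0, zero_mem _, by ring⟩ ?_ (fun g hg r => ?_) hp
  · rintro _ _ ⟨v, hv, u, hu, w, hw, rfl⟩ ⟨v', hv', u', hu', w', hw', rfl⟩
    exact ⟨_, add_mem hv hv', _, add_mem hu hu', _, add_mem hw hw', by ring⟩
  · by_cases h : re a g = 0
    · exact ⟨monomial g r, monomial_mem (A := setU _ _) ((hU g hg h)), 0, zero_mem _, 0, zero_mem _,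
        by ring⟩
    · have hlt := re_lt a g
      obtain ⟨g, rfl, h'⟩ := exists_add_yexp h
      have hg := hy g (by omega) hg
      by_cases h : re a g = 0
      · exact ⟨0, zero_mem _, monomial g r, monomial_mem (A := setU _ _) ((hU g hg h)), 0, zero_mem _,
          by rw [hm]; ring⟩
      · obtain ⟨g, rfl, h''⟩ := exists_add_yexp h
        have hg := hy g (by omega) hg
        exact ⟨0, zero_mem _, 0, zero_mem _, monomial g r,
          monomial_mem (A := setU _ _) ((hU g hg (by omega))), by rw [hm, hm]; ring⟩

theorem mul_y_mem {J : Finset (κ × ℕ)} {a : κ × ℕ} {k : ℕ} (hk : k < 2) {p : MvPolynomial (κ × ℕ) F3}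
    (hp : p ∈ restrictSupport F3 {g | g ∈ setS (insert a J) ∧ re a g = k}) :
    p * y a ∈ restrictSupport F3 {g | g ∈ setS (insert a J) ∧ re a g = k + 1} := by
  refine mul_monomial_mem (B := {g | g ∈ setS (insert a J) ∧ re a g = k + 1})
    (fun g hg => ⟨fun b hb => ?_, ?_⟩) hp
  · change qe b (g + yexp a) = 0 ∧ re b (g + yexp a) = 0
    rw [qe_add_yexp _ _ (by rw [hg.2]; exact hk), re_add_yexp _ _ (by rw [hg.2]; exact hk)]
    have h1 := hg.1 b hb
    rw [Finset.mem_insert, not_or] at hb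
    rwa [if_neg hb.1]
  · change re a (g + yexp a) = k + 1
    rw [re_add_yexp _ _ (by rw [hg.2]; exact hk), if_pos rfl, hg.2]

theorem U_le' {J : Finset (κ × ℕ)} {a : κ × ℕ} {p : MvPolynomial (κ × ℕ) F3} (hp : p ∈ U J a) :
    p ∈ restrictSupport F3 {g | g ∈ setS (insert a J) ∧ re a g = 0} :=
  restrictSupport_mono F3 (t := {g | g ∈ setS (insert a J) ∧ re a g = 0})
    (fun _ hg => ⟨setU_sub J a hg, hg.2⟩) hp

theorem layer (J : Finset (κ × ℕ)) (a : κ × ℕ) (ha : a ∉ J) : PairLayer δ (x a) (y a) (S J) (U J a) where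
  δ_mul := δ_mul
  three := three_eq_zero _
  δ_y := δ_y a
  δ_x := δ_x a
  le := restrictSupport_mono F3 (setS_sub ha)
  δ_V _ := δ_mem_S J
  δ_U _ := δ_mem_U J a
  x_U _ hp := mul_monomial_mem (fun _ => add_xexp_mem_setU) hp
  split _ := split ha
  indep₂ v hv u hu h := by
    have h1 : u * x a ∈ restrictSupport F3 {g | qe a g ≠ 0} := by
      refine mul_monomial_mem (fun g _ => ?_) hu
      change qe a (g + xexp a) ≠ 0
      rw [qe_add_xexp, if_pos rfl]
      exact Nat.succ_ne_zero _
    have h2 := eq_zero_of_add hv h1 (fun g hg => not_not.2 (hg a ha).1) h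
    rw [h2, zero_add] at h
    refine ⟨h2, (mul_eq_zero.1 h).resolve_right ?_⟩
    rw [x]
    exact (monomial_eq_zero (R := F3)).not.2 one_ne_zero
  indep₃ α hα β hβ γ hγ h := by
    have h0 := U_le' hα
    have h1 := mul_y_mem (by norm_num) (U_le' hβ)
    have h2 := mul_y_mem (by norm_num) (mul_y_mem (by norm_num) (U_le' hγ))
    rw [mul_assoc, ← pow_two] at h2
    have hy : y a ≠ 0 := X_ne_zero _
    have hset : ∀ k, restrictSupport F3 {g | g ∈ setS (insert a J) ∧ re a g = k} ≤
        restrictSupport F3 {g | re a g = k} := fun k => restrictSupport_mono F3 fun g hg => hg.2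
    have hset' : ∀ k, 0 < k → restrictSupport F3 {g | g ∈ setS (insert a J) ∧ re a g = k} ≤
        restrictSupport F3 {g | re a g ≠ 0} := fun k hk => restrictSupport_mono F3 fun g hg => by
      change re a g ≠ 0
      rw [hg.2]; omega
    have e0 : α = 0 := eq_zero_of_add (hset 0 h0) (add_mem (hset' _ (by norm_num) h1)
      (hset' _ (by norm_num) h2)) (fun g hg => not_not.2 hg) (by rw [← add_assoc]; exact h)
    rw [e0, zero_add] at h
    have e1 : β * y a = 0 := eq_zero_of_add (hset _ h1) (hset _ h2) (fun g hg hg' => by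
      rw [Set.mem_ofPred_eq] at hg hg'; omega) h
    rw [e1, zero_add] at h
    exact ⟨e0, (mul_eq_zero.1 e1).resolve_right hy, (mul_eq_zero.1 h).resolve_right (pow_ne_zero 2 hy)⟩

theorem exhaust (p : MvPolynomial (κ × ℕ) F3) : ∃ J, p ∈ S J := by
  refine ⟨p.vars ∪ p.vars.image (fun a => (a.1, a.2 - 1)), fun g hg a ha => ?_⟩
  rw [Finset.notMem_union, Finset.mem_image] at ha
  have hv : ∀ a, a ∉ p.vars → g a = 0 := fun a ha => by
    by_contra h
    exact ha ((mem_vars_iff_mem_support a).2 ⟨g, hg, Finsupp.mem_support_iff.2 h⟩)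
  have h1 := hv _ ha.1
  have h2 := hv (a.1, a.2 + 1) fun h => ha.2 ⟨_, h, by simp⟩
  rw [qe, re, h1, h2]
  simp

theorem setS_empty {g : κ × ℕ →₀ ℕ} (hg : g ∈ setS ∅) : g = 0 := by
  ext ⟨c, m⟩
  rw [Finsupp.zero_apply]
  have h := fun a => hg a (Finset.notMem_empty a)
  cases m with
  | zero =>
    have := (h (c, 0)).1
    rwa [qe, if_pos rfl] at this
  | succ m =>
    have h1 := (h (c, m + 1)).1
    have h2 := (h (c, m)).2
    rw [qe, if_neg (Nat.succ_ne_zero m)] at h1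
    rw [re] at h2
    change g (c, m + 1) % 3 = 0 at h2
    omega

theorem S_empty {p : MvPolynomial (κ × ℕ) F3} (hp : p ∈ S (∅ : Finset (κ × ℕ))) : ∃ r, p = C r := by
  refine restrict_induction (P := fun p => ∃ r, p = C r) ⟨0, by rw [C_0]⟩ ?_ (fun g hg r => ?_) hp
  · rintro _ _ ⟨r, rfl⟩ ⟨s, rfl⟩
    exact ⟨r + s, by rw [C_add]⟩
  · exact ⟨r, by rw [setS_empty hg]; rfl⟩

theorem C_mem_S (J : Finset (κ × ℕ)) (r : F3) : C r ∈ S J :=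
  monomial_mem (A := setS _) (fun a _ => by simp [qe, re])

/-- The polynomial ring with the derivation `δ` is built up from the pairs of variables `x a`, `y a`. -/
def layering : Layering (κ × ℕ) (δ (κ := κ)) where
  x := x
  y := y
  S := S
  U := U
  layer := layer
  U_le J a _ := restrictSupport_mono F3 (setU_sub J a)
  mul_y J a _ p hp := restrictSupport_mono F3 (fun _ hg => hg.1) (mul_y_mem (by norm_num) (U_le' hp))
  expand _ _ _ _ := expand
  exhaust := exhaust
  δ_S J _ := δ_mem_S J
  one_mem J := by
    have := C_mem_S J 1
    rwa [C_1] at this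
  const p hp := by
    obtain ⟨r, rfl⟩ := S_empty hp
    exact δ_C r

end PairPoly

/-! ### The localized Ext rings over polynomial rings -/

/-- Transport of the ring `N` along an isomorphism. -/
def TateRing.transport {N N' W : Type} [CommRing N] [CommRing N'] [Ring W] (T : TateRing N W)
    (f : N' ≃+* N) (δ' : N' →+ N') (h : ∀ q, f (δ' q) = T.δ (f q)) : TateRing N' W where
  δ := δ'
  δ_mul m n := f.injective (by rw [h, map_mul, T.δ_mul, map_add, map_mul, map_mul, h, h])
  δ_three n := f.injective (by rw [h, h, h, T.δ_three, map_zero])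
  c0 n := T.c0 (f n)
  c1 n := T.c1 (f n)
  c0_one := by rw [map_one, T.c0_one]
  c0_add {m n} hm hn := by
    rw [map_add, T.c0_add] <;> rw [← h] <;> simp [hm, hn]
  c0_mul {m n} hm hn := by
    rw [map_mul, T.c0_mul] <;> rw [← h] <;> simp [hm, hn]
  c1_add {m n} hm hn := by
    rw [map_add, T.c1_add] <;> rw [← h, ← h] <;> simp [hm, hn]
  c0_δδ n := by rw [h, h, T.c0_δδ]
  c1_δ n := by rw [h, T.c1_δ]
  c1_mul_c0 {u n} hu hn := by
    rw [map_mul, T.c1_mul_c0] <;> rw [← h] <;> simp [← h, hu, hn]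
  c0_mul_c1 {u n} hu hn := by
    rw [map_mul, T.c0_mul_c1] <;> rw [← h] <;> simp [← h, hu, hn]
  b := T.b
  b_comm := T.b_comm
  c1_mul_c1 {u v} hu hv := by
    rw [map_sub, map_mul, map_mul, h, h, T.c1_mul_c1] <;> rw [← h, ← h] <;> simp [hu, hv]
  sign := T.sign
  sign_b := T.sign_b
  sign_c0 {n} hn := T.sign_c0 (by rw [← h, hn, map_zero])
  sign_c1 {u} hu := T.sign_c1 (by rw [← h, ← h, hu, map_zero])
  exists_rep w := by
    obtain ⟨n, u, h0, h1, s, hs, hw⟩ := T.exists_rep w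
    refine ⟨fun k => f.symm (n k), fun k => f.symm (u k), fun k => f.injective ?_, fun k => f.injective ?_,
      s, fun k hk => ?_, ?_⟩
    · rw [h, f.apply_symm_apply, h0, map_zero]
    · rw [h, h, f.apply_symm_apply, h1, map_zero]
    · simp only [hs k hk, map_zero, and_self]
    · simpa only [f.apply_symm_apply] using hw
  rep_zero n u h' k := by
    obtain ⟨h0, h1, s, hs, hw⟩ := h'
    have := T.rep_zero (fun k => f (n k)) (fun k => f (u k))
      ⟨fun k => by rw [← h, h0, map_zero], fun k => by rw [← h, ← h, h1, map_zero], s,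
        fun k hk => by simp only [hs k hk, map_zero, and_self], hw⟩ k
    obtain ⟨⟨m, hm⟩, m', hm'⟩ := this
    refine ⟨⟨f.symm m, f.injective ?_⟩, f.symm m', f.injective ?_⟩
    · rw [h, h, f.apply_symm_apply, hm]
    · rw [h, f.apply_symm_apply, hm']

namespace PairPoly
open MvPolynomial
variable {κ N : Type} [DecidableEq κ] [CommRing N] [Algebra F3 N]

/-- An isomorphism that is compatible with the derivations on the generators is compatible with the
derivations. -/
theorem map_δ (E : MvPolynomial (κ × ℕ) F3 →ₐ[F3] N) (D : N →ₗ[F3] N)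
    (hD : ∀ m n, D (m * n) = D m * n + m * D n)
    (h : ∀ a, D (E (X a)) = E (dX a)) (q : MvPolynomial (κ × ℕ) F3) : E (δ q) = D (E q) := by
  have h1 : D 1 = 0 := by
    have := hD 1 1
    rwa [mul_one, mul_one, one_mul, left_eq_add] at this
  induction q using MvPolynomial.induction_on with
  | C r => rw [δ_C, map_zero, ← algebraMap_eq, AlgHom.commutes, Algebra.algebraMap_eq_smul_one, map_smul,
      h1, smul_zero]
  | add p q hp hq => rw [map_add, map_add, map_add, map_add, hp, hq]
  | mul_X p a hp => rw [δ_mul, map_add, map_mul, map_mul, map_mul, hD, hp, δ_X, h]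

end PairPoly

namespace BB

theorem gen_zero : gen 0 = xiCube 0 := rfl
theorem gen_succ (m : ℕ) : gen (m + 1) = xi m := rfl
theorem xiCube_succ (m : ℕ) : xiCube (m + 1) = gen (m + 1) ^ 3 := rfl

/-- The image of `x m` for the isomorphism of `B` with a polynomial ring. -/
theorem xiCube_eq (m : ℕ) : xiCube m = gen m ^ (if m = 0 then 1 else 3) := by
  cases m with
  | zero => rw [if_pos rfl, pow_one, gen_zero]
  | succ m => rw [if_neg (Nat.succ_ne_zero m), xiCube_succ]

theorem δ_gen (m : ℕ) : DualD.coDer.δ BB (gen m) = if m = 0 then 0 else xiCube (m - 1) := by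
  cases m with
  | zero => rw [if_pos rfl, gen_zero, δ_D_xiCube]
  | succ m => rw [if_neg (Nat.succ_ne_zero m), gen_succ, δ_D_xi, Nat.add_sub_cancel]

open MvPolynomial in
/-- `B` as a polynomial ring in pairs of variables. -/
def pairEquiv : MvPolynomial (Fin 1 × ℕ) F3 ≃ₐ[F3] BB :=
  (renameEquiv F3 (Equiv.uniqueProd ℕ (Fin 1))).trans polyEquiv

theorem pairEquiv_X (a : Fin 1 × ℕ) : pairEquiv (MvPolynomial.X a) = gen a.2 := by
  refine Eq.trans ?_ (polyEquiv_X a.2)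
  exact congrArg polyEquiv (MvPolynomial.rename_X _ _)

theorem pairEquiv_x (a : Fin 1 × ℕ) : pairEquiv (PairPoly.x a) = xiCube a.2 := by
  rw [PairPoly.x_eq, map_pow, pairEquiv_X, xiCube_eq]

theorem pairEquiv_y (a : Fin 1 × ℕ) : pairEquiv (PairPoly.y a) = xi a.2 := pairEquiv_X _

theorem pairEquiv_δ (q : MvPolynomial (Fin 1 × ℕ) F3) :
    pairEquiv (PairPoly.δ q) = DualD.coDer.δ BB (pairEquiv q) := by
  refine PairPoly.map_δ pairEquiv.toAlgHom (DualD.coDer.δ BB) DualD.coDer.δ_mul (fun a => ?_) q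
  change DualD.coDer.δ BB (pairEquiv (MvPolynomial.X a)) = pairEquiv (PairPoly.dX a)
  rw [pairEquiv_X, δ_gen, PairPoly.dX]
  split_ifs
  · rw [map_zero]
  · rw [pairEquiv_x]

end BB

namespace TPow

/-- The element of `B^{⊗ n}` with the `m`-th generator in the factor `k - 1`, and `0` for `k = 0`. -/
def pt (n : ℕ) : ℕ → BB → TPow BB n
  | 0, _ => 0
  | k + 1, x => if h : k < n then incl ⟨k, h⟩ x else 0

theorem pt_zero (n : ℕ) (x : BB) : pt n 0 x = 0 := rfl

theorem pt_succ {n k : ℕ} (h : k < n) (x : BB) : pt n (k + 1) x = incl ⟨k, h⟩ x := dif_pos h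

theorem δ_pt (n k : ℕ) (x : BB) : DualP.coDer.δ (TPow BB n) (pt n k x) = pt n k (DualD.coDer.δ BB x) := by
  cases k with
  | zero => exact map_zero _
  | succ k =>
    rw [pt, pt]
    split_ifs
    · exact BB.δ_incl _ _
    · exact map_zero _

theorem pt_pow (n k : ℕ) (x : BB) {l : ℕ} (hl : l ≠ 0) : pt n k (x ^ l) = pt n k x ^ l := by
  cases k with
  | zero => rw [pt_zero, pt_zero, zero_pow hl]
  | succ k =>
    rw [pt, pt]
    split_ifs
    · exact map_pow _ _ _
    · rw [zero_pow hl]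

theorem pt_map_zero (n k : ℕ) : pt n k 0 = 0 := by
  cases k with
  | zero => rfl
  | succ k =>
    rw [pt]
    split_ifs
    · exact map_zero _
    · rfl

/-- The generators of `B^{⊗ n}`: the differences of the generators of neighbouring factors. -/
def diff (n : ℕ) (c : ℕ) (x : BB) : TPow BB n := pt n (c + 1) x - pt n c x

/-- The map from a polynomial ring to `B^{⊗ n}`. -/
def pres (n : ℕ) : MvPolynomial (Fin n × ℕ) F3 →ₐ[F3] TPow BB n :=
  MvPolynomial.aeval fun a => diff n a.1 (BB.gen a.2)

theorem pres_X {n : ℕ} (a : Fin n × ℕ) : pres n (MvPolynomial.X a) = diff n a.1 (BB.gen a.2) :=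
  MvPolynomial.aeval_X _ _

/-- A partial sum of variables. -/
def psum (n k m : ℕ) : MvPolynomial (Fin n × ℕ) F3 :=
  ∑ j ∈ Finset.range k, if h : j < n then MvPolynomial.X (⟨j, h⟩, m) else 0

theorem pres_psum {n k : ℕ} (m : ℕ) (hk : k ≤ n) : pres n (psum n k m) = pt n k (BB.gen m) := by
  rw [psum, map_sum, ← sub_zero (pt n k (BB.gen m)), ← pt_zero n (BB.gen m),
    ← Finset.sum_range_sub (fun k => pt n k (BB.gen m))]
  refine Finset.sum_congr rfl fun j hj => ?_
  rw [Finset.mem_range] at hj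
  rw [dif_pos (hj.trans_le hk), pres_X]
  rfl

/-- The inverse of the map from a polynomial ring to `B^{⊗ n}`. -/
def presInv (n : ℕ) : TPow BB n →ₐ[F3] MvPolynomial (Fin n × ℕ) F3 :=
  lift fun c => (MvPolynomial.aeval fun m => psum n (c + 1) m).comp (BB.polyEquiv.symm : BB →ₐ[F3] _)

theorem presInv_incl {n : ℕ} (c : Fin n) (m : ℕ) : presInv n (incl c (BB.gen m)) = psum n (c + 1) m := by
  rw [presInv, lift_incl, ← BB.polyEquiv_X, AlgHom.comp_apply]
  refine Eq.trans (congrArg _ (AlgEquiv.symm_apply_apply _ _)) (MvPolynomial.aeval_X _ _)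

theorem presInv_pt {n k : ℕ} (m : ℕ) (hk : k ≤ n) : presInv n (pt n k (BB.gen m)) = psum n k m := by
  cases k with
  | zero => rw [pt_zero, map_zero]; rfl
  | succ k => rw [pt_succ hk, presInv_incl]

theorem presInv_pres {n : ℕ} (q : MvPolynomial (Fin n × ℕ) F3) : presInv n (pres n q) = q := by
  induction q using MvPolynomial.induction_on with
  | C r => rw [← MvPolynomial.algebraMap_eq, AlgHom.commutes, AlgHom.commutes]
  | add p q hp hq => rw [map_add, map_add, hp, hq]
  | mul_X p a hp =>
    rw [map_mul, map_mul, hp, pres_X, diff, map_sub, presInv_pt _ a.1.2, presInv_pt _ a.1.2.le, psum, psum,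
        Finset.sum_range_succ, add_sub_cancel_left, dif_pos a.1.2]

theorem pres_presInv_incl {n : ℕ} (c : Fin n) (q : MvPolynomial ℕ F3) :
    pres n (presInv n (incl c (BB.polyEquiv q))) = incl c (BB.polyEquiv q) := by
  induction q using MvPolynomial.induction_on with
  | C r =>
    rw [← MvPolynomial.algebraMap_eq]
    refine (congrArg (fun x => pres n (presInv n (incl c x))) (AlgEquiv.commutes _ _)).trans ?_
    refine Eq.trans ?_ (congrArg (incl c) (AlgEquiv.commutes _ _)).symm
    rw [AlgHom.commutes, AlgHom.commutes, AlgHom.commutes]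
  | add p q hp hq => rw [map_add, map_add, map_add, map_add, hp, hq]
  | mul_X p m hp =>
    rw [map_mul, map_mul, map_mul, map_mul, hp, BB.polyEquiv_X, presInv_incl, pres_psum _ c.2, pt_succ c.2]

theorem pres_presInv {n : ℕ} (x : TPow BB n) : pres n (presInv n x) = x := by
  have h : (pres n).comp (presInv n) = AlgHom.id F3 _ := hom_ext fun c x => by
    obtain ⟨q, rfl⟩ := BB.polyEquiv.surjective x
    exact pres_presInv_incl c q
  exact DFunLike.congr_fun h x

/-- `B^{⊗ n}` as a polynomial ring in pairs of variables. -/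
def pairEquiv (n : ℕ) : MvPolynomial (Fin n × ℕ) F3 ≃ₐ[F3] TPow BB n :=
  { pres n with
    invFun := presInv n
    left_inv := presInv_pres
    right_inv := pres_presInv }

theorem pairEquiv_X {n : ℕ} (a : Fin n × ℕ) : pairEquiv n (MvPolynomial.X a) = diff n a.1 (BB.gen a.2) :=
  pres_X a

theorem pairEquiv_y {n : ℕ} (a : Fin n × ℕ) : pairEquiv n (PairPoly.y a) = diff n a.1 (BB.xi a.2) :=
  pairEquiv_X _

theorem pairEquiv_x {n : ℕ} (a : Fin n × ℕ) : pairEquiv n (PairPoly.x a) = diff n a.1 (BB.xiCube a.2) := by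
  rw [PairPoly.x_eq, map_pow, pairEquiv_X, BB.xiCube_eq, diff, diff]
  split_ifs
  · rw [pow_one, pow_one]
  · rw [pt_pow _ _ _ (by norm_num), pt_pow _ _ _ (by norm_num), sub_eq_add_neg, DualP.add_cube,
      Odd.neg_pow (by decide), ← sub_eq_add_neg]

theorem pairEquiv_δ {n : ℕ} (q : MvPolynomial (Fin n × ℕ) F3) :
    pairEquiv n (PairPoly.δ q) = DualP.coDer.δ (TPow BB n) (pairEquiv n q) := by
  refine PairPoly.map_δ (pres n) (DualP.coDer.δ (TPow BB n)) DualP.coDer.δ_mul (fun a => ?_) q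
  change DualP.coDer.δ (TPow BB n) (pairEquiv n (MvPolynomial.X a)) = pairEquiv n (PairPoly.dX a)
  rw [pairEquiv_X, diff, map_sub, δ_pt, δ_pt, BB.δ_gen, PairPoly.dX]
  split_ifs
  · rw [map_zero, pt_map_zero, pt_map_zero, sub_zero]
  · rw [pairEquiv_x, diff]

end TPow

/-- The ring `π_{**}(K^{⊗(n+1)})` in terms of the derivation of a polynomial ring. -/
def KX.tate (n : ℕ) : TateRing (MvPolynomial (Fin n × ℕ) F3) (KX (n + 1)) :=
  (TPow.coRes n).tate.transport (TPow.pairEquiv n).toRingEquiv PairPoly.δ TPow.pairEquiv_δ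

/-- The ring `b₁₀⁻¹ Ext_D(k, B)` in terms of the derivation of a polynomial ring. -/
def BB.tate : TateRing (MvPolynomial (Fin 1 × ℕ) F3) (BExt DualD BB) :=
  (DualD.coRes BB).tate.transport BB.pairEquiv.toRingEquiv PairPoly.δ BB.pairEquiv_δ

/-! ### The exterior generators -/

namespace BB

/-- `ξ_m³` as an element of `B`. -/
def cube : ℕ → BB
  | 0 => 1
  | m + 1 => xiCube m

theorem coe_cube (m : ℕ) : (cube m : DualP) = DualP.xi m ^ 3 := by
  cases m with
  | zero => rw [DualP.xi_zero, one_pow]; rfl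
  | succ m => rfl

theorem cotensor_xiCube (m : ℕ) : Cotensor.coact DualP.toD (xiCube m) = 1 ⊗ₜ xiCube m +
    ∑ i ∈ Finset.range (m + 1), (DualP.xi (i + 1) ^ 3) ⊗ₜ (cube (m - i) ^ 3 ^ (i + 1)) := by
  refine Cotensor.incl_injective DualP.toD ((Cotensor.incl_coact _ _).trans ?_)
  rw [map_add, map_sum]
  refine (map_pow (Bialgebra.comulAlgHom F3 DualP) (DualP.xi (m + 1)) 3).trans ?_
  refine (congrArg (· ^ 3) (DualP.comul_xi (m + 1))).trans ?_
  refine (DualP.sum_pow (Finset.range (m + 1 + 1)) _ 1).trans ?_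
  rw [Finset.sum_range_succ', add_comm]
  refine congrArg₂ (· + ·) ?_ (Finset.sum_congr rfl fun i hi => ?_)
  · rw [Algebra.TensorProduct.tmul_pow, pow_zero, pow_one, pow_one, DualP.xi_zero, one_pow]
    rfl
  · rw [Algebra.TensorProduct.tmul_pow, pow_one, Nat.add_sub_add_right]
    refine congrArg (fun z => (DualP.xi (i + 1) ^ 3) ⊗ₜ[F3] z) ?_
    change _ = ((cube (m - i) : DualP)) ^ 3 ^ (i + 1)
    rw [coe_cube, ← pow_mul, ← pow_mul, mul_comm]

theorem cotensor_xi (m : ℕ) : Cotensor.coact DualP.toD (xi m) = 1 ⊗ₜ xi m +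
    DualP.xi 1 ⊗ₜ xiCube m +
    ∑ i ∈ Finset.range (m + 1), DualP.xi (i + 2) ⊗ₜ (cube (m - i) ^ 3 ^ (i + 1)) := by
  refine Cotensor.incl_injective DualP.toD ((Cotensor.incl_coact _ _).trans ?_)
  rw [map_add, map_add, map_sum]
  refine (DualP.comul_xi (m + 2)).trans ?_
  rw [Finset.sum_range_succ', Finset.sum_range_succ', add_comm, add_comm (Finset.sum _ _), ← add_assoc]
  refine congrArg₂ (· + ·) (congrArg₂ (· + ·) ?_ ?_) (Finset.sum_congr rfl fun i hi => ?_)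
  · rw [pow_zero, pow_one, DualP.xi_zero]
    rfl
  · rfl
  · rw [Nat.add_sub_add_right]
    refine congrArg (fun z => DualP.xi (i + 2) ⊗ₜ[F3] z) ?_
    change _ = ((cube (m - i) : DualP)) ^ 3 ^ (i + 1)
    rw [coe_cube, ← pow_mul, ← pow_succ']

theorem counit_xi (m : ℕ) : Coalgebra.counit (R := F3) ((xi m : BB) : DualP) = 0 := DualP.counit_xi (m + 2)

theorem counit_xiCube (m : ℕ) : Coalgebra.counit (R := F3) ((xiCube m : BB) : DualP) = 0 := by
  refine (map_pow (Bialgebra.counitAlgHom F3 DualP) (DualP.xi (m + 1)) 3).trans ?_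
  have h : Bialgebra.counitAlgHom F3 DualP (DualP.xi (m + 1)) = 0 := DualP.counit_xi (m + 1)
  rw [h, zero_pow (by norm_num)]

end BB

namespace TPow

/-- The primitive elements `q_m` of `B ⊗ B` with `Σᵢ (ξ_i³ ⊗ 1) q_{m-i}^{3^i} = 1 ⊗ ξ_m³`. -/
def prim : ℕ → TPow BB 2
  | 0 => 1
  | m + 1 => incl 1 (BB.xiCube m) -
      ∑ i : Fin (m + 1), incl 0 (BB.xiCube i) * prim (m - i) ^ 3 ^ (i + 1 : ℕ)

theorem prim_zero : prim 0 = 1 := by rw [prim.eq_def]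

theorem prim_succ (m : ℕ) : prim (m + 1) = incl 1 (BB.xiCube m) -
    ∑ i ∈ Finset.range (m + 1), incl 0 (BB.xiCube i) * prim (m - i) ^ 3 ^ (i + 1) := by
  rw [prim.eq_def, Finset.sum_range]

/-- The elements of `B ⊗ B` that lift the generators: `ξ_n ↦ 1 ⊗ ξ_n - Σ_{i ≥ 2} (ξ_i ⊗ 1) q_{n-i}^{3^{i-1}}`, for
`n = m + 2`. -/
def coprim (m : ℕ) : TPow BB 2 := incl 1 (BB.xi m) -
    ∑ i ∈ Finset.range (m + 1), incl 0 (BB.xi i) * prim (m - i) ^ 3 ^ (i + 1)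

theorem coact_incl_one (x : BB) : coind 1 (incl 1 x) =
    Algebra.TensorProduct.map (AlgHom.id F3 DualP) (incl 0) (Cotensor.coact DualP.toD x) :=
  (coind_succ 0 x).trans (coact_incl 0 x)

theorem coind_prim (m : ℕ) : coind 1 (prim m) = 1 ⊗ₜ incl 0 (BB.cube m) := by
  induction m using Nat.strong_induction_on with
  | _ m ih =>
    cases m with
    | zero => rw [prim_zero, map_one, Algebra.TensorProduct.one_def]; exact congrArg _ (map_one _).symm
    | succ m =>
      rw [prim_succ, map_sub, coact_incl_one, BB.cotensor_xiCube, map_add, map_sum, map_sum,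
        Algebra.TensorProduct.map_tmul, add_sub_assoc]
      refine (congrArg₂ (· + ·) rfl (sub_eq_zero.2 (Finset.sum_congr rfl fun i hi => ?_))).trans
        (add_zero _)
      rw [map_mul, map_pow, ih (m - i) (by omega), coind_zero, Algebra.TensorProduct.tmul_pow,
        Algebra.TensorProduct.tmul_mul_tmul, Algebra.TensorProduct.map_tmul, map_pow (incl (0 : Fin 1)), one_pow,
        mul_one, one_mul]
      rfl

theorem coind_coprim (m : ℕ) : coind 1 (coprim m) = 1 ⊗ₜ incl 0 (BB.xi m) +
    DualP.xi 1 ⊗ₜ incl 0 (BB.xiCube m) := by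
  rw [coprim, map_sub, coact_incl_one, BB.cotensor_xi, map_add, map_add, map_sum, map_sum,
    Algebra.TensorProduct.map_tmul, Algebra.TensorProduct.map_tmul, add_sub_assoc]
  refine (congrArg₂ (· + ·) rfl (sub_eq_zero.2 (Finset.sum_congr rfl fun i hi => ?_))).trans
    (add_zero _)
  rw [map_mul, map_pow, coind_prim, coind_zero, Algebra.TensorProduct.tmul_pow,
    Algebra.TensorProduct.tmul_mul_tmul, Algebra.TensorProduct.map_tmul, map_pow (incl (0 : Fin 1)), one_pow,
    mul_one, one_mul]
  rfl

/-- The coaction on `B ⊗ B` can be computed in the coinduced comodule algebra `P ⊗ B`. -/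
theorem eq_of_coind {x : TPow BB 2} {y : DualP ⊗[F3] TPow BB 2} (h : (ComodAlg.coact (coind 1 x) :
    DualP ⊗[F3] (DualP ⊗[F3] TPow BB 1)) = Algebra.TensorProduct.map (AlgHom.id F3 DualP) (coind 1) y) :
    ComodAlg.coact x = y := by
  refine (Module.Flat.lTensor_preserves_injective_linearMap (M := DualP)
    (coind 1).toLinearMap (coRes 1).inj) ?_
  exact (coind_compat 1 x).symm.trans h

theorem coact_prim (m : ℕ) : (ComodAlg.coact (prim m) : DualP ⊗[F3] TPow BB 2) = 1 ⊗ₜ prim m := by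
  refine eq_of_coind ?_
  rw [coind_prim, ComodAlg.coind_coact, Bialgebra.comul_one, Algebra.TensorProduct.map_tmul, coind_prim]
  rfl

theorem coact_coprim (m : ℕ) : (ComodAlg.coact (coprim m) : DualP ⊗[F3] TPow BB 2) =
    1 ⊗ₜ coprim m + HasXi.xi ⊗ₜ prim (m + 1) := by
  have h : Coalgebra.comul (R := F3) (DualP.xi 1) = DualP.xi 1 ⊗ₜ[F3] 1 + 1 ⊗ₜ[F3] DualP.xi 1 :=
    HasXi.comul_xi
  refine eq_of_coind ?_
  rw [coind_coprim, map_add, map_add, ComodAlg.coind_coact, ComodAlg.coind_coact, Bialgebra.comul_one,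
    Algebra.TensorProduct.map_tmul, Algebra.TensorProduct.map_tmul, coind_prim, coind_coprim, h]
  change (1 : DualP) ⊗ₜ[F3] ((1 : DualP) ⊗ₜ[F3] incl 0 (BB.xi m)) +
    Algebra.TensorProduct.assoc F3 F3 F3 DualP DualP (TPow BB 1)
      ((DualP.xi 1 ⊗ₜ[F3] 1 + 1 ⊗ₜ[F3] DualP.xi 1) ⊗ₜ incl 0 (BB.xiCube m)) =
    (1 : DualP) ⊗ₜ[F3] (1 ⊗ₜ[F3] incl 0 (BB.xi m) + DualP.xi 1 ⊗ₜ[F3] incl 0 (BB.xiCube m)) +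
    DualP.xi 1 ⊗ₜ[F3] (1 ⊗ₜ[F3] incl 0 (BB.xiCube m))
  rw [TensorProduct.add_tmul, map_add, Algebra.TensorProduct.assoc_tmul, Algebra.TensorProduct.assoc_tmul,
    TensorProduct.tmul_add, add_assoc, add_comm (DualP.xi 1 ⊗ₜ[F3] _)]

end TPow

namespace BExt
variable {H N : Type} [CommRing H] [Bialgebra F3 H] [CommRing N] [Algebra F3 N] [ComodAlg H N] [HasXi H]

/-- The cochain `[ξ₁]m - [ξ₁²]m'`. -/
def pair (m m' : N) : Cobar H N :=
  Cobar.cons HasXi.xi (Cobar.ofN m) - Cobar.cons (HasXi.xi ^ 2) (Cobar.ofN m')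

end BExt

namespace KX

theorem d_pair {n : ℕ} {m m' : TPow BB (n + 1)}
    (h : (ComodAlg.coact m : DualP ⊗[F3] TPow BB (n + 1)) = 1 ⊗ₜ m + HasXi.xi ⊗ₜ m')
    (h' : (ComodAlg.coact m' : DualP ⊗[F3] TPow BB (n + 1)) = 1 ⊗ₜ m') :
    Cobar.d (BExt.pair (H := DualP) m m') = 0 :=
  (TPow.coRes n).res.d_of_one ((TPow.coRes n).d_pair h h')

/-- The class `e_{m+2}`, given by the cocycle `[ξ₁]a - [ξ₁²]q` with `a` and `q` as above. -/
def e (m : ℕ) : KX 2 := BExt.cls (BExt.pair (TPow.coprim m) (TPow.prim (m + 1)))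
  (d_pair (TPow.coact_coprim m) (TPow.coact_prim (m + 1)))

end KX

theorem TPow.ev_incl {n : ℕ} (i : Fin (n + 1)) (x : BB) (hx : Coalgebra.counit (R := F3) (x : DualP) = 0) :
    (TPow.coRes n).ev (TPow.incl i x) = TPow.pt n i x := by
  refine Fin.cases ?_ (fun i => ?_) i
  · rw [TPow.ev_zero, hx, map_zero]; rfl
  · rw [TPow.ev_succ]; exact (TPow.pt_succ i.2 x).symm

namespace TatePre
variable {N W : Type} [CommRing N] [Ring W] (T : TatePre N W)

/-- If `δ² y = 0` then `y δ² w = δ (y δ w - δ y w)`. -/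
theorem c1_mul_δδ {y : N} (hy : T.δ (T.δ y) = 0) (w : N) : T.c1 (y * T.δ (T.δ w)) = 0 := by
  rw [← T.c1_δ (y * T.δ w - T.δ y * w)]
  refine congrArg T.c1 ?_
  rw [map_sub, T.δ_mul, T.δ_mul, hy]
  ring

theorem c1_sum {ι : Type} (s : Finset ι) (u : ι → N) (h : ∀ i ∈ s, T.δ (T.δ (u i)) = 0) :
    T.c1 (∑ i ∈ s, u i) = ∑ i ∈ s, T.c1 (u i) := by
  classical
  induction s using Finset.induction_on with
  | empty => rw [Finset.sum_empty, Finset.sum_empty, T.c1_zero]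
  | insert a s ha ih =>
    rw [Finset.sum_insert ha, Finset.sum_insert ha, T.c1_add (h a (Finset.mem_insert_self _ _)),
      ih fun i hi => h i (Finset.mem_insert_of_mem hi)]
    rw [map_sum, map_sum]
    exact Finset.sum_eq_zero fun i hi => h i (Finset.mem_insert_of_mem hi)

theorem δ_pow {q : N} (h : T.δ q = 0) (k : ℕ) : T.δ (q ^ k) = 0 := by
  induction k with
  | zero =>
    have := T.δ_mul 1 1
    rw [pow_zero]
    rwa [mul_one, mul_one, one_mul, left_eq_add] at this
  | succ k ih => rw [pow_succ, T.δ_mul, ih, h, zero_mul, mul_zero, add_zero]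

theorem δδ_mul {n w : N} (h : T.δ n = 0) : T.δ (T.δ (w * n)) = T.δ (T.δ w) * n := by
  rw [T.δ_mul, h, mul_zero, add_zero, T.δ_mul, h, mul_zero, add_zero]

theorem c1_sub {m n : N} (hm : T.δ (T.δ m) = 0) (hn : T.δ (T.δ n) = 0) :
    T.c1 (m - n) = T.c1 m - T.c1 n := by
  rw [sub_eq_add_neg, T.c1_add hm (by rw [map_neg, map_neg, hn, neg_zero]), T.c1_neg hn, ← sub_eq_add_neg]

end TatePre

namespace KX
open TPow

/-- The element of `Ext¹` represented by `ξ_{m+2}` in the factor `k - 1` of `B^{⊗ n}`, which corresponds to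
the factor `k` of `B^{⊗(n+1)}`. It is `0` for `k = 0`: the evaluation `ev` uses up the first factor. -/
def v (n k m : ℕ) : KX (n + 1) := (coRes n).tate.c1 (pt n k (BB.xi m))

theorem δ_pt_xi (n k m : ℕ) : (coRes n).tate.δ (pt n k (BB.xi m)) = pt n k (BB.xiCube m) :=
  (δ_pt n k _).trans (congrArg _ (BB.δ_D_xi m))

theorem δ_pt_xiCube (n k m : ℕ) : (coRes n).tate.δ (pt n k (BB.xiCube m)) = 0 :=
  (δ_pt n k _).trans ((congrArg _ (BB.δ_D_xiCube m)).trans (pt_map_zero _ _))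

theorem δδ_pt_xi (n k m : ℕ) : (coRes n).tate.δ ((coRes n).tate.δ (pt n k (BB.xi m))) = 0 := by
  rw [δ_pt_xi, δ_pt_xiCube]

/-- The cube of `x = δ y` is `δ²(-y² x)`, in characteristic `3`. -/
theorem exists_δδ_cube (n k m : ℕ) :
    ∃ w, (coRes n).tate.δ ((coRes n).tate.δ w) = pt n k (BB.xiCube m) ^ 3 := by
  refine ⟨-(pt n k (BB.xi m)) ^ 2 * pt n k (BB.xiCube m), ?_⟩
  rw [TatePre.δδ_mul _ (δ_pt_xiCube n k m), map_neg, map_neg, pow_two, TatePre.δ_mul, map_add,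
    TatePre.δ_mul, TatePre.δ_mul, δ_pt_xi, δ_pt_xiCube]
  linear_combination (-(pt n k (BB.xiCube m)) ^ 3) * three_eq_zero (TPow BB n)

section
variable {n : ℕ} (f : Fin 2 → Fin (n + 1))

/-- The image of `q_m` for the evaluation. -/
def evPrim (m : ℕ) : TPow BB n := (coRes n).ev (TPow.map f (prim m))

theorem map_coact {x y : TPow BB 2} (h : (ComodAlg.coact x : DualP ⊗[F3] TPow BB 2) =
    1 ⊗ₜ x + HasXi.xi ⊗ₜ y) : (ComodAlg.coact (TPow.map f x) : DualP ⊗[F3] TPow BB (n + 1)) =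
    1 ⊗ₜ TPow.map f x + HasXi.xi ⊗ₜ TPow.map f y := by
  refine ((map_compat (H := DualP) f x).trans (congrArg _ h)).trans ?_
  rw [map_add]
  rfl

theorem map_coact' {x : TPow BB 2} (h : (ComodAlg.coact x : DualP ⊗[F3] TPow BB 2) =
    1 ⊗ₜ x) : (ComodAlg.coact (TPow.map f x) : DualP ⊗[F3] TPow BB (n + 1)) =
    1 ⊗ₜ TPow.map f x :=
  (map_compat (H := DualP) f x).trans (congrArg _ h)

theorem δ_evPrim (m : ℕ) : (coRes n).tate.δ (evPrim f m) = 0 := by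
  refine ((coRes n).δ_ev_of_coact (m' := 0) ?_).trans (map_zero _)
  rw [TensorProduct.tmul_zero, add_zero]
  exact map_coact' f (coact_prim m)

theorem evPrim_zero : evPrim f 0 = 1 := by
  rw [evPrim, prim_zero, map_one, map_one]

theorem ev_map_incl (i : Fin 2) (x : BB) (hx : Coalgebra.counit (R := F3) (x : DualP) = 0) :
    (coRes n).ev (TPow.map f (incl i x)) = pt n (f i) x :=
  (congrArg _ (lift_incl _ _ _)).trans (ev_incl _ _ hx)

theorem evPrim_succ (m : ℕ) : evPrim f (m + 1) = pt n (f 1) (BB.xiCube m) -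
    ∑ i ∈ Finset.range (m + 1), pt n (f 0) (BB.xiCube i) * evPrim f (m - i) ^ 3 ^ (i + 1) := by
  rw [evPrim, prim_succ, map_sub, map_sub, map_sum, map_sum, ev_map_incl _ _ _ (BB.counit_xiCube m)]
  refine congrArg _ (Finset.sum_congr rfl fun i _ => ?_)
  rw [map_mul, map_mul, map_pow, map_pow, ev_map_incl _ _ _ (BB.counit_xiCube i)]
  rfl

theorem ev_coprim (m : ℕ) : (coRes n).ev (TPow.map f (coprim m)) = pt n (f 1) (BB.xi m) -
    ∑ i ∈ Finset.range (m + 1), pt n (f 0) (BB.xi i) * evPrim f (m - i) ^ 3 ^ (i + 1) := by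
  rw [coprim, map_sub, map_sub, map_sum, map_sum, ev_map_incl _ _ _ (BB.counit_xi m)]
  refine congrArg _ (Finset.sum_congr rfl fun i _ => ?_)
  rw [map_mul, map_mul, map_pow, map_pow, ev_map_incl _ _ _ (BB.counit_xi i)]
  rfl

theorem exists_δδ_evPrim (m : ℕ) :
    ∃ w, (coRes n).tate.δ ((coRes n).tate.δ w) = evPrim f (m + 1) ^ 3 := by
  have h1 : evPrim f (m + 1) ^ 3 = pt n (f 1) (BB.xiCube m) ^ 3 +
      ∑ i ∈ Finset.range (m + 1), pt n (f 0) (BB.xiCube i) ^ 3 *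
        -((evPrim f (m - i) ^ 3 ^ (i + 1)) ^ 3) := by
    have h2 := DualP.sum_pow (Finset.range (m + 1))
      (fun i => pt n (f 0) (BB.xiCube i) * evPrim f (m - i) ^ 3 ^ (i + 1)) 1
    rw [pow_one] at h2
    rw [evPrim_succ, sub_eq_add_neg, DualP.add_cube, Odd.neg_pow (by decide), h2, ← Finset.sum_neg_distrib]
    refine congrArg _ (Finset.sum_congr rfl fun i _ => ?_)
    rw [mul_pow, mul_neg]
  choose w hw using exists_δδ_cube n
  refine ⟨w (f 1) m + ∑ i ∈ Finset.range (m + 1), w (f 0) i *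
    -((evPrim f (m - i) ^ 3 ^ (i + 1)) ^ 3), ?_⟩
  rw [map_add, map_add, map_sum, map_sum, hw, h1]
  refine congrArg _ (Finset.sum_congr rfl fun i _ => ?_)
  rw [TatePre.δδ_mul, hw]
  rw [map_neg, TatePre.δ_pow _ (TatePre.δ_pow _ (δ_evPrim f _) _), neg_zero]

/-- The terms of `ev a` that are products vanish in cohomology, as `ξ_i⁹ = δ²(-ξ_{i+1}² ξ_i³)`. -/
theorem c1_mul_evPrim {i m : ℕ} (k : ℕ) (h : i < m) :
    (coRes n).tate.c1 (pt n k (BB.xi i) * evPrim f (m - i) ^ 3 ^ (i + 1)) = 0 := by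
  obtain ⟨l, hl⟩ : ∃ l, m - i = l + 1 := ⟨m - i - 1, by omega⟩
  obtain ⟨w, hw⟩ := exists_δδ_evPrim f l
  obtain ⟨r, hr⟩ : ∃ r, 3 ^ (i + 1) = 3 + r := ⟨3 ^ (i + 1) - 3, by
    have : 3 ^ 1 ≤ 3 ^ (i + 1) := Nat.pow_le_pow_right (by norm_num) (by omega)
    omega⟩
  rw [hl, hr, pow_add, ← hw, ← TatePre.δδ_mul _ (TatePre.δ_pow _ (δ_evPrim f _) _)]
  exact TatePre.c1_mul_δδ _ (δδ_pt_xi n k i) _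

/-- The class `e_{m+2}` behaves like the difference `1 ⊗ ξ_{m+2} - ξ_{m+2} ⊗ 1`. All its values under the
structure maps follow from this formula. -/
theorem map_e (m : ℕ) : map f (e m) = v n (f 1) m - v n (f 0) m := by
  have hδ : ∀ i, (coRes n).tate.δ ((coRes n).tate.δ (pt n (f 0) (BB.xi i) *
      evPrim f (m - i) ^ 3 ^ (i + 1))) = 0 := fun i => by
    rw [TatePre.δδ_mul _ (TatePre.δ_pow _ (δ_evPrim f _) _), δδ_pt_xi, zero_mul]
  have h1 : map f (e m) = (coRes n).tate.c1 ((coRes n).ev (TPow.map f (coprim m))) := by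
    refine Eq.trans ?_ ((coRes n).tate_c1_pair (map_coact f (coact_coprim m))
      (map_coact' f (coact_prim (m + 1)))
      (d_pair (map_coact f (coact_coprim m)) (map_coact' f (coact_prim (m + 1)))))
    refine (BExt.map_cls _ _ _ _ _ _).trans (BExt.cls_congr ?_ _ _)
    rw [BExt.pair, map_sub, Cobar.map_cons, Cobar.map_cons, Cobar.map_ofN, Cobar.map_ofN]
    rfl
  rw [h1, ev_coprim, TatePre.c1_sub _ (δδ_pt_xi _ _ _) (by
    rw [map_sum, map_sum]; exact Finset.sum_eq_zero fun i _ => hδ i), TatePre.c1_sum _ _ _ (fun i _ => hδ i),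
    Finset.sum_range_succ, Finset.sum_eq_zero (fun i hi => c1_mul_evPrim f _ (Finset.mem_range.1 hi)),
    zero_add, Nat.sub_self, evPrim_zero, one_pow, mul_one]
  rfl

end

theorem v_zero (n m : ℕ) : v n 0 m = 0 := TatePre.c1_zero _

theorem map_v_sub {k n : ℕ} (f : Fin (k + 1) → Fin (n + 1)) (i j : Fin (k + 1)) (m : ℕ) :
    map f (v k i m - v k j m) = v n (f i) m - v n (f j) m := by
  have h := map_e ![j, i] m
  rw [Matrix.cons_val_one, Matrix.cons_val_zero] at h
  change map ![j, i] (e m) = v k i m - v k j m at h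
  rw [← h, map_map, map_e]
  rfl

theorem e_eq (m : ℕ) : e m = v 1 1 m := by
  have h := map_e (id : Fin 2 → Fin 2) m
  rw [map_id] at h
  rw [h]
  change v 1 1 m - v 1 0 m = _
  rw [v_zero, sub_zero]

end KX

theorem KK.counit_e (m : ℕ) : KK.counit (KX.e m) = 0 :=
  (KX.map_e (n := 0) ![0, 0] m).trans (sub_self _)

theorem KK.conj_e (m : ℕ) : KK.conj (KX.e m) = -KX.e m := by
  refine (KX.map_e (n := 1) ![1, 0] m).trans ?_
  change KX.v 1 0 m - KX.v 1 1 m = _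
  rw [KX.v_zero, KX.e_eq, zero_sub]

theorem KK.alpha_e (m : ℕ) : KK.alpha (KX.e m) = KK.front (KX.e m) + KK.back (KX.e m) := by
  rw [KK.alpha, KK.front, KK.back, KX.map_e (n := 2) ![0, 2], KX.map_e (n := 2) ![0, 1], KX.map_e (n := 2) ![1, 2]]
  change KX.v 2 2 m - KX.v 2 0 m = KX.v 2 1 m - KX.v 2 0 m + (KX.v 2 2 m - KX.v 2 1 m)
  abel

/-- After `ε_P ⊗ 1`, only the leading terms `1 ⊗ ξ_{m+2}` and `1 ⊗ ξ_{m+1}³` of the cocycle survive. -/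
theorem KK.theta_e (m : ℕ) : KK.theta (KX.e m) = BExt.cls (eCochain m) (d_eCochain m) := by
  have h0 : ∀ x : BB, Coalgebra.counit (R := F3) (x : DualP) = 0 → KK.shear (TPow.incl 0 x) = 0 := fun x hx => by
    refine (TPow.lift_incl _ _ _).trans ?_
    refine (congrArg (algebraMap F3 BB) hx).trans (map_zero _)
  have h1 : ∀ x : BB, KK.shear (TPow.incl 1 x) = x := fun x => TPow.lift_incl _ _ _
  refine (BExt.map_cls _ _ _ _ _ _).trans (BExt.cls_congr ?_ _ _)
  have e1 : KK.shear (TPow.coprim m) = BB.xi m := by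
    rw [TPow.coprim, map_sub, h1, map_sum, Finset.sum_eq_zero fun i _ => ?_, sub_zero]
    rw [map_mul, h0 _ (BB.counit_xi i), zero_mul]
  have e2 : KK.shear (TPow.prim (m + 1)) = BB.xiCube m := by
    rw [TPow.prim_succ, map_sub, h1, map_sum, Finset.sum_eq_zero fun i _ => ?_, sub_zero]
    rw [map_mul, h0 _ (BB.counit_xiCube i), zero_mul]
  rw [BExt.pair, map_sub, Cobar.map_cons, Cobar.map_cons, Cobar.map_ofN, Cobar.map_ofN, e1, e2, map_pow]
  rw [show DualP.toD (HasXi.xi : DualP) = DualD.xi from KK.toD_xi]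
  rfl

/-! ### Degrees of the exterior generators -/

namespace DualP

theorem xi_mem_degree (m : ℕ) : xi m ∈ degree (2 * (3 ^ m - 1)) := by
  cases m with
  | zero => rw [xi_zero]; exact MvPolynomial.isWeightedHomogeneous_one F3 _
  | succ m => exact MvPolynomial.isWeightedHomogeneous_X F3 _ m

theorem pow_mem_degree {x : DualP} {u : ℕ} (h : x ∈ degree u) (k : ℕ) : x ^ k ∈ degree (k * u) :=
  MvPolynomial.IsWeightedHomogeneous.pow h k

end DualP

namespace BB

theorem one_mem_degree : (1 : BB) ∈ degree 0 := MvPolynomial.isWeightedHomogeneous_one F3 _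

theorem mul_mem_degree {x y : BB} {u w : ℕ} (hx : x ∈ degree u) (hy : y ∈ degree w) :
    x * y ∈ degree (u + w) := MvPolynomial.IsWeightedHomogeneous.mul (hx : (x : DualP) ∈ DualP.degree u) hy

theorem xi_mem_degree (m : ℕ) : xi m ∈ degree (2 * (3 ^ (m + 2) - 1)) := DualP.xi_mem_degree (m + 2)

theorem xiCube_mem_degree (m : ℕ) : xiCube m ∈ degree (3 * (2 * (3 ^ (m + 1) - 1))) :=
  DualP.pow_mem_degree (DualP.xi_mem_degree (m + 1)) 3

end BB

namespace TPow
variable {n : ℕ}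

theorem one_mem_degree : (1 : TPow BB n) ∈ degree n 0 :=
  Submodule.subset_span ⟨0, 1, fun _ => BB.one_mem_degree, by simp, rfl⟩

theorem mul_mem_degree {x y : TPow BB n} {u w : ℕ} (hx : x ∈ degree n u) (hy : y ∈ degree n w) :
    x * y ∈ degree n (u + w) := by
  have h := Submodule.mul_mem_mul hx hy
  rw [degree, degree, Submodule.span_mul_span] at h
  refine Submodule.span_le.2 ?_ h
  rintro _ ⟨_, ⟨v, x, hv, rfl, rfl⟩, _, ⟨v', x', hv', rfl, rfl⟩, rfl⟩
  refine Submodule.subset_span ⟨v + v', x * x', fun i => BB.mul_mem_degree (hv i) (hv' i), ?_, ?_⟩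
  · simp [Finset.sum_add_distrib]
  · exact PiTensorProduct.tprod_mul_tprod _ _

theorem pow_mem_degree {x : TPow BB n} {u : ℕ} (h : x ∈ degree n u) (k : ℕ) : x ^ k ∈ degree n (k * u) := by
  induction k with
  | zero => rw [pow_zero, zero_mul]; exact one_mem_degree
  | succ k ih => rw [pow_succ, add_mul, one_mul]; exact mul_mem_degree ih h

theorem incl_mem_degree (i : Fin n) {x : BB} {u : ℕ} (hx : x ∈ BB.degree u) : incl i x ∈ degree n u := by
  refine Submodule.subset_span ⟨Pi.single i u, Pi.mulSingle i x, fun j => ?_, by simp, rfl⟩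
  by_cases h : j = i
  · subst h
    rwa [Pi.mulSingle_eq_same, Pi.single_eq_same]
  · rw [Pi.mulSingle_eq_of_ne h, Pi.single_eq_of_ne h]
    exact BB.one_mem_degree

theorem prim_mem_degree (m : ℕ) : prim m ∈ degree 2 (3 * (2 * (3 ^ m - 1))) := by
  induction m using Nat.strong_induction_on with
  | _ m ih =>
    cases m with
    | zero => rw [prim_zero]; exact one_mem_degree
    | succ m =>
      rw [prim_succ]
      refine sub_mem (incl_mem_degree 1 (BB.xiCube_mem_degree m)) (sum_mem fun i hi => ?_)
      rw [Finset.mem_range] at hi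
      have := mul_mem_degree (incl_mem_degree 0 (BB.xiCube_mem_degree i))
        (pow_mem_degree (ih (m - i) (by omega)) (3 ^ (i + 1)))
      convert this using 1
      have h1 : 3 ^ (m + 1) = 3 ^ (i + 1) * 3 ^ (m - i) := by rw [← pow_add]; congr 1; omega
      have h2 : 1 ≤ 3 ^ (i + 1) := Nat.one_le_pow _ _ (by norm_num)
      have h3 : 1 ≤ 3 ^ (m - i) := Nat.one_le_pow _ _ (by norm_num)
      obtain ⟨a, ha⟩ := Nat.exists_eq_add_of_le h2
      obtain ⟨b, hb⟩ := Nat.exists_eq_add_of_le h3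
      rw [h1, ha, hb, Nat.add_sub_cancel_left, Nat.add_sub_cancel_left,
        show (1 + a) * (1 + b) = 1 + (a + (1 + a) * b) by ring, Nat.add_sub_cancel_left]
      ring_nf

theorem coprim_mem_degree (m : ℕ) : coprim m ∈ degree 2 (2 * (3 ^ (m + 2) - 1)) := by
  refine sub_mem (incl_mem_degree 1 (BB.xi_mem_degree m)) (sum_mem fun i hi => ?_)
  rw [Finset.mem_range] at hi
  have := mul_mem_degree (incl_mem_degree 0 (BB.xi_mem_degree i))
    (pow_mem_degree (prim_mem_degree (m - i)) (3 ^ (i + 1)))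
  convert this using 1
  have h1 : 3 ^ (m + 2) = 3 ^ (i + 2) * 3 ^ (m - i) := by rw [← pow_add]; congr 1; omega
  have h2 : 1 ≤ 3 ^ (i + 1) := Nat.one_le_pow _ _ (by norm_num)
  have h3 : 1 ≤ 3 ^ (m - i) := Nat.one_le_pow _ _ (by norm_num)
  obtain ⟨a, ha⟩ := Nat.exists_eq_add_of_le h2
  obtain ⟨b, hb⟩ := Nat.exists_eq_add_of_le h3
  rw [h1, pow_succ 3 (i + 1), ha, hb, Nat.add_sub_cancel_left,
    show (1 + a) * 3 * (1 + b) = 1 + (2 + 3 * a + 3 * (1 + a) * b) by ring, Nat.add_sub_cancel_left,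
    show (1 + a) * 3 = 1 + (2 + 3 * a) by ring, Nat.add_sub_cancel_left]
  ring_nf

end TPow

theorem Cobar.cons_mem_bidegree {H N : Type} [CommRing H] [Bialgebra F3 H] [CommRing N] [Algebra F3 N]
    {gH : ℕ → Submodule F3 H} {gN : ℕ → Submodule F3 N} {u w v : ℕ} {a : H} {n : N} (ha : a ∈ gH u)
    (hn : n ∈ gN w) (hv : u + w = v) : cons a (ofN n) ∈ bidegree gH gN 1 v :=
  (le_iSup₂_of_le (f := fun (p : ℕ × ℕ) (_ : p ∈ Finset.HasAntidiagonal.antidiagonal v) =>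
    Submodule.map₂ Cobar.cons (gH p.1) (Cobar.bidegree gH gN 0 p.2)) (u, w) (Finset.HasAntidiagonal.mem_antidiagonal.2 hv) le_rfl)
    (Submodule.apply_mem_map₂ _ ha (Submodule.mem_map_of_mem hn))

theorem KX.e_isBihomogeneous (m : ℕ) :
    BExt.IsBihomogeneous DualP.degree (TPow.degree 2) 1 (2 * (3 ^ (m + 2) + 1)) (e m) := by
  have h3 : 1 ≤ 3 ^ (m + 1) := Nat.one_le_pow _ _ (by norm_num)
  have hx : (HasXi.xi : DualP) ∈ DualP.degree 4 := DualP.xi_mem_degree 1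
  refine ⟨0, 1, 2 * (3 ^ (m + 2) + 1), rfl, by push_cast; ring, _, sub_mem ?_ ?_, d_pair (TPow.coact_coprim m)
    (TPow.coact_prim (m + 1)), ?_⟩
  · exact Cobar.cons_mem_bidegree hx (TPow.coprim_mem_degree m) (by rw [pow_succ]; omega)
  · exact Cobar.cons_mem_bidegree (DualP.pow_mem_degree hx 2) (TPow.prim_mem_degree (m + 1))
      (by rw [pow_succ 3 (m + 1)]; omega)
  · rw [pow_zero, one_mul]; rfl

/-! ### Generators and graded commutativity -/

namespace TatePre
variable {N W : Type} [CommRing N] [Ring W] {T : TatePre N W}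

theorem c0_natCast (k : ℕ) : T.c0 (k : N) = k := by
  have hδ : ∀ k : ℕ, T.δ (k : N) = 0 := fun k => by
    have h1 : T.δ 1 = 0 := by
      have := T.δ_mul 1 1
      rwa [mul_one, mul_one, one_mul, left_eq_add] at this
    induction k with
    | zero => rw [Nat.cast_zero, map_zero]
    | succ k ih => rw [Nat.cast_succ, map_add, ih, h1, add_zero]
  induction k with
  | zero => rw [Nat.cast_zero, Nat.cast_zero, T.c0_zero]
  | succ k ih =>
    have h1 := hδ 1
    rw [Nat.cast_one] at h1
    rw [Nat.cast_succ, T.c0_add (hδ k) h1, ih, T.c0_one, Nat.cast_succ]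

theorem δ_one : T.δ 1 = 0 := by
  have := T.δ_mul 1 1
  rwa [mul_one, mul_one, one_mul, left_eq_add] at this

theorem sign_b_zpow (k : ℤ) : T.sign ((T.b ^ k : Wˣ) : W) = ((T.b ^ k : Wˣ) : W) := by
  have h : Units.map (T.sign : W →* W) T.b = T.b := Units.ext T.sign_b
  have h2 := congrArg Units.val (map_zpow (Units.map (T.sign : W →* W)) T.b k)
  rw [h] at h2
  exact h2

theorem c0_c1_comm {u n : N} (hu : T.δ (T.δ u) = 0) (hn : T.δ n = 0) :
    T.c0 n * T.c1 u = T.c1 u * T.c0 n := by rw [T.c0_mul_c1 hu hn, T.c1_mul_c0 hu hn]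

theorem c0_c0_comm {m n : N} (hm : T.δ m = 0) (hn : T.δ n = 0) :
    T.c0 n * T.c0 m = T.c0 m * T.c0 n := by rw [← T.c0_mul hm hn, ← T.c0_mul hn hm, mul_comm]

theorem c1_c1_comm {u v : N} (hu : T.δ (T.δ u) = 0) (hv : T.δ (T.δ v) = 0) :
    T.c1 u * T.c1 v = -(T.c1 v * T.c1 u) := by
  rw [T.c1_mul_c1 hu hv, T.c1_mul_c1 hv hu, ← mul_neg, ← T.c0_neg (by
    rw [map_sub, T.δ_mul, T.δ_mul, hu, hv]; ring)]
  refine congrArg _ (congrArg _ ?_)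
  ring

theorem c1_sq {u : N} (hu : T.δ (T.δ u) = 0) : T.c1 u * T.c1 u = 0 := by
  rw [T.c1_mul_c1 hu hu, mul_comm, sub_self, T.c0_zero, mul_zero]

end TatePre

namespace TateRing
variable {N W : Type} [CommRing N] [Ring W] (T : TateRing N W)

theorem induction {p : W → Prop}
    (h0 : ∀ (k : ℤ), ∀ n, T.δ n = 0 → p (((T.b ^ k : Wˣ) : W) * T.c0 n))
    (h1 : ∀ (k : ℤ), ∀ u, T.δ (T.δ u) = 0 → p (((T.b ^ k : Wˣ) : W) * T.c1 u))
    (hz : p 0) (ha : ∀ v w, p v → p w → p (v + w)) (w : W) : p w := by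
  obtain ⟨n, u, hn, hu, s, -, rfl⟩ := T.exists_rep w
  refine Finset.sum_induction _ p ha hz fun k _ => ?_
  rw [mul_add]
  exact ha _ _ (h0 k _ (hn k)) (h1 k _ (hu k))

theorem c0_comm {n : N} (hn : T.δ n = 0) (z : W) : T.c0 n * z = z * T.c0 n := by
  induction z using T.induction with
  | h0 k m hm =>
    rw [← mul_assoc, ← (TatePre.b_zpow_comm k (T.c0 n)).eq, mul_assoc, mul_assoc, TatePre.c0_c0_comm hm hn]
  | h1 k u hu =>
    rw [← mul_assoc, ← (TatePre.b_zpow_comm k (T.c0 n)).eq, mul_assoc, mul_assoc, TatePre.c0_c1_comm hu hn]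
  | hz => rw [mul_zero, zero_mul]
  | ha v w hv hw => rw [mul_add, add_mul, hv, hw]

theorem c1_comm {u : N} (hu : T.δ (T.δ u) = 0) (z : W) : T.c1 u * z = T.sign z * T.c1 u := by
  induction z using T.induction with
  | h0 k m hm =>
    rw [← mul_assoc, ← (TatePre.b_zpow_comm k (T.c1 u)).eq, mul_assoc, map_mul, TatePre.sign_b_zpow,
      T.sign_c0 hm, mul_assoc, TatePre.c0_c1_comm hu hm]
  | h1 k v hv =>
    rw [← mul_assoc, ← (TatePre.b_zpow_comm k (T.c1 u)).eq, mul_assoc, map_mul, TatePre.sign_b_zpow,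
      T.sign_c1 hv, mul_assoc, TatePre.c1_c1_comm hu hv, neg_mul]
  | hz => rw [mul_zero, map_zero, zero_mul]
  | ha v w hv hw => rw [mul_add, map_add, add_mul, hv, hw]

/-- The elements `w ± sign w` are twice the even and the odd part of `w`. Division by `2` is possible in
characteristic `3`. -/
theorem comm_aux (w z : W) : (w + T.sign w) * z = z * (w + T.sign w) ∧
    (w - T.sign w) * z = T.sign z * (w - T.sign w) := by
  induction w using T.induction with
  | h0 k n hn =>
    rw [map_mul, TatePre.sign_b_zpow, T.sign_c0 hn, sub_self, zero_mul, mul_zero]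
    refine ⟨?_, rfl⟩
    rw [add_mul, mul_add, mul_assoc, T.c0_comm hn, ← mul_assoc, (TatePre.b_zpow_comm k z).eq, mul_assoc]
  | h1 k u hu =>
    rw [map_mul, TatePre.sign_b_zpow, T.sign_c1 hu, mul_neg, add_neg_cancel, zero_mul, mul_zero]
    refine ⟨rfl, ?_⟩
    rw [sub_neg_eq_add, add_mul, mul_add, mul_assoc, T.c1_comm hu, ← mul_assoc,
      (TatePre.b_zpow_comm k (T.sign z)).eq, mul_assoc]
  | hz => rw [map_zero, add_zero, sub_zero, zero_mul, mul_zero, mul_zero]; exact ⟨rfl, rfl⟩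
  | ha v w hv hw =>
    rw [map_add, add_add_add_comm, add_sub_add_comm, add_mul (v + T.sign v), mul_add z (v + T.sign v),
      add_mul (v - T.sign v), mul_add (T.sign z), hv.1, hv.2, hw.1, hw.2]
    exact ⟨rfl, rfl⟩

variable (h3 : (3 : W) = 0)
include h3

theorem eq_neg_two_mul (w : W) : w = -(w + w) := by
  have h : w + w + w = 3 * w := by
    rw [show (3 : W) = 1 + 1 + 1 by norm_num, add_mul, add_mul, one_mul]
  rw [h3, zero_mul] at h
  exact (neg_eq_of_add_eq_zero_right h).symm

/-- Elements of even degree are central. -/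
theorem even_comm {w : W} (hw : T.sign w = w) (z : W) : w * z = z * w := by
  have h := (T.comm_aux w z).1
  rw [hw] at h
  rw [eq_neg_two_mul h3 w, neg_mul, mul_neg, h]

/-- Elements of odd degree commute up to sign. -/
theorem odd_comm {w : W} (hw : T.sign w = -w) (z : W) : w * z = T.sign z * w := by
  have h := (T.comm_aux w z).2
  rw [hw, sub_neg_eq_add] at h
  rw [eq_neg_two_mul h3 w, neg_mul, mul_neg, h]

end TateRing

/-- To contain a subring it suffices for a subgroup to contain `1` and to be closed under multiplication
by the generators. -/
theorem Subring.closure_le_of_mul_mem {A : Type} [Ring A] {s : Set A} {M : AddSubgroup A} (h1 : 1 ∈ M)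
    (hm : ∀ x ∈ M, ∀ g ∈ s, x * g ∈ M) {x : A} (hx : x ∈ Subring.closure s) : x ∈ M := by
  rw [Subring.mem_closure_iff] at hx
  refine (AddSubgroup.closure_le M).2 (fun x hx => ?_) hx
  exact Submonoid.closure_induction_right (motive := fun x _ => x ∈ M) h1 (fun x _ g hg h => hm x h g hg) hx

namespace TateRing
variable {N W ι : Type} [CommRing N] [Ring W] [DecidableEq ι] (T : TateRing N W) (L : Layering ι T.δ)

/-- The generators `b`, `b⁻¹`, `h` of the coefficient ring. -/
def base : Set W := {(T.b : W), ((T.b⁻¹ : Wˣ) : W), T.c1 1}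

/-- The subring generated by the coefficients and the elements `e a` for `a ∈ X`. -/
def G (X : Set ι) : Subring W := Subring.closure (T.base ∪ T.e L '' X)

theorem base_subset_G (X : Set ι) : T.base ⊆ T.G L X := Set.subset_union_left.trans Subring.subset_closure

theorem e_mem_G {X : Set ι} {a : ι} (ha : a ∈ X) : T.e L a ∈ T.G L X :=
  Subring.subset_closure (Or.inr ⟨a, ha, rfl⟩)

theorem G_mono {X Y : Set ι} (h : X ⊆ Y) : T.G L X ≤ T.G L Y :=
  Subring.closure_mono (Set.union_subset_union_right _ (Set.image_mono h))

theorem b_zpow_mem_G (X : Set ι) (k : ℤ) : ((T.b ^ k : Wˣ) : W) ∈ T.G L X := by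
  have h1 : (T.b : W) ∈ T.G L X := T.base_subset_G L X (Or.inl rfl)
  have h2 : ((T.b⁻¹ : Wˣ) : W) ∈ T.G L X := T.base_subset_G L X (Or.inr (Or.inl rfl))
  cases k with
  | ofNat k => rw [Int.ofNat_eq_natCast, zpow_natCast, Units.val_pow_eq_pow_val]; exact pow_mem h1 k
  | negSucc k => rw [zpow_negSucc, ← inv_pow, Units.val_pow_eq_pow_val]; exact pow_mem h2 _

theorem mul_e_mem_H' {J : Finset ι} {a : ι} (ha : a ∈ J) {w : W} (hw : w ∈ T.H (L.S J)) :
    w * T.e L a ∈ T.H (L.S J) := by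
  rw [← Finset.insert_erase ha] at hw ⊢
  obtain ⟨v, hv, v', -, rfl⟩ := TatePre.exists_eq_add_mul_e L (Finset.notMem_erase a J) hw
  rw [add_mul, mul_assoc, TatePre.e, TatePre.c1_sq (TatePre.δδ_y L a), mul_zero, add_zero]
  exact TatePre.mul_e_mem_H L (Finset.notMem_erase a J) hv

theorem mul_h_mem_H {J : Finset ι} {w : W} (hw : w ∈ T.H (L.S J)) : w * T.c1 1 ∈ T.H (L.S J) := by
  have h1 := TatePre.δ_one (T := T.toTatePre)
  have h1' : T.δ (T.δ 1) = 0 := by rw [h1, map_zero]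
  refine TatePre.H_induction (p := fun w => w * T.c1 1 ∈ T.H (L.S J))
    (fun k n hn h => ?_) (fun k u hu h => ?_) ?_ ?_ ?_ hw
  · rw [mul_assoc, T.c0_mul_c1 h1' h, one_mul]
    exact TatePre.c1_mem_H k hn (by rw [h, map_zero])
  · rw [mul_assoc, T.c1_mul_c1 h h1', h1, mul_one, mul_zero, sub_zero, ← mul_assoc, ← Units.val_mul,
      ← zpow_add_one]
    exact TatePre.c0_mem_H _ (L.δ_S J _ hu) h
  · rw [zero_mul]; exact zero_mem _
  · intro v w hv hw; rw [add_mul]; exact add_mem hv hw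
  · intro w hw; rw [neg_mul]; exact neg_mem hw

theorem exists_mem_H_of_mem_G {X : Set ι} {w : W} (hw : w ∈ T.G L X) :
    ∃ J : Finset ι, (J : Set ι) ⊆ X ∧ w ∈ T.H (L.S J) := by
  let M : AddSubgroup W :=
    { carrier := {w | ∃ J : Finset ι, (J : Set ι) ⊆ X ∧ w ∈ T.H (L.S J)}
      zero_mem' := ⟨∅, by simp, zero_mem _⟩
      add_mem' := by
        rintro v w ⟨J, hJ, hv⟩ ⟨K, hK, hw⟩
        exact ⟨J ∪ K, by rw [Finset.coe_union]; exact Set.union_subset hJ hK,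
          add_mem (TatePre.H_mono (L.mono Finset.subset_union_left) hv)
            (TatePre.H_mono (L.mono Finset.subset_union_right) hw)⟩
      neg_mem' := by
        rintro w ⟨J, hJ, hw⟩
        exact ⟨J, hJ, neg_mem hw⟩ }
  refine Subring.closure_le_of_mul_mem (M := M) ⟨∅, by simp, ?_⟩ ?_ hw
  · have := TatePre.c0_mem_H (T := T.toTatePre) 0 (L.one_mem ∅) TatePre.δ_one
    rwa [zpow_zero, Units.val_one, one_mul, T.c0_one] at this
  · rintro w ⟨J, hJ, hw⟩ g ((rfl | rfl | rfl) | ⟨a, ha, rfl⟩)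
    · refine ⟨J, hJ, ?_⟩
      have := TatePre.b_zpow_mul_mem_H 1 hw
      rwa [zpow_one, (T.b_comm w).eq] at this
    · refine ⟨J, hJ, ?_⟩
      have := TatePre.b_zpow_mul_mem_H (-1) hw
      rwa [(TatePre.b_zpow_comm (-1) w).eq, zpow_neg_one] at this
    · exact ⟨J, hJ, T.mul_h_mem_H L hw⟩
    · by_cases h : a ∈ J
      · exact ⟨J, hJ, T.mul_e_mem_H' L h hw⟩
      · refine ⟨insert a J, ?_, TatePre.mul_e_mem_H L h hw⟩
        rw [Finset.coe_insert]
        exact Set.insert_subset ha hJ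

/-- The constants of the layering are multiples of `1`. -/
def ConstNat : Prop := ∀ n ∈ L.S ∅, ∃ k : ℕ, n = k

variable {L}

theorem H_le_G (hL : T.ConstNat L) (J : Finset ι) {w : W} (hw : w ∈ T.H (L.S J)) : w ∈ T.G L J := by
  induction J using Finset.induction_on generalizing w with
  | empty =>
    refine TatePre.H_induction (fun k n hn h => ?_) (fun k u hu h => ?_) (zero_mem _) (fun _ _ => add_mem)
      (fun _ => neg_mem) hw
    · obtain ⟨r, rfl⟩ := hL n hn
      rw [TatePre.c0_natCast]
      exact mul_mem (T.b_zpow_mem_G L _ k) (natCast_mem _ _)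
    · obtain ⟨r, rfl⟩ := hL u hu
      have h1 := TatePre.δ_one (T := T.toTatePre)
      have h2 := T.c0_mul_c1 (u := 1) (n := (r : N)) (by rw [h1, map_zero]) (L.const _ hu)
      rw [one_mul, TatePre.c0_natCast] at h2
      rw [← h2]
      exact mul_mem (T.b_zpow_mem_G L _ k) (mul_mem (natCast_mem _ _) (T.base_subset_G L _ (Or.inr (Or.inr rfl))))
  | insert a J ha ih =>
    obtain ⟨v, hv, v', hv', rfl⟩ := TatePre.exists_eq_add_mul_e L ha hw
    have hs : T.G L J ≤ T.G L ((insert a J : Finset ι) : Set ι) :=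
      T.G_mono L (Finset.coe_subset.2 (Finset.subset_insert a J))
    exact add_mem (hs (ih hv)) (mul_mem (hs (ih hv')) (T.e_mem_G L (Finset.mem_coe.2 (Finset.mem_insert_self a J))))

theorem G_univ (hL : T.ConstNat L) : T.G L Set.univ = ⊤ := by
  refine eq_top_iff.2 fun w _ => ?_
  obtain ⟨J, hJ⟩ := T.exists_mem_H L w
  exact T.G_mono L (Set.subset_univ _) (T.H_le_G hL J hJ)

theorem exists_finset (hL : T.ConstNat L) (w : W) : ∃ J : Finset ι, w ∈ T.G L J := by
  obtain ⟨J, hJ⟩ := T.exists_mem_H L w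
  exact ⟨J, T.H_le_G hL J hJ⟩

theorem G_expand (hL : T.ConstNat L) {X : Set ι} {a : ι} {w : W} (hw : w ∈ T.G L (insert a X)) :
    ∃ v ∈ T.G L X, ∃ v' ∈ T.G L X, w = v + v' * T.e L a := by
  obtain ⟨J, hJ, hw⟩ := T.exists_mem_H_of_mem_G L hw
  have h1 : J ⊆ insert a (J.erase a) := Finset.insert_erase_subset a J
  obtain ⟨v, hv, v', hv', rfl⟩ := TatePre.exists_eq_add_mul_e L (Finset.notMem_erase a J)
    (TatePre.H_mono (L.mono h1) hw)
  have hs : ((J.erase a : Finset ι) : Set ι) ⊆ X := fun b hb => by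
    rw [Finset.mem_coe, Finset.mem_erase] at hb
    exact (hJ hb.2).resolve_left hb.1
  exact ⟨v, T.G_mono L hs (T.H_le_G hL _ hv), v', T.G_mono L hs (T.H_le_G hL _ hv'), rfl⟩

theorem G_indep {X : Set ι} {a : ι} (ha : a ∉ X) {v v' : W} (hv : v ∈ T.G L X) (hv' : v' ∈ T.G L X)
    (h : v + v' * T.e L a = 0) : v = 0 ∧ v' = 0 := by
  obtain ⟨J, hJ, hv⟩ := T.exists_mem_H_of_mem_G L hv
  obtain ⟨K, hK, hv'⟩ := T.exists_mem_H_of_mem_G L hv'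
  refine T.indep L (J := J ∪ K) ?_ (TatePre.H_mono (L.mono Finset.subset_union_left) hv)
    (TatePre.H_mono (L.mono Finset.subset_union_right) hv') h
  rw [Finset.mem_union]
  exact not_or.2 ⟨fun h => ha (hJ h), fun h => ha (hK h)⟩

end TateRing

theorem PairPoly.exists_natCast {κ : Type} [DecidableEq κ] {p : MvPolynomial (κ × ℕ) F3}
    (hp : p ∈ PairPoly.S (∅ : Finset (κ × ℕ))) : ∃ k : ℕ, p = k := by
  obtain ⟨r, rfl⟩ := PairPoly.S_empty hp
  refine ⟨r.val, ?_⟩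
  rw [← map_natCast (MvPolynomial.C : F3 →+* MvPolynomial (κ × ℕ) F3), ZMod.natCast_zmod_val]

/-! ### The coefficient ring -/

namespace BExt
variable {H N : Type} [CommRing H] [Bialgebra F3 H] [CommRing N] [Algebra F3 N] [ComodAlg H N] [HasXi H]

theorem three_eq_zero : (3 : BExt H N) = 0 := by
  have h1 : (3 : Cobar H N) = 0 := by
    have h2 : (3 : F3) • (1 : Cobar H N) = 0 := by rw [show (3 : F3) = 0 from rfl, zero_smul]
    have h3 : ((3 : ℕ) : F3) • (1 : Cobar H N) = (3 : ℕ) • (1 : Cobar H N) := Nat.cast_smul_eq_nsmul F3 _ _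
    rw [Nat.cast_ofNat, h2, nsmul_eq_mul, mul_one] at h3
    exact h3.symm
  have h2 : (3 : (Cobar.dg H N).cycles) = 0 := Subtype.ext h1
  have h3 := congrArg ((Loc.of (bClass H N)).comp (Cobar.dg H N).proj) h2
  rwa [map_ofNat, map_zero] at h3

instance : Algebra F3 (BExt H N) :=
  letI := (CharP.exists (BExt H N)).choose_spec
  ZMod.algebra' (BExt H N) (CharP.exists (BExt H N)).choose
    ((CharP.exists (BExt H N)).choose_spec.cast_eq_zero_iff 3 |>.1 (by exact_mod_cast three_eq_zero))

variable {H' N' : Type} [CommRing H'] [Bialgebra F3 H'] [CommRing N'] [Algebra F3 N'] [ComodAlg H' N'] [HasXi H']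

theorem map_h10 (f : H →ₐc[F3] H') (g : N →ₐ[F3] N') (hfg : Cobar.Compat f g) (hxi : f HasXi.xi = HasXi.xi) :
    map f g hfg hxi (h10 H N) = h10 H' N' := by
  refine (map_cls _ _ _ _ _ _).trans (cls_congr ?_ _ _)
  rw [Cobar.hCochain, Cobar.map_cons, Cobar.map_ofN, map_one, hxi]
  rfl

theorem map_b10 (f : H →ₐc[F3] H') (g : N →ₐ[F3] N') (hfg : Cobar.Compat f g) (hxi : f HasXi.xi = HasXi.xi) :
    map f g hfg hxi (b10 H N) = b10 H' N' := by
  refine (map_cls _ _ _ _ _ _).trans (cls_congr ?_ _ _)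
  rw [Cobar.bCochain, map_add, Cobar.map_cons, Cobar.map_cons, Cobar.map_cons, Cobar.map_cons, Cobar.map_ofN,
    map_one, map_pow, hxi]
  rfl

end BExt

/-- A ring homomorphism between algebras over a prime field. -/
def RingHom.primeAlgHom {A A' : Type} [Ring A] [Algebra F3 A] [Ring A'] [Algebra F3 A'] (f : A →+* A') :
    A →ₐ[F3] A' :=
  { f with commutes' := fun r => RingHom.congr_fun (Subsingleton.elim (f.comp (algebraMap F3 A)) (algebraMap F3 A')) r }

namespace TateRing
variable {N W ι : Type} [CommRing N] [Ring W] [DecidableEq ι] (T : TateRing N W)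

theorem h_sq : T.c1 1 * T.c1 1 = 0 := TatePre.c1_sq (by rw [TatePre.δ_one, map_zero])

section coeff
variable [Algebra F3 W]

/-- The map `k[b, b⁻¹] → W`. -/
def laurent : LaurentPolynomial F3 →ₐ[F3] W :=
  AddMonoidAlgebra.lift F3 W ℤ
    { toFun := fun k => ((T.b ^ k.toAdd : Wˣ) : W)
      map_one' := by rw [toAdd_one, zpow_zero, Units.val_one]
      map_mul' := fun k l => by rw [toAdd_mul, zpow_add, Units.val_mul] }

theorem laurent_T (k : ℤ) : T.laurent (LaurentPolynomial.T k) = ((T.b ^ k : Wˣ) : W) := by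
  refine (AddMonoidAlgebra.lift_single _ _ _).trans ?_
  rw [one_smul]
  rfl

theorem laurent_apply (f : LaurentPolynomial F3) :
    T.laurent f = ∑ k ∈ f.coeff.support, algebraMap F3 W (f.coeff k) * ((T.b ^ k : Wˣ) : W) :=
  AddMonoidAlgebra.lift_apply' _ _

theorem laurent_comm (f : LaurentPolynomial F3) (w : W) : Commute (T.laurent f) w := by
  rw [laurent_apply]
  exact Commute.sum_left _ _ _ fun k _ =>
    Commute.mul_left (show Commute _ _ from Algebra.commutes _ w) (TatePre.b_zpow_comm k w)

theorem sign_laurent (f : LaurentPolynomial F3) : T.sign (T.laurent f) = T.laurent f := by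
  rw [laurent_apply, map_sum]
  refine Finset.sum_congr rfl fun k _ => ?_
  rw [map_mul, TatePre.sign_b_zpow]
  exact congrArg (· * _) (T.sign.primeAlgHom.commutes _)

/-- The map `R → W`. -/
def coeffHom : RR →ₐ[F3] W :=
  DualNumber.lift ⟨(T.laurent, T.c1 1), T.h_sq, fun a => (T.laurent_comm a _).symm⟩

theorem coeffHom_apply (r : RR) : T.coeffHom r = T.laurent r.fst + T.laurent r.snd * T.c1 1 := rfl

theorem coeffHom_h : T.coeffHom RR.h = T.c1 1 := DualNumber.lift_apply_eps _

theorem coeffHom_inl (f : LaurentPolynomial F3) : T.coeffHom (TrivSqZeroExt.inl f) = T.laurent f :=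
  DualNumber.lift_apply_inl _ _

theorem coeffHom_b : T.coeffHom RR.b = T.b := by
  rw [RR.b, coeffHom_inl, laurent_T, zpow_one]

theorem c0_algebraMap [Algebra F3 N] (r : F3) : T.c0 (algebraMap F3 N r) = algebraMap F3 W r := by
  rw [← ZMod.natCast_zmod_val r, map_natCast, map_natCast, TatePre.c0_natCast]

theorem coeffHom_injective [Algebra F3 N] [Nontrivial N] (L : Layering ι T.δ) : Function.Injective T.coeffHom := by
  refine (injective_iff_map_eq_zero _).2 fun x hx => ?_
  have hS : ∀ r : F3, algebraMap F3 N r ∈ L.S ∅ := fun r => by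
    rw [← ZMod.natCast_zmod_val r, map_natCast, ← nsmul_one]
    exact nsmul_mem (L.one_mem ∅) _
  have hδ : ∀ r : F3, T.δ (algebraMap F3 N r) = 0 := fun r => L.const _ (hS r)
  have hrep : T.Rep 0 (fun k => algebraMap F3 N (x.fst.coeff k)) (fun k => algebraMap F3 N (x.snd.coeff k)) := by
    refine ⟨fun k => hδ _, fun k => by rw [hδ, map_zero], x.fst.coeff.support ∪ x.snd.coeff.support, fun k hk => ?_, ?_⟩
    · rw [Finset.mem_union, not_or, Finsupp.notMem_support_iff, Finsupp.notMem_support_iff] at hk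
      exact ⟨(congrArg _ hk.1).trans (map_zero _), (congrArg _ hk.2).trans (map_zero _)⟩
    · rw [← hx, coeffHom_apply, laurent_apply, laurent_apply]
      simp only [mul_add, Finset.sum_add_distrib]
      refine congrArg₂ (· + ·) ?_ ?_
      · rw [Finset.sum_subset (Finset.subset_union_left (s₂ := x.snd.coeff.support))]
        · refine Finset.sum_congr rfl fun k _ => ?_
          rw [T.c0_algebraMap, Algebra.commutes]
        · intro k _ hk
          rw [Finsupp.notMem_support_iff.1 hk, map_zero, zero_mul]
      · rw [Finset.sum_subset (Finset.subset_union_right (s₁ := x.fst.coeff.support)), Finset.sum_mul]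
        · refine Finset.sum_congr rfl fun k _ => ?_
          have h2 := T.c0_mul_c1 (u := 1) (n := algebraMap F3 N (x.snd.coeff k))
            (by rw [TatePre.δ_one, map_zero]) (hδ _)
          rw [one_mul, T.c0_algebraMap] at h2
          rw [← h2, Algebra.commutes, mul_assoc]
        · intro k _ hk
          rw [Finsupp.notMem_support_iff.1 hk, map_zero, zero_mul]
  have h := T.rep_const L (fun k => hS _) (fun k => hS _) hrep
  have hinj := (algebraMap F3 N).injective
  refine TrivSqZeroExt.ext (AddMonoidAlgebra.ext (Finsupp.ext fun k => ?_)) (AddMonoidAlgebra.ext (Finsupp.ext fun k => ?_))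
  · exact hinj ((h k).1.trans (map_zero _).symm)
  · exact hinj ((h k).2.trans (map_zero _).symm)

theorem G_empty_le (L : Layering ι T.δ) {w : W} (hw : w ∈ T.G L ∅) : ∃ r, T.coeffHom r = w := by
  have h : T.G L ∅ ≤ (T.coeffHom : RR →+* W).range := by
    refine Subring.closure_le.2 ?_
    rw [Set.image_empty, Set.union_empty]
    rintro _ (rfl | rfl | rfl)
    · exact ⟨RR.b, T.coeffHom_b⟩
    · refine ⟨TrivSqZeroExt.inl (LaurentPolynomial.T (-1)), ?_⟩
      refine (T.coeffHom_inl _).trans ?_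
      rw [laurent_T, zpow_neg_one]
    · exact ⟨RR.h, T.coeffHom_h⟩
  exact h hw

theorem coeffHom_mem_G (L : Layering ι T.δ) (X : Set ι) (r : RR) : T.coeffHom r ∈ T.G L X := by
  have h : ∀ f, T.laurent f ∈ T.G L X := fun f => by
    rw [laurent_apply]
    refine sum_mem fun k _ => mul_mem ?_ (T.b_zpow_mem_G L X k)
    rw [← ZMod.natCast_zmod_val (f.coeff k), map_natCast]
    exact natCast_mem _ _
  rw [coeffHom_apply]
  exact add_mem (h _) (mul_mem (h _) (T.base_subset_G L X (Or.inr (Or.inr rfl))))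

end coeff

section hom
variable {T} {N' W' : Type} [CommRing N'] [Ring W'] {T' : TateRing N' W'} {f : W →+* W'}
  (hb : f T.b = T'.b) (hh : f (T.c1 1) = T'.c1 1)
include hb

theorem map_b_zpow (k : ℤ) : f ((T.b ^ k : Wˣ) : W) = ((T'.b ^ k : W'ˣ) : W') := by
  have h : Units.map (f : W →* W') T.b = T'.b := Units.ext hb
  rw [← h, ← map_zpow]
  rfl

variable [Algebra F3 W] [Algebra F3 W']

theorem map_laurent (g : LaurentPolynomial F3) : f (T.laurent g) = T'.laurent g := by
  rw [laurent_apply, laurent_apply, map_sum]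
  refine Finset.sum_congr rfl fun k _ => ?_
  rw [map_mul, map_b_zpow hb]
  exact congrArg (· * _) (f.primeAlgHom.commutes _)

include hh

theorem map_coeffHom (r : RR) : f (T.coeffHom r) = T'.coeffHom r := by
  rw [coeffHom_apply, coeffHom_apply, map_add, map_mul, map_laurent hb, map_laurent hb, hh]

omit [Algebra F3 W] [Algebra F3 W'] in
theorem map_base {g : W} (hg : g ∈ T.base) : f g ∈ T'.base := by
  rcases hg with rfl | rfl | rfl
  · exact Or.inl hb
  · refine Or.inr (Or.inl ?_)
    have := map_b_zpow hb (-1)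
    rwa [zpow_neg_one, zpow_neg_one] at this
  · exact Or.inr (Or.inr hh)

omit [Algebra F3 W] [Algebra F3 W'] in
theorem map_mem_G {ι' : Type} [DecidableEq ι'] {L : Layering ι T.δ} {L' : Layering ι' T'.δ} {X : Set ι} {Y : Set ι'}
    (he : ∀ a ∈ X, f (T.e L a) ∈ T'.G L' Y) {w : W} (hw : w ∈ T.G L X) : f w ∈ T'.G L' Y := by
  have h : T.G L X ≤ (T'.G L' Y).comap f := by
    refine Subring.closure_le.2 ?_
    rintro _ (hg | ⟨a, ha, rfl⟩)
    · exact T'.base_subset_G L' Y (map_base hb hh hg)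
    · exact he a ha
  exact h hw

/-- A ring homomorphism that maps the generators to each other is bijective: by induction on the
generators, both sides have the basis of products of the `e a` over the same coefficient ring. -/
theorem bijective_of_map_e [Algebra F3 N'] [Nontrivial N'] {L : Layering ι T.δ} {L' : Layering ι T'.δ}
    (hL : T.ConstNat L) (hL' : T'.ConstNat L') (he : ∀ a, f (T.e L a) = T'.e L' a) : Function.Bijective f := by
  have hmem : ∀ (J : Set ι) w, w ∈ T.G L J → f w ∈ T'.G L' J := fun J w hw =>
    map_mem_G hb hh (fun a ha => by rw [he]; exact T'.e_mem_G L' ha) hw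
  constructor
  · refine (injective_iff_map_eq_zero _).2 fun w hw => ?_
    obtain ⟨J, hJ⟩ := T.exists_finset hL w
    induction J using Finset.induction_on generalizing w with
    | empty =>
      rw [Finset.coe_empty] at hJ
      obtain ⟨r, rfl⟩ := T.G_empty_le L hJ
      rw [map_coeffHom hb hh] at hw
      rw [T'.coeffHom_injective L' (hw.trans (map_zero _).symm), map_zero]
    | insert a J ha ih =>
      rw [Finset.coe_insert] at hJ
      obtain ⟨v, hv, v', hv', rfl⟩ := T.G_expand hL hJ
      rw [map_add, map_mul, he] at hw
      obtain ⟨h1, h2⟩ := T'.G_indep (Finset.mem_coe.not.2 ha) (hmem _ _ hv) (hmem _ _ hv') hw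
      rw [ih v h1 hv, ih v' h2 hv', zero_mul, add_zero]
  · intro w
    have h : T'.G L' Set.univ ≤ f.range := by
      refine Subring.closure_le.2 ?_
      rintro _ ((rfl | rfl | rfl) | ⟨a, -, rfl⟩)
      · exact ⟨_, hb⟩
      · refine ⟨((T.b⁻¹ : Wˣ) : W), ?_⟩
        have := map_b_zpow hb (-1)
        rwa [zpow_neg_one, zpow_neg_one] at this
      · exact ⟨_, hh⟩
      · exact ⟨_, he a⟩
    rw [T'.G_univ hL'] at h
    exact h (Subring.mem_top w)

end hom
end TateRing

/-! ### The rings of co-operations -/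

namespace KX

/-- The layering of the polynomial ring that computes `π_{**}(K^{⊗(n+1)})`. -/
def lay (n : ℕ) : Layering (Fin n × ℕ) (tate n).δ := PairPoly.layering

theorem constNat (n : ℕ) : (tate n).ConstNat (lay n) := fun _ => PairPoly.exists_natCast

/-- The image of `e_{m+2}` for the inclusion of the factors `c` and `c + 1`. -/
def ee (n c m : ℕ) : KX (n + 1) := v n (c + 1) m - v n c m

theorem tate_e {n : ℕ} (c : Fin n) (m : ℕ) : (tate n).e (lay n) (c, m) = ee n c m := by
  change (TPow.coRes n).tate.c1 (TPow.pairEquiv n (PairPoly.y (c, m))) = _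
  rw [TPow.pairEquiv_y, TPow.diff]
  exact TatePre.c1_sub _ (δδ_pt_xi _ _ _) (δδ_pt_xi _ _ _)

theorem tate_h (n : ℕ) : (tate n).c1 1 = BExt.h10 DualP (TPow BB (n + 1)) := by
  rw [(TPow.coRes n).tate_h]
  exact congrArg (TPow.coRes n).tate.c1 (map_one (TPow.pairEquiv n))

section map
variable {k n : ℕ} (f : Fin (k + 1) → Fin (n + 1))

theorem map_b : map f (tate k).b = (tate n).b := BExt.map_b10 _ _ _ _

theorem map_h : map f ((tate k).c1 1) = (tate n).c1 1 := by
  rw [tate_h, tate_h]; exact BExt.map_h10 _ _ _ _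

theorem map_coeffHom (r : RR) : map f ((tate k).coeffHom r) = (tate n).coeffHom r :=
  TateRing.map_coeffHom (map_b f) (map_h f) r

theorem map_ee {c : ℕ} (hc : c < k) (m : ℕ) :
    map f (ee k c m) = v n (f ⟨c + 1, by omega⟩) m - v n (f ⟨c, by omega⟩) m :=
  map_v_sub f ⟨c + 1, by omega⟩ ⟨c, by omega⟩ m

end map

theorem sign_v (n k m : ℕ) : sign (n + 1) (v n k m) = -v n k m := (TPow.coRes n).tate.sign_c1 (δδ_pt_xi _ _ _)

theorem sign_ee (n c m : ℕ) : sign (n + 1) (ee n c m) = -ee n c m := by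
  rw [ee, map_sub, sign_v, sign_v]; abel

theorem e_eq_ee (m : ℕ) : e m = ee 1 0 m := by
  rw [e_eq, ee, v_zero, sub_zero]

theorem sign_e (m : ℕ) : sign 2 (e m) = -e m := by rw [e_eq_ee, sign_ee]

theorem even_comm {n : ℕ} {w : KX (n + 1)} (hw : sign (n + 1) w = w) (z : KX (n + 1)) : w * z = z * w :=
  (tate n).even_comm BExt.three_eq_zero hw z

theorem odd_comm {n : ℕ} {w : KX (n + 1)} (hw : sign (n + 1) w = -w) (z : KX (n + 1)) :
    w * z = sign (n + 1) z * w :=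
  (tate n).odd_comm BExt.three_eq_zero hw z

instance (n : ℕ) : Nontrivial (MvPolynomial (Fin n × ℕ) F3) := inferInstance

theorem coeffHom_injective (n : ℕ) : Function.Injective (tate n).coeffHom := (tate n).coeffHom_injective (lay n)

/-- The isomorphism of `R` with `K_{**}`. -/
def phi : RR ≃+* KX 1 := RingEquiv.ofBijective ((tate 0).coeffHom : RR →+* KX 1)
  ⟨coeffHom_injective 0, fun w => by
    have h : w ∈ (tate 0).G (lay 0) Set.univ := by rw [(tate 0).G_univ (constNat 0)]; exact Subring.mem_top w
    rw [Set.univ_eq_empty_iff.2 inferInstance] at h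
    exact (tate 0).G_empty_le _ h⟩

theorem phi_h : phi RR.h = BExt.h10 DualP (TPow BB 1) := (tate 0).coeffHom_h.trans (tate_h 0)
theorem phi_b : phi RR.b = BExt.b10 DualP (TPow BB 1) := (tate 0).coeffHom_b

theorem map_phi {n : ℕ} (f : Fin 1 → Fin (n + 1)) (r : RR) : map f (phi r) = (tate n).coeffHom r :=
  map_coeffHom (k := 0) f r

end KX

namespace KK

theorem etaL_phi (r : RR) : etaL (KX.phi r) = (KX.tate 1).coeffHom r := KX.map_phi (n := 1) _ r
theorem etaR_phi (r : RR) : etaR (KX.phi r) = (KX.tate 1).coeffHom r := KX.map_phi (n := 1) _ r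

/-- Both units are given by `h₁₀ ↦ h₁₀` and `b₁₀ ↦ b₁₀`, and `K_{**}` is generated by these classes. -/
theorem etaL_eq_etaR : etaL = etaR := RingHom.ext fun x => by
  obtain ⟨r, rfl⟩ := KX.phi.surjective x
  rw [etaL_phi, etaR_phi]

end KK

namespace BB

/-- The layering of `B` as a polynomial ring. -/
def lay : Layering (Fin 1 × ℕ) tate.δ := PairPoly.layering

theorem tate_e (a : Fin 1 × ℕ) : tate.e lay a = BExt.cls (eCochain a.2) (d_eCochain a.2) := by
  change (DualD.coRes BB).tate.c1 (pairEquiv (PairPoly.y a)) = _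
  rw [pairEquiv_y]
  refine Eq.trans ?_ ((DualD.coRes BB).tate_c1_pair (coact_xi a.2) (coact_xiCube a.2) (d_eCochain a.2)).symm
  rw [DualD.ev_coRes]

theorem tate_h : tate.c1 1 = BExt.h10 DualD BB := by
  rw [(DualD.coRes BB).tate_h]
  exact congrArg (DualD.coRes BB).tate.c1 (map_one pairEquiv)

end BB

theorem KK.theta_bijective : Function.Bijective KK.theta := by
  refine TateRing.bijective_of_map_e (T := KX.tate 1) (T' := BB.tate) (BExt.map_b10 _ _ _ _) ?_
    (L := KX.lay 1) (L' := BB.lay) (KX.constNat 1) (fun _ => PairPoly.exists_natCast) (fun a => ?_)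
  · rw [KX.tate_h, BB.tate_h]
    exact BExt.map_h10 _ _ _ _
  · obtain ⟨c, m⟩ := a
    obtain rfl : c = 0 := Subsingleton.elim _ _
    rw [KX.tate_e, BB.tate_e]
    exact (congrArg _ (KX.e_eq_ee m).symm).trans (KK.theta_e m)

/-! ### The Hopf algebra structure -/

namespace KX

/-- The subring of `π_{**}(K^{⊗(n+1)})` generated by `R` and the elements `ee n c m` for `(c, m) ∈ X`. -/
def GX (n : ℕ) (X : Set (ℕ × ℕ)) : Subring (KX (n + 1)) :=
  (tate n).G (lay n) {a | ((a.1 : ℕ), a.2) ∈ X}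

variable {n : ℕ} {X Y : Set (ℕ × ℕ)}

theorem ee_mem_GX {c m : ℕ} (hc : c < n) (h : (c, m) ∈ X) : ee n c m ∈ GX n X := by
  rw [← tate_e ⟨c, hc⟩]
  exact TateRing.e_mem_G _ _ h

theorem GX_mono (h : X ⊆ Y) : GX n X ≤ GX n Y := TateRing.G_mono _ _ fun _ ha => h ha

theorem GX_le (h : ∀ p ∈ X, p.1 < n → p ∈ Y) : GX n X ≤ GX n Y :=
  TateRing.G_mono _ _ fun a ha => h (a.1, a.2) ha a.1.2

theorem GX_expand {c m : ℕ} (hc : c < n) {w : KX (n + 1)} (hw : w ∈ GX n (insert (c, m) X)) :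
    ∃ v ∈ GX n X, ∃ v' ∈ GX n X, w = v + v' * ee n c m := by
  rw [← tate_e ⟨c, hc⟩]
  refine TateRing.G_expand _ (constNat n) (TateRing.G_mono _ _ (fun a ha => ?_) hw)
  rcases ha with ha | ha
  · have ha' : ((a.1 : ℕ), a.2) = (c, m) := ha
    exact Or.inl (Prod.ext (Fin.ext (Prod.ext_iff.1 ha').1) (Prod.ext_iff.1 ha').2)
  · exact Or.inr ha

theorem GX_indep {c m : ℕ} (hc : c < n) (h : (c, m) ∉ X) {v v' : KX (n + 1)} (hv : v ∈ GX n X)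
    (hv' : v' ∈ GX n X) (h0 : v + v' * ee n c m = 0) : v = 0 ∧ v' = 0 := by
  rw [← tate_e ⟨c, hc⟩] at h0
  exact TateRing.G_indep _ (X := {a : Fin n × ℕ | ((a.1 : ℕ), a.2) ∈ X}) h hv hv' h0

theorem coeffHom_mem_GX (r : RR) : (tate n).coeffHom r ∈ GX n X := TateRing.coeffHom_mem_G _ _ _ _

theorem exists_coeffHom (hX : ∀ p ∈ X, n ≤ p.1) {w : KX (n + 1)} (hw : w ∈ GX n X) :
    ∃ r, (tate n).coeffHom r = w := by
  refine TateRing.G_empty_le _ (lay n) (TateRing.G_mono _ _ (fun a ha => ?_) hw)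
  exact absurd (hX _ ha) (by simp)

theorem map_mem_GX {k : ℕ} {f : Fin (k + 1) → Fin (n + 1)}
    (h : ∀ c m (hc : c < k), (c, m) ∈ X → v n (f ⟨c + 1, by omega⟩) m - v n (f ⟨c, by omega⟩) m ∈ GX n Y)
    {w : KX (k + 1)} (hw : w ∈ GX k X) : map f w ∈ GX n Y := by
  refine @TateRing.map_mem_G _ _ (Fin k × ℕ) _ _ _ (tate k) _ _ _ _ (tate n) (map f) (map_b f) (map_h f)
    (Fin n × ℕ) _ (lay k) (lay n) {a | ((a.1 : ℕ), a.2) ∈ X} {a | ((a.1 : ℕ), a.2) ∈ Y} (fun a ha => ?_) w hw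
  obtain ⟨c, m⟩ := a
  rw [tate_e, map_ee f c.2]
  exact h c m c.2 ha

theorem GX_univ : GX n Set.univ = ⊤ := TateRing.G_univ _ (constNat n)

theorem exists_GX (w : KX (n + 1)) : ∃ J : Finset ℕ, w ∈ GX n {p | p.2 ∈ J} := by
  obtain ⟨J, hJ⟩ := (tate n).exists_finset (constNat n) w
  refine ⟨J.image Prod.snd, TateRing.G_mono _ _ (fun a ha => ?_) hJ⟩
  have h : a.2 ∈ J.image Prod.snd := Finset.mem_image_of_mem Prod.snd (Finset.mem_coe.1 ha)
  exact h

/-- A subgroup that contains `1` and is closed under multiplication by the generators is everything. -/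
theorem mem_of_mul_mem {M : AddSubgroup (KX (n + 1))} (h1 : 1 ∈ M)
    (hr : ∀ x ∈ M, ∀ r, x * (tate n).coeffHom r ∈ M)
    (he : ∀ x ∈ M, ∀ c m, c < n → x * ee n c m ∈ M) (w : KX (n + 1)) : w ∈ M := by
  have hw : w ∈ (tate n).G (lay n) Set.univ := by rw [(tate n).G_univ (constNat n)]; exact Subring.mem_top w
  refine Subring.closure_le_of_mul_mem h1 (fun x hx g hg => ?_) hw
  rcases hg with hg | ⟨a, -, rfl⟩
  · obtain ⟨r, rfl⟩ := (tate n).G_empty_le (lay n) ((tate n).base_subset_G (lay n) ∅ hg)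
    exact hr x hx r
  · obtain ⟨c, m⟩ := a
    rw [tate_e]
    exact he x hx c m c.2

theorem eq_neg_self {w : KX (n + 1)} (h : w = -w) : w = 0 := by
  have h2 := TateRing.eq_neg_two_mul (BExt.three_eq_zero) w
  nth_rw 2 [h] at h2
  rw [neg_add_cancel, neg_zero] at h2
  exact h2

theorem odd_sq {w : KX (n + 1)} (hw : sign (n + 1) w = -w) : w * w = 0 := by
  refine eq_neg_self ?_
  nth_rw 1 [odd_comm hw w]
  rw [hw, neg_mul]

/-- The parity `i` part. -/
def HasParity (i : ZMod 2) (w : KX (n + 1)) : Prop := sign (n + 1) w = if i = 0 then w else -w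

theorem HasParity.comm {i j : ZMod 2} {x y : KX (n + 1)} (hx : HasParity i x) (hy : HasParity j y) :
    x * y = ((-1 : ℤˣ) ^ (j * i)) • (y * x) := by
  have h2 : ∀ i : ZMod 2, i = 0 ∨ i = 1 := by decide
  rcases h2 i with rfl | rfl
  · rw [HasParity, if_pos rfl] at hx
    rw [mul_zero, uzpow_zero, one_smul, even_comm hx]
  · rw [HasParity, if_neg (by decide)] at hx
    rw [mul_one, odd_comm hx, hy]
    rcases h2 j with rfl | rfl
    · rw [if_pos rfl, uzpow_zero, one_smul]
    · rw [if_neg (by decide), uzpow_one, Units.neg_smul, one_smul, neg_mul]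

theorem hasParity_coeffHom {i : ZMod 2} {r : RR} (hr : r ∈ RR.parity i) : HasParity i ((tate n).coeffHom r) := by
  have h2 : ∀ i : ZMod 2, i = 0 ∨ i = 1 := by decide
  rw [HasParity, TateRing.coeffHom_apply, map_add, map_mul]
  change (tate n).sign _ + (tate n).sign _ * (tate n).sign _ = _
  rw [TateRing.sign_laurent, TateRing.sign_laurent, (tate n).sign_c1 (by rw [TatePre.δ_one, map_zero])]
  rcases h2 i with rfl | rfl
  · rw [RR.mem_even.1 hr, map_zero, zero_mul, zero_mul, if_pos rfl]
  · rw [RR.mem_odd.1 hr, map_zero, zero_add, zero_add, if_neg (by decide), mul_neg]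

end KX

namespace EE
open KX

/-- The map of algebras `E[e₂, e₃, …] → K_{**}K`. -/
def toKX : EE →ₐ[F3] KX 2 := ExteriorAlgebra.lift F3 ⟨Finsupp.linearCombination F3 e, fun m => by
  refine odd_sq (n := 1) ?_
  change (sign 2).primeAlgHom.toLinearMap _ = _
  rw [Finsupp.linearCombination_apply, Finsupp.sum, map_sum, ← Finset.sum_neg_distrib]
  refine Finset.sum_congr rfl fun i _ => ?_
  rw [map_smul, ← smul_neg]
  exact congrArg _ (sign_e i)⟩

theorem toKX_gen (m : ℕ) : toKX (gen m) = e m := by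
  refine (ExteriorAlgebra.lift_ι_apply F3 _ _ _).trans ?_
  rw [Finsupp.linearCombination_single, one_smul]

theorem hom_ext {A : Type} [Ring A] [Algebra F3 A] {f g : EE →ₐ[F3] A} (h : ∀ m, f (gen m) = g (gen m)) : f = g :=
  ExteriorAlgebra.hom_ext (Finsupp.lhom_ext' fun m => LinearMap.ext_ring (h m))

theorem sign_toKX (x : EE) : sign 2 (toKX x) = toKX (CliffordAlgebra.involute x) := by
  have h : (sign 2).primeAlgHom.comp toKX = toKX.comp CliffordAlgebra.involute := hom_ext fun m => by
    change sign 2 (toKX (gen m)) = toKX (CliffordAlgebra.involute (CliffordAlgebra.ι _ _))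
    rw [CliffordAlgebra.involute_ι, map_neg]
    change _ = -toKX (gen m)
    rw [toKX_gen, sign_e]
  exact DFunLike.congr_fun h x

theorem hasParity_toKX {i : ZMod 2} {x : EE} (hx : x ∈ parity i) : HasParity (n := 1) i (toKX x) := by
  have h2 : ∀ i : ZMod 2, i = 0 ∨ i = 1 := by decide
  rw [HasParity, sign_toKX]
  rcases h2 i with rfl | rfl
  · rw [if_pos rfl, CliffordAlgebra.involute_eq_of_mem_even hx]
  · rw [if_neg (by decide), CliffordAlgebra.involute_eq_of_mem_odd hx, map_neg]

/-- The subalgebra generated by the `e_m` for `m ∈ J`. -/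
def sub (J : Set ℕ) : Subalgebra F3 EE := Algebra.adjoin F3 (gen '' J)

theorem gen_mul_gen (a b : ℕ) : gen a * gen b = -(gen b * gen a) :=
  eq_neg_of_add_eq_zero_left (ExteriorAlgebra.ι_add_mul_swap _ _)

theorem gen_sq (a : ℕ) : gen a * gen a = 0 := ExteriorAlgebra.ι_sq_zero _

theorem expand {J : Set ℕ} {a : ℕ} {x : EE} (hx : x ∈ sub (insert a J)) :
    ∃ y ∈ sub J, ∃ z ∈ sub J, x = y + z * gen a := by
  let M : Submodule F3 EE :=
    { carrier := {x | ∃ y ∈ sub J, ∃ z ∈ sub J, x = y + z * gen a}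
      zero_mem' := ⟨0, zero_mem _, 0, zero_mem _, by simp⟩
      add_mem' := by
        rintro _ _ ⟨y, hy, z, hz, rfl⟩ ⟨y', hy', z', hz', rfl⟩
        exact ⟨y + y', add_mem hy hy', z + z', add_mem hz hz', by rw [add_mul]; abel⟩
      smul_mem' := by
        rintro r _ ⟨y, hy, z, hz, rfl⟩
        exact ⟨r • y, Subalgebra.smul_mem _ hy r, r • z, Subalgebra.smul_mem _ hz r, by
          rw [smul_add, smul_mul_assoc]⟩ }
  have h : Subalgebra.toSubmodule (sub (insert a J)) ≤ M := by
    rw [sub, Algebra.adjoin_eq_span]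
    refine Submodule.span_le.2 fun x hx => ?_
    refine Submonoid.closure_induction_right (motive := fun x _ => x ∈ M) ⟨1, one_mem _, 0, zero_mem _, by simp⟩ ?_ hx
    rintro _ - _ ⟨b, hb, rfl⟩ ⟨y, hy, z, hz, rfl⟩
    rcases hb with rfl | hb
    · exact ⟨0, zero_mem _, y, hy, by rw [add_mul, mul_assoc, gen_sq, mul_zero, add_zero, zero_add]⟩
    · have hb' : gen b ∈ sub J := Algebra.subset_adjoin ⟨b, hb, rfl⟩
      refine ⟨y * gen b, mul_mem hy hb', -(z * gen b), neg_mem (mul_mem hz hb'), ?_⟩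
      rw [add_mul, mul_assoc, gen_mul_gen a b, mul_neg, neg_mul, mul_assoc]
  exact h hx

theorem sub_mono {J K : Set ℕ} (h : J ⊆ K) : sub J ≤ sub K := Algebra.adjoin_mono (Set.image_mono h)

theorem exists_sub (x : EE) : ∃ J : Finset ℕ, x ∈ sub J := by
  induction x using ExteriorAlgebra.induction with
  | algebraMap r => exact ⟨∅, Subalgebra.algebraMap_mem _ _⟩
  | ι m =>
    refine ⟨m.support, ?_⟩
    have h : ExteriorAlgebra.ι F3 m = ∑ i ∈ m.support, ExteriorAlgebra.ι F3 (Finsupp.single i (m i)) :=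
      (congrArg _ (Finsupp.sum_single m).symm).trans (map_sum _ _ _)
    rw [h]
    refine sum_mem fun i hi => ?_
    rw [← mul_one (m i), ← smul_eq_mul, ← Finsupp.smul_single, map_smul]
    exact Subalgebra.smul_mem _ (Algebra.subset_adjoin (Set.mem_image_of_mem gen (Finset.mem_coe.2 hi))) _
  | mul x y hx hy =>
    obtain ⟨J, hJ⟩ := hx
    obtain ⟨K, hK⟩ := hy
    refine ⟨J ∪ K, ?_⟩
    rw [Finset.coe_union]
    exact mul_mem (sub_mono Set.subset_union_left hJ) (sub_mono Set.subset_union_right hK)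
  | add x y hx hy =>
    obtain ⟨J, hJ⟩ := hx
    obtain ⟨K, hK⟩ := hy
    refine ⟨J ∪ K, ?_⟩
    rw [Finset.coe_union]
    exact add_mem (sub_mono Set.subset_union_left hJ) (sub_mono Set.subset_union_right hK)

theorem toKX_mem {J : Set ℕ} {x : EE} (hx : x ∈ sub J) : toKX x ∈ GX 1 {p | p.2 ∈ J} := by
  refine Algebra.adjoin_induction (p := fun x _ => toKX x ∈ GX 1 {p | p.2 ∈ J}) ?_ (fun r => ?_)
    (fun x y _ _ hx hy => ?_) (fun x y _ _ hx hy => ?_) hx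
  · rintro _ ⟨m, hm, rfl⟩
    rw [toKX_gen, e_eq_ee]
    exact ee_mem_GX Nat.zero_lt_one hm
  · rw [AlgHom.commutes, ← ZMod.natCast_zmod_val r, map_natCast]
    exact natCast_mem _ _
  · rw [map_add]; exact add_mem hx hy
  · rw [map_mul]; exact mul_mem hx hy

end EE

namespace RE
open KX

/-- The map `R ⊗ E[e₂, e₃, …] → K_{**}K`. -/
def toKX : RE →ₐ[F3] KX 2 := GradedTensorProduct.lift RR.parity EE.parity (tate 1).coeffHom EE.toKX
  fun _ _ a b => (hasParity_coeffHom a.2).comm (EE.hasParity_toKX b.2)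

theorem toKX_tmul (r : RR) (x : EE) : toKX (tmul r x) = (tate 1).coeffHom r * EE.toKX x :=
  GradedTensorProduct.lift_tmul _ _ _ _ _ _ _

theorem tmul_mul (r : RR) (x y : EE) : tmul r x * tmul 1 y = tmul r (x * y) := by
  rw [tmul, tmul, tmul, ← GradedTensorProduct.tmul_one_mul_one_tmul, mul_assoc]
  rw [← GradedTensorProduct.tmul_one_mul_one_tmul RR.parity EE.parity r (x * y)]
  refine congrArg _ ?_
  exact (map_mul (GradedTensorProduct.includeRight RR.parity EE.parity) x y).symm

/-- The subgroup of `R ⊗ E[e₂, e₃, …]` spanned by the products of the `e_m` for `m ∈ J`. -/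
def sub (J : Set ℕ) : AddSubgroup RE := AddSubgroup.closure {z | ∃ r, ∃ x ∈ EE.sub J, z = tmul r x}

theorem sub_mono {J K : Set ℕ} (h : J ⊆ K) : sub J ≤ sub K :=
  AddSubgroup.closure_mono fun _ ⟨r, x, hx, hz⟩ => ⟨r, x, EE.sub_mono h hx, hz⟩

theorem exists_sub (z : RE) : ∃ J : Finset ℕ, z ∈ sub J := by
  refine TensorProduct.induction_on (motive := fun z => ∃ J : Finset ℕ, (GradedTensorProduct.of F3 RR.parity EE.parity z) ∈ sub J)
    ((GradedTensorProduct.of F3 RR.parity EE.parity).symm z) ⟨∅, zero_mem _⟩ (fun r x => ?_) ?_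
  · obtain ⟨J, hJ⟩ := EE.exists_sub x
    exact ⟨J, AddSubgroup.subset_closure ⟨r, x, hJ, rfl⟩⟩
  · rintro y z ⟨J, hJ⟩ ⟨K, hK⟩
    refine ⟨J ∪ K, ?_⟩
    rw [Finset.coe_union, map_add]
    exact add_mem (sub_mono Set.subset_union_left hJ) (sub_mono Set.subset_union_right hK)

theorem expand {J : Set ℕ} {a : ℕ} {z : RE} (hz : z ∈ sub (insert a J)) :
    ∃ x ∈ sub J, ∃ y ∈ sub J, z = x + y * tmul 1 (EE.gen a) := by
  refine AddSubgroup.closure_induction (p := fun z _ => ∃ x ∈ sub J, ∃ y ∈ sub J, z = x + y * tmul 1 (EE.gen a))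
    ?_ ⟨0, zero_mem _, 0, zero_mem _, by rw [zero_mul, add_zero]⟩ ?_ ?_ hz
  · rintro _ ⟨r, x, hx, rfl⟩
    obtain ⟨y, hy, z, hz, rfl⟩ := EE.expand hx
    refine ⟨_, AddSubgroup.subset_closure ⟨r, y, hy, rfl⟩, _, AddSubgroup.subset_closure ⟨r, z, hz, rfl⟩, ?_⟩
    rw [tmul_mul]
    exact TensorProduct.tmul_add _ _ _
  · rintro _ _ - - ⟨x, hx, y, hy, rfl⟩ ⟨x', hx', y', hy', rfl⟩
    exact ⟨x + x', add_mem hx hx', y + y', add_mem hy hy', by rw [add_mul]; abel⟩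
  · rintro _ - ⟨x, hx, y, hy, rfl⟩
    exact ⟨-x, neg_mem hx, -y, neg_mem hy, by rw [neg_mul, neg_add]⟩

theorem toKX_mem {J : Set ℕ} {z : RE} (hz : z ∈ sub J) : toKX z ∈ GX 1 {p | p.2 ∈ J} := by
  refine AddSubgroup.closure_induction (p := fun z _ => toKX z ∈ GX 1 {p | p.2 ∈ J}) ?_ ?_ ?_ ?_ hz
  · rintro _ ⟨r, x, hx, rfl⟩
    rw [toKX_tmul]
    exact mul_mem (coeffHom_mem_GX r) (EE.toKX_mem hx)
  · rw [map_zero]; exact zero_mem _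
  · rintro x y - - hx hy; rw [map_add]; exact add_mem hx hy
  · rintro x - hx; rw [map_neg]; exact neg_mem hx

theorem sub_empty {z : RE} (hz : z ∈ sub ∅) : ∃ r, z = tmul r 1 := by
  refine AddSubgroup.closure_induction (p := fun z _ => ∃ r, z = tmul r 1) ?_ ?_ ?_ ?_ hz
  · rintro _ ⟨r, x, hx, rfl⟩
    rw [EE.sub, Set.image_empty, Algebra.adjoin_empty] at hx
    obtain ⟨t, rfl⟩ := Algebra.mem_bot.1 hx
    refine ⟨t • r, ?_⟩
    rw [Algebra.algebraMap_eq_smul_one]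
    exact (TensorProduct.smul_tmul t r 1).symm
  · exact ⟨0, (TensorProduct.zero_tmul _ _).symm⟩
  · rintro _ _ - - ⟨r, rfl⟩ ⟨s, rfl⟩
    exact ⟨r + s, (TensorProduct.add_tmul _ _ _).symm⟩
  · rintro _ - ⟨r, rfl⟩
    exact ⟨-r, (TensorProduct.neg_tmul _ _).symm⟩

theorem toKX_gen (m : ℕ) : toKX (tmul 1 (EE.gen m)) = e m := by
  rw [toKX_tmul, map_one, one_mul, EE.toKX_gen]

theorem toKX_coeff (r : RR) : toKX (tmul r 1) = (tate 1).coeffHom r := by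
  rw [toKX_tmul, map_one, mul_one]

/-- By induction on the generators `e_a`, which are exterior on both sides. -/
theorem toKX_bijective : Function.Bijective toKX := by
  constructor
  · refine (injective_iff_map_eq_zero _).2 fun z hz => ?_
    obtain ⟨J, hJ⟩ := exists_sub z
    induction J using Finset.induction_on generalizing z with
    | empty =>
      rw [Finset.coe_empty] at hJ
      obtain ⟨r, rfl⟩ := sub_empty hJ
      rw [toKX_coeff] at hz
      rw [coeffHom_injective 1 (hz.trans (map_zero _).symm)]
      exact TensorProduct.zero_tmul _ _
    | insert a J ha ih =>
      rw [Finset.coe_insert] at hJ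
      obtain ⟨x, hx, y, hy, rfl⟩ := expand hJ
      rw [map_add, map_mul, toKX_gen, e_eq_ee] at hz
      obtain ⟨h1, h2⟩ := GX_indep (X := {p | p.2 ∈ (J : Set ℕ)}) Nat.zero_lt_one
        (show a ∉ (J : Set ℕ) from Finset.mem_coe.not.2 ha) (toKX_mem hx) (toKX_mem hy) hz
      rw [ih x h1 hx, ih y h2 hy, zero_mul, add_zero]
  · refine fun w => mem_of_mul_mem (M := (toKX : RE →+* KX 2).range.toAddSubgroup) (one_mem (toKX : RE →+* KX 2).range)
      ?_ ?_ w
    · intro x hx r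
      exact mul_mem (S := Subring (KX 2)) hx ⟨tmul r 1, toKX_coeff r⟩
    · intro x hx c m hc
      obtain rfl : c = 0 := by omega
      exact mul_mem (S := Subring (KX 2)) hx ⟨tmul 1 (EE.gen m), (toKX_gen m).trans (e_eq_ee m)⟩

/-- The isomorphism of `R ⊗ E[e₂, e₃, …]` with `K_{**}K`. -/
def equivKX : RE ≃+* KX 2 := RingEquiv.ofBijective (toKX : RE →+* KX 2) toKX_bijective

end RE

/-! ### Balanced tensors and the comultiplication -/

namespace KK
open KX

theorem free :
    letI : Module RR (KX 2) := Module.compHom (KX 2) (etaL.comp (phi : RR →+* KX 1))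
    Module.Free RR (KX 2) := by
  let _ : Module RR (KX 2) := Module.compHom (KX 2) (etaL.comp (phi : RR →+* KX 1))
  let E := ((GradedTensorProduct.of F3 RR.parity EE.parity).toAddEquiv.trans RE.equivKX.toAddEquiv)
  have hE : ∀ r x, E (r ⊗ₜ x) = (tate 1).coeffHom r * EE.toKX x := RE.toKX_tmul
  suffices h : ∀ (r : RR) z, E (r • z) = r • E z from
    Module.Free.of_equiv (show (RR ⊗[F3] EE) ≃ₗ[RR] KX 2 from { E with map_smul' := h })
  intro r z
  change E (r • z) = etaL (phi r) * E z
  rw [etaL_phi]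
  induction z using TensorProduct.induction_on with
  | zero => rw [smul_zero, map_zero, mul_zero]
  | add y z hy hz => rw [smul_add, map_add, map_add, mul_add, hy, hz]
  | tmul s x => rw [TensorProduct.smul_tmul', smul_eq_mul, hE, hE, map_mul, mul_assoc]

theorem front_ee (m : ℕ) : front (ee 1 0 m) = ee 2 0 m := map_ee (k := 1) (n := 2) _ Nat.zero_lt_one m
theorem back_ee (m : ℕ) : back (ee 1 0 m) = ee 2 1 m := map_ee (k := 1) (n := 2) _ Nat.zero_lt_one m
theorem front_coeffHom (r : RR) : front ((tate 1).coeffHom r) = (tate 2).coeffHom r :=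
  map_coeffHom (k := 1) (n := 2) _ r
theorem back_coeffHom (r : RR) : back ((tate 1).coeffHom r) = (tate 2).coeffHom r :=
  map_coeffHom (k := 1) (n := 2) _ r
theorem alpha_coeffHom (r : RR) : alpha ((tate 1).coeffHom r) = (tate 2).coeffHom r :=
  map_coeffHom (k := 1) (n := 2) _ r

theorem front_injective : Function.Injective front := by
  refine Function.LeftInverse.injective (g := KX.map ![0, 1, 1]) fun x => ?_
  rw [front, map_map]
  refine Eq.trans (congrArg (fun f => KX.map f x) (funext fun i => ?_)) (map_id x)
  fin_cases i <;> rfl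

namespace Bal

theorem add_tmul (x y z : KX 2) : tmul (x + y) z = tmul x z + tmul y z :=
  congrArg (QuotientAddGroup.mk (s := balRel)) (TensorProduct.add_tmul x y z)

theorem tmul_add (x y z : KX 2) : tmul x (y + z) = tmul x y + tmul x z :=
  congrArg (QuotientAddGroup.mk (s := balRel)) (TensorProduct.tmul_add x y z)

theorem neg_tmul (x y : KX 2) : tmul (-x) y = -tmul x y :=
  congrArg (QuotientAddGroup.mk (s := balRel)) (TensorProduct.neg_tmul x y)

theorem tmul_etaL_mul (x y : KX 2) (a : KX 1) : tmul x (etaL a * y) = tmul (x * etaR a) y := by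
  refine (QuotientAddGroup.eq_iff_sub_mem.2 ?_).symm
  exact AddSubgroup.subset_closure ⟨x, y, a, rfl⟩

theorem induction {p : Bal → Prop} (tmul : ∀ x y, p (tmul x y)) (add : ∀ x y, p x → p y → p (x + y)) (z : Bal) :
    p z := by
  obtain ⟨z, rfl⟩ := QuotientAddGroup.mk_surjective z
  induction z using TensorProduct.induction_on with
  | zero => rw [← TensorProduct.zero_tmul (KX 2) (0 : KX 2)]; exact tmul 0 0
  | tmul x y => exact tmul x y
  | add x y hx hy => exact add _ _ hx hy

/-- Right multiplication on the right factor. -/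
def mulRight (g : KX 2) : Bal →+ Bal :=
  QuotientAddGroup.map balRel balRel (LinearMap.lTensor (KX 2) (LinearMap.mulRight ℤ g)).toAddMonoidHom (by
    refine (AddSubgroup.closure_le _).2 ?_
    rintro _ ⟨x, y, a, rfl⟩
    refine AddSubgroup.subset_closure ⟨x, y * g, a, ?_⟩
    rw [← mul_assoc, map_sub]
    rfl)

theorem mulRight_tmul (g x y : KX 2) : mulRight g (tmul x y) = tmul x (y * g) := rfl

theorem beta_mulRight (g : KX 2) (z : Bal) : beta (mulRight g z) = beta z * back g := by
  induction z using induction with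
  | tmul x y => rw [mulRight_tmul, beta_tmul, beta_tmul, map_mul, mul_assoc]
  | add x y hx hy => rw [map_add, map_add, map_add, hx, hy, add_mul]

/-- The subgroup of the `x ⊗ y` where `y` only involves the `e_m` for `m ∈ J`. -/
def sub (J : Set ℕ) : AddSubgroup Bal := AddSubgroup.closure {z | ∃ x, ∃ y ∈ GX 1 {p | p.2 ∈ J}, z = tmul x y}

theorem sub_mono {J K : Set ℕ} (h : J ⊆ K) : sub J ≤ sub K :=
  AddSubgroup.closure_mono fun _ ⟨x, y, hy, hz⟩ => ⟨x, y, GX_mono (fun _ hp => h hp) hy, hz⟩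

theorem exists_sub (z : Bal) : ∃ J : Finset ℕ, z ∈ sub J := by
  induction z using induction with
  | tmul x y =>
    obtain ⟨J, hJ⟩ := exists_GX (n := 1) y
    exact ⟨J, AddSubgroup.subset_closure ⟨x, y, hJ, rfl⟩⟩
  | add x y hx hy =>
    obtain ⟨J, hJ⟩ := hx
    obtain ⟨K, hK⟩ := hy
    refine ⟨J ∪ K, ?_⟩
    rw [Finset.coe_union]
    exact add_mem (sub_mono Set.subset_union_left hJ) (sub_mono Set.subset_union_right hK)

/-- The expansion of the right factor in `e_a`. -/
theorem expand {J : Set ℕ} {a : ℕ} {z : Bal} (hz : z ∈ sub (insert a J)) :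
    ∃ x ∈ sub J, ∃ y ∈ sub J, z = x + mulRight (ee 1 0 a) y := by
  refine AddSubgroup.closure_induction (p := fun z _ => ∃ x ∈ sub J, ∃ y ∈ sub J, z = x + mulRight (ee 1 0 a) y)
    ?_ ⟨0, zero_mem _, 0, zero_mem _, by rw [map_zero, add_zero]⟩ ?_ ?_ hz
  · rintro _ ⟨x, y, hy, rfl⟩
    have hy' : y ∈ GX 1 (insert (0, a) {p | p.2 ∈ J}) := by
      refine GX_le ?_ hy
      rintro ⟨c, m⟩ (hm | hm) hc
      · exact Or.inl (Prod.ext (Nat.lt_one_iff.1 hc) hm)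
      · exact Or.inr hm
    obtain ⟨u, hu, v, hv, rfl⟩ := GX_expand Nat.zero_lt_one hy'
    exact ⟨_, AddSubgroup.subset_closure ⟨x, u, hu, rfl⟩, _, AddSubgroup.subset_closure ⟨x, v, hv, rfl⟩,
      tmul_add _ _ _⟩
  · rintro _ _ - - ⟨x, hx, y, hy, rfl⟩ ⟨x', hx', y', hy', rfl⟩
    exact ⟨x + x', add_mem hx hx', y + y', add_mem hy hy', by rw [map_add]; abel⟩
  · rintro _ - ⟨x, hx, y, hy, rfl⟩
    exact ⟨-x, neg_mem hx, -y, neg_mem hy, by rw [map_neg]; abel⟩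

/-- Over `R` alone, the right factor can be moved to the left since `η_L = η_R`. -/
theorem sub_empty {z : Bal} (hz : z ∈ sub ∅) : ∃ x, z = tmul x 1 := by
  refine AddSubgroup.closure_induction (p := fun z _ => ∃ x, z = tmul x 1) ?_ ?_ ?_ ?_ hz
  · rintro _ ⟨x, y, hy, rfl⟩
    obtain ⟨r, rfl⟩ := exists_coeffHom (X := {p | p.2 ∈ (∅ : Set ℕ)}) (fun p hp => hp.elim) hy
    refine ⟨x * etaR (phi r), ?_⟩
    rw [← tmul_etaL_mul, mul_one, etaL_phi]
  · exact ⟨0, congrArg (QuotientAddGroup.mk (s := balRel)) (TensorProduct.zero_tmul _ _).symm⟩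
  · rintro _ _ - - ⟨x, rfl⟩ ⟨y, rfl⟩
    exact ⟨x + y, (add_tmul _ _ _).symm⟩
  · rintro _ - ⟨x, rfl⟩
    exact ⟨-x, (neg_tmul _ _).symm⟩

theorem beta_mem {J : Set ℕ} {z : Bal} (hz : z ∈ sub J) :
    beta z ∈ GX 2 {p | p.1 = 1 → p.2 ∈ J} := by
  refine AddSubgroup.closure_induction (p := fun z _ => beta z ∈ GX 2 {p | p.1 = 1 → p.2 ∈ J}) ?_ ?_ ?_ ?_ hz
  · rintro _ ⟨x, y, hy, rfl⟩
    rw [beta_tmul]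
    refine mul_mem ?_ ?_
    · refine map_mem_GX (k := 1) (n := 2) (X := Set.univ) (fun c m hc _ => ?_) (by rw [GX_univ]; exact Subring.mem_top x)
      obtain rfl : c = 0 := by omega
      exact ee_mem_GX (n := 2) (c := 0) (by omega) fun h => absurd (show 0 = 1 from h) Nat.zero_ne_one
    · refine map_mem_GX (k := 1) (n := 2) (X := {p | p.2 ∈ J}) (fun c m hc hm => ?_) hy
      obtain rfl : c = 0 := by omega
      exact ee_mem_GX (n := 2) (c := 1) (by omega) fun _ => hm
  · rw [map_zero]; exact zero_mem _
  · rintro x y - - hx hy; rw [map_add]; exact add_mem hx hy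
  · rintro x - hx; rw [map_neg]; exact neg_mem hx

end Bal

/-- Injectivity is by induction on the generators `e_a` that the right factor involves: on both
sides, each stage is the direct sum of the previous one and its multiple by `e_a`. -/
theorem beta_bijective : Function.Bijective beta := by
  constructor
  · refine (injective_iff_map_eq_zero _).2 fun z hz => ?_
    obtain ⟨J, hJ⟩ := Bal.exists_sub z
    induction J using Finset.induction_on generalizing z with
    | empty =>
      rw [Finset.coe_empty] at hJ
      obtain ⟨x, rfl⟩ := Bal.sub_empty hJ
      rw [beta_tmul, map_one, mul_one] at hz
      rw [front_injective (hz.trans (map_zero _).symm)]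
      exact congrArg (QuotientAddGroup.mk (s := balRel)) (TensorProduct.zero_tmul _ _)
    | insert a J ha ih =>
      rw [Finset.coe_insert] at hJ
      obtain ⟨x, hx, y, hy, rfl⟩ := Bal.expand hJ
      rw [map_add, Bal.beta_mulRight, back_ee] at hz
      obtain ⟨h1, h2⟩ := GX_indep (n := 2) (c := 1) (m := a) (X := {p | p.1 = 1 → p.2 ∈ (J : Set ℕ)}) (by omega)
        (fun h => ha (h rfl)) (Bal.beta_mem hx) (Bal.beta_mem hy) hz
      rw [ih x h1 hx, ih y h2 hy, map_zero, add_zero]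
  · have hM : ∀ g : KX 3, (∀ x y, front x * back y * g ∈ beta.range) → ∀ x ∈ beta.range, x * g ∈ beta.range := by
      rintro g hg _ ⟨z, rfl⟩
      induction z using Bal.induction with
      | tmul x y => exact hg x y
      | add x y hx hy => rw [map_add, add_mul]; exact add_mem hx hy
    refine fun w => mem_of_mul_mem (n := 2) (M := beta.range) ⟨Bal.tmul 1 1, ?_⟩ ?_ ?_ w
    · rw [beta_tmul, map_one, map_one, mul_one]
    · refine fun x hx r => hM _ (fun x y => ⟨Bal.tmul x (y * (tate 1).coeffHom r), ?_⟩) x hx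
      rw [beta_tmul, map_mul, back_coeffHom, mul_assoc]
    · refine fun x hx c m hc => hM _ (fun x y => ?_) x hx
      obtain rfl | rfl : c = 0 ∨ c = 1 := by omega
      -- The odd generator of the left factor moves past `1 ⊗ y`, which changes the sign of the odd part of `y`.
      · refine ⟨Bal.tmul (x * ee 1 0 m) (sign 2 y), ?_⟩
        rw [beta_tmul, map_mul, front_ee, mul_assoc, odd_comm (n := 2) (sign_ee 2 0 m), back, ← map_sign, sign_sign,
          mul_assoc]
      · refine ⟨Bal.tmul x (y * ee 1 0 m), ?_⟩
        rw [beta_tmul, map_mul, back_ee, mul_assoc]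

/-- The comultiplication `β⁻¹ ∘ α`. -/
def comul : KX 2 →+ Bal := (AddEquiv.ofBijective beta beta_bijective).symm.toAddMonoidHom.comp alpha.toAddMonoidHom

theorem beta_comul (x : KX 2) : beta (comul x) = alpha x :=
  (AddEquiv.ofBijective beta beta_bijective).apply_symm_apply _

theorem comul_e (m : ℕ) : comul (e m) = Bal.tmul (e m) 1 + Bal.tmul 1 (e m) := by
  refine beta_bijective.1 ?_
  rw [beta_comul, map_add, beta_tmul, beta_tmul, map_one, map_one, one_mul, mul_one, alpha_e]

theorem _root_.EE.comul_gen (m : ℕ) : EE.comul (EE.gen m) =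
    EE.gen m ᵍ⊗ₜ[F3] (1 : EE) + (1 : EE) ᵍ⊗ₜ[F3] EE.gen m :=
  ExteriorAlgebra.lift_ι_apply F3 _ _ _

theorem hasParity_map {n : ℕ} (f : Fin 2 → Fin (n + 1)) {i : ZMod 2} {x : KX 2} (hx : HasParity (n := 1) i x) :
    HasParity (n := n) i (KX.map f x) := by
  rw [HasParity] at hx ⊢
  rw [← map_sign, hx]
  split_ifs
  · rfl
  · exact map_neg _ _

/-- The map of algebras `x ⊗ y ↦ (x ⊗ 1)(1 ⊗ y)` on `E[e₂, e₃, …] ⊗ E[e₂, e₃, …]`. -/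
def betaEE : EE.parity ᵍ⊗[F3] EE.parity →ₐ[F3] KX 3 :=
  GradedTensorProduct.lift EE.parity EE.parity (front.primeAlgHom.comp EE.toKX) (back.primeAlgHom.comp EE.toKX)
    fun _ _ a b => (hasParity_map (n := 2) _ (EE.hasParity_toKX a.2)).comm
      (hasParity_map (n := 2) _ (EE.hasParity_toKX b.2))

theorem betaEE_tmul (x y : EE) : betaEE (x ᵍ⊗ₜ[F3] y) = front (EE.toKX x) * back (EE.toKX y) :=
  GradedTensorProduct.lift_tmul _ _ _ _ _ _ _

theorem betaEE_comul (x : EE) : betaEE (EE.comul x) = alpha (EE.toKX x) := by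
  refine DFunLike.congr_fun (show betaEE.comp EE.comul = alpha.primeAlgHom.comp EE.toKX from
    EE.hom_ext fun m => ?_) x
  change betaEE (EE.comul (EE.gen m)) = alpha (EE.toKX (EE.gen m))
  rw [EE.comul_gen, map_add, betaEE_tmul, betaEE_tmul, map_one, map_one, map_one, mul_one, one_mul, EE.toKX_gen,
    alpha_e]

theorem comul_equivKX (r : RR) (x : EE) (m : ℕ) (y z : Fin m → EE) (h : EE.comul x = ∑ i, y i ᵍ⊗ₜ[F3] z i) :
    comul (RE.equivKX (RE.tmul r x)) =
      ∑ i, Bal.tmul (RE.equivKX (RE.tmul r (y i))) (RE.equivKX (RE.tmul 1 (z i))) := by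
  refine beta_bijective.1 ?_
  have hE : ∀ r x, RE.equivKX (RE.tmul r x) = (tate 1).coeffHom r * EE.toKX x := RE.toKX_tmul
  rw [beta_comul, map_sum, hE, map_mul, ← betaEE_comul, h, map_sum, alpha_coeffHom, Finset.mul_sum]
  refine Finset.sum_congr rfl fun i _ => ?_
  rw [betaEE_tmul, beta_tmul, hE, hE, map_one, one_mul, map_mul, front_coeffHom, mul_assoc]

theorem counit_equivKX (r : RR) (x : EE) :
    counit (RE.equivKX (RE.tmul r x)) = phi (r * algebraMap F3 RR (EE.counit x)) := by
  have hE : RE.equivKX (RE.tmul r x) = (tate 1).coeffHom r * EE.toKX x := RE.toKX_tmul r x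
  have h : counit (EE.toKX x) = algebraMap F3 (KX 1) (EE.counit x) := by
    refine DFunLike.congr_fun (show counit.primeAlgHom.comp EE.toKX = (Algebra.ofId F3 (KX 1)).comp EE.counit from
      EE.hom_ext fun m => ?_) x
    change counit (EE.toKX (EE.gen m)) = algebraMap F3 (KX 1) (EE.counit (EE.gen m))
    have h0 : EE.counit (EE.gen m) = 0 := ExteriorAlgebra.lift_ι_apply F3 _ _ _
    rw [EE.toKX_gen, counit_e, h0, map_zero]
  rw [hE, map_mul, h, map_mul]
  refine congrArg₂ (· * ·) (map_coeffHom (k := 1) (n := 0) _ r) ?_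
  exact ((tate 0).coeffHom.commutes _).symm

theorem conj_equivKX (r : RR) (x : EE) :
    conj (RE.equivKX (RE.tmul r x)) = RE.equivKX (RE.tmul r (EE.conj x)) := by
  have hE : ∀ r x, RE.equivKX (RE.tmul r x) = (tate 1).coeffHom r * EE.toKX x := RE.toKX_tmul
  have h : conj (EE.toKX x) = EE.toKX (EE.conj x) := by
    refine DFunLike.congr_fun (show conj.primeAlgHom.comp EE.toKX = EE.toKX.comp EE.conj from
      EE.hom_ext fun m => ?_) x
    change conj (EE.toKX (EE.gen m)) = EE.toKX (EE.conj (EE.gen m))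
    have h0 : EE.conj (EE.gen m) = -EE.gen m := (ExteriorAlgebra.map_apply_ι _ _).trans (map_neg _ _)
    rw [EE.toKX_gen, conj_e, h0, map_neg, EE.toKX_gen]
  rw [hE, hE, map_mul, h]
  exact congrArg (· * _) (map_coeffHom (k := 1) (n := 1) _ r)

end KK

/-! ### The differential of the `E₁` page -/

namespace E1
open KX

/-! The generator `e_c` with `m` fixed is the difference of the factors `c` and `c + 1`; a coface shifts its
index, or, when it separates the two factors, replaces it by a sum. -/

section coface
variable {s i c : ℕ} (m : ℕ)

theorem coface_ee_le (hc : c < s) (h : i ≤ c) : KX.map (coface s i) (ee s c m) = ee (s + 1) (c + 1) m := by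
  rw [map_ee _ hc, coface_val (a := c + 1) rfl, coface_val (a := c) rfl, if_neg (by omega), if_neg (by omega)]
  rfl

theorem coface_ee_eq (hc : c < s) :
    KX.map (coface s (c + 1)) (ee s c m) = ee (s + 1) c m + ee (s + 1) (c + 1) m := by
  rw [map_ee _ hc, coface_val (a := c + 1) rfl, coface_val (a := c) rfl, if_neg (by omega), if_pos (by omega), ee, ee]
  abel

theorem coface_ee_lt (hc : c < s) (h : c + 1 < i) : KX.map (coface s i) (ee s c m) = ee (s + 1) c m := by
  rw [map_ee _ hc, coface_val (a := c + 1) rfl, coface_val (a := c) rfl, if_pos (by omega), if_pos (by omega)]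
  rfl

end coface

/-- The map that identifies `j` and `j + 1`; the induced map multiplies the factors `j` and `j + 1`. -/
def codegen (n j : ℕ) : Fin (n + 2) → Fin (n + 1) :=
  fun i => ⟨if (i : ℕ) ≤ j ∧ (i : ℕ) ≤ n then i else i - 1, by split_ifs <;> omega⟩

theorem codegen_val {n j : ℕ} {i : Fin (n + 2)} {a : ℕ} (h : (i : ℕ) = a) :
    (codegen n j i : ℕ) = if a ≤ j ∧ a ≤ n then a else a - 1 := by
  subst h; rfl

theorem codegen_coface_self {n j : ℕ} (x : Page (n + 1)) :
    KX.map (codegen (n + 1) j) (KX.map (coface (n + 1) (j + 1)) x) = x := by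
  rw [map_map]
  refine (map_congr (fun a => ?_) x).trans (map_id x)
  rw [Function.comp_apply, codegen_val (coface_val rfl), id]
  split_ifs <;> omega

theorem codegen_coface_lt {n j i : ℕ} (hj : j ≤ n) (hi : j < i) (x : Page (n + 1)) :
    KX.map (codegen (n + 1) j) (KX.map (coface (n + 1) (i + 1)) x) =
      KX.map (coface n i) (KX.map (codegen n j) x) := by
  rw [map_map, map_map]
  refine map_congr (fun a => ?_) x
  rw [Function.comp_apply, Function.comp_apply, codegen_val (coface_val rfl), coface_val (codegen_val rfl)]
  split_ifs <;> omega

/-- The generators `ee s c m` with `m ∈ J`, or with `m = a` and `c < k`. -/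
def gens (J : Set ℕ) (a k : ℕ) : Set (ℕ × ℕ) := {p | p.2 ∈ J ∨ (p.2 = a ∧ p.1 < k)}

variable {J : Set ℕ} {a s n : ℕ}

theorem gens_mono {k l : ℕ} (h : k ≤ l) : gens J a k ⊆ gens J a l :=
  fun _ hp => hp.imp_right fun hp => ⟨hp.1, hp.2.trans_le h⟩

theorem coface_ee_mem (i : ℕ) {c m : ℕ} (hc : c < s) {X : Set (ℕ × ℕ)} (h0 : (c, m) ∈ X) (h1 : (c + 1, m) ∈ X) :
    KX.map (coface s i) (ee s c m) ∈ GX (s + 1) X := by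
  have h0' : ee (s + 1) c m ∈ GX (s + 1) X := ee_mem_GX (by omega) h0
  have h1' : ee (s + 1) (c + 1) m ∈ GX (s + 1) X := ee_mem_GX (by omega) h1
  rcases le_or_gt i c with h | h
  · rwa [coface_ee_le m hc h]
  · rcases (show c + 1 ≤ i from h).eq_or_lt with rfl | h
    · rw [coface_ee_eq m hc]; exact add_mem h0' h1'
    · rwa [coface_ee_lt m hc h]

theorem coface_mem (i : ℕ) {k : ℕ} {x : Page s} (hx : x ∈ GX s (gens J a k)) :
    KX.map (coface s i) x ∈ GX (s + 1) (gens J a (k + 1)) := by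
  refine map_mem_GX (fun c m hc hm => ?_) hx
  rw [← map_ee _ hc]
  exact coface_ee_mem i hc (gens_mono (Nat.le_succ k) hm) (hm.imp_right fun hp => ⟨hp.1, Nat.succ_lt_succ hp.2⟩)

theorem coface_mem_of_lt {i k : ℕ} (hi : k < i) {x : Page s} (hx : x ∈ GX s (gens J a k)) :
    KX.map (coface s i) x ∈ GX (s + 1) (gens J a k) := by
  refine map_mem_GX (fun c m hc hm => ?_) hx
  rw [← map_ee _ hc]
  rcases hm with hm | ⟨hm, hk⟩
  · exact coface_ee_mem i hc (Or.inl hm) (Or.inl hm)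
  · have hk' : c < k := hk
    rw [coface_ee_lt m hc (by omega)]
    exact ee_mem_GX (by omega) (Or.inr ⟨hm, hk⟩)

theorem coface_mem_zero (i : ℕ) {x : Page s} (hx : x ∈ GX s (gens J a 0)) :
    KX.map (coface s i) x ∈ GX (s + 1) (gens J a 0) := by
  refine map_mem_GX (fun c m hc hm => ?_) hx
  rw [← map_ee _ hc]
  rcases hm with hm | ⟨_, hk⟩
  · exact coface_ee_mem i hc (Or.inl hm) (Or.inl hm)
  · exact absurd hk (Nat.not_lt_zero _)

theorem codegen_mem {j : ℕ} (hj : j ≤ n) {x : Page (n + 1)} (hx : x ∈ GX (n + 1) (gens J a j)) :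
    KX.map (codegen n j) x ∈ GX n (gens J a j) := by
  refine map_mem_GX (fun c m hc hm => ?_) hx
  rw [codegen_val (a := c + 1) rfl, codegen_val (a := c) rfl]
  rcases lt_trichotomy c j with h | rfl | h
  · rw [if_pos (by omega), if_pos (by omega)]
    exact ee_mem_GX (n := n) (by omega) (hm.imp_right fun hp => ⟨hp.1, h⟩)
  · rw [if_neg (by omega), if_pos (by omega), Nat.add_sub_cancel, sub_self]
    exact zero_mem _
  · rw [if_neg (by omega), if_neg (by omega)]
    obtain ⟨c, rfl⟩ : ∃ k, c = k + 1 := ⟨c - 1, by omega⟩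
    rcases hm with hm | ⟨-, hk⟩
    · exact ee_mem_GX (n := n) (by omega) (Or.inl hm)
    · have hk' : c + 1 < j := hk
      omega

/-- The part of the differential with index `> c`. -/
def dUpper (s c : ℕ) : Page s →+ Page (s + 1) :=
  ∑ i ∈ Finset.range (s + 2), if c < i then (-1 : ℤ) ^ i • (KX.map (coface s i)).toAddMonoidHom else 0

/-- The part of the differential with index `≤ c + 1`. -/
def dLower (s c : ℕ) : Page s →+ Page (s + 1) :=
  ∑ i ∈ Finset.range (s + 2), if i ≤ c + 1 then (-1 : ℤ) ^ i • (KX.map (coface s i)).toAddMonoidHom else 0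

theorem dUpper_apply (s c : ℕ) (x : Page s) : dUpper s c x =
    ∑ i ∈ Finset.range (s + 2), if c < i then (-1 : ℤ) ^ i • KX.map (coface s i) x else 0 := by
  rw [dUpper, AddMonoidHom.finsetSum_apply]
  refine Finset.sum_congr rfl fun i _ => ?_
  split_ifs <;> rfl

theorem dLower_apply (s c : ℕ) (x : Page s) : dLower s c x =
    ∑ i ∈ Finset.range (s + 2), if i ≤ c + 1 then (-1 : ℤ) ^ i • KX.map (coface s i) x else 0 := by
  rw [dLower, AddMonoidHom.finsetSum_apply]
  refine Finset.sum_congr rfl fun i _ => ?_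
  split_ifs <;> rfl

theorem dUpper_mem {c : ℕ} {x : Page s} (hx : x ∈ GX s (gens J a c)) :
    dUpper s c x ∈ GX (s + 1) (gens J a c) := by
  rw [dUpper_apply]
  refine sum_mem fun i _ => ?_
  split_ifs with h
  · exact zsmul_mem (coface_mem_of_lt h hx) _
  · exact zero_mem _

theorem dLower_mem {c : ℕ} {x : Page s} (hx : x ∈ GX s (gens J a c)) :
    dLower s c x ∈ GX (s + 1) (gens J a (c + 1)) := by
  rw [dLower_apply]
  refine sum_mem fun i _ => ?_
  split_ifs with h
  · exact zsmul_mem (coface_mem i hx) _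
  · exact zero_mem _

theorem d1_mem {x : Page s} (hx : x ∈ GX s (gens J a 0)) : d1 s x ∈ GX (s + 1) (gens J a 0) := by
  rw [d1_apply]
  exact sum_mem fun i _ => zsmul_mem (coface_mem_zero i hx) _

/-- The cofaces with index `> c` keep a summand `e_c` and those with index `≤ c + 1` a summand
`e_{c+1}`; for the index `c + 1` both occur. -/
theorem d1_mul_ee {c : ℕ} (hc : c < s) (x : Page s) (m : ℕ) : d1 s (x * ee s c m) =
    dUpper s c x * ee (s + 1) c m + dLower s c x * ee (s + 1) (c + 1) m := by
  rw [d1_apply, dUpper_apply, dLower_apply, Finset.sum_mul, Finset.sum_mul, ← Finset.sum_add_distrib]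
  refine Finset.sum_congr rfl fun i _ => ?_
  rw [map_mul]
  rcases le_or_gt i c with h | h
  · rw [coface_ee_le m hc h, if_neg (by omega), if_pos (by omega), zero_mul, zero_add, smul_mul_assoc]
  · rcases (show c + 1 ≤ i from h).eq_or_lt with rfl | h
    · rw [coface_ee_eq m hc, if_pos (by omega), if_pos (by omega), mul_add, smul_add, smul_mul_assoc, smul_mul_assoc]
    · rw [coface_ee_lt m hc h, if_pos (by omega), if_neg (by omega), zero_mul, add_zero, smul_mul_assoc]

/-- The codegeneracy `j` is a contracting homotopy for the upper part of the differential. -/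
theorem eq_dUpper_codegen {j : ℕ} (hj : j ≤ n) {x : Page (n + 1)} (h : dUpper (n + 1) j x = 0) :
    x = dUpper n j ((-1 : ℤ) ^ (j + 1) • KX.map (codegen n j) x) := by
  have h1 := congrArg (KX.map (codegen (n + 1) j)) h
  rw [map_zero, dUpper_apply, map_sum, Finset.sum_range_succ', if_neg (Nat.not_lt_zero _), map_zero, add_zero] at h1
  have h2 : ∀ i, KX.map (codegen (n + 1) j) (if j < i + 1 then (-1 : ℤ) ^ (i + 1) • KX.map (coface (n + 1) (i + 1)) x else 0) =
      (if i = j then (-1 : ℤ) ^ (j + 1) • x else 0) -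
      (if j < i then (-1 : ℤ) ^ i • KX.map (coface n i) (KX.map (codegen n j) x) else 0) := fun i => by
    rcases lt_trichotomy i j with hi | rfl | hi
    · rw [if_neg (by omega), if_neg (by omega), if_neg (by omega), map_zero, sub_zero]
    · rw [if_pos (by omega), if_pos rfl, if_neg (by omega), map_zsmul, codegen_coface_self, sub_zero]
    · rw [if_pos (by omega), if_neg (by omega), if_pos hi, map_zsmul, codegen_coface_lt hj hi, zero_sub, pow_succ,
        mul_neg_one, neg_smul]
  rw [Finset.sum_congr rfl fun i _ => h2 i, Finset.sum_sub_distrib, ← dUpper_apply, Finset.sum_ite_eq',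
    if_pos (Finset.mem_range.2 (by omega)), sub_eq_zero] at h1
  rw [map_zsmul, ← h1, smul_smul, ← mul_pow, neg_one_mul, neg_neg, one_pow, one_smul]

/-! ### Expansions `y + ∑ x_c e_c` in the generators with `m = a` -/

theorem exists_expansion {k : ℕ} (hk : k ≤ s) {y : Page s} (hy : y ∈ GX s (gens J a k)) :
    ∃ y₀ ∈ GX s (gens J a 0), ∃ x : ℕ → Page s, (∀ c, x c ∈ GX s (gens J a c)) ∧
      y = y₀ + ∑ c ∈ Finset.range k, x c * ee s c a := by
  induction k generalizing y with
  | zero => exact ⟨y, hy, 0, fun c => zero_mem _, by rw [Finset.sum_range_zero, add_zero]⟩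
  | succ k ih =>
    have h : gens J a (k + 1) ⊆ insert (k, a) (gens J a k) := by
      rintro ⟨c, m⟩ (hm | ⟨hm, hc⟩)
      · exact Or.inr (Or.inl hm)
      · rcases (Nat.lt_succ_iff.1 hc).eq_or_lt with h | h
        · exact Or.inl (Prod.ext h hm)
        · exact Or.inr (Or.inr ⟨hm, h⟩)
    obtain ⟨v, hv, w, hw, rfl⟩ := GX_expand (by omega) (GX_mono h hy)
    obtain ⟨y₀, hy₀, x, hx, rfl⟩ := ih (by omega) hv
    refine ⟨y₀, hy₀, Function.update x k w, fun c => ?_, ?_⟩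
    · by_cases hc : c = k
      · subst hc; rwa [Function.update_self]
      · rw [Function.update_of_ne hc]; exact hx c
    · rw [Finset.sum_range_succ, Function.update_self, add_assoc]
      refine congrArg (y₀ + ·) (congrArg (· + _) (Finset.sum_congr rfl fun c hc => ?_))
      rw [Function.update_of_ne (Finset.mem_range.1 hc).ne]

theorem sum_mem_GX {k : ℕ} (hk : k ≤ s) {y₀ : Page s} (hy₀ : y₀ ∈ GX s (gens J a 0)) {x : ℕ → Page s}
    (hx : ∀ c < k, x c ∈ GX s (gens J a c)) : y₀ + ∑ c ∈ Finset.range k, x c * ee s c a ∈ GX s (gens J a k) := by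
  refine add_mem (GX_mono (gens_mono (Nat.zero_le k)) hy₀) (sum_mem fun c hc => ?_)
  have hc' := Finset.mem_range.1 hc
  exact mul_mem (GX_mono (gens_mono hc'.le) (hx c hc')) (ee_mem_GX (by omega) (Or.inr ⟨rfl, hc'⟩))

theorem expansion_unique (ha : a ∉ J) {k : ℕ} (hk : k ≤ s) {y₀ : Page s} (hy₀ : y₀ ∈ GX s (gens J a 0))
    {x : ℕ → Page s} (hx : ∀ c < k, x c ∈ GX s (gens J a c))
    (h : y₀ + ∑ c ∈ Finset.range k, x c * ee s c a = 0) : y₀ = 0 ∧ ∀ c < k, x c = 0 := by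
  induction k with
  | zero => rw [Finset.sum_range_zero, add_zero] at h; exact ⟨h, fun c hc => absurd hc (Nat.not_lt_zero c)⟩
  | succ k ih =>
    rw [Finset.sum_range_succ, ← add_assoc] at h
    have hka : (k, a) ∉ gens J a k := by
      rintro (hm | ⟨-, hm⟩)
      · exact ha hm
      · exact lt_irrefl _ hm
    have hx' : ∀ c < k, x c ∈ GX s (gens J a c) := fun c hc => hx c (by omega)
    obtain ⟨h1, h2⟩ := GX_indep (by omega) hka (sum_mem_GX (by omega) hy₀ hx') (hx k (by omega)) h
    obtain ⟨h3, h4⟩ := ih (by omega) hx' h1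
    refine ⟨h3, fun c hc => ?_⟩
    rcases (Nat.lt_succ_iff.1 hc).eq_or_lt with rfl | hc
    · exact h2
    · exact h4 c hc

/-- The coefficients of the differential of `∑ x_c e_c`. -/
def dCoeff (s : ℕ) (x : ℕ → Page s) (c : ℕ) : Page (s + 1) :=
  (if c < s then dUpper s c (x c) else 0) + if 0 < c then dLower s (c - 1) (x (c - 1)) else 0

theorem d1_sum (x : ℕ → Page s) (m : ℕ) : d1 s (∑ c ∈ Finset.range s, x c * ee s c m) =
    ∑ c ∈ Finset.range (s + 1), dCoeff s x c * ee (s + 1) c m := by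
  rw [map_sum, Finset.sum_congr rfl fun c hc => d1_mul_ee (Finset.mem_range.1 hc) (x c) m, Finset.sum_add_distrib]
  refine Eq.trans ?_ ((Finset.sum_congr rfl fun c _ => add_mul _ _ (ee (s + 1) c m)).trans Finset.sum_add_distrib).symm
  refine congrArg₂ (· + ·) ?_ ?_
  · rw [Finset.sum_range_succ, if_neg (lt_irrefl s), zero_mul, add_zero]
    refine Finset.sum_congr rfl fun c hc => ?_
    rw [if_pos (Finset.mem_range.1 hc)]
  · rw [Finset.sum_range_succ', if_neg (lt_irrefl 0), zero_mul, add_zero]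
    refine Finset.sum_congr rfl fun c hc => ?_
    rw [if_pos (Nat.succ_pos c), Nat.add_sub_cancel]

theorem dCoeff_mem {x : ℕ → Page s} (hx : ∀ c, x c ∈ GX s (gens J a c)) (c : ℕ) :
    dCoeff s x c ∈ GX (s + 1) (gens J a c) := by
  refine add_mem ?_ ?_
  · split_ifs
    · exact dUpper_mem (hx c)
    · exact zero_mem _
  · rcases c with _ | c
    · rw [if_neg (lt_irrefl 0)]; exact zero_mem _
    · rw [if_pos (Nat.succ_pos c), Nat.add_sub_cancel]; exact dLower_mem (hx c)

/-- Multiplication by `e_a` on the `E₁` page adds one factor and the last of the generators. -/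
theorem mul_e (w : Page n) : mul (t := 1) w (e a) = KX.map (coface n (n + 1)) (sign (n + 1) w) * ee (n + 1) n a := by
  refine congrArg₂ (· * ·) (map_congr (fun i => ?_) _) ?_
  · rw [front_val, coface_val rfl, if_pos i.2]
  · rw [e_eq_ee]
    exact map_ee (k := 1) (n := n + 1) (back n 1) Nat.zero_lt_one a

theorem sign_mem {X : Set (ℕ × ℕ)} {w : Page n} (hw : w ∈ GX n X) : sign (n + 1) w ∈ GX n X := by
  have h : GX n X ≤ (GX n X).comap (sign (n + 1)) := by
    refine Subring.closure_le.2 ?_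
    rintro w (hw | ⟨⟨c, m⟩, hm, rfl⟩)
    · obtain ⟨r, rfl⟩ := (tate n).G_empty_le (lay n) ((tate n).base_subset_G (lay n) ∅ hw)
      change sign (n + 1) _ ∈ GX n X
      have h1 : sign (n + 1) ((tate n).coeffHom r) =
          (tate n).coeffHom (TrivSqZeroExt.inl r.fst - TrivSqZeroExt.inr r.snd) := by
        rw [TateRing.coeffHom_apply, TateRing.coeffHom_apply, map_add, map_mul]
        change (tate n).sign _ + (tate n).sign _ * (tate n).sign _ = _
        rw [TateRing.sign_laurent, TateRing.sign_laurent, (tate n).sign_c1 (by rw [TatePre.δ_one, map_zero])]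
        simp [sub_eq_add_neg]
      rw [h1]
      exact coeffHom_mem_GX _
    · change sign (n + 1) ((tate n).e (lay n) (c, m)) ∈ GX n X
      rw [tate_e, sign_ee]
      exact neg_mem (ee_mem_GX c.2 hm)
  exact h hw

/-- The first coefficient `x_j` is a boundary for the upper part of the differential, since the coefficient
of `e_j` in the differential of the sum is the upper part of the differential of `x_j`. -/
theorem exists_eq_dUpper (ha : a ∉ J) {y₀ : Page (n + 1)} (hy₀ : y₀ ∈ GX (n + 1) (gens J a 0))
    {z₀ z : Page (n + 2)} (hz₀ : z₀ ∈ GX (n + 2) (gens J a 0)) (hz : z ∈ GX (n + 2) (gens J a (n + 1)))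
    {j : ℕ} (hj : j ≤ n) {x : ℕ → Page (n + 1)} (hx : ∀ c, x c ∈ GX (n + 1) (gens J a c))
    (hx0 : ∀ c < j, x c = 0)
    (h : d1 (n + 1) (y₀ + ∑ c ∈ Finset.range (n + 1), x c * ee (n + 1) c a) = z₀ + z * ee (n + 2) (n + 1) a) :
    ∃ u ∈ GX n (gens J a j), x j = dUpper n j u := by
  refine ⟨_, zsmul_mem (codegen_mem hj (hx j)) _, eq_dUpper_codegen hj ?_⟩
  have h1 : (d1 (n + 1) y₀ - z₀) + ∑ c ∈ Finset.range (n + 2),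
      (dCoeff (n + 1) x c - if c = n + 1 then z else 0) * ee (n + 2) c a = 0 := by
    rw [map_add, d1_sum] at h
    rw [Finset.sum_congr rfl fun c _ => sub_mul _ _ (ee (n + 2) c a), Finset.sum_sub_distrib]
    simp only [ite_mul, zero_mul]
    rw [Finset.sum_ite_eq', if_pos (Finset.mem_range.2 (by omega)), sub_add_sub_comm, h, sub_self]
  have h2 := (expansion_unique ha le_rfl (sub_mem (d1_mem hy₀) hz₀) (fun c _ => ?_) h1).2 j (by omega)
  · rw [if_neg (by omega), sub_zero, dCoeff, if_pos (by omega)] at h2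
    rcases j with _ | j
    · rwa [if_neg (lt_irrefl 0), add_zero] at h2
    · rwa [if_pos (Nat.succ_pos j), Nat.add_sub_cancel, hx0 j (Nat.lt_succ_self j), map_zero, add_zero] at h2
  · refine sub_mem (dCoeff_mem hx c) ?_
    split_ifs with hc
    · subst hc; exact hz
    · exact zero_mem _

/-- If the differential of `y₀ + ∑ x_c e_c` only involves the last of the generators `e_c`, then so does
`∑ x_c e_c` up to a boundary. -/
theorem reduction (ha : a ∉ J) {y₀ : Page (n + 1)} (hy₀ : y₀ ∈ GX (n + 1) (gens J a 0))
    {z₀ z : Page (n + 2)} (hz₀ : z₀ ∈ GX (n + 2) (gens J a 0)) (hz : z ∈ GX (n + 2) (gens J a (n + 1)))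
    (k j : ℕ) (hj : j + k = n) (x : ℕ → Page (n + 1)) (hx : ∀ c, x c ∈ GX (n + 1) (gens J a c))
    (hx0 : ∀ c < j, x c = 0)
    (h : d1 (n + 1) (y₀ + ∑ c ∈ Finset.range (n + 1), x c * ee (n + 1) c a) = z₀ + z * ee (n + 2) (n + 1) a) :
    ∃ u ∈ GX n (gens J a n), ∃ w ∈ GX n (gens J a n),
      ∑ c ∈ Finset.range (n + 1), x c * ee (n + 1) c a = d1 n u + mul (t := 1) w (e a) := by
  induction k generalizing j x with
  | zero =>
    obtain rfl : j = n := hj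
    obtain ⟨u, hu, hxj⟩ := exists_eq_dUpper ha hy₀ hz₀ hz le_rfl hx hx0 h
    -- In the last position, the upper part consists of a single coface, so `x_n e_n` is a product with `e_a`.
    refine ⟨0, zero_mem _, sign (j + 1) ((-1 : ℤ) ^ (j + 1) • u), sign_mem (zsmul_mem hu _), ?_⟩
    rw [map_zero, zero_add, mul_e, sign_sign, map_zsmul, Finset.sum_range_succ, Finset.sum_eq_zero, zero_add, hxj]
    · refine congrArg (· * _) ?_
      rw [dUpper_apply, Finset.sum_range_succ, Finset.sum_eq_zero, zero_add, if_pos (Nat.lt_succ_self j)]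
      exact fun i hi => if_neg (by have := Finset.mem_range.1 hi; omega)
    · intro c hc
      rw [hx0 c (Finset.mem_range.1 hc), zero_mul]
  | succ k ih =>
    obtain ⟨u, hu, hxj⟩ := exists_eq_dUpper ha hy₀ hz₀ hz (by omega) hx hx0 h
    -- Subtracting the boundary of `u e_j` removes `x_j` and changes `x_{j+1}`.
    let x' : ℕ → Page (n + 1) := fun c =>
      x c - (if c = j then x j else 0) - (if c = j + 1 then dLower n j u else 0)
    have hsum : ∑ c ∈ Finset.range (n + 1), x' c * ee (n + 1) c a =
        ∑ c ∈ Finset.range (n + 1), x c * ee (n + 1) c a - d1 n (u * ee n j a) := by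
      have h1 : ∀ c, x' c * ee (n + 1) c a = x c * ee (n + 1) c a - (if c = j then x j * ee (n + 1) c a else 0) -
          (if c = j + 1 then dLower n j u * ee (n + 1) c a else 0) := fun c => by
        rw [sub_mul, sub_mul, ite_mul, ite_mul, zero_mul]
      rw [Finset.sum_congr rfl fun c _ => h1 c, Finset.sum_sub_distrib, Finset.sum_sub_distrib, Finset.sum_ite_eq',
        Finset.sum_ite_eq', if_pos (Finset.mem_range.2 (by omega)), if_pos (Finset.mem_range.2 (by omega)),
        d1_mul_ee (by omega), ← hxj, sub_sub]
    have hx' : ∀ c, x' c ∈ GX (n + 1) (gens J a c) := fun c => by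
      refine sub_mem (sub_mem (hx c) ?_) ?_
      · split_ifs with hc
        · subst hc; exact hx c
        · exact zero_mem _
      · split_ifs with hc
        · subst hc; exact dLower_mem hu
        · exact zero_mem _
    have hx0' : ∀ c < j + 1, x' c = 0 := fun c hc => by
      change x c - _ - _ = 0
      rcases (Nat.lt_succ_iff.1 hc).eq_or_lt with rfl | hc
      · rw [if_pos rfl, if_neg (by omega), sub_self, sub_zero]
      · rw [if_neg (by omega), if_neg (by omega), hx0 c hc, sub_zero, sub_zero]
    obtain ⟨v, hv, w, hw, hvw⟩ := ih (j + 1) (by omega) x' hx' hx0'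
      (by rw [hsum, ← h, ← add_sub_assoc, map_sub, d1_d1, sub_zero])
    refine ⟨u * ee n j a + v, add_mem (mul_mem (GX_mono (gens_mono (by omega)) hu)
      (ee_mem_GX (by omega) (Or.inr ⟨rfl, show j < n by omega⟩))) hv, w, hw, ?_⟩
    rw [map_add, sub_eq_iff_eq_add.1 (hsum.symm.trans hvw)]
    abel

end E1

/-! ### Splitting off one generator on the `E₁` page -/

namespace E1
open KX

variable {J : Set ℕ} {a s n : ℕ}

/-- The subring of `E₁^s` generated by `R` and the images of the `e_m` for `m ∈ J`. -/
noncomputable def sub (J : Set ℕ) (s : ℕ) : Subring (Page s) := GX s {p | p.2 ∈ J}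

theorem GX_gens_zero : GX s (gens J a 0) = sub J s :=
  le_antisymm (GX_le fun _ hp _ => hp.elim id fun h => absurd h.2 (Nat.not_lt_zero _))
    (GX_le fun _ hp _ => Or.inl hp)

theorem GX_gens_self : GX s (gens J a s) = sub (insert a J) s :=
  le_antisymm (GX_le fun _ hp _ => hp.elim Or.inr fun h => Or.inl h.1)
    (GX_le fun _ hp hs => hp.elim (fun h => Or.inr ⟨h, hs⟩) Or.inl)

theorem sub_zero_eq : sub J 0 = ⊤ := by
  rw [← GX_univ (n := 0)]
  exact le_antisymm (GX_mono (Set.subset_univ _)) (GX_le fun _ _ h => absurd h (Nat.not_lt_zero _))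

theorem d1_phi (r : RR) : d1 0 (phi r) = 0 := by
  rw [d1_apply, Finset.sum_range_succ, Finset.sum_range_one, map_phi, map_phi]
  simp

/-- On the image of `R`, the alternating sum of the `s + 2` cofaces is `0` or the identity. -/
theorem d1_coeffHom (r : RR) : d1 s ((tate s).coeffHom r) = if Even s then 0 else (tate (s + 1)).coeffHom r := by
  rw [d1_apply, Finset.sum_congr rfl fun i _ => congrArg ((-1 : ℤ) ^ i • ·) (map_coeffHom (coface s i) r),
    ← Finset.sum_smul, neg_one_geom_sum]
  by_cases h : Even s
  · rw [if_pos h, if_pos (by simpa [parity_simps] using h), zero_smul]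
  · rw [if_neg h, if_neg (by simpa [parity_simps] using h), one_smul]

theorem d1_e (m : ℕ) : d1 1 (e m) = 0 := by
  rw [d1_apply, Finset.sum_range_succ, Finset.sum_range_succ, Finset.sum_range_one, e_eq_ee,
    coface_ee_le m Nat.zero_lt_one le_rfl, coface_ee_eq m Nat.zero_lt_one,
    coface_ee_lt m Nat.zero_lt_one (by omega)]
  simp

theorem d1_mul_e (w : Page n) (m : ℕ) : d1 (n + 1) (mul (t := 1) w (e m)) = mul (t := 1) (d1 n w) (e m) := by
  rw [d1_mul, d1_e]
  have h : mul (t := 1 + 1) ((-1 : ℤ) ^ n • sign (n + 1) w) (0 : Page (1 + 1)) = 0 := by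
    rw [mul, map_zero, mul_zero]
  rw [h, add_zero]
  exact (map_congr (fun i => rfl) _).trans (map_id _)

/-- In `z + w e_a`, with `z` free of `e_a`, both `z` and `w` are determined by the sum. -/
theorem mul_e_indep (ha : a ∉ J) {z : Page (n + 1)} (hz : z ∈ sub J (n + 1)) {w : Page n}
    (hw : w ∈ sub (insert a J) n) (h : z + mul (t := 1) w (e a) = 0) : z = 0 ∧ w = 0 := by
  rw [mul_e] at h
  rw [← GX_gens_self] at hw
  rw [← GX_gens_zero (a := a)] at hz
  have hna : (n, a) ∉ gens J a n := by
    rintro (hm | ⟨-, hm⟩)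
    · exact ha hm
    · exact lt_irrefl _ hm
  obtain ⟨h1, h2⟩ := GX_indep (n := n + 1) (Nat.lt_succ_self n) hna (GX_mono (gens_mono (Nat.zero_le n)) hz)
    (coface_mem_of_lt (Nat.lt_succ_self n) (sign_mem hw)) h
  refine ⟨h1, ?_⟩
  have h3 := congrArg (KX.map (codegen n n)) h2
  have h4 : KX.map (codegen n n) (KX.map (coface n (n + 1)) (sign (n + 1) w)) = sign (n + 1) w := by
    rw [map_map]
    refine (map_congr (fun a => ?_) _).trans (map_id _)
    rw [Function.comp_apply, codegen_val (coface_val rfl), id]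
    split_ifs <;> omega
  rw [h4, map_zero] at h3
  rw [← sign_sign w, h3, map_zero]

/-- An element whose differential is of the form `z + w e_a`, in particular a cocycle, is itself of this
form up to a boundary. -/
theorem exists_eq_add_mul_e (ha : a ∉ J) {y : Page (n + 1)} (hy : y ∈ sub (insert a J) (n + 1))
    {z : Page (n + 2)} (hz : z ∈ sub J (n + 2)) {w : Page (n + 1)} (hw : w ∈ sub (insert a J) (n + 1))
    (h : d1 (n + 1) y = z + mul (t := 1) w (e a)) :
    ∃ y₀ ∈ sub J (n + 1), ∃ u ∈ sub (insert a J) n, ∃ v ∈ sub (insert a J) n,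
      y = y₀ + d1 n u + mul (t := 1) v (e a) := by
  rw [← GX_gens_self] at hy hw
  rw [← GX_gens_zero (a := a)] at hz
  obtain ⟨y₀, hy₀, x, hx, rfl⟩ := exists_expansion le_rfl hy
  rw [mul_e] at h
  obtain ⟨u, hu, v, hv, huv⟩ := reduction ha hy₀ hz (coface_mem_of_lt (Nat.lt_succ_self _) (sign_mem hw)) n 0
    (Nat.zero_add n) x hx (fun c hc => absurd hc (Nat.not_lt_zero c)) h
  rw [GX_gens_self] at hu hv
  rw [GX_gens_zero] at hy₀
  exact ⟨y₀, hy₀, u, hu, v, hv, (congrArg (y₀ + ·) huv).trans (add_assoc _ _ _).symm⟩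

/-! ### The total `E₁` page -/

theorem d_of_phi (r : RR) : dg.d (DirectSum.of Page 0 (phi r)) = 0 := by
  refine (d_of 0 _).trans ?_
  rw [d1_phi, map_zero]

/-- The element `e_m` of the total `E₁` page. -/
noncomputable def W (m : ℕ) : Total := DirectSum.of Page 1 (e m)

theorem d_W (m : ℕ) : dg.d (W m) = 0 := by
  refine (d_of 1 _).trans ?_
  rw [d1_e, map_zero]

theorem mul_phi (x : Page s) (r : RR) : mul (t := 0) x (phi r) = x * (tate s).coeffHom r := by
  refine congrArg₂ (· * ·) ?_ (map_phi (n := s) _ r)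
  exact (map_congr (fun _ => rfl) _).trans (map_id x)

theorem d_apply_succ (u : Total) (s : ℕ) : (d u) (s + 1) = d1 s (u s) := by
  induction u using DirectSum.induction_on with
  | zero => rw [map_zero, DirectSum.zero_apply, DirectSum.zero_apply, map_zero]
  | of t x =>
    rw [d_of]
    by_cases h : t = s
    · subst h
      rw [DirectSum.of_eq_same, DirectSum.of_eq_same]
    · rw [DirectSum.of_eq_of_ne _ _ _ (by omega), DirectSum.of_eq_of_ne _ _ _ (by omega), map_zero]
  | add x y hx hy => rw [map_add, DirectSum.add_apply, DirectSum.add_apply, hx, hy, map_add]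

theorem d_apply_zero (u : Total) : (d u) 0 = 0 := by
  induction u using DirectSum.induction_on with
  | zero => rw [map_zero, DirectSum.zero_apply]
  | of t x => rw [d_of, DirectSum.of_eq_of_ne _ _ _ (by omega)]
  | add x y hx hy => rw [map_add, DirectSum.add_apply, hx, hy, add_zero]

theorem mul_add_e (x y : Page s) (m : ℕ) : mul (t := 1) (x + y) (e m) = mul (t := 1) x (e m) + mul (t := 1) y (e m) := by
  rw [mul_e, mul_e, mul_e, map_add, map_add, add_mul]

theorem mul_zero_e (m : ℕ) : mul (t := 1) (0 : Page s) (e m) = 0 := by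
  rw [mul_e, map_zero, map_zero, zero_mul]

theorem mul_W_apply_succ (u : Total) (m s : ℕ) : (u * W m) (s + 1) = mul (t := 1) (u s) (e m) := by
  induction u using DirectSum.induction_on with
  | zero => rw [zero_mul, DirectSum.zero_apply, DirectSum.zero_apply, mul_zero_e]
  | of t x =>
    rw [W, of_mul_of]
    by_cases h : t = s
    · subst h
      rw [DirectSum.of_eq_same, DirectSum.of_eq_same]
    · rw [DirectSum.of_eq_of_ne _ _ _ (by omega), DirectSum.of_eq_of_ne _ _ _ (by omega), mul_zero_e]
  | add x y hx hy => rw [add_mul, DirectSum.add_apply, DirectSum.add_apply, hx, hy, mul_add_e]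

theorem mul_W_apply_zero (u : Total) (m : ℕ) : (u * W m) 0 = 0 := by
  induction u using DirectSum.induction_on with
  | zero => rw [zero_mul, DirectSum.zero_apply]
  | of t x => rw [W, of_mul_of, DirectSum.of_eq_of_ne _ _ _ (by omega)]
  | add x y hx hy => rw [add_mul, DirectSum.add_apply, hx, hy, add_zero]

theorem mul_phi_apply (u : Total) (r : RR) (s : ℕ) :
    (u * DirectSum.of Page 0 (phi r)) s = u s * (tate s).coeffHom r := by
  induction u using DirectSum.induction_on with
  | zero => rw [zero_mul, DirectSum.zero_apply, zero_mul]
  | of t x =>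
    rw [of_mul_of, mul_phi]
    by_cases h : t = s
    · subst h
      exact (DirectSum.of_eq_same (β := Page) _ _).trans (congrArg (· * _) (DirectSum.of_eq_same (β := Page) _ _).symm)
    · rw [DirectSum.of_eq_of_ne t s x (by omega), zero_mul]
      exact DirectSum.of_eq_of_ne (β := Page) _ _ _ (by omega)
  | add x y hx hy => rw [add_mul, DirectSum.add_apply, DirectSum.add_apply, hx, hy, add_mul]

theorem d_mul_W (u : Total) (m : ℕ) : d (u * W m) = d u * W m := by
  refine (dg.d_mul u (W m)).trans ?_
  rw [d_W, mul_zero, add_zero]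
  rfl

/-- The subgroup of the elements of the `E₁` page that only involve the `e_m` for `m ∈ J`. -/
noncomputable def subTotal (J : Set ℕ) : AddSubgroup Total where
  carrier := {u | ∀ s, u s ∈ sub J s}
  zero_mem' := fun _ => zero_mem _
  add_mem' := fun hx hy s => add_mem (hx s) (hy s)
  neg_mem' := fun hx s => neg_mem (hx s)

theorem mul_W_mem {u : Total} (hu : u ∈ subTotal J) (hm : a ∈ J) : u * W a ∈ subTotal J := fun s => by
  rcases s with _ | s
  · rw [mul_W_apply_zero]; exact zero_mem _
  · rw [mul_W_apply_succ, mul_e]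
    have hu' := hu s
    rw [← GX_gens_zero (a := a)] at hu'
    refine mul_mem ?_ (ee_mem_GX (n := s + 1) (Nat.lt_succ_self s) hm)
    rw [← GX_gens_zero (a := a)]
    exact coface_mem_zero _ (sign_mem hu')

theorem mul_phi_mem {u : Total} (hu : u ∈ subTotal J) (r : RR) : u * DirectSum.of Page 0 (phi r) ∈ subTotal J :=
  fun s => by
    rw [mul_phi_apply]
    exact mul_mem (hu s) (coeffHom_mem_GX r)

theorem one_mem_subTotal : (1 : Total) ∈ subTotal J := fun s => by
  have h : (1 : Total) = DirectSum.of Page 0 (1 : KX 1) := rfl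
  rw [h]
  rcases s with _ | s
  · rw [sub_zero_eq]; exact Subring.mem_top _
  · rw [DirectSum.of_eq_of_ne _ _ _ (by omega)]; exact zero_mem _

theorem d_mem_subTotal {u : Total} (hu : u ∈ subTotal J) : d u ∈ subTotal J := fun s => by
  rcases s with _ | s
  · rw [d_apply_zero]; exact zero_mem _
  · rw [d_apply_succ, ← GX_gens_zero (a := 0)]
    have hu' := hu s
    rw [← GX_gens_zero (a := 0)] at hu'
    exact d1_mem hu'

/-- The decomposition `y + x e_a` with `y` free of `e_a` is unique. -/
theorem mul_W_indep {y x : Total} (hy : y ∈ subTotal {a}ᶜ) (h : y + x * W a = 0) : y = 0 ∧ x = 0 := by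
  have h1 : ∀ s, y (s + 1) = 0 ∧ x s = 0 := fun s => by
    refine mul_e_indep (J := {a}ᶜ) (fun h => h rfl) (hy (s + 1)) ?_ ?_ (a := a)
    · rw [Set.insert_eq, Set.union_compl_self]
      exact (congrArg (x s ∈ ·) (GX_univ (n := s))).mpr (Subring.mem_top _)
    · rw [← mul_W_apply_succ, ← DirectSum.add_apply, h, DirectSum.zero_apply]
  refine ⟨DFinsupp.ext fun s => ?_, DFinsupp.ext fun s => (h1 s).2⟩
  rcases s with _ | s
  · have h2 := congrArg (fun z : Total => z 0) h
    simp only [DirectSum.add_apply, mul_W_apply_zero, add_zero] at h2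
    exact h2
  · exact (h1 s).1

/-- If the differential of `u` has the form `y + x e_a` with `y` free of `e_a`, then so does `u`, up to a
boundary. -/
theorem exists_eq_add_mul_W {y x u : Total} (hy : y ∈ subTotal {a}ᶜ) (h : d u = y + x * W a) :
    ∃ u₀ ∈ subTotal {a}ᶜ, ∃ u' v, u = u₀ + d u' + v * W a := by
  let M : AddSubgroup Total :=
    { carrier := {u | ∃ u₀ ∈ subTotal {a}ᶜ, ∃ u' v, u = u₀ + d u' + v * W a}
      zero_mem' := ⟨0, zero_mem _, 0, 0, by rw [map_zero, zero_mul, add_zero, add_zero]⟩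
      add_mem' := by
        rintro _ _ ⟨u₀, h, u', v, rfl⟩ ⟨u₀', h', u'', v', rfl⟩
        exact ⟨u₀ + u₀', add_mem h h', u' + u'', v + v', by rw [map_add, add_mul]; abel⟩
      neg_mem' := by
        rintro _ ⟨u₀, h, u', v, rfl⟩
        exact ⟨-u₀, neg_mem h, -u', -v, by rw [map_neg, neg_mul v]; abel⟩ }
  have hof : ∀ {s : ℕ} {z : Page s}, z ∈ sub {a}ᶜ s → DirectSum.of Page s z ∈ subTotal {a}ᶜ := fun {s z} hz t => by
    by_cases h : s = t
    · subst h
      rwa [DirectSum.of_eq_same]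
    · rw [DirectSum.of_eq_of_ne _ _ _ (Ne.symm h)]
      exact zero_mem _
  have huniv : ∀ {s : ℕ} (z : Page s), z ∈ sub (insert a {a}ᶜ) s := fun {s} z => by
    rw [Set.insert_eq, Set.union_compl_self]
    exact (congrArg (z ∈ ·) (GX_univ (n := s))).mpr (Subring.mem_top _)
  classical
  have hu : u ∈ M := by
    rw [← DirectSum.sum_support_of u]
    refine sum_mem fun s _ => ?_
    rcases s with _ | s
    · have h0 : u 0 ∈ sub {a}ᶜ 0 := by rw [sub_zero_eq]; exact Subring.mem_top _
      exact ⟨_, hof h0, 0, 0, by rw [map_zero, zero_mul, add_zero, add_zero]⟩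
    · have hs : d1 (s + 1) (u (s + 1)) = y (s + 2) + mul (t := 1) (x (s + 1)) (e a) := by
        rw [← d_apply_succ, h, DirectSum.add_apply, mul_W_apply_succ]
      obtain ⟨y₀, hy₀, u', -, v, -, hv⟩ := exists_eq_add_mul_e (J := {a}ᶜ) (a := a) (fun h => h rfl)
        (huniv _) (hy (s + 2)) (huniv _) hs
      refine ⟨_, hof hy₀, DirectSum.of Page s u', DirectSum.of Page s v, ?_⟩
      rw [d_of, W, of_mul_of, ← map_add, ← map_add, hv]
  exact hu

end E1

/-! ### The `E₂` page -/

namespace E1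
open KX

/-- The class of `r ∈ R` in the `E₂` page. -/
noncomputable def coeff : RR →+* dg.Coh := dg.proj.comp
  { toFun := fun r => ⟨DirectSum.of Page 0 (phi r), d_of_phi r⟩
    map_one' := Subtype.ext (congrArg (DirectSum.of Page 0) (map_one phi))
    map_zero' := Subtype.ext ((congrArg (DirectSum.of Page 0) (map_zero phi)).trans (map_zero _))
    map_add' := fun r s => Subtype.ext ((congrArg (DirectSum.of Page 0) (map_add phi r s)).trans (map_add _ _ _))
    map_mul' := fun r s => Subtype.ext (by
      refine Eq.trans ?_ (of_mul_of (phi r) (phi s)).symm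
      refine congrArg (DirectSum.of Page 0) ((map_mul phi r s).trans ?_)
      exact (mul_phi (s := 0) (phi r) s).symm) }

/-- The class `w_m` of `e_m`. -/
noncomputable def w (m : ℕ) : dg.Coh := dg.cls (W m) (d_W m)

theorem cls_eq_zero_iff {x : Total} (hx : dg.d x = 0) : dg.cls x hx = 0 ↔ ∃ u, d u = x :=
  Ideal.Quotient.eq_zero_iff_mem

theorem cls_surjective (z : dg.Coh) : ∃ x hx, dg.cls x hx = z := by
  obtain ⟨⟨x, hx⟩, rfl⟩ := dg.proj_surjective z
  exact ⟨x, hx, rfl⟩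

theorem coeff_injective : Function.Injective coeff := by
  refine (injective_iff_map_eq_zero _).2 fun r hr => ?_
  obtain ⟨u, hu⟩ := (cls_eq_zero_iff _).1 hr
  have h := congrArg (fun z : Total => z 0) hu
  simp only [d_apply_zero, DirectSum.of_eq_same] at h
  exact (map_eq_zero_iff phi phi.injective).1 h.symm

theorem W_mul_phi (m : ℕ) (r : RR) :
    W m * DirectSum.of Page 0 (phi r) = DirectSum.of Page 0 (phi r) * W m := by
  rw [W, of_mul_of, of_mul_of, mul_phi]
  refine (of_eq (show 1 + 0 = 0 + 1 from rfl) _).trans (congrArg _ ?_)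
  refine (map_congr (fun i => rfl) _).trans ((map_id _).trans ?_)
  rw [mul_e, e_eq_ee, odd_comm (sign_ee 1 0 m), map_sign, map_phi]

/-- The elements `e_m` commute up to the boundary of the product `e_m e_k` in `E₁¹`. -/
theorem W_mul_W (m k : ℕ) : W m * W k = W k * W m + d (DirectSum.of Page 1 (e m * e k)) := by
  rw [W, W, of_mul_of, of_mul_of, d_of, ← map_add]
  refine congrArg (DirectSum.of Page 2) ?_
  rw [mul_e, mul_e, d1_apply, Finset.sum_range_succ, Finset.sum_range_succ, Finset.sum_range_one]
  simp only [map_mul, e_eq_ee, sign_ee, map_neg]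
  rw [coface_ee_le m Nat.zero_lt_one le_rfl, coface_ee_le k Nat.zero_lt_one le_rfl,
    coface_ee_eq m Nat.zero_lt_one, coface_ee_eq k Nat.zero_lt_one,
    coface_ee_lt m Nat.zero_lt_one (by omega), coface_ee_lt k Nat.zero_lt_one (by omega)]
  have h : ee (1 + 1) (0 + 1) m * ee (1 + 1) 0 k = -(ee (1 + 1) 0 k * ee (1 + 1) (0 + 1) m) := by
    rw [odd_comm (sign_ee 2 1 m), sign_ee, neg_mul]
  rw [add_mul, mul_add, mul_add, h]
  simp only [pow_zero, one_smul, pow_one, neg_smul]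
  norm_num
  abel

theorem commute_gens : ∀ x ∈ Set.range coeff ∪ Set.range w, ∀ y ∈ Set.range coeff ∪ Set.range w, x * y = y * x := by
  have hrw : ∀ r m, coeff r * w m = w m * coeff r := fun r m =>
    congrArg dg.proj (Subtype.ext (W_mul_phi m r).symm)
  rintro _ (⟨r, rfl⟩ | ⟨m, rfl⟩) _ (⟨s, rfl⟩ | ⟨k, rfl⟩)
  · rw [← map_mul, mul_comm, map_mul]
  · exact hrw r k
  · exact (hrw s m).symm
  · rw [← sub_eq_zero]
    refine Ideal.Quotient.eq_zero_iff_mem.2 ⟨DirectSum.of Page 1 (e m * e k), ?_⟩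
    change d _ = W m * W k - W k * W m
    rw [W_mul_W, add_sub_cancel_left]

/-- The subgroup of the cocycles whose class lies in the subring generated by `R` and the `w_m`. -/
noncomputable def good : AddSubgroup Total where
  carrier := {y | ∃ h : dg.d y = 0, dg.cls y h ∈ Subring.closure (Set.range coeff ∪ Set.range w)}
  zero_mem' := ⟨map_zero _, by
    rw [(cls_eq_zero_iff (map_zero _)).2 ⟨0, map_zero _⟩]
    exact zero_mem _⟩
  add_mem' := by
    rintro x y ⟨hx, hx'⟩ ⟨hy, hy'⟩
    exact ⟨by rw [map_add, hx, hy, add_zero], add_mem hx' hy'⟩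
  neg_mem' := by
    rintro x ⟨hx, hx'⟩
    exact ⟨by rw [map_neg, hx, neg_zero], neg_mem hx'⟩

theorem d_mem_good (u : Total) : d u ∈ good :=
  ⟨dg.d_d u, by
    change dg.cls (dg.d u) (dg.d_d u) ∈ _
    rw [(cls_eq_zero_iff (dg.d_d u)).2 ⟨u, rfl⟩]
    exact zero_mem _⟩

theorem mul_W_mem_good {x : Total} (hx : x ∈ good) (m : ℕ) : x * W m ∈ good := by
  obtain ⟨h, hx⟩ := hx
  have hm : w m ∈ Subring.closure (Set.range coeff ∪ Set.range w) := Subring.subset_closure (Or.inr ⟨m, rfl⟩)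
  refine ⟨?_, mul_mem hx hm⟩
  refine (d_mul_W x m).trans ?_
  rw [show d x = 0 from h, zero_mul]

/-- The image of `R` in the `E₁` page is a complex with differentials `0, 1, 0, 1, …`, so that it only
contributes in degree `0`. -/
theorem of_coeffHom_mem_good (r : RR) (h : d1 s ((tate s).coeffHom r) = 0) :
    DirectSum.of Page s ((tate s).coeffHom r) ∈ good := by
  rcases s with _ | n
  · exact ⟨d_of_phi r, Subring.subset_closure (Or.inl ⟨r, rfl⟩)⟩
  rw [d1_coeffHom] at h
  by_cases hn : Even (n + 1)
  · have h1 := d1_coeffHom (s := n) r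
    rw [if_neg fun h => Nat.even_add_one.1 hn h] at h1
    rw [← h1, ← d_of]
    exact d_mem_good _
  · rw [if_neg hn] at h
    rw [coeffHom_injective (n + 2) (h.trans (map_zero _).symm), map_zero, map_zero]
    exact zero_mem _

/-- By induction on the generators and on the degree: a cocycle is `y₀ + d u + v e_a`, where `y₀` is a
cocycle that does not involve `e_a` and `v` is a cocycle of lower degree. -/
theorem of_mem_good (J : Finset ℕ) (s : ℕ) {y : Page s} (hy : y ∈ sub J s) (h : d1 s y = 0) :
    DirectSum.of Page s y ∈ good := by
  induction J using Finset.induction_on generalizing s y with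
  | empty =>
    obtain ⟨r, rfl⟩ := exists_coeffHom (X := {p | p.2 ∈ ((∅ : Finset ℕ) : Set ℕ)})
      (fun p hp => absurd hp (Finset.notMem_empty _)) hy
    exact of_coeffHom_mem_good r h
  | insert a J ha ih =>
    rw [Finset.coe_insert] at hy
    have ha' : a ∉ (J : Set ℕ) := fun h => ha (Finset.mem_coe.1 h)
    induction s with
    | zero => exact ih 0 (by rw [sub_zero_eq]; exact Subring.mem_top _) h
    | succ n ihn =>
      obtain ⟨y₀, hy₀, u, hu, v, hv, rfl⟩ := exists_eq_add_mul_e (z := 0) (w := 0) ha' hy (zero_mem _) (zero_mem _)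
        (by rw [h, mul_zero_e, add_zero])
      rw [map_add, map_add, d1_d1, add_zero, d1_mul_e] at h
      have hy₀' : d1 (n + 1) y₀ ∈ sub (J : Set ℕ) (n + 2) := by
        rw [← GX_gens_zero (a := a)] at hy₀ ⊢
        exact d1_mem hy₀
      have hv' : d1 n v ∈ sub (insert a (J : Set ℕ)) (n + 1) := by
        rw [← GX_gens_zero (a := a)] at hv ⊢
        exact d1_mem hv
      obtain ⟨h1, h2⟩ := mul_e_indep ha' hy₀' hv' h
      rw [map_add, map_add, ← d_of, ← of_mul_of]
      exact add_mem (add_mem (ih (n + 1) hy₀ h1) (d_mem_good _)) (mul_W_mem_good (ihn hv h2) a)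

theorem closure_eq_top : Subring.closure (Set.range coeff ∪ Set.range w) = ⊤ := by
  classical
  refine eq_top_iff.2 fun z _ => ?_
  obtain ⟨x, hx, rfl⟩ := cls_surjective z
  suffices h : x ∈ good from h.2
  rw [← DirectSum.sum_support_of x]
  refine sum_mem fun s _ => ?_
  obtain ⟨J, hJ⟩ := exists_GX (n := s) (x s)
  refine of_mem_good J s hJ ?_
  rw [← d_apply_succ]
  exact DFunLike.congr_fun hx (s + 1)

/-- The `E₂` page is commutative, since it is generated by elements that commute. It is needed
as a local instance for the polynomial ring only. -/
local instance : CommRing dg.Coh :=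
  { (inferInstance : Ring dg.Coh) with
    mul_comm := fun x y => by
      have h1 : Subring.closure (Set.range coeff ∪ Set.range w) ≤ Subring.centralizer (Set.range coeff ∪ Set.range w) :=
        Subring.closure_le.2 fun x hx y hy => commute_gens y hy x hx
      have h2 := Subring.closure_le_centralizer_centralizer (Set.range coeff ∪ Set.range w)
      rw [closure_eq_top] at h1 h2
      exact h2 (Subring.mem_top y) x (h1 (Subring.mem_top x)) }

local instance : Algebra RR dg.Coh := coeff.toAlgebra

/-- A polynomial in the `w_m` with `m ≠ a` is represented by a cocycle that does not involve `e_a`. -/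
theorem exists_subTotal {t : Set ℕ} (ha : a ∉ t) {q : dg.Coh} (hq : q ∈ Algebra.adjoin RR (w '' t)) :
    ∃ y ∈ subTotal {a}ᶜ, ∃ hy, q = dg.cls y hy := by
  let M : AddSubgroup dg.Coh :=
    { carrier := {q | ∃ y ∈ subTotal {a}ᶜ, ∃ hy, q = dg.cls y hy}
      zero_mem' := ⟨0, zero_mem _, map_zero _, rfl⟩
      add_mem' := by
        rintro _ _ ⟨y, hy, h, rfl⟩ ⟨y', hy', h', rfl⟩
        exact ⟨y + y', add_mem hy hy', by rw [map_add, h, h', add_zero], rfl⟩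
      neg_mem' := by
        rintro _ ⟨y, hy, h, rfl⟩
        exact ⟨-y, neg_mem hy, by rw [map_neg, h, neg_zero], rfl⟩ }
  rw [← Subalgebra.mem_toSubring, Algebra.adjoin_eq_ring_closure] at hq
  refine Subring.closure_le_of_mul_mem (M := M) ⟨1, one_mem_subTotal, dg.cycles.one_mem, rfl⟩ ?_ hq
  rintro _ ⟨y, hy, h, rfl⟩ _ (⟨r, rfl⟩ | ⟨m, hm, rfl⟩)
  · exact ⟨_, mul_phi_mem hy r, dg.cycles.mul_mem h (d_of_phi r), rfl⟩
  · exact ⟨_, mul_W_mem hy (fun h => ha (h ▸ hm)), dg.cycles.mul_mem h (d_W m), rfl⟩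

/-- If `x e_a + y` is the differential of `u`, then `u = u₀ + d u' + v e_a` and comparison of coefficients
gives `x = d v` and `y = d u₀`. -/
theorem mul_w_indep {t : Set ℕ} (ha : a ∉ t) {q z : dg.Coh} (hq : q ∈ Algebra.adjoin RR (w '' t))
    (h : z * w a + q = 0) : z = 0 ∧ q = 0 := by
  obtain ⟨y, hy, hdy, rfl⟩ := exists_subTotal ha hq
  obtain ⟨x, hx, rfl⟩ := cls_surjective z
  obtain ⟨u, hu⟩ := (cls_eq_zero_iff (x := x * W a + y)
    (dg.cycles.add_mem (dg.cycles.mul_mem hx (d_W a)) hdy)).1 h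
  rw [add_comm] at hu
  obtain ⟨u₀, hu₀, u', v, rfl⟩ := exists_eq_add_mul_W hy hu
  have hdd : d (d u') = 0 := dg.d_d u'
  rw [map_add, map_add, hdd, add_zero, d_mul_W] at hu
  obtain ⟨h1, h2⟩ := mul_W_indep (a := a) (y := y - d u₀) (x := x - d v) (sub_mem hy (d_mem_subTotal hu₀)) (by
    rw [sub_mul, sub_add_sub_comm, hu, sub_self])
  exact ⟨(cls_eq_zero_iff hx).2 ⟨v, (sub_eq_zero.1 h2).symm⟩, (cls_eq_zero_iff hdy).2 ⟨u₀, (sub_eq_zero.1 h1).symm⟩⟩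

theorem transcendental_w {t : Set ℕ} (ha : a ∉ t) : Transcendental (Algebra.adjoin RR (w '' t)) (w a) := by
  refine transcendental_iff.2 fun p hp => ?_
  have h : ∀ n (p : Polynomial (Algebra.adjoin RR (w '' t))), Polynomial.aeval (w a) p = 0 → p.coeff n = 0 := by
    intro n
    have key : ∀ p : Polynomial (Algebra.adjoin RR (w '' t)), Polynomial.aeval (w a) p = 0 →
        Polynomial.aeval (w a) p.divX = 0 ∧ (p.coeff 0 : dg.Coh) = 0 := fun p hp => by
      refine mul_w_indep ha (p.coeff 0).2 ?_
      rw [← Polynomial.divX_mul_X_add p, map_add, map_mul, Polynomial.aeval_X, Polynomial.aeval_C] at hp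
      exact hp
    induction n with
    | zero => exact fun p hp => Subtype.ext (key p hp).2
    | succ n ih => exact fun p hp => by rw [← Polynomial.coeff_divX]; exact ih _ (key p hp).1
  exact Polynomial.ext fun n => (h n p hp).trans (Polynomial.coeff_zero n).symm

theorem algebraicIndependent_w : AlgebraicIndependent RR w :=
  algebraicIndependent_of_finite_type' coeff_injective fun _ _ _ _ ha => transcendental_w ha

/-- The isomorphism of `R[w₂, w₃, …]` with the `E₂` page. -/
noncomputable def psi : MvPolynomial ℕ RR ≃+* dg.Coh :=
  RingEquiv.ofBijective ((MvPolynomial.aeval w : MvPolynomial ℕ RR →ₐ[RR] dg.Coh) : MvPolynomial ℕ RR →+* dg.Coh)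
    ⟨algebraicIndependent_w, fun z => by
      have h : Subring.closure (Set.range coeff ∪ Set.range w) ≤
          ((MvPolynomial.aeval w : MvPolynomial ℕ RR →ₐ[RR] dg.Coh) : MvPolynomial ℕ RR →+* dg.Coh).range := by
        refine Subring.closure_le.2 ?_
        rintro _ (⟨r, rfl⟩ | ⟨m, rfl⟩)
        · exact ⟨MvPolynomial.C r, MvPolynomial.aeval_C w r⟩
        · exact ⟨MvPolynomial.X m, MvPolynomial.aeval_X w m⟩
      rw [closure_eq_top] at h
      exact h (Subring.mem_top z)⟩

theorem psi_C (r : RR) : psi (MvPolynomial.C r) = dg.cls _ (d_of_phi r) := MvPolynomial.aeval_C w r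

theorem psi_X (m : ℕ) : psi (MvPolynomial.X m) = dg.cls _ (d_W m) := MvPolynomial.aeval_X w m

end E1

end

theorem theorem4p1 :
    -- the coefficient ring `K(ξ₁)_{**}` is `R = E[h₁₀] ⊗ k[b₁₀, b₁₀⁻¹]`
    ∃ φ : RR ≃+* KX 1, φ RR.h = BExt.h10 DualP (TPow BB 1) ∧ φ RR.b = BExt.b10 DualP (TPow BB 1) ∧
    -- the co-operations are `b₁₀⁻¹ Ext_D(k, B)`
    Function.Bijective KK.theta ∧
    -- the left and the right unit agree, and the co-operations are flat and free over `R`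
    KK.etaL = KK.etaR ∧
    (letI : Module RR (KX 2) := Module.compHom (KX 2) (KK.etaL.comp (φ : RR →+* KX 1))
     Module.Flat RR (KX 2) ∧ Module.Free RR (KX 2)) ∧
    -- the Künneth map is bijective, so that there is a comultiplication
    Function.Bijective KK.beta ∧
    ∃ Δ : KX 2 →+ KK.Bal, (∀ x, KK.beta (Δ x) = KK.alpha x) ∧
    -- the elements `e_{n+2} = [ξ₁]ξ_{n+2} − [ξ₁²]ξ_{n+1}³`; they have the stated bidegree
    ∃ e : ℕ → KX 2,
      (∀ n, KK.theta (e n) = BExt.cls (eCochain n) (d_eCochain n)) ∧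
      (∀ n, BExt.IsBihomogeneous DualP.degree (TPow.degree 2) 1 (2 * (3 ^ (n + 2) + 1)) (e n)) ∧
      -- they are primitive
      (∀ n, Δ (e n) = KK.Bal.tmul (e n) 1 + KK.Bal.tmul 1 (e n)) ∧
      -- the isomorphism of Hopf algebras
      (∃ Φ : RE ≃+* KX 2,
        (∀ r, Φ (RE.tmul r 1) = KK.etaL (φ r)) ∧
        (∀ n, Φ (RE.tmul 1 (EE.gen n)) = e n) ∧
        (∀ (r : RR) (x : EE) (m : ℕ) (y z : Fin m → EE),
          EE.comul x = ∑ i, y i ᵍ⊗ₜ[F3] z i →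
          Δ (Φ (RE.tmul r x)) = ∑ i, KK.Bal.tmul (Φ (RE.tmul r (y i))) (Φ (RE.tmul 1 (z i)))) ∧
        (∀ r x, KK.counit (Φ (RE.tmul r x)) = φ (r * algebraMap F3 RR (EE.counit x))) ∧
        (∀ r x, KK.conj (Φ (RE.tmul r x)) = Φ (RE.tmul r (EE.conj x)))) ∧
      -- the `E₂` page is `R[w₂, w₃, …]` with `w_{n+2}` represented by `e_{n+2}`
      (∃ (h0 : ∀ r : RR, E1.dg.d (DirectSum.of E1.Page 0 (φ r)) = 0)
         (h1 : ∀ n, E1.dg.d (DirectSum.of E1.Page 1 (e n)) = 0)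
         (Ψ : MvPolynomial ℕ RR ≃+* E1.dg.Coh),
         (∀ r, Ψ (MvPolynomial.C r) = E1.dg.cls _ (h0 r)) ∧
         (∀ n, Ψ (MvPolynomial.X n) = E1.dg.cls _ (h1 n))) :=
  ⟨KX.phi, KX.phi_h, KX.phi_b, KK.theta_bijective, KK.etaL_eq_etaR,
    ⟨@Module.Flat.of_free _ _ _ _ (Module.compHom (KX 2) (KK.etaL.comp (KX.phi : RR →+* KX 1))) KK.free, KK.free⟩,
    KK.beta_bijective, KK.comul, KK.beta_comul, KX.e, KK.theta_e, KX.e_isBihomogeneous, KK.comul_e,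
    ⟨RE.equivKX, fun r => (RE.toKX_coeff r).trans (KK.etaL_phi r).symm, RE.toKX_gen, KK.comul_equivKX,
      KK.counit_equivKX, KK.conj_equivKX⟩,
    E1.d_of_phi, E1.d_W, E1.psi, E1.psi_C, E1.psi_X⟩
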